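/- Let $\mathbb K=\mathbb R$ or $\mathbb C$. Consider triples $(M,\nabla,P)$, where $M$ is a smooth manifold (of any dimension), $\nabla$ a smooth torsionfree linear connection on $M$ with curvature tensor $R$, and $P$ a Poisson tensor on $M$. A \emph{concatenation} with $p$ free indices is a contravariant $p$-tensor obtained from a finite product of factors $(\nabla^m P)^{\cdot\cdot}_{\cdot\cdots\cdot}$ and $(\nabla^m R)^{\cdot}_{\cdots}$ ($m\ge 0$) by contracting every lower index with an upper index, leaving $p$ upper indices free; it is of \emph{no-loop type} if no lower index of a factor is contracted with an upper index of the same factor. A \emph{universal Poisson $p$-cochain of no-loop type and of degree $k$} is an assignment $(M,\nabla,P)\mapsto c^{(M,\nabla,P)}$ of skewsymmetric contravariant $p$-tensor fields which is a linear combination, with constant coefficients in $\mathbb K$ that do not depend on $(M,\nabla,P)$, of concatenations of no-loop type, and which satisfies $c^{(M,\nabla,tP)}=t^k c^{(M,\nabla,P)}$ for $t\in\mathbb R$. It is a \emph{cocycle} if $[P,c^{(M,\nabla,P)}]_{SN}=0$ for all $(M,\nabla,P)$, where $[\cdot,\cdot]_{SN}$ is the Schouten--Nijenhuis bracket. A cocycle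 is a \emph{coboundary} if $c^{(M,\nabla,P)}=[P,b^{(M,\nabla,P)}]_{SN}$ for all $(M,\nabla,P)$, for some universal Poisson $(p-1)$-cochain $b$ of no-loop type and of degree $k-1$. Let $H^p_{(no\text{-}loop)\,pol\,k}$ be the quotient of the space of cocycles by the space of coboundaries. Then the space of universal Poisson $2$-cochains of no-loop type and of degree $3$ has dimension $48$, its quotient by the subspace of coboundaries has dimension $44$, and $$H^2_{(no\text{-}loop)\,pol\,3}=0 ,$$ that is, every universal Poisson $2$-cocycle of no-loop type and of degree $3$ is a universal coboundary of no-loop type. -/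

import Mathlib

open scoped Manifold ContDiff

noncomputable section

attribute [local instance high] chartedSpaceSelf

namespace UniversalPoisson

/-- A smooth manifold of dimension `dim` together with a smooth torsionfree linear connection. -/
structure ConnManifold : Type 1 where
  dim : ℕ
  carrier : Type
  [top : TopologicalSpace carrier]
  [charted : ChartedSpace (EuclideanSpace ℝ (Fin dim)) carrier]
  [mfd : IsManifold (𝓡 dim) ∞ carrier]
  [t2 : T2Space carrier]
  [secondCountable : SecondCountableTopology carrier]
  conn : CovariantDerivative (𝓡 dim) (EuclideanSpace ℝ (Fin dim))
    (TangentSpace (𝓡 dim) : carrier → Type _)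
  conn_smooth :
    haveI : IsManifold (𝓡 dim) 1 carrier := IsManifold.of_le (n := ∞) (by simp)
    CovariantDerivative.ContMDiffCovariantDerivative conn ∞
  conn_torsionFree :
    haveI : IsManifold (𝓡 dim) 2 carrier :=
      IsManifold.of_le (n := ∞) (WithTop.coe_le_coe.2 le_top)
    conn.torsion = 0

attribute [instance] ConnManifold.top ConnManifold.charted ConnManifold.mfd ConnManifold.t2
  ConnManifold.secondCountable

/-- The model space `ℝⁿ`. -/
abbrev ConnManifold.Model (X : ConnManifold) : Type := EuclideanSpace ℝ (Fin X.dim)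

/-- The charts of the atlas of the manifold. -/
abbrev ConnManifold.Chart (X : ConnManifold) : Type :=
  {φ : OpenPartialHomeomorph X.carrier X.Model // φ ∈ atlas X.Model X.carrier}

/-- The partial derivative `∂_l f` of a function of `n` real variables. -/
def pd {n : ℕ} {F : Type*} [NormedAddCommGroup F] [NormedSpace ℝ F] (l : Fin n)
    (f : EuclideanSpace ℝ (Fin n) → F) (y : EuclideanSpace ℝ (Fin n)) : F :=
  fderiv ℝ f y (EuclideanSpace.single l 1)

namespace ConnManifold

variable (X : ConnManifold)

/-- The coordinate vector field `∂_i` of a chart (meaningful on the domain of the chart). -/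
def coordField (φ : X.Chart) (i : Fin X.dim) (x : X.carrier) : TangentSpace (𝓡 X.dim) x :=
  VectorField.mpullback (𝓡 X.dim) (𝓡 X.dim) φ.1
    (fun _ => (EuclideanSpace.single i 1 : EuclideanSpace ℝ (Fin X.dim))) x

/-- The coordinate differential `dx^i` of a chart (meaningful on the domain of the chart). -/
def coordForm (φ : X.Chart) (i : Fin X.dim) (x : X.carrier) :
    TangentSpace (𝓡 X.dim) x →L[ℝ] ℝ :=
  (EuclideanSpace.proj i : EuclideanSpace ℝ (Fin X.dim) →L[ℝ] ℝ).comp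
    (mfderiv (𝓡 X.dim) (𝓡 X.dim) φ.1 x)

/-- The Christoffel symbol `Γ_{ij}^k = dx^k(∇_{∂_i} ∂_j)` in a chart. -/
def christoffel (φ : X.Chart) (i j k : Fin X.dim) (y : X.Model) : ℝ :=
  X.coordForm φ k (φ.1.symm y)
    (X.conn (X.coordField φ j) (φ.1.symm y) (X.coordField φ i (φ.1.symm y)))

/-- Components, in a chart, of a tensor field with `b` lower and `a` upper indices: the value at
`L`, `U`, `y` is `T_{L}^{U}(y)`. -/
abbrev Components (b a : ℕ) : Type :=
  (Fin b → Fin X.dim) → (Fin a → Fin X.dim) → X.Model → ℝ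

/-- The covariant derivative of a tensor field, in a chart. The new lower index is the first one:
`(∇T)_{i L}^{U} = ∂_i T_L^U - ∑_s Γ_{i L_s}^e T_{L[s ↦ e]}^U + ∑_s Γ_{i e}^{U_s} T_L^{U[s ↦ e]}`. -/
def covDeriv (φ : X.Chart) {b a : ℕ} (T : X.Components b a) : X.Components (b + 1) a :=
  fun L U y =>
    pd (L 0) (T (Fin.tail L) U) y
      - ∑ s : Fin b, ∑ e : Fin X.dim,
          X.christoffel φ (L 0) (Fin.tail L s) e y * T (Function.update (Fin.tail L) s e) U y
      + ∑ s : Fin a, ∑ e : Fin X.dim,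
          X.christoffel φ (L 0) e (U s) y * T (Fin.tail L) (Function.update U s e) y

/-- The `m`-th covariant derivative `∇^m T`. -/
def iterCovDeriv (φ : X.Chart) {b a : ℕ} (T : X.Components b a) :
    (m : ℕ) → X.Components (b + m) a
  | 0 => T
  | m + 1 => X.covDeriv φ (iterCovDeriv φ T m)

/-- The curvature tensor: `R(∂_i, ∂_j) ∂_k = ∑_d R_{ijk}^d ∂_d`, with
`R(Y, Z) = ∇_Y ∇_Z - ∇_Z ∇_Y - ∇_{[Y, Z]}`. -/
def curvature (φ : X.Chart) : X.Components 3 1 :=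
  fun L U y =>
    pd (L 0) (X.christoffel φ (L 1) (L 2) (U 0)) y
      - pd (L 1) (X.christoffel φ (L 0) (L 2) (U 0)) y
      + ∑ e : Fin X.dim,
          (X.christoffel φ (L 0) e (U 0) y * X.christoffel φ (L 1) (L 2) e y
            - X.christoffel φ (L 1) e (U 0) y * X.christoffel φ (L 0) (L 2) e y)

/-- The component `P(dx^i, dx^j)` in a chart of a field of bilinear forms on the cotangent
spaces. -/
def bivectorComp
    (P : ∀ x : X.carrier, (TangentSpace (𝓡 X.dim) x →L[ℝ] ℝ) →ₗ[ℝ]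
      (TangentSpace (𝓡 X.dim) x →L[ℝ] ℝ) →ₗ[ℝ] ℝ)
    (φ : X.Chart) (i j : Fin X.dim) (y : X.Model) : ℝ :=
  P (φ.1.symm y) (X.coordForm φ i (φ.1.symm y)) (X.coordForm φ j (φ.1.symm y))

/-- A Poisson tensor: a smooth skewsymmetric contravariant 2-tensor field whose bracket
`{f, g} = P(df, dg)` satisfies the Jacobi identity. -/
structure PoissonTensor where
  toFun : ∀ x : X.carrier, (TangentSpace (𝓡 X.dim) x →L[ℝ] ℝ) →ₗ[ℝ]
    (TangentSpace (𝓡 X.dim) x →L[ℝ] ℝ) →ₗ[ℝ] ℝ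
  skew : ∀ x α β, toFun x α β = - toFun x β α
  smooth : ∀ (φ : X.Chart) (i j : Fin X.dim),
    ContDiffOn ℝ ∞ (X.bivectorComp toFun φ i j) φ.1.target
  jacobi : ∀ (φ : X.Chart) (i j k : Fin X.dim), ∀ y ∈ φ.1.target,
    ∑ l : Fin X.dim,
      (X.bivectorComp toFun φ i l y * pd l (X.bivectorComp toFun φ j k) y
        + X.bivectorComp toFun φ j l y * pd l (X.bivectorComp toFun φ k i) y
        + X.bivectorComp toFun φ k l y * pd l (X.bivectorComp toFun φ i j) y) = 0

end ConnManifold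

/-- The component `P^{ij}` of a Poisson tensor in a chart. -/
def ConnManifold.PoissonTensor.comp {X : ConnManifold} (P : X.PoissonTensor) (φ : X.Chart)
    (i j : Fin X.dim) : X.Model → ℝ :=
  X.bivectorComp P.toFun φ i j

/-- A Poisson tensor as a tensor field with two upper indices, in a chart. -/
def ConnManifold.PoissonTensor.components {X : ConnManifold} (P : X.PoissonTensor)
    (φ : X.Chart) : X.Components 0 2 :=
  fun _ U => P.comp φ (U 0) (U 1)

/-! ### Concatenations -/

/-- The tensors which are concatenated: `∇^m P` and `∇^m R`. -/
inductive Factor : Type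
  | P (m : ℕ)
  | R (m : ℕ)

namespace Factor

/-- Number of lower indices. -/
def lower : Factor → ℕ
  | P m => 0 + m
  | R m => 3 + m

/-- Number of upper indices. -/
def upper : Factor → ℕ
  | P _ => 2
  | R _ => 1

/-- The components of `∇^m P` or `∇^m R` in a chart. -/
def comp {X : ConnManifold} (P : X.PoissonTensor) (φ : X.Chart) :
    (f : Factor) → X.Components f.lower f.upper
  | Factor.P m => X.iterCovDeriv φ (P.components φ) m
  | Factor.R m => X.iterCovDeriv φ (X.curvature φ) m

end Factor

/-- A concatenation with `p` free upper indices: a finite family of factors `∇^m P`, `∇^m R`,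
and a matching of all upper index slots with the lower index slots (contractions) and the `p`
free indices. -/
structure Concatenation (p : ℕ) where
  size : ℕ
  factor : Fin size → Factor
  matching : ((Σ f : Fin size, Fin (factor f).lower) ⊕ Fin p) ≃
    (Σ f : Fin size, Fin (factor f).upper)

namespace Concatenation

variable {p : ℕ}

/-- No lower index of a factor is contracted with an upper index of the same factor. -/
def NoLoop (G : Concatenation p) : Prop :=
  ∀ (f : Fin G.size) (s : Fin (G.factor f).lower), (G.matching (Sum.inl ⟨f, s⟩)).1 ≠ f

/-- The contravariant `p`-tensor defined by a concatenation: in a chart, the sum over all values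
`σ` of the contracted indices of the products of the components of the factors. -/
def eval (G : Concatenation p) {X : ConnManifold} (P : X.PoissonTensor) (φ : X.Chart)
    (I : Fin p → Fin X.dim) (y : X.Model) : ℝ :=
  ∑ σ : (Σ f : Fin G.size, Fin (G.factor f).lower) → Fin X.dim,
    ∏ f : Fin G.size,
      (G.factor f).comp P φ (fun s => σ ⟨f, s⟩)
        (fun s => Sum.elim σ I (G.matching.symm ⟨f, s⟩)) y

end Concatenation

/-! ### Universal cochains -/

section Cochains

variable (𝕂 : Type) [RCLike 𝕂] (p : ℕ)

/-- An association to any manifold with torsionfree connection and Poisson tensor, and to any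
chart, of the components of a contravariant `p`-tensor. -/
abbrev ComponentFamily : Type 1 :=
  ∀ (X : ConnManifold) (_ : X.PoissonTensor) (_ : X.Chart),
    (Fin p → Fin X.dim) → X.Model → 𝕂

/-- The families whose components are smooth on the image of each chart (and, by convention,
zero outside of it). -/
def SmoothFamily : Submodule 𝕂 (ComponentFamily 𝕂 p) where
  carrier := {c | ∀ X P φ I, ContDiffOn ℝ ∞ (c X P φ I) φ.1.target ∧
    ∀ y, y ∉ φ.1.target → c X P φ I y = 0}
  add_mem' := fun {a b} ha hb X P φ I =>
    ⟨(ha X P φ I).1.add (hb X P φ I).1, fun y hy => by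
      simp [(ha X P φ I).2 y hy, (hb X P φ I).2 y hy]⟩
  zero_mem' := fun _ _ _ _ => ⟨contDiffOn_const, fun _ _ => rfl⟩
  smul_mem' := fun a c hc X P φ I =>
    ⟨(hc X P φ I).1.const_smul a, fun y hy => by simp [(hc X P φ I).2 y hy]⟩

instance : AddCommGroup (SmoothFamily 𝕂 p) := Submodule.addCommGroup _

/-- The family of component functions defined by a concatenation. -/
def Concatenation.family {p : ℕ} (𝕂 : Type) [RCLike 𝕂] (G : Concatenation p) : ComponentFamily 𝕂 p :=
  fun _ P φ I => φ.1.target.indicator fun y => ((G.eval P φ I y : ℝ) : 𝕂)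

/-- Universal Poisson-related contravariant `p`-tensors of no-loop type: combinations with
constant coefficients of concatenations without loops. -/
def universalNoLoop : Submodule 𝕂 (SmoothFamily 𝕂 p) :=
  (Submodule.span 𝕂
    {c : ComponentFamily 𝕂 p | ∃ G : Concatenation p, G.NoLoop ∧ c = G.family 𝕂}).comap
    (SmoothFamily 𝕂 p).subtype

/-- The families which are polynomials of degree `k` in the Poisson structure:
`c^{(M, ∇, tP)} = t^k c^{(M, ∇, P)}`. -/
def homogeneous (k : ℕ) : Submodule 𝕂 (SmoothFamily 𝕂 p) where
  carrier := {c | ∀ (X : ConnManifold) (P Q : X.PoissonTensor) (t : ℝ),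
    (∀ x α β, Q.toFun x α β = t * P.toFun x α β) →
      ∀ φ I y, c.1 X Q φ I y = (t : 𝕂) ^ k * c.1 X P φ I y}
  add_mem' := fun {a b} ha hb X P Q t h φ I y => by
    simp [ha X P Q t h φ I y, hb X P Q t h φ I y, mul_add]
  zero_mem' := fun _ _ _ _ _ _ _ _ => by simp
  smul_mem' := fun a c hc X P Q t h φ I y => by
    simp [hc X P Q t h φ I y, mul_left_comm]

/-- The totally skewsymmetric families. -/
def skewFamilies : Submodule 𝕂 (SmoothFamily 𝕂 p) where
  carrier := {c | ∀ X P φ (I : Fin p → Fin X.dim) (τ : Equiv.Perm (Fin p)) y,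
    c.1 X P φ (I ∘ τ) y = ((Equiv.Perm.sign τ : ℤ) : 𝕂) * c.1 X P φ I y}
  add_mem' := fun {a b} ha hb X P φ I τ y => by
    simp [ha X P φ I τ y, hb X P φ I τ y, mul_add]
  zero_mem' := fun _ _ _ _ _ _ => by simp
  smul_mem' := fun a c hc X P φ I τ y => by
    simp [hc X P φ I τ y, mul_left_comm]

/-- Universal Poisson `p`-cochains of no-loop type and of degree `k` in the Poisson structure. -/
def cochains (k : ℕ) : Submodule 𝕂 (SmoothFamily 𝕂 p) :=
  universalNoLoop 𝕂 p ⊓ homogeneous 𝕂 p k ⊓ skewFamilies 𝕂 p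

/-! ### The Poisson coboundary -/

variable {𝕂 p}

/-- The components in a chart of the Poisson coboundary `[P, c]` of a skewsymmetric `p`-tensor:
the Chevalley coboundary of `C(u_1, …, u_p) = c(du_1, …, du_p)`,
`∑_k (-1)^k {u_k, C(…, û_k, …)} + ∑_{k < m} (-1)^(k+m) C({u_k, u_m}, …, û_k, …, û_m, …)`
(indices starting from `0`), evaluated on the coordinate functions `u_s = x^{I s}`. In the second
sum the argument `{u_k, u_m}` has been moved to the slot of `u_m`. -/
def coboundaryComp {X : ConnManifold} (P : X.PoissonTensor) (φ : X.Chart)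
    (c : (Fin p → Fin X.dim) → X.Model → 𝕂) (I : Fin (p + 1) → Fin X.dim) (y : X.Model) : 𝕂 :=
  ∑ k : Fin (p + 1), (-1 : 𝕂) ^ (k : ℕ) *
    (∑ l : Fin X.dim, P.comp φ (I k) l y • pd l (c (I ∘ k.succAbove)) y
      - ∑ m ∈ Finset.Ioi k, ∑ l : Fin X.dim,
          pd l (P.comp φ (I k) (I m)) y • c (Function.update I m l ∘ k.succAbove) y)

theorem contDiffOn_pd {n : ℕ} {F : Type*} [NormedAddCommGroup F] [NormedSpace ℝ F]
    {f : EuclideanSpace ℝ (Fin n) → F} {s : Set (EuclideanSpace ℝ (Fin n))} (hs : IsOpen s)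
    (hf : ContDiffOn ℝ ∞ f s) (l : Fin n) : ContDiffOn ℝ ∞ (pd l f) s :=
  (hf.fderiv_of_isOpen hs (m := ∞) (by simp)).clm_apply contDiffOn_const

theorem pd_add {n : ℕ} {f g : EuclideanSpace ℝ (Fin n) → 𝕂} {s : Set (EuclideanSpace ℝ (Fin n))}
    (hs : IsOpen s) (hf : ContDiffOn ℝ ∞ f s) (hg : ContDiffOn ℝ ∞ g s) (l : Fin n)
    {y : EuclideanSpace ℝ (Fin n)} (hy : y ∈ s) : pd l (f + g) y = pd l f y + pd l g y := by
  have h1 : DifferentiableAt ℝ f y :=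
    (hf.contDiffAt (hs.mem_nhds hy)).differentiableAt (by simp)
  have h2 : DifferentiableAt ℝ g y :=
    (hg.contDiffAt (hs.mem_nhds hy)).differentiableAt (by simp)
  simp [pd, fderiv_add h1 h2]

theorem pd_smul {n : ℕ} (a : 𝕂) {f : EuclideanSpace ℝ (Fin n) → 𝕂}
    {s : Set (EuclideanSpace ℝ (Fin n))} (hs : IsOpen s) (hf : ContDiffOn ℝ ∞ f s) (l : Fin n)
    {y : EuclideanSpace ℝ (Fin n)} (hy : y ∈ s) : pd l (a • f) y = a * pd l f y := by
  have h1 : DifferentiableAt ℝ f y :=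
    (hf.contDiffAt (hs.mem_nhds hy)).differentiableAt (by simp)
  simp [pd, fderiv_const_smul h1 a]

theorem contDiffOn_coboundaryComp (c : SmoothFamily 𝕂 p) (X : ConnManifold)
    (P : X.PoissonTensor) (φ : X.Chart) (I : Fin (p + 1) → Fin X.dim) :
    ContDiffOn ℝ ∞ (coboundaryComp P φ (c.1 X P φ) I) φ.1.target := by
  unfold coboundaryComp
  refine ContDiffOn.sum fun k _ => contDiffOn_const.mul (ContDiffOn.sub ?_ ?_)
  · exact ContDiffOn.sum fun l _ =>
      (P.smooth φ _ _).smul (contDiffOn_pd φ.1.open_target (c.2 X P φ _).1 l)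
  · exact ContDiffOn.sum fun m _ => ContDiffOn.sum fun l _ =>
      (contDiffOn_pd φ.1.open_target (P.smooth φ _ _) l).smul (c.2 X P φ _).1

variable (𝕂 p) in
/-- The Poisson coboundary operator `c ↦ [P, c]`. -/
def coboundary : SmoothFamily 𝕂 p →ₗ[𝕂] SmoothFamily 𝕂 (p + 1) where
  toFun c := ⟨fun X P φ I => φ.1.target.indicator (coboundaryComp P φ (c.1 X P φ) I),
    fun X P φ I => ⟨(contDiffOn_coboundaryComp c X P φ I).congr fun y hy => by simp [hy],
      fun y hy => by simp [hy]⟩⟩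
  map_add' := fun a b => by
    ext X P φ I y
    by_cases hy : y ∈ φ.1.target
    · have h : ∀ l J, pd l (a.1 X P φ J + b.1 X P φ J) y
          = pd l (a.1 X P φ J) y + pd l (b.1 X P φ J) y := fun l J =>
        pd_add φ.1.open_target (a.2 X P φ J).1 (b.2 X P φ J).1 l hy
      simp only [Submodule.coe_add, Pi.add_apply, Set.indicator_of_mem hy, coboundaryComp, h,
        smul_add, Finset.sum_add_distrib]
      rw [← Finset.sum_add_distrib]
      exact Finset.sum_congr rfl fun k _ => by ring
    · simp [hy]
  map_smul' := fun r a => by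
    ext X P φ I y
    by_cases hy : y ∈ φ.1.target
    · have h : ∀ l J, pd l (r • a.1 X P φ J) y = r * pd l (a.1 X P φ J) y := fun l J =>
        pd_smul r φ.1.open_target (a.2 X P φ J).1 l hy
      simp only [SetLike.val_smul, Pi.smul_apply, Set.indicator_of_mem hy, coboundaryComp, h,
        RingHom.id_apply, smul_eq_mul, Finset.mul_sum, mul_sub, mul_smul_comm,
        mul_left_comm r]
    · simp [hy]

/-! ### Cohomology -/

variable (𝕂 p)

/-- Universal Poisson `p`-cocycles of no-loop type and of degree `k`. -/
def cocycles (k : ℕ) : Submodule 𝕂 (SmoothFamily 𝕂 p) :=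
  cochains 𝕂 p k ⊓ LinearMap.ker (coboundary 𝕂 p)

/-- Universal Poisson `(p+1)`-coboundaries of no-loop type and of degree `k+1`: the cocycles of
the form `[P, b]` with `b` a universal `p`-cochain of no-loop type and of degree `k`. -/
def coboundaries (k : ℕ) : Submodule 𝕂 (SmoothFamily 𝕂 (p + 1)) :=
  cocycles 𝕂 (p + 1) (k + 1) ⊓ (cochains 𝕂 p k).map (coboundary 𝕂 p)

/-- The universal Poisson cohomology `H^{p+1}` of no-loop type and of degree `k+1` in the Poisson
structure. -/
abbrev Cohomology (k : ℕ) : Type 1 :=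
  cocycles 𝕂 (p + 1) (k + 1) ⧸
    (coboundaries 𝕂 p k).submoduleOf (cocycles 𝕂 (p + 1) (k + 1))

end Cochains

end UniversalPoisson

end

open scoped Manifold ContDiff

noncomputable section

attribute [local instance high] chartedSpaceSelf

namespace UniversalPoisson

/-! The theorem follows from three estimates: the cochains have dimension 48, the cocycles have
dimension at most 4, the coboundaries have dimension at least 4. Coboundaries are cocycles, so these
two spaces coincide and both have dimension 4; the cohomology vanishes and the quotient has
dimension 48 - 4 = 44.

Spanning by 48 elements. A concatenation without loops is written as an `Expr`, a list of factors
whose slots carry labels. Comparing coefficients of powers of `t` shows that the cochains of degree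
3 are spanned by the skewsymmetrized expressions with exactly three factors `∇^m P`
(`mem_exprSpan_of_mem_cochains`). Counting slots leaves at most two curvature factors and nine lists
of factors (`mem_shapes`). The expressions are filtered by the number of curvature factors. Modulo
more curvature, covariant derivatives commute by the Ricci identity, and besides there are the
skewness of `P` and `R`, both Bianchi identities, the Jacobi identity and its first covariant
derivative. Each of these is an identity between components (`LocalRel`) which may be differentiated
and multiplied by any remaining factors. A finite enumeration and an elimination, both evaluated in
the kernel (`candidates_known`), then express everything by 4 + 30 + 14 generators with 0, 1 and 2
curvature factors; descending through the filtration gives `exprSpan_le_basisSpan`.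

Independence. On explicit polynomial Poisson tensors and connections on `ℝⁿ`, with `n` between 3 and
6, the generators and their Poisson coboundaries are evaluated in the origin. This gives 48 linear
functionals, and a certificate of invertibility of their matrix on the generators
(`functionals_check`, `combinations_check`). Hence the generators form a basis (`finrank_cochains`).
The functionals are chosen such that 44 of them are components of the coboundary. These vanish on
cocycles, so the other four separate cocycles (`finrank_cocycles_le`).

Coboundaries. Four vector fields given by expressions of degree 2 have coboundaries which are again
combinations of expressions without loops (`Expr.WF.coboundaryComp_value`). They are cocycles
because the square of the coboundary vanishes by the Jacobi identity
(`coboundaryComp_coboundaryComp`), and four evaluations show that they are independent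
(`linearIndependent_boundarySmooth`). -/

theorem mlieBracket_const_const {E : Type*} [NormedAddCommGroup E] [NormedSpace ℝ E] (v w x : E) :
    VectorField.mlieBracket 𝓘(ℝ, E) (fun y => (v : TangentSpace 𝓘(ℝ, E) y))
      (fun y => (w : TangentSpace 𝓘(ℝ, E) y)) x = 0 := by
  have h := congrFun (VectorField.mlieBracketWithin_eq_lieBracketWithin (𝕜 := ℝ)
    (V := fun y => (v : TangentSpace 𝓘(ℝ, E) y)) (W := fun y => (w : TangentSpace 𝓘(ℝ, E) y))
    (s := Set.univ)) x
  refine (congrFun VectorField.mlieBracketWithin_univ.symm x).trans (h.trans ?_)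
  have hc : ∀ u : E, fderivWithin ℝ (fun _ : E => u) Set.univ x = 0 := fun u => by simp
  show fderivWithin ℝ (fun _ : E => w) Set.univ x v - fderivWithin ℝ (fun _ : E => v) Set.univ x w
    = 0
  rw [hc, hc]
  simp

/-! ### Christoffel symbols in a chart: symmetry and smoothness. -/

namespace ConnManifold

variable (X : ConnManifold)

instance isManifoldOne : IsManifold (𝓡 X.dim) 1 X.carrier :=
  IsManifold.of_le (n := ∞) (by simp)

instance isManifoldTwo : IsManifold (𝓡 X.dim) 2 X.carrier :=
  IsManifold.of_le (n := ∞) (WithTop.coe_le_coe.2 le_top)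

theorem contMDiffOn_chart (φ : X.Chart) :
    ContMDiffOn (𝓡 X.dim) (𝓡 X.dim) ∞ φ.1 φ.1.source :=
  contMDiffOn_of_mem_maximalAtlas (IsManifold.subset_maximalAtlas φ.2)

theorem contMDiffOn_chart_symm (φ : X.Chart) :
    ContMDiffOn (𝓡 X.dim) (𝓡 X.dim) ∞ φ.1.symm φ.1.target :=
  contMDiffOn_symm_of_mem_maximalAtlas (IsManifold.subset_maximalAtlas φ.2)

theorem contMDiffAt_chart (φ : X.Chart) {x : X.carrier} (hx : x ∈ φ.1.source) :
    ContMDiffAt (𝓡 X.dim) (𝓡 X.dim) ∞ φ.1 x :=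
  (X.contMDiffOn_chart φ).contMDiffAt (φ.1.open_source.mem_nhds hx)

theorem isInvertible_mfderiv_chart (φ : X.Chart) {x : X.carrier} (hx : x ∈ φ.1.source) :
    (mfderiv (𝓡 X.dim) (𝓡 X.dim) φ.1 x).IsInvertible := by
  have h := mdifferentiable_of_mem_atlas (I := 𝓡 X.dim) φ.2
  exact ⟨h.mfderiv hx, rfl⟩

theorem contMDiffAt_coordField (φ : X.Chart) (i : Fin X.dim) {x : X.carrier}
    (hx : x ∈ φ.1.source) :
    ContMDiffAt (𝓡 X.dim) ((𝓡 X.dim).prod 𝓘(ℝ, X.Model)) ∞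
      (fun x => (Bundle.TotalSpace.mk' X.Model x (X.coordField φ i x) :
        TangentBundle (𝓡 X.dim) X.carrier)) x := by
  refine ContMDiffAt.mpullback_vectorField_preimage (n := ∞) ?_ (X.contMDiffAt_chart φ hx)
    (X.isInvertible_mfderiv_chart φ hx) (by simp)
  exact contMDiffAt_vectorSpace_iff_contDiffAt.2 contDiffAt_const

/-- Coordinate fields are pullbacks of constant fields under the chart, and pullback commutes with
the Lie bracket. -/
theorem mlieBracket_coordField (φ : X.Chart) (i j : Fin X.dim) {x : X.carrier}
    (hx : x ∈ φ.1.source) :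
    VectorField.mlieBracket (𝓡 X.dim) (X.coordField φ i) (X.coordField φ j) x = 0 := by
  have e2 : minSmoothness ℝ 2 = 2 := minSmoothness_of_isRCLikeNormedField
  have : IsManifold (𝓡 X.dim) (minSmoothness ℝ 2) X.carrier := by
    rw [e2]; infer_instance
  have hc : ∀ v : X.Model, MDifferentiableAt 𝓘(ℝ, X.Model) (𝓘(ℝ, X.Model).prod 𝓘(ℝ, X.Model))
      (fun y : X.Model => (Bundle.TotalSpace.mk' X.Model y v : TangentBundle 𝓘(ℝ, X.Model) X.Model))
      (φ.1 x) := fun v =>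
    (contMDiffAt_vectorSpace_iff_contDiffAt.2 contDiffAt_const :
      ContMDiffAt _ _ 1 _ _).mdifferentiableAt one_ne_zero
  have h := VectorField.mpullback_mlieBracket (I := 𝓡 X.dim) (I' := 𝓡 X.dim) (f := φ.1)
    (V := fun _ => (EuclideanSpace.single i 1 : EuclideanSpace ℝ (Fin X.dim)))
    (W := fun _ => (EuclideanSpace.single j 1 : EuclideanSpace ℝ (Fin X.dim))) (n := ∞) (x₀ := x)
    (hc _) (hc _) (X.contMDiffAt_chart φ hx) (e2.le.trans (WithTop.coe_le_coe.2 le_top))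
  unfold coordField
  rw [← h]
  have h0 := mlieBracket_const_const (EuclideanSpace.single i 1 : X.Model)
    (EuclideanSpace.single j 1) (φ.1 x)
  rw [VectorField.mpullback_apply]
  exact (congrArg _ h0).trans (map_zero _)

/-- Coordinate fields commute, so the torsion on them is `∇_i ∂_j - ∇_j ∂_i`. All later uses of the
vanishing of the torsion go through this symmetry. -/
theorem christoffel_symm (φ : X.Chart) (i j k : Fin X.dim) {y : X.Model} (hy : y ∈ φ.1.target) :
    X.christoffel φ i j k y = X.christoffel φ j i k y := by
  have hx := φ.1.map_target hy
  have h := (CovariantDerivative.torsion_eq_zero_iff X.conn).1 X.conn_torsionFree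
    ((X.contMDiffAt_coordField φ i hx).mdifferentiableAt (by simp))
    ((X.contMDiffAt_coordField φ j hx).mdifferentiableAt (by simp))
  rw [X.mlieBracket_coordField φ i j hx, sub_eq_zero] at h
  simp only [christoffel, h]

/-- The smoothness of the connection is a statement about sections which are smooth on all of `M`,
while coordinate fields are smooth only on the domain of a chart. A bump function turns `σ` into a
global section `τ`, and locality of the covariant derivative leads back to `σ` near `x`. -/
theorem contMDiffAt_conn (σ : ∀ x : X.carrier, TangentSpace (𝓡 X.dim) x) {U : Set X.carrier}
    (hU : IsOpen U)
    (hσ : ∀ x ∈ U, ContMDiffAt (𝓡 X.dim) ((𝓡 X.dim).prod 𝓘(ℝ, X.Model)) ∞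
      (fun x => (Bundle.TotalSpace.mk' X.Model x (σ x) : TangentBundle (𝓡 X.dim) X.carrier)) x)
    {x : X.carrier} (hx : x ∈ U) :
    ContMDiffAt (𝓡 X.dim) ((𝓡 X.dim).prod 𝓘(ℝ, X.Model →L[ℝ] X.Model)) ∞
      (fun x => (Bundle.TotalSpace.mk' (X.Model →L[ℝ] X.Model)
        (E := fun x : X.carrier => TangentSpace (𝓡 X.dim) x →L[ℝ] TangentSpace (𝓡 X.dim) x)
          x (X.conn σ x))) x := by
  obtain ⟨f, -, hf⟩ := (SmoothBumpFunction.nhds_basis_tsupport (I := 𝓡 X.dim) x).mem_iff.1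
    (hU.mem_nhds hx)
  set τ : ∀ x : X.carrier, TangentSpace (𝓡 X.dim) x := fun z => f z • σ z with hτ
  have hτs : ContMDiff (𝓡 X.dim) ((𝓡 X.dim).prod 𝓘(ℝ, X.Model)) (∞ + 1)
      (fun x => (Bundle.TotalSpace.mk' X.Model x (τ x) : TangentBundle (𝓡 X.dim) X.carrier)) := by
    -- The connection loses one derivative, so the section has to be of class `∞ + 1`, which is no
    -- more than smooth.
    have e : (∞ + 1 : WithTop ℕ∞) = ∞ := rfl
    rw [e]
    intro z
    by_cases hz : z ∈ U
    · exact (f.contMDiff z).smul_section (hσ z hz)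
    · have hz' : z ∉ tsupport f := fun h => hz (hf h)
      have h0 : (fun x => (Bundle.TotalSpace.mk' X.Model x (τ x) :
          TangentBundle (𝓡 X.dim) X.carrier)) =ᶠ[nhds z]
          Bundle.zeroSection X.Model (TangentSpace (𝓡 X.dim) : X.carrier → Type _) := by
        filter_upwards [(isClosed_tsupport f).isOpen_compl.mem_nhds hz'] with w hw
        have : f w = 0 := image_eq_zero_of_notMem_tsupport hw
        simp [hτ, this, Bundle.zeroSection]
      exact (Bundle.contMDiff_zeroSection ℝ _ z).congr_of_eventuallyEq h0
  have hconn := (X.conn_smooth.contMDiff.contMDiff hτs.contMDiffOn).contMDiffAt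
    (Filter.univ_mem (f := nhds x))
  refine hconn.congr_of_eventuallyEq ?_
  -- The bump function is 1 near every point `w` close to `x`: agreement of `σ` and `τ` at `w` alone
  -- would not determine the derivative there.
  have h1 : ∀ᶠ w in nhds x, ∀ᶠ v in nhds w, f v = 1 := by
    have := f.eventuallyEq_one
    exact this.eventually_nhds
  filter_upwards [h1, hU.mem_nhds hx] with w hw hwU
  have : X.conn σ w = X.conn τ w := by
    refine X.conn.isCovariantDerivativeOn.congr_of_eventuallyEq (s := Set.univ)
      ((hσ w hwU).mdifferentiableAt (by simp)) ((hτs w).mdifferentiableAt (by simp))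
      Filter.univ_mem ?_
    filter_upwards [hw] with v hv
    simp [hτ, hv]
  simp only [this]

/-- The Christoffel symbol is a coordinate of the image of the smooth vector field `∇_{∂_i} ∂_j`
under the tangent map of the chart, read in the coordinates of the chart. -/
theorem contDiffOn_christoffel (φ : X.Chart) (i j k : Fin X.dim) :
    ContDiffOn ℝ ∞ (X.christoffel φ i j k) φ.1.target := by
  have h1 : ∀ x ∈ φ.1.source, ContMDiffAt (𝓡 X.dim) ((𝓡 X.dim).prod 𝓘(ℝ, X.Model)) ∞
      (fun x => (Bundle.TotalSpace.mk' X.Model x (X.conn (X.coordField φ j) x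
        (X.coordField φ i x)) : TangentBundle (𝓡 X.dim) X.carrier)) x := fun x hx =>
    (X.contMDiffAt_conn _ φ.1.open_source (fun z hz => X.contMDiffAt_coordField φ j hz)
      hx).clm_bundle_apply (X.contMDiffAt_coordField φ i hx)
  have h2 : ContMDiffOn (𝓡 X.dim) 𝓘(ℝ, X.Model) ∞ (fun x => mfderiv (𝓡 X.dim) (𝓡 X.dim) φ.1 x
      (X.conn (X.coordField φ j) x (X.coordField φ i x))) φ.1.source := by
    have h3 := (X.contMDiffOn_chart φ).contMDiffOn_tangentMapWithin (m := ∞) (by simp)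
      φ.1.open_source.uniqueMDiffOn
    have h4 : ContMDiffOn (𝓡 X.dim) (𝓡 X.dim).tangent ∞ (fun x => tangentMapWithin (𝓡 X.dim)
        (𝓡 X.dim) φ.1 φ.1.source (Bundle.TotalSpace.mk' X.Model x (X.conn (X.coordField φ j) x
        (X.coordField φ i x)) : TangentBundle (𝓡 X.dim) X.carrier)) φ.1.source :=
      h3.comp (fun x hx => (h1 x hx).contMDiffWithinAt) (fun x hx => hx)
    have h5 := (contMDiff_snd_tangentBundle_modelSpace X.Model (𝓡 X.dim)
      (n := ∞)).comp_contMDiffOn h4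
    refine h5.congr fun x hx => ?_
    simp only [Function.comp, tangentMapWithin]
    rw [mfderivWithin_of_isOpen φ.1.open_source hx]
  have h6 := h2.comp (X.contMDiffOn_chart_symm φ) (fun y hy => φ.1.map_target hy)
  have h7 := h6.contDiffOn
  exact (EuclideanSpace.proj (𝕜 := ℝ) k : X.Model →L[ℝ] ℝ).contDiff.comp_contDiffOn h7

end ConnManifold

/-! ### Connections and Poisson tensors on `ℝⁿ` with prescribed components. -/

section EuclideanModel

variable {n : ℕ}

/-- The endomorphism valued form `v ↦ (w ↦ ∑ Γ_{ij}^k v^j w^i ∂_k)` with coefficients `Γ`. -/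
def christoffelForm (Γ : Fin n → Fin n → Fin n → ℝ) :
    EuclideanSpace ℝ (Fin n) →L[ℝ] EuclideanSpace ℝ (Fin n) →L[ℝ] EuclideanSpace ℝ (Fin n) :=
  ∑ i, ∑ j, ∑ k, Γ i j k • (EuclideanSpace.proj (𝕜 := ℝ) j : EuclideanSpace ℝ (Fin n) →L[ℝ] ℝ).smulRight
    ((EuclideanSpace.proj (𝕜 := ℝ) i : EuclideanSpace ℝ (Fin n) →L[ℝ] ℝ).smulRight
      (EuclideanSpace.single k (1 : ℝ)))

theorem christoffelForm_apply (Γ : Fin n → Fin n → Fin n → ℝ) (v w : EuclideanSpace ℝ (Fin n))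
    (k : Fin n) : christoffelForm Γ v w k = ∑ i, ∑ j, Γ i j k * v j * w i := by
  simp only [christoffelForm, FunLike.coe_sum, Finset.sum_apply, smul_apply,
    ContinuousLinearMap.smulRight_apply, WithLp.ofLp_sum, WithLp.ofLp_smul, PiLp.ofLp_single,
    Pi.smul_apply, smul_eq_mul, PiLp.proj_apply]
  refine Finset.sum_congr rfl fun i _ => Finset.sum_congr rfl fun j _ => ?_
  rw [Finset.sum_eq_single k]
  · simp; ring
  · intro b _ hb; simp [hb.symm]
  · simp

theorem christoffelForm_symm {Γ : Fin n → Fin n → Fin n → ℝ} (hs : ∀ i j k, Γ i j k = Γ j i k)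
    (v w : EuclideanSpace ℝ (Fin n)) : christoffelForm Γ v w = christoffelForm Γ w v := by
  ext k
  rw [christoffelForm_apply, christoffelForm_apply, Finset.sum_comm]
  refine Finset.sum_congr rfl fun i _ => Finset.sum_congr rfl fun j _ => ?_
  rw [hs]; ring

theorem mdifferentiableAt_section_vectorSpace {E : Type*} [NormedAddCommGroup E] [NormedSpace ℝ E]
    {σ : ∀ x : E, TangentSpace 𝓘(ℝ, E) x} {x : E}
    (h : MDifferentiableAt 𝓘(ℝ, E) (𝓘(ℝ, E).prod 𝓘(ℝ, E))
      (fun y => (Bundle.TotalSpace.mk' E y (σ y) : TangentBundle 𝓘(ℝ, E) E)) x) :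
    DifferentiableAt ℝ (fun y => (σ y : E)) x := by
  have := (mdifferentiableAt_section (IB := 𝓘(ℝ, E)) (F := E) σ).1 h
  exact MDifferentiableAt.differentiableAt (by simpa using this)

theorem fderiv_add_clm_add {E : Type*} [NormedAddCommGroup E] [NormedSpace ℝ E] {σ τ : E → E} {x : E}
    (A : E →L[ℝ] E →L[ℝ] E) (hσ : DifferentiableAt ℝ σ x) (hτ : DifferentiableAt ℝ τ x) :
    fderiv ℝ (fun y => σ y + τ y) x + A (σ x + τ x) = fderiv ℝ σ x + A (σ x) +
      (fderiv ℝ τ x + A (τ x)) := by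
  rw [fderiv_fun_add hσ hτ, map_add]
  exact add_add_add_comm _ _ _ _

theorem fderiv_smul_add_clm_smul {E : Type*} [NormedAddCommGroup E] [NormedSpace ℝ E] {σ : E → E}
    {g : E → ℝ} {x : E} (A : E →L[ℝ] E →L[ℝ] E) (hσ : DifferentiableAt ℝ σ x)
    (hg : DifferentiableAt ℝ g x) :
    fderiv ℝ (fun y => g y • σ y) x + A (g x • σ x) = g x • (fderiv ℝ σ x + A (σ x)) +
      (fderiv ℝ g x).smulRight (σ x) := by
  rw [fderiv_fun_smul hg hσ, map_smul, smul_add]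
  exact add_right_comm _ _ _

/-- The connection on `ℝⁿ` with given Christoffel symbols. -/
def euclideanConn (Γ : Fin n → Fin n → Fin n → EuclideanSpace ℝ (Fin n) → ℝ) :
    CovariantDerivative (𝓡 n) (EuclideanSpace ℝ (Fin n))
      (TangentSpace (𝓡 n) : EuclideanSpace ℝ (Fin n) → Type _) where
  toFun σ x := (fderiv ℝ (fun y => (σ y : EuclideanSpace ℝ (Fin n))) x
      + christoffelForm (fun i j k => Γ i j k x) (σ x) :
        EuclideanSpace ℝ (Fin n) →L[ℝ] EuclideanSpace ℝ (Fin n))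
  isCovariantDerivativeOnUniv :=
    { add := fun {σ σ' x} hσ hσ' _ => fderiv_add_clm_add
        (christoffelForm fun i j k => Γ i j k x) (mdifferentiableAt_section_vectorSpace hσ)
        (mdifferentiableAt_section_vectorSpace hσ')
      leibniz := fun {σ g x} hσ hg _ => by
        have h3 : mvfderiv 𝓘(ℝ, EuclideanSpace ℝ (Fin n)) g x = fderiv ℝ g x := mfderiv_eq_fderiv
        rw [h3]
        exact fderiv_smul_add_clm_smul (christoffelForm fun i j k => Γ i j k x)
          (mdifferentiableAt_section_vectorSpace hσ) hg.differentiableAt }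

/-- The trivializations of the tangent bundle of a vector space are identities, so smoothness of a
section of the bundle of endomorphisms is smoothness of a map between vector spaces. -/
theorem contMDiff_euclideanConn (Γ : Fin n → Fin n → Fin n → EuclideanSpace ℝ (Fin n) → ℝ)
    (hΓ : ∀ i j k, ContDiff ℝ ∞ (Γ i j k)) :
    CovariantDerivative.ContMDiffCovariantDerivative (euclideanConn Γ) ∞ := by
  refine ⟨⟨fun {σ} hσ => ?_⟩⟩
  have h1 : ContDiff ℝ ∞ (fun y => (σ y : EuclideanSpace ℝ (Fin n))) :=
    contMDiff_vectorSpace_iff_contDiff.1 (contMDiffOn_univ.1 hσ)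
  have h2 : ContDiff ℝ ∞ (fun x => (fderiv ℝ (fun y => (σ y : EuclideanSpace ℝ (Fin n))) x
      + christoffelForm (fun i j k => Γ i j k x) (σ x) :
        EuclideanSpace ℝ (Fin n) →L[ℝ] EuclideanSpace ℝ (Fin n))) := by
    refine (h1.fderiv_right (m := ∞) (by simp)).add ?_
    refine ContDiff.clm_apply ?_ h1
    unfold christoffelForm
    exact ContDiff.sum fun i _ => ContDiff.sum fun j _ => ContDiff.sum fun k _ =>
      (hΓ i j k).smul contDiff_const
  rw [contMDiffOn_univ]
  intro x
  rw [contMDiffAt_hom_bundle]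
  refine ⟨contMDiffAt_id, ?_⟩
  refine (h2.contMDiff.contMDiffAt (x := x)).congr_of_eventuallyEq (Filter.Eventually.of_forall ?_)
  intro y
  exact inCoordinates_tangent_bundle_core_model_space _ _ _ _ _

/-- The part of the connection given by the ordinary derivative produces exactly the Lie bracket,
and the Christoffel terms cancel by symmetry. -/
theorem torsion_euclideanConn (Γ : Fin n → Fin n → Fin n → EuclideanSpace ℝ (Fin n) → ℝ)
    (hs : ∀ i j k y, Γ i j k y = Γ j i k y) : (euclideanConn Γ).torsion = 0 := by
  rw [CovariantDerivative.torsion_eq_zero_iff]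
  intro V W x hV hW
  have h := congrFun (VectorField.mlieBracketWithin_eq_lieBracketWithin (𝕜 := ℝ)
    (V := V) (W := W) (s := Set.univ)) x
  refine Eq.trans ?_ (h.symm.trans (congrFun VectorField.mlieBracketWithin_univ x))
  refine Eq.trans ?_ (congrArg₂ (fun a b : EuclideanSpace ℝ (Fin n) →L[ℝ] EuclideanSpace ℝ (Fin n) =>
    a (V x) - b (W x)) (congrFun (fderivWithin_univ (𝕜 := ℝ) (f := fun y => (W y : EuclideanSpace ℝ (Fin n)))) x)
    (congrFun (fderivWithin_univ (𝕜 := ℝ) (f := fun y => (V y : EuclideanSpace ℝ (Fin n)))) x)).symm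
  have h2 := christoffelForm_symm (fun i j k => hs i j k x) (W x) (V x)
  have h3 : ∀ a b c d : EuclideanSpace ℝ (Fin n), c = d → (a + c) - (b + d) = a - b := by
    rintro a b c d rfl; abel
  exact h3 _ _ _ _ h2

/-- `ℝⁿ` with the connection with given symmetric Christoffel symbols. -/
def euclideanManifold (Γ : Fin n → Fin n → Fin n → EuclideanSpace ℝ (Fin n) → ℝ)
    (hΓ : ∀ i j k, ContDiff ℝ ∞ (Γ i j k)) (hs : ∀ i j k y, Γ i j k y = Γ j i k y) :
    ConnManifold where
  dim := n
  carrier := EuclideanSpace ℝ (Fin n)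
  conn := euclideanConn Γ
  conn_smooth := contMDiff_euclideanConn Γ hΓ
  conn_torsionFree := torsion_euclideanConn Γ hs

variable {Γ : Fin n → Fin n → Fin n → EuclideanSpace ℝ (Fin n) → ℝ}
  {hΓ : ∀ i j k, ContDiff ℝ ∞ (Γ i j k)} {hs : ∀ i j k y, Γ i j k y = Γ j i k y}

/-- The identity chart of `ℝⁿ`. -/
def euclideanChart : (euclideanManifold Γ hΓ hs).Chart :=
  ⟨OpenPartialHomeomorph.refl _, rfl⟩

/-- The atlas of the model space contains nothing but the identity, so statements about all charts
concern this one. -/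
theorem eq_euclideanChart (φ : (euclideanManifold Γ hΓ hs).Chart) : φ = euclideanChart :=
  Subtype.ext φ.2

theorem mfderiv_refl_euclidean (x : EuclideanSpace ℝ (Fin n)) :
    mfderiv (𝓡 n) (𝓡 n) (OpenPartialHomeomorph.refl (EuclideanSpace ℝ (Fin n))) x
      = ContinuousLinearMap.id ℝ (EuclideanSpace ℝ (Fin n)) := mfderiv_id

theorem coordField_euclideanChart (i : Fin n) (x : EuclideanSpace ℝ (Fin n)) :
    (euclideanManifold Γ hΓ hs).coordField euclideanChart i x
      = (EuclideanSpace.single i 1 : EuclideanSpace ℝ (Fin n)) := by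
  show (mfderiv (𝓡 n) (𝓡 n) (OpenPartialHomeomorph.refl (EuclideanSpace ℝ (Fin n))) x).inverse
    (EuclideanSpace.single i 1 : EuclideanSpace ℝ (Fin n)) = _
  refine (congrArg (fun A : EuclideanSpace ℝ (Fin n) →L[ℝ] EuclideanSpace ℝ (Fin n) => A.inverse
    (EuclideanSpace.single i 1 : EuclideanSpace ℝ (Fin n))) (mfderiv_refl_euclidean x)).trans ?_
  show (ContinuousLinearMap.id ℝ (EuclideanSpace ℝ (Fin n))).inverse _ = _
  rw [ContinuousLinearMap.inverse_id]
  rfl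

theorem coordForm_euclideanChart (i : Fin n) (x : EuclideanSpace ℝ (Fin n))
    (v : EuclideanSpace ℝ (Fin n)) :
    (euclideanManifold Γ hΓ hs).coordForm euclideanChart i x v = v i := by
  show (EuclideanSpace.proj i : EuclideanSpace ℝ (Fin n) →L[ℝ] ℝ)
    (mfderiv (𝓡 n) (𝓡 n) (OpenPartialHomeomorph.refl _) x v) = _
  erw [mfderiv_refl_euclidean]
  rfl

/-- The coordinate fields of the identity chart are constant, so that the ordinary derivative
contributes nothing. -/
theorem christoffel_euclideanChart (i j k : Fin n) (y : EuclideanSpace ℝ (Fin n)) :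
    (euclideanManifold Γ hΓ hs).christoffel euclideanChart i j k y = Γ i j k y := by
  have h1 : (euclideanManifold Γ hΓ hs).coordField euclideanChart j
      = fun _ => (EuclideanSpace.single j 1 : EuclideanSpace ℝ (Fin n)) :=
    funext fun x => coordField_euclideanChart j x
  unfold ConnManifold.christoffel
  rw [h1]
  refine (coordForm_euclideanChart k y _).trans ?_
  show ((fderiv ℝ (fun _ => (EuclideanSpace.single j 1 : EuclideanSpace ℝ (Fin n))) y
    + christoffelForm (fun i j k => Γ i j k y) (EuclideanSpace.single j 1))
      ((euclideanManifold Γ hΓ hs).coordField euclideanChart i y : EuclideanSpace ℝ (Fin n)) :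
        EuclideanSpace ℝ (Fin n)) k = _
  rw [coordField_euclideanChart, fderiv_fun_const]
  simp only [Pi.zero_apply, zero_add]
  rw [christoffelForm_apply, Finset.sum_eq_single i, Finset.sum_eq_single j]
  · simp
  · intro b _ hb; simp [hb]
  · simp
  · intro b _ hb; simp [hb]
  · simp

/-- The bilinear form on the dual of `ℝⁿ` with given matrix. -/
def dualForm (c : Fin n → Fin n → ℝ) : (EuclideanSpace ℝ (Fin n) →L[ℝ] ℝ) →ₗ[ℝ]
    (EuclideanSpace ℝ (Fin n) →L[ℝ] ℝ) →ₗ[ℝ] ℝ :=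
  LinearMap.mk₂ ℝ (fun α β => ∑ i, ∑ j, c i j * α (EuclideanSpace.single i 1)
      * β (EuclideanSpace.single j 1))
    (fun a b d => by simp only [add_apply, mul_add, add_mul, Finset.sum_add_distrib])
    (fun t a b => by
      simp only [smul_apply, smul_eq_mul, Finset.mul_sum]
      exact Finset.sum_congr rfl fun i _ => Finset.sum_congr rfl fun j _ => by ring)
    (fun a b d => by simp only [add_apply, mul_add, Finset.sum_add_distrib])
    (fun t a b => by
      simp only [smul_apply, smul_eq_mul, Finset.mul_sum]
      exact Finset.sum_congr rfl fun i _ => Finset.sum_congr rfl fun j _ => by ring)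

theorem dualForm_swap {c : Fin n → Fin n → ℝ} (hc : ∀ i j, c i j = - c j i)
    (α β : EuclideanSpace ℝ (Fin n) →L[ℝ] ℝ) : dualForm c α β = - dualForm c β α := by
  simp only [dualForm, LinearMap.mk₂_apply]
  rw [Finset.sum_comm, ← Finset.sum_neg_distrib]
  refine Finset.sum_congr rfl fun i _ => ?_
  rw [← Finset.sum_neg_distrib]
  refine Finset.sum_congr rfl fun j _ => ?_
  rw [hc]; ring

theorem dualForm_of_apply_single (c : Fin n → Fin n → ℝ)
    {α β : EuclideanSpace ℝ (Fin n) →L[ℝ] ℝ} {i j : Fin n}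
    (hα : ∀ a, α (EuclideanSpace.single a 1) = if a = i then 1 else 0)
    (hβ : ∀ a, β (EuclideanSpace.single a 1) = if a = j then 1 else 0) :
    dualForm c α β = c i j := by
  simp [dualForm, LinearMap.mk₂_apply, hα, hβ]

theorem bivectorComp_dualForm (p : Fin n → Fin n → EuclideanSpace ℝ (Fin n) → ℝ)
    (φ : (euclideanManifold Γ hΓ hs).Chart) (i j : Fin n) :
    (euclideanManifold Γ hΓ hs).bivectorComp (fun x => dualForm fun a b => p a b x) φ i j
      = p i j := by
  obtain rfl := eq_euclideanChart φ
  funext y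
  have h : ∀ i a : Fin n, ((euclideanManifold Γ hΓ hs).coordForm euclideanChart i y :
      EuclideanSpace ℝ (Fin n) →L[ℝ] ℝ) (EuclideanSpace.single a 1) = if a = i then 1 else 0 := by
    intro i a
    refine (coordForm_euclideanChart i y _).trans ?_
    exact (PiLp.single_apply 2 ℝ a (1 : ℝ) i).trans (by simp [eq_comm])
  exact dualForm_of_apply_single _ (h i) (h j)

/-- A Poisson tensor on `ℝⁿ` with given components. -/
def euclideanPoisson (p : Fin n → Fin n → EuclideanSpace ℝ (Fin n) → ℝ)
    (hp : ∀ i j, ContDiff ℝ ∞ (p i j)) (hsk : ∀ i j y, p i j y = - p j i y)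
    (hj : ∀ i j k y, ∑ l, (p i l y * pd l (p j k) y + p j l y * pd l (p k i) y
      + p k l y * pd l (p i j) y) = 0) :
    (euclideanManifold Γ hΓ hs).PoissonTensor where
  toFun x := dualForm fun a b => p a b x
  skew x α β := dualForm_swap (fun i j => hsk i j x) α β
  smooth φ i j := (hp i j).contDiffOn.congr fun y _ => congrFun (bivectorComp_dualForm p φ i j) y
  jacobi φ i j k y _ := by
    have h := hj i j k y
    rw [← (funext₂ fun i j => bivectorComp_dualForm p φ i j :
      (euclideanManifold Γ hΓ hs).bivectorComp (fun x => dualForm fun a b => p a b x) φ = p)] at h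
    exact h

theorem comp_euclideanPoisson (p : Fin n → Fin n → EuclideanSpace ℝ (Fin n) → ℝ)
    (hp : ∀ i j, ContDiff ℝ ∞ (p i j)) (hsk : ∀ i j y, p i j y = - p j i y)
    (hj : ∀ i j k y, ∑ l, (p i l y * pd l (p j k) y + p j l y * pd l (p k i) y
      + p k l y * pd l (p i j) y) = 0) (φ : (euclideanManifold Γ hΓ hs).Chart) (i j : Fin n) :
    (euclideanPoisson p hp hsk hj).comp φ i j = p i j :=
  bivectorComp_dualForm p φ i j

end EuclideanModel

/-! ### Rules for partial derivatives. -/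

section PartialDerivatives

variable {n : ℕ} {y : EuclideanSpace ℝ (Fin n)} {l : Fin n}

theorem pd_fun_add {f g : EuclideanSpace ℝ (Fin n) → ℝ} (hf : DifferentiableAt ℝ f y)
    (hg : DifferentiableAt ℝ g y) : pd l (fun z => f z + g z) y = pd l f y + pd l g y := by
  simp [pd, fderiv_fun_add hf hg]

theorem pd_fun_sub {f g : EuclideanSpace ℝ (Fin n) → ℝ} (hf : DifferentiableAt ℝ f y)
    (hg : DifferentiableAt ℝ g y) : pd l (fun z => f z - g z) y = pd l f y - pd l g y := by
  simp [pd, fderiv_fun_sub hf hg]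

theorem pd_fun_mul {f g : EuclideanSpace ℝ (Fin n) → ℝ} (hf : DifferentiableAt ℝ f y)
    (hg : DifferentiableAt ℝ g y) :
    pd l (fun z => f z * g z) y = pd l f y * g y + f y * pd l g y := by
  simp [pd, fderiv_fun_mul hf hg]; ring

theorem pd_fun_const_mul {f : EuclideanSpace ℝ (Fin n) → ℝ} (c : ℝ) (hf : DifferentiableAt ℝ f y) :
    pd l (fun z => c * f z) y = c * pd l f y := by
  simp [pd, fderiv_const_mul hf]

theorem pd_fun_sum {ι : Type*} {s : Finset ι} {f : ι → EuclideanSpace ℝ (Fin n) → ℝ}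
    (hf : ∀ i ∈ s, DifferentiableAt ℝ (f i) y) :
    pd l (fun z => ∑ i ∈ s, f i z) y = ∑ i ∈ s, pd l (f i) y := by
  simp [pd, fderiv_fun_sum hf]

theorem pd_const (c : ℝ) : pd l (fun _ : EuclideanSpace ℝ (Fin n) => c) y = 0 := by
  simp [pd]

theorem pd_congr_of_eqOn {f g : EuclideanSpace ℝ (Fin n) → ℝ} {s : Set (EuclideanSpace ℝ (Fin n))}
    (hs : IsOpen s) (h : ∀ z ∈ s, f z = g z) (hy : y ∈ s) : pd l f y = pd l g y := by
  unfold pd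
  rw [Filter.EventuallyEq.fderiv_eq (Filter.eventually_of_mem (hs.mem_nhds hy) h)]

/-- Symmetry of the second derivative. It is used for Christoffel symbols, components of tensors and
functions which are smooth only on the target of a chart, hence the open set `s`. -/
theorem pd_pd_comm {f : EuclideanSpace ℝ (Fin n) → ℝ} {s : Set (EuclideanSpace ℝ (Fin n))}
    (hs : IsOpen s) (hf : ContDiffOn ℝ ∞ f s) (hy : y ∈ s) (k : Fin n) :
    pd k (pd l f) y = pd l (pd k f) y := by
  have hc : ContDiffAt ℝ ∞ f y := hf.contDiffAt (hs.mem_nhds hy)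
  have hd : DifferentiableAt ℝ (fderiv ℝ f) y :=
    (hc.fderiv_right (m := 1) (WithTop.coe_le_coe.2 le_top)).differentiableAt one_ne_zero
  have h2 := (hc.of_le (WithTop.coe_le_coe.2 le_top : (2 : WithTop ℕ∞) ≤ ∞)).isSymmSndFDerivAt
    (by simp [minSmoothness_of_isRCLikeNormedField])
  have h3 : ∀ a b : Fin n, pd a (pd b f) y
      = fderiv ℝ (fderiv ℝ f) y (EuclideanSpace.single a 1) (EuclideanSpace.single b 1) := by
    intro a b
    unfold pd
    rw [fderiv_clm_apply hd (differentiableAt_const _)]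
    simp
  rw [h3, h3]
  exact h2 _ _

end PartialDerivatives

/-! ### Smoothness of covariant derivatives and of the curvature. -/

namespace ConnManifold

variable {X : ConnManifold}

/-- A tensor field has smooth components in a chart. -/
def Components.SmoothOn {b a : ℕ} (T : X.Components b a) (φ : X.Chart) : Prop :=
  ∀ L U, ContDiffOn ℝ ∞ (T L U) φ.1.target

variable {φ : X.Chart} {b a : ℕ} {T : X.Components b a}

theorem differentiableAt_of_contDiffOn {f : X.Model → ℝ} (hf : ContDiffOn ℝ ∞ f φ.1.target)
    {y : X.Model} (hy : y ∈ φ.1.target) : DifferentiableAt ℝ f y :=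
  (hf.contDiffAt (φ.1.open_target.mem_nhds hy)).differentiableAt (by simp)

theorem Components.SmoothOn.differentiableAt (hT : T.SmoothOn φ) {y : X.Model}
    (hy : y ∈ φ.1.target) (L : Fin b → Fin X.dim) (U : Fin a → Fin X.dim) :
    DifferentiableAt ℝ (T L U) y :=
  differentiableAt_of_contDiffOn (hT L U) hy

theorem Components.SmoothOn.covDeriv (hT : T.SmoothOn φ) : (X.covDeriv φ T).SmoothOn φ := by
  intro L U
  unfold ConnManifold.covDeriv
  refine ((contDiffOn_pd φ.1.open_target (hT _ _) _).sub ?_).add ?_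
  · exact ContDiffOn.sum fun s _ => ContDiffOn.sum fun e _ =>
      (X.contDiffOn_christoffel φ _ _ _).mul (hT _ _)
  · exact ContDiffOn.sum fun s _ => ContDiffOn.sum fun e _ =>
      (X.contDiffOn_christoffel φ _ _ _).mul (hT _ _)

theorem Components.SmoothOn.iterCovDeriv (hT : T.SmoothOn φ) :
    ∀ m, (X.iterCovDeriv φ T m).SmoothOn φ
  | 0 => hT
  | m + 1 => (Components.SmoothOn.iterCovDeriv hT m).covDeriv

theorem smoothOn_curvature (φ : X.Chart) : (X.curvature φ).SmoothOn φ := by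
  intro L U
  unfold ConnManifold.curvature
  refine ((contDiffOn_pd φ.1.open_target (X.contDiffOn_christoffel φ _ _ _) _).sub
    (contDiffOn_pd φ.1.open_target (X.contDiffOn_christoffel φ _ _ _) _)).add ?_
  exact ContDiffOn.sum fun e _ => ((X.contDiffOn_christoffel φ _ _ _).mul
    (X.contDiffOn_christoffel φ _ _ _)).sub ((X.contDiffOn_christoffel φ _ _ _).mul
    (X.contDiffOn_christoffel φ _ _ _))

theorem smoothOn_comp (P : X.PoissonTensor) (φ : X.Chart) (f : Factor) :
    Components.SmoothOn (f.comp P φ) φ := by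
  cases f with
  | P m => exact Components.SmoothOn.iterCovDeriv (fun L U => P.smooth φ _ _) m
  | R m => exact Components.SmoothOn.iterCovDeriv (smoothOn_curvature φ) m

end ConnManifold

/-! ### The Ricci identity -/

section SlotOperator

variable {S : Type*} [Fintype S] [DecidableEq S] {n : ℕ}

/-- The operator on functions of multi-indices by which a family of matrices, one for each slot,
acts as a derivation. -/
def slotOperator (A : S → Fin n → Fin n → ℝ) (T : (S → Fin n) → ℝ) (V : S → Fin n) : ℝ :=
  ∑ s, ∑ e, A s (V s) e * T (Function.update V s e)

theorem slotOperator_slotOperator (A B : S → Fin n → Fin n → ℝ) (T : (S → Fin n) → ℝ)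
    (V : S → Fin n) :
    slotOperator A (slotOperator B T) V = ∑ s, ∑ t, ∑ e, ∑ f,
      A s (V s) e * (B t (Function.update V s e t) f
        * T (Function.update (Function.update V s e) t f)) := by
  unfold slotOperator
  simp only [Finset.mul_sum]
  exact Finset.sum_congr rfl fun s _ => Finset.sum_comm

/-- Matrices which act on different slots commute, so only the commutators of the two matrices in
the same slot survive. -/
theorem slotOperator_comm (A B : S → Fin n → Fin n → ℝ) (T : (S → Fin n) → ℝ) (V : S → Fin n) :
    slotOperator A (slotOperator B T) V - slotOperator B (slotOperator A T) V
      = slotOperator (fun s u v => ∑ e, (A s u e * B s e v - B s u e * A s e v)) T V := by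
  rw [slotOperator_slotOperator, slotOperator_slotOperator]
  conv_lhs => rw [sub_eq_add_neg]; arg 2; rw [Finset.sum_comm]
  rw [← sub_eq_add_neg, ← Finset.sum_sub_distrib]
  refine Finset.sum_congr rfl fun s _ => ?_
  rw [← Finset.sum_sub_distrib, Finset.sum_eq_single s]
  · simp only [Function.update_self, Function.update_idem, Finset.sum_mul]
    conv_rhs => rw [Finset.sum_comm]
    simp only [← Finset.sum_sub_distrib]
    exact Finset.sum_congr rfl fun e _ => Finset.sum_congr rfl fun f _ => by ring
  -- Two different slots: the two orders give the same terms after an exchange of the summations.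
  · intro t _ hts
    rw [sub_eq_zero]
    conv_rhs => rw [Finset.sum_comm]
    refine Finset.sum_congr rfl fun e _ => Finset.sum_congr rfl fun f _ => ?_
    rw [Function.update_of_ne hts, Function.update_of_ne hts.symm, Function.update_comm hts]
    ring
  · simp

theorem slotOperator_add (A : S → Fin n → Fin n → ℝ) (T T' : (S → Fin n) → ℝ) (V : S → Fin n) :
    slotOperator A (fun V => T V + T' V) V = slotOperator A T V + slotOperator A T' V := by
  simp only [slotOperator, mul_add, Finset.sum_add_distrib]

end SlotOperator

namespace ConnManifold

variable {X : ConnManifold} {φ : X.Chart} {b a : ℕ} {T : X.Components b a} {y : X.Model}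

/-- A tensor field as a function of all its indices. -/
def Components.flat (T : X.Components b a) (V : Fin b ⊕ Fin a → Fin X.dim) (y : X.Model) : ℝ :=
  T (fun s => V (Sum.inl s)) (fun s => V (Sum.inr s)) y

/-- The matrices of the connection, acting on lower and upper indices. -/
def connMatrix (X : ConnManifold) (φ : X.Chart) (b a : ℕ) (k : Fin X.dim) (y : X.Model) :
    Fin b ⊕ Fin a → Fin X.dim → Fin X.dim → ℝ
  | Sum.inl _, v, e => - X.christoffel φ k v e y
  | Sum.inr _, v, e => X.christoffel φ k e v y

theorem update_inl {b a n : ℕ} (V : Fin b ⊕ Fin a → Fin n) (s : Fin b) (e : Fin n) :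
    (fun t => Function.update V (Sum.inl s) e (Sum.inl t))
      = Function.update (fun t => V (Sum.inl t)) s e := by
  funext t; simp [Function.update_apply]

theorem update_inr {b a n : ℕ} (V : Fin b ⊕ Fin a → Fin n) (s : Fin a) (e : Fin n) :
    (fun t => Function.update V (Sum.inr s) e (Sum.inr t))
      = Function.update (fun t => V (Sum.inr t)) s e := by
  funext t; simp [Function.update_apply]

/-- Puts `∇_k` into the form `∂_k + A_k`, where `A_k` acts as a derivation on all slots at once.
Lower and upper indices then need no separate treatment, and the Ricci identity becomes a
computation of commutators. -/
theorem covDeriv_eq_slotOperator (T : X.Components b a) (k : Fin X.dim)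
    (V : Fin b ⊕ Fin a → Fin X.dim) (y : X.Model) :
    X.covDeriv φ T (Fin.cons k fun s => V (Sum.inl s)) (fun s => V (Sum.inr s)) y
      = pd k (T.flat V) y + slotOperator (X.connMatrix φ b a k y) (fun V => T.flat V y) V := by
  have e1 : (Components.flat T V) = T (fun s => V (Sum.inl s)) (fun s => V (Sum.inr s)) := rfl
  simp only [ConnManifold.covDeriv, Fin.cons_zero, Fin.tail_cons, slotOperator,
    Fintype.sum_sum_type, connMatrix, e1, Components.flat, update_inl, update_inr,
    neg_mul, Finset.sum_neg_distrib, Function.update_of_ne (Sum.inl_ne_inr),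
    Function.update_of_ne (Sum.inr_ne_inl)]
  ring

/-- The action of the curvature on a tensor field. -/
def curvatureMatrix (X : ConnManifold) (φ : X.Chart) (b a : ℕ) (i j : Fin X.dim) (y : X.Model) :
    Fin b ⊕ Fin a → Fin X.dim → Fin X.dim → ℝ
  | Sum.inl _, v, e => - X.curvature φ ![i, j, v] ![e] y
  | Sum.inr _, v, e => X.curvature φ ![i, j, e] ![v] y

theorem contDiffOn_connMatrix (k : Fin X.dim) (s : Fin b ⊕ Fin a) (v e : Fin X.dim) :
    ContDiffOn ℝ ∞ (fun y => X.connMatrix φ b a k y s v e) φ.1.target := by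
  cases s with
  | inl s => exact (X.contDiffOn_christoffel φ _ _ _).neg
  | inr s => exact X.contDiffOn_christoffel φ _ _ _

/-- The curvature is `∂_i A_j - ∂_j A_i + [A_i, A_j]` in every slot. On a lower slot `A` is the
negative transpose of its form on an upper slot; this is compatible with commutators up to the same
sign, so the formula is uniform. -/
theorem curvatureMatrix_eq (i j : Fin X.dim) (s : Fin b ⊕ Fin a) (v e : Fin X.dim) :
    X.curvatureMatrix φ b a i j y s v e
      = pd i (fun y => X.connMatrix φ b a j y s v e) y
        - pd j (fun y => X.connMatrix φ b a i y s v e) y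
        + ∑ x, (X.connMatrix φ b a i y s v x * X.connMatrix φ b a j y s x e
          - X.connMatrix φ b a j y s v x * X.connMatrix φ b a i y s x e) := by
  have hn : ∀ (k : Fin X.dim) (f : X.Model → ℝ), pd k (fun y => - f y) y = - pd k f y := by
    intro k f; simp [pd]
  cases s with
  | inl s =>
    simp only [curvatureMatrix, connMatrix, curvature, hn, Matrix.cons_val_zero,
      Matrix.cons_val_one, Matrix.cons_val_two, Matrix.head_cons, Matrix.tail_cons]
    rw [neg_add, ← Finset.sum_neg_distrib]
    congr 1
    · simp; ring
    · exact Finset.sum_congr rfl fun x _ => by simp; ring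
  | inr s =>
    simp only [curvatureMatrix, connMatrix, curvature]
    congr 1

theorem pd_slotOperator (hT : T.SmoothOn φ) (i j : Fin X.dim) (V : Fin b ⊕ Fin a → Fin X.dim)
    (hy : y ∈ φ.1.target) :
    pd i (fun y => slotOperator (X.connMatrix φ b a j y) (fun V => T.flat V y) V) y
      = slotOperator (fun s v e => pd i (fun y => X.connMatrix φ b a j y s v e) y)
          (fun V => T.flat V y) V
        + slotOperator (X.connMatrix φ b a j y) (fun V => pd i (T.flat V) y) V := by
  have h1 : ∀ s v e, DifferentiableAt ℝ (fun y => X.connMatrix φ b a j y s v e) y :=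
    fun s v e => differentiableAt_of_contDiffOn (contDiffOn_connMatrix j s v e) hy
  have h2 : ∀ V, DifferentiableAt ℝ (T.flat V) y := fun V => hT.differentiableAt hy _ _
  unfold slotOperator
  beta_reduce
  rw [pd_fun_sum fun s _ => DifferentiableAt.fun_sum fun e _ => (h1 s _ e).fun_mul (h2 _),
    ← Finset.sum_add_distrib]
  refine Finset.sum_congr rfl fun s _ => ?_
  rw [pd_fun_sum fun e _ => (h1 s _ e).fun_mul (h2 _), ← Finset.sum_add_distrib]
  exact Finset.sum_congr rfl fun e _ => pd_fun_mul (h1 s _ e) (h2 _)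

theorem contDiffOn_slotOperator (hT : T.SmoothOn φ) (j : Fin X.dim)
    (V : Fin b ⊕ Fin a → Fin X.dim) :
    ContDiffOn ℝ ∞ (fun y => slotOperator (X.connMatrix φ b a j y) (fun V => T.flat V y) V)
      φ.1.target :=
  ContDiffOn.sum fun _ _ => ContDiffOn.sum fun _ _ => (contDiffOn_connMatrix j _ _ _).mul (hT _ _)

/-- The outer derivative acts on the slots of `T` and also on the index `j` of the inner derivative;
the latter gives the last sum, which contains `Γ_{ij}^e`. Of the remaining terms, those with one
connection matrix and one derivative of `T` are together symmetric in `i` and `j`. -/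
theorem covDeriv_covDeriv (hT : T.SmoothOn φ) (i j : Fin X.dim) (V : Fin b ⊕ Fin a → Fin X.dim)
    (hy : y ∈ φ.1.target) :
    X.covDeriv φ (X.covDeriv φ T) (Fin.cons i (Fin.cons j fun s => V (Sum.inl s)))
        (fun s => V (Sum.inr s)) y
      = pd i (pd j (T.flat V)) y
        + slotOperator (fun s v e => pd i (fun y => X.connMatrix φ b a j y s v e) y)
          (fun V => T.flat V y) V
        + slotOperator (X.connMatrix φ b a j y) (fun V => pd i (T.flat V) y) V
        + slotOperator (X.connMatrix φ b a i y) (fun V => pd j (T.flat V) y) V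
        + slotOperator (X.connMatrix φ b a i y)
          (slotOperator (X.connMatrix φ b a j y) fun V => T.flat V y) V
        - ∑ e, X.christoffel φ i j e y
          * X.covDeriv φ T (Fin.cons e fun s => V (Sum.inl s)) (fun s => V (Sum.inr s)) y := by
  have key : ∀ (V : Fin b ⊕ Fin a → Fin X.dim) (z : X.Model),
      X.covDeriv φ T (Fin.cons j fun s => V (Sum.inl s)) (fun s => V (Sum.inr s)) z
      = pd j (T.flat V) z + slotOperator (X.connMatrix φ b a j z) (fun V => T.flat V z) V :=
    fun V z => covDeriv_eq_slotOperator T j V z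
  have h1 : pd i (fun z => X.covDeriv φ T (Fin.cons j fun s => V (Sum.inl s))
      (fun s => V (Sum.inr s)) z) y = pd i (pd j (T.flat V)) y
        + (slotOperator (fun s v e => pd i (fun y => X.connMatrix φ b a j y s v e) y)
          (fun V => T.flat V y) V
        + slotOperator (X.connMatrix φ b a j y) (fun V => pd i (T.flat V) y) V) := by
    simp only [key]
    rw [pd_fun_add, pd_slotOperator hT i j V hy]
    · exact differentiableAt_of_contDiffOn (contDiffOn_pd φ.1.open_target (hT _ _) j) hy
    · exact differentiableAt_of_contDiffOn (contDiffOn_slotOperator hT j V) hy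
  have h2 : slotOperator (X.connMatrix φ b a i y) (fun V => pd j (T.flat V) y) V
        + slotOperator (X.connMatrix φ b a i y)
          (slotOperator (X.connMatrix φ b a j y) fun V => T.flat V y) V
      = slotOperator (X.connMatrix φ b a i y) (fun V => X.covDeriv φ T
        (Fin.cons j fun s => V (Sum.inl s)) (fun s => V (Sum.inr s)) y) V := by
    simp only [key]
    rw [slotOperator_add]
  rw [add_assoc (_ + _ + _), h2]
  rw [ConnManifold.covDeriv]
  simp only [Fin.cons_zero, Fin.tail_cons, Fin.sum_univ_succ, Fin.cons_succ, Fin.update_cons_zero,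
    ← Fin.cons_update]
  rw [show (X.covDeriv φ T (Fin.cons j fun s => V (Sum.inl s)) fun s => V (Sum.inr s))
    = fun z => X.covDeriv φ T (Fin.cons j fun s => V (Sum.inl s))
      (fun s => V (Sum.inr s)) z from rfl, h1]
  simp only [slotOperator, Fintype.sum_sum_type, connMatrix, update_inl, update_inr, neg_mul,
    Finset.sum_neg_distrib, Function.update_of_ne, ne_eq, reduceCtorEq, not_false_eq_true]
  ring

/-- The Ricci identity. -/
theorem ricci_identity (hT : T.SmoothOn φ) (i j : Fin X.dim) (V : Fin b ⊕ Fin a → Fin X.dim)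
    (hy : y ∈ φ.1.target) :
    X.covDeriv φ (X.covDeriv φ T) (Fin.cons i (Fin.cons j fun s => V (Sum.inl s)))
        (fun s => V (Sum.inr s)) y
      - X.covDeriv φ (X.covDeriv φ T) (Fin.cons j (Fin.cons i fun s => V (Sum.inl s)))
        (fun s => V (Sum.inr s)) y
      = slotOperator (X.curvatureMatrix φ b a i j y) (fun V => T.flat V y) V := by
  have hTV : ContDiffOn ℝ ∞ (T.flat V) φ.1.target := hT _ _
  rw [covDeriv_covDeriv hT i j V hy, covDeriv_covDeriv hT j i V hy,
    pd_pd_comm φ.1.open_target hTV hy i]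
  -- Vanishing torsion makes the terms which come from the index of the inner derivative cancel.
  have hs : ∀ e, X.christoffel φ j i e y = X.christoffel φ i j e y := fun e =>
    X.christoffel_symm φ j i e hy
  simp only [hs]
  have hc := slotOperator_comm (X.connMatrix φ b a i y) (X.connMatrix φ b a j y)
    (fun V => T.flat V y) V
  have hR : slotOperator (X.curvatureMatrix φ b a i j y) (fun V => T.flat V y) V
      = slotOperator (fun s v e => pd i (fun y => X.connMatrix φ b a j y s v e) y)
          (fun V => T.flat V y) V
        - slotOperator (fun s v e => pd j (fun y => X.connMatrix φ b a i y s v e) y)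
          (fun V => T.flat V y) V
        + slotOperator (fun s u v => ∑ e, (X.connMatrix φ b a i y s u e * X.connMatrix φ b a j y s e v
          - X.connMatrix φ b a j y s u e * X.connMatrix φ b a i y s e v))
          (fun V => T.flat V y) V := by
    simp only [slotOperator, ← Finset.sum_sub_distrib, ← Finset.sum_add_distrib, curvatureMatrix_eq]
    exact Finset.sum_congr rfl fun s _ => Finset.sum_congr rfl fun e _ => by ring
  rw [hR, ← hc]
  ring

/-! ### The Bianchi identities -/

theorem curvature_skew (L : Fin 3 → Fin X.dim) (U : Fin 1 → Fin X.dim) (y : X.Model) :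
    X.curvature φ (L ∘ Equiv.swap 0 1) U y = - X.curvature φ L U y := by
  have h0 : (L ∘ Equiv.swap (0 : Fin 3) 1) 0 = L 1 := by simp
  have h1 : (L ∘ Equiv.swap (0 : Fin 3) 1) 1 = L 0 := by simp
  have h2 : (L ∘ Equiv.swap (0 : Fin 3) 1) 2 = L 2 := by
    exact congrArg L (by decide)
  unfold ConnManifold.curvature
  rw [h0, h1, h2, neg_add, ← Finset.sum_neg_distrib]
  congr 1
  · ring
  · exact Finset.sum_congr rfl fun x _ => by ring

/-- By the symmetry of the Christoffel symbols, each of the six derivatives of `Γ` in the cyclic sum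
occurs together with its negative, and so does each of the six products. The symmetry may be
differentiated because it holds on an open set. -/
theorem curvature_bianchi (i j k d : Fin X.dim) (hy : y ∈ φ.1.target) :
    X.curvature φ ![i, j, k] ![d] y + X.curvature φ ![j, k, i] ![d] y
      + X.curvature φ ![k, i, j] ![d] y = 0 := by
  have hp : ∀ l i j, pd l (X.christoffel φ i j d) y = pd l (X.christoffel φ j i d) y :=
    fun l i j => pd_congr_of_eqOn φ.1.open_target (fun z hz => X.christoffel_symm φ i j d hz) hy
  simp only [ConnManifold.curvature, Matrix.cons_val_zero, Matrix.cons_val_one, Matrix.cons_val]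
  rw [hp i k j, hp j i k, hp k j i]
  have hz : ∑ e, (X.christoffel φ i e d y * X.christoffel φ j k e y
        - X.christoffel φ j e d y * X.christoffel φ i k e y)
      + ∑ e, (X.christoffel φ j e d y * X.christoffel φ k i e y
        - X.christoffel φ k e d y * X.christoffel φ j i e y)
      + ∑ e, (X.christoffel φ k e d y * X.christoffel φ i j e y
        - X.christoffel φ i e d y * X.christoffel φ k j e y) = 0 := by
    rw [← Finset.sum_add_distrib, ← Finset.sum_add_distrib]
    refine Finset.sum_eq_zero fun e _ => ?_
    rw [X.christoffel_symm φ k j e hy, X.christoffel_symm φ k i e hy, X.christoffel_symm φ j i e hy]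
    ring
  linarith

/-- The curvature as a matrix valued function, in a chart. -/
def curvatureEndo (X : ConnManifold) (φ : X.Chart) (i j : Fin X.dim) (y : X.Model) :
    Matrix (Fin X.dim) (Fin X.dim) ℝ :=
  fun u d => X.curvature φ ![i, j, d] ![u] y

/-- The connection as a matrix valued function, in a chart. -/
def connEndo (X : ConnManifold) (φ : X.Chart) (i : Fin X.dim) (y : X.Model) :
    Matrix (Fin X.dim) (Fin X.dim) ℝ :=
  fun u d => X.christoffel φ i d u y

theorem curvatureEndo_apply (i j u d : Fin X.dim) (y : X.Model) :
    X.curvatureEndo φ i j y u d = pd i (X.christoffel φ j d u) y - pd j (X.christoffel φ i d u) y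
      + (X.connEndo φ i y * X.connEndo φ j y - X.connEndo φ j y * X.connEndo φ i y) u d := by
  simp only [curvatureEndo, curvature, Matrix.sub_apply, Matrix.mul_apply, connEndo,
    ← Finset.sum_sub_distrib]
  rfl

/-- Partial derivatives of the connection matrices. -/
def pdConn (X : ConnManifold) (φ : X.Chart) (i j : Fin X.dim) (y : X.Model) :
    Matrix (Fin X.dim) (Fin X.dim) ℝ :=
  fun u d => pd i (X.christoffel φ j d u) y

theorem pd_connEndo_mul (i j k u d : Fin X.dim) (hy : y ∈ φ.1.target) :
    pd i (fun y => (X.connEndo φ j y * X.connEndo φ k y) u d) y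
      = (X.pdConn φ i j y * X.connEndo φ k y + X.connEndo φ j y * X.pdConn φ i k y) u d := by
  have h : ∀ i j k, DifferentiableAt ℝ (X.christoffel φ i j k) y := fun i j k =>
    differentiableAt_of_contDiffOn (X.contDiffOn_christoffel φ i j k) hy
  simp only [Matrix.mul_apply, Matrix.add_apply, connEndo]
  rw [pd_fun_sum fun e _ => (h _ _ _).fun_mul (h _ _ _), ← Finset.sum_add_distrib]
  exact Finset.sum_congr rfl fun e _ => pd_fun_mul (h _ _ _) (h _ _ _)

theorem pd_curvatureEndo (i j k u d : Fin X.dim) (hy : y ∈ φ.1.target) :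
    pd i (fun y => X.curvatureEndo φ j k y u d) y
      = pd i (pd j (X.christoffel φ k d u)) y - pd i (pd k (X.christoffel φ j d u)) y
        + (X.pdConn φ i j y * X.connEndo φ k y + X.connEndo φ j y * X.pdConn φ i k y
          - (X.pdConn φ i k y * X.connEndo φ j y + X.connEndo φ k y * X.pdConn φ i j y)) u d := by
  have h : ∀ i j k l, DifferentiableAt ℝ (pd l (X.christoffel φ i j k)) y := fun i j k l =>
    differentiableAt_of_contDiffOn
      (contDiffOn_pd φ.1.open_target (X.contDiffOn_christoffel φ i j k) l) hy
  have h' : ∀ j k, DifferentiableAt ℝ (fun y => (X.connEndo φ j y * X.connEndo φ k y) u d) y := by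
    intro j k
    simp only [Matrix.mul_apply]
    exact DifferentiableAt.fun_sum fun e _ =>
      (differentiableAt_of_contDiffOn (X.contDiffOn_christoffel φ _ _ _) hy).fun_mul
        (differentiableAt_of_contDiffOn (X.contDiffOn_christoffel φ _ _ _) hy)
  simp only [curvatureEndo_apply, Matrix.sub_apply (_ * _)]
  rw [pd_fun_add ((h _ _ _ _).fun_sub (h _ _ _ _)) ((h' _ _).fun_sub (h' _ _)),
    pd_fun_sub (h _ _ _ _) (h _ _ _ _), pd_fun_sub (h' _ _) (h' _ _),
    pd_connEndo_mul _ _ _ _ _ hy, pd_connEndo_mul _ _ _ _ _ hy]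
  rfl

/-- The last lower index and the upper index are the two indices of an endomorphism, on which the
connection acts by a commutator. Only the two form indices `j`, `k` need explicit Christoffel sums.
-/
theorem covDeriv_curvature (i j k d u : Fin X.dim) (y : X.Model) :
    X.covDeriv φ (X.curvature φ) ![i, j, k, d] ![u] y
      = pd i (fun y => X.curvatureEndo φ j k y u d) y
        - ∑ e, X.christoffel φ i j e y * X.curvatureEndo φ e k y u d
        - ∑ e, X.christoffel φ i k e y * X.curvatureEndo φ j e y u d
        + (X.connEndo φ i y * X.curvatureEndo φ j k y
          - X.curvatureEndo φ j k y * X.connEndo φ i y) u d := by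
  have h0 : Fin.tail ![i, j, k, d] = ![j, k, d] := rfl
  have u0 : ∀ e, Function.update ![j, k, d] 0 e = ![e, k, d] := fun e => by
    funext t; fin_cases t <;> simp
  have u1 : ∀ e, Function.update ![j, k, d] 1 e = ![j, e, d] := fun e => by
    funext t; fin_cases t <;> simp
  have u2 : ∀ e, Function.update ![j, k, d] 2 e = ![j, k, e] := fun e => by
    funext t; fin_cases t <;> simp
  have u3 : ∀ e, Function.update ![u] 0 e = ![e] := fun e => by
    funext t; fin_cases t; simp
  simp only [covDeriv, h0, Fin.sum_univ_three, Fin.sum_univ_one, u0, u1, u2, u3, Matrix.sub_apply,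
    Matrix.mul_apply, connEndo, curvatureEndo, Matrix.cons_val_zero, Matrix.cons_val_one,
    Matrix.cons_val]
  have hc : ∑ e, X.curvature φ ![j, k, e] ![u] y * X.christoffel φ i d e y
      = ∑ e, X.christoffel φ i d e y * X.curvature φ ![j, k, e] ![u] y :=
    Finset.sum_congr rfl fun e _ => mul_comm _ _
  rw [hc]
  have hp : (X.curvature φ ![j, k, d] ![u]) = fun y => X.curvature φ ![j, k, d] ![u] y := rfl
  rw [hp]
  ring

theorem curvatureEndo_skew (i j : Fin X.dim) (y : X.Model) :
    X.curvatureEndo φ j i y = - X.curvatureEndo φ i j y := by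
  ext u d
  rw [Matrix.neg_apply, curvatureEndo_apply, curvatureEndo_apply]
  simp only [Matrix.sub_apply]
  ring

/-- This is the Jacobi identity for the operators `∂_i + A_i`. The cyclic sum splits into second
derivatives of the Christoffel symbols, Christoffel sums over form indices, and a polynomial in
noncommuting matrices; each part vanishes separately. -/
theorem covDeriv_curvature_bianchi (i j k d u : Fin X.dim) (hy : y ∈ φ.1.target) :
    X.covDeriv φ (X.curvature φ) ![i, j, k, d] ![u] y
      + X.covDeriv φ (X.curvature φ) ![j, k, i, d] ![u] y
      + X.covDeriv φ (X.curvature φ) ![k, i, j, d] ![u] y = 0 := by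
  have hR : ∀ i j, X.curvatureEndo φ i j y = X.pdConn φ i j y - X.pdConn φ j i y
      + (X.connEndo φ i y * X.connEndo φ j y - X.connEndo φ j y * X.connEndo φ i y) := by
    intro i j; ext u d; rw [curvatureEndo_apply]; rfl
  -- The connection acting on the form indices: symmetry of `Γ` against skewness of `R` in its first
  -- two indices.
  have hΓ : ∀ i j k, ∑ e, X.christoffel φ i j e y * X.curvatureEndo φ e k y u d
      + ∑ e, X.christoffel φ j i e y * X.curvatureEndo φ k e y u d = 0 := by
    intro i j k
    rw [← Finset.sum_add_distrib]
    refine Finset.sum_eq_zero fun e _ => ?_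
    rw [X.christoffel_symm φ j i e hy, curvatureEndo_skew e k, Matrix.neg_apply]
    ring
  have hpp : ∀ l i j, pd l (pd i (X.christoffel φ j d u)) y
      = pd i (pd l (X.christoffel φ j d u)) y := fun l i j =>
    pd_pd_comm φ.1.open_target (X.contDiffOn_christoffel φ j d u) hy l
  -- What remains is an identity in the free noncommutative ring on the connection matrices and
  -- their derivatives.
  have hm : ((X.pdConn φ i j y * X.connEndo φ k y + X.connEndo φ j y * X.pdConn φ i k y
          - (X.pdConn φ i k y * X.connEndo φ j y + X.connEndo φ k y * X.pdConn φ i j y))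
      + (X.pdConn φ j k y * X.connEndo φ i y + X.connEndo φ k y * X.pdConn φ j i y
          - (X.pdConn φ j i y * X.connEndo φ k y + X.connEndo φ i y * X.pdConn φ j k y))
      + (X.pdConn φ k i y * X.connEndo φ j y + X.connEndo φ i y * X.pdConn φ k j y
          - (X.pdConn φ k j y * X.connEndo φ i y + X.connEndo φ j y * X.pdConn φ k i y))
      + (X.connEndo φ i y * X.curvatureEndo φ j k y - X.curvatureEndo φ j k y * X.connEndo φ i y)
      + (X.connEndo φ j y * X.curvatureEndo φ k i y - X.curvatureEndo φ k i y * X.connEndo φ j y)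
      + (X.connEndo φ k y * X.curvatureEndo φ i j y - X.curvatureEndo φ i j y * X.connEndo φ k y))
      = 0 := by
    simp only [hR]
    noncomm_ring
  have hm' := congrFun (congrFun hm u) d
  simp only [Matrix.add_apply (_ + _), Matrix.zero_apply] at hm'
  rw [Matrix.add_apply] at hm'
  rw [covDeriv_curvature, covDeriv_curvature, covDeriv_curvature, pd_curvatureEndo _ _ _ _ _ hy,
    pd_curvatureEndo _ _ _ _ _ hy, pd_curvatureEndo _ _ _ _ _ hy, hpp j k i, hpp k i j, hpp i j k]
  linarith [hΓ i j k, hΓ j k i, hΓ k i j]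

theorem PoissonTensor.comp_skew (P : X.PoissonTensor) (φ : X.Chart) (i j : Fin X.dim)
    (y : X.Model) : P.comp φ j i y = - P.comp φ i j y :=
  P.skew _ _ _

theorem covDeriv_components (P : X.PoissonTensor) (l j k : Fin X.dim) (y : X.Model) :
    X.covDeriv φ (P.components φ) ![l] ![j, k] y
      = pd l (P.comp φ j k) y + ∑ e, X.christoffel φ l e j y * P.comp φ e k y
        + ∑ e, X.christoffel φ l e k y * P.comp φ j e y := by
  have u1 : ∀ e, Function.update ![j, k] 0 e = ![e, k] := fun e => by
    funext t; fin_cases t <;> simp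
  have u2 : ∀ e, Function.update ![j, k] 1 e = ![j, e] := fun e => by
    funext t; fin_cases t <;> simp
  simp only [covDeriv, Fin.sum_univ_two, u1, u2, PoissonTensor.components, Matrix.cons_val_zero,
    Matrix.cons_val_one, Finset.univ_eq_empty, Finset.sum_empty]
  ring

/-- In the Jacobi identity partial derivatives may be replaced by covariant ones of a torsionfree
connection, because the additional Christoffel terms cancel in pairs. -/
theorem covariant_jacobi (P : X.PoissonTensor) (i j k : Fin X.dim) (hy : y ∈ φ.1.target) :
    ∑ l, (P.comp φ i l y * X.covDeriv φ (P.components φ) ![l] ![j, k] y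
      + P.comp φ j l y * X.covDeriv φ (P.components φ) ![l] ![k, i] y
      + P.comp φ k l y * X.covDeriv φ (P.components φ) ![l] ![i, j] y) = 0 := by
  have hJ := P.jacobi φ i j k y hy
  -- The two terms with the upper index `j` on the Christoffel symbol: exchanging the summation
  -- indices reproduces the other term with the opposite sign, by symmetry of `Γ` and skewness of
  -- `P`.
  have hz : ∀ i j k, ∑ l, P.comp φ i l y * ∑ e, X.christoffel φ l e j y * P.comp φ e k y
      + ∑ l, P.comp φ k l y * ∑ e, X.christoffel φ l e j y * P.comp φ i e y = 0 := by
    intro i j k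
    simp only [Finset.mul_sum]
    conv_lhs => arg 2; rw [Finset.sum_comm]
    rw [← Finset.sum_add_distrib]
    refine Finset.sum_eq_zero fun l _ => ?_
    rw [← Finset.sum_add_distrib]
    refine Finset.sum_eq_zero fun e _ => ?_
    rw [X.christoffel_symm φ e l j hy, P.comp_skew φ e k]
    ring
  simp only [covDeriv_components, mul_add, Finset.sum_add_distrib] at hJ ⊢
  have h1 := hz i j k
  have h2 := hz j k i
  have h3 := hz k i j
  change ∑ l, P.comp φ i l y * pd l (P.comp φ j k) y + ∑ l, P.comp φ j l y * pd l (P.comp φ k i) y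
    + ∑ l, P.comp φ k l y * pd l (P.comp φ i j) y = 0 at hJ
  linarith

end ConnManifold

/-! ### Index expressions -/

/-- The factor `∇f`. -/
def Factor.succ : Factor → Factor
  | Factor.P m => Factor.P (m + 1)
  | Factor.R m => Factor.R (m + 1)

/-- A factor whose indices are labelled by variables, which are natural numbers. -/
structure Atom where
  f : Factor
  lo : List ℕ
  up : List ℕ

/-- A product of factors whose indices are labelled by variables. -/
abbrev Expr : Type := List Atom

namespace Atom

/-- The number of variables is correct. -/
def Ok (A : Atom) : Prop := A.lo.length = A.f.lower ∧ A.up.length = A.f.upper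

/-- The covariant derivative, with `w` for the new index. -/
def deriv (w : ℕ) (A : Atom) : Atom := ⟨A.f.succ, w :: A.lo, A.up⟩

/-- Renaming of variables. -/
def map (g : ℕ → ℕ) (A : Atom) : Atom := ⟨A.f, A.lo.map g, A.up.map g⟩

variable {X : ConnManifold} (P : X.PoissonTensor) (φ : X.Chart)

/-- The value, for given values of the variables for lower and for upper indices. -/
def val (A : Atom) (ν μ : ℕ → Fin X.dim) (y : X.Model) : ℝ :=
  A.f.comp P φ (fun s => ν (A.lo.getD s 0)) (fun s => μ (A.up.getD s 0)) y

end Atom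

namespace Expr

/-- The variables for lower indices. -/
def lows (E : Expr) : List ℕ := E.flatMap Atom.lo

/-- The variables for upper indices. -/
def ups (E : Expr) : List ℕ := E.flatMap Atom.up

@[simp] theorem lows_nil : lows [] = [] := rfl
@[simp] theorem ups_nil : ups [] = [] := rfl
@[simp] theorem lows_cons (A : Atom) (E : Expr) : lows (A :: E) = A.lo ++ lows E := by simp [lows]
@[simp] theorem ups_cons (A : Atom) (E : Expr) : ups (A :: E) = A.up ++ ups E := by simp [ups]
@[simp] theorem lows_append (E F : Expr) : lows (E ++ F) = lows E ++ lows F := by simp [lows]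
@[simp] theorem ups_append (E F : Expr) : ups (E ++ F) = ups E ++ ups F := by simp [ups]

/-- The terms of the covariant derivative of a product. -/
def deriv (w : ℕ) : Expr → List Expr
  | [] => []
  | A :: E => (A.deriv w :: E) :: (deriv w E).map (A :: ·)

/-- Renaming of variables. -/
def rename (g : ℕ → ℕ) (E : Expr) : Expr := E.map (Atom.map g)

@[simp] theorem lows_rename (g : ℕ → ℕ) (E : Expr) : lows (rename g E) = (lows E).map g := by
  induction E with
  | nil => rfl
  | cons A E ih => simp only [rename, List.map_cons, lows_cons, List.map_append]; rw [← ih]; rfl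

@[simp] theorem ups_rename (g : ℕ → ℕ) (E : Expr) : ups (rename g E) = (ups E).map g := by
  induction E with
  | nil => rfl
  | cons A E ih => simp only [rename, List.map_cons, ups_cons, List.map_append]; rw [← ih]; rfl

variable {X : ConnManifold} (P : X.PoissonTensor) (φ : X.Chart)

/-- The product of the values of the factors. -/
def pval (E : Expr) (ν μ : ℕ → Fin X.dim) (y : X.Model) : ℝ :=
  (E.map fun A => A.val P φ ν μ y).prod

@[simp] theorem pval_nil (ν μ : ℕ → Fin X.dim) (y : X.Model) : pval P φ [] ν μ y = 1 := rfl

@[simp] theorem pval_cons (A : Atom) (E : Expr) (ν μ : ℕ → Fin X.dim) (y : X.Model) :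
    pval P φ (A :: E) ν μ y = A.val P φ ν μ y * pval P φ E ν μ y := by simp [pval]

@[simp] theorem pval_append (E F : Expr) (ν μ : ℕ → Fin X.dim) (y : X.Model) :
    pval P φ (E ++ F) ν μ y = pval P φ E ν μ y * pval P φ F ν μ y := by simp [pval]

end Expr

/-- Summation of a function of an assignment of values to variables over all values of the
variables in a list. -/
def sumOver {n : ℕ} : List ℕ → ((ℕ → Fin n) → ℝ) → (ℕ → Fin n) → ℝ
  | [], F, ν => F ν
  | v :: vs, F, ν => ∑ e, sumOver vs F (Function.update ν v e)

/-! ### Sums over the values of labelled indices. -/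

section SumOver

variable {n : ℕ} {vs : List ℕ} {F G : (ℕ → Fin n) → ℝ} {ν : ℕ → Fin n}

theorem sumOver_add : sumOver vs (fun ν => F ν + G ν) ν = sumOver vs F ν + sumOver vs G ν := by
  induction vs generalizing ν with
  | nil => rfl
  | cons v vs ih => simp only [sumOver, ih, Finset.sum_add_distrib]

theorem sumOver_mul_left (c : ℝ) : sumOver vs (fun ν => c * F ν) ν = c * sumOver vs F ν := by
  induction vs generalizing ν with
  | nil => rfl
  | cons v vs ih => simp only [sumOver, ih, Finset.mul_sum]

theorem sumOver_zero : sumOver vs (fun _ => (0 : ℝ)) ν = 0 := by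
  induction vs generalizing ν with
  | nil => rfl
  | cons v vs ih => simp only [sumOver, ih, Finset.sum_const_zero]

theorem sumOver_sub : sumOver vs (fun ν => F ν - G ν) ν = sumOver vs F ν - sumOver vs G ν := by
  induction vs generalizing ν with
  | nil => rfl
  | cons v vs ih => simp only [sumOver, ih, Finset.sum_sub_distrib]

theorem sumOver_list_sum {α : Type*} (l : List α) (F : α → (ℕ → Fin n) → ℝ) :
    sumOver vs (fun ν => (l.map fun a => F a ν).sum) ν = (l.map fun a => sumOver vs (F a) ν).sum := by
  induction l with
  | nil => simpa using sumOver_zero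
  | cons a l ih => simp only [List.map_cons, List.sum_cons, sumOver_add, ih]

theorem sumOver_sum {α : Type*} (l : Finset α) (F : α → (ℕ → Fin n) → ℝ) :
    sumOver vs (fun ν => ∑ a ∈ l, F a ν) ν = ∑ a ∈ l, sumOver vs (F a) ν := by
  induction vs generalizing ν with
  | nil => rfl
  | cons v vs ih => simp only [sumOver, ih]; rw [Finset.sum_comm]

theorem sumOver_append (vs ws : List ℕ) :
    sumOver (vs ++ ws) F ν = sumOver vs (sumOver ws F) ν := by
  induction vs generalizing ν with
  | nil => rfl
  | cons v vs ih => simp only [List.cons_append, sumOver, ih]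

theorem sumOver_congr (h : ∀ μ : ℕ → Fin n, (∀ v, v ∉ vs → μ v = ν v) → F μ = G μ) :
    sumOver vs F ν = sumOver vs G ν := by
  induction vs generalizing ν with
  | nil => exact h ν fun _ _ => rfl
  | cons v vs ih =>
    refine Finset.sum_congr rfl fun e _ => ih fun μ hμ => h μ fun u hu => ?_
    simp only [List.mem_cons, not_or] at hu
    rw [hμ u hu.2, Function.update_of_ne hu.1]

theorem sumOver_perm {vs ws : List ℕ} (h : vs.Perm ws) : sumOver vs F ν = sumOver ws F ν := by
  induction h generalizing ν with
  | nil => rfl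
  | cons v _ ih => exact Finset.sum_congr rfl fun e _ => ih
  | swap u v vs =>
    simp only [sumOver]
    by_cases huv : u = v
    · rw [huv]
    · rw [Finset.sum_comm]
      exact Finset.sum_congr rfl fun e _ => Finset.sum_congr rfl fun f _ => by
        rw [Function.update_comm huv]
  | trans _ _ h1 h2 => rw [h1, h2]

theorem sumOver_update {v : ℕ} (hv : v ∉ vs) (e : Fin n) :
    sumOver vs (fun μ => F (Function.update μ v e)) ν = sumOver vs F (Function.update ν v e) := by
  induction vs generalizing ν with
  | nil => rfl
  | cons u vs ih =>
    simp only [List.mem_cons, not_or] at hv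
    refine Finset.sum_congr rfl fun f _ => ?_
    rw [ih hv.2, Function.update_comm hv.1]

/-- Terms which agree after summation over one of the variables give the same total sum. -/
theorem sumOver_congr_sum {v : ℕ} (hv : v ∈ vs)
    (h : ∀ μ : ℕ → Fin n, (∀ u, u ∉ vs → μ u = ν u) →
      ∑ e, F (Function.update μ v e) = ∑ e, G (Function.update μ v e)) :
    sumOver vs F ν = sumOver vs G ν := by
  obtain ⟨l₁, l₂, rfl⟩ := List.append_of_mem hv
  have hp : (l₁ ++ v :: l₂).Perm (l₁ ++ l₂ ++ [v]) := by
    rw [List.append_assoc]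
    exact List.Perm.append_left _ (List.perm_append_singleton _ _).symm
  rw [sumOver_perm hp, sumOver_perm hp, sumOver_append (l₁ ++ l₂), sumOver_append (l₁ ++ l₂)]
  refine sumOver_congr fun μ hμ => h μ fun u hu => hμ u fun hu' => hu ?_
  simp only [List.mem_append, List.mem_cons] at hu' ⊢
  tauto

/-- Renaming of the variables of summation. -/
theorem sumOver_rename (S : ℕ → Prop) {g : ℕ → ℕ} (hg : ∀ u v, S u → S v → g u = g v → u = v)
    (hvs : ∀ v ∈ vs, S v) {ν ν' : ℕ → Fin n} (hν : ∀ v, S v → v ∉ vs → ν' v = ν (g v))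
    (hF : ∀ μ μ' : ℕ → Fin n, (∀ v, S v → μ v = μ' v) → F μ = F μ') :
    sumOver (vs.map g) (fun μ => F (μ ∘ g)) ν = sumOver vs F ν' := by
  induction vs generalizing ν ν' with
  | nil => exact hF _ _ fun v hv => (hν v hv (by simp)).symm
  | cons v vs ih =>
    refine Finset.sum_congr rfl fun e _ => ih (fun u hu => hvs u (by simp [hu])) fun u hu hu' => ?_
    by_cases huv : u = v
    · rw [huv, Function.update_self, Function.update_self]
    · rw [Function.update_of_ne huv, Function.update_of_ne fun h =>
        huv (hg u v hu (hvs v (by simp)) h), hν u hu (by simp [huv, hu'])]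

end SumOver

/-! ### The Leibniz rule for products of factors. -/

namespace Atom

variable {X : ConnManifold} {P : X.PoissonTensor} {φ : X.Chart} {y : X.Model}

theorem getD_mem {l : List ℕ} {s n : ℕ} (h : l.length = n) (hs : s < n) : l.getD s 0 ∈ l := by
  rw [List.getD_eq_getElem l 0 (h ▸ hs)]; exact List.getElem_mem _

theorem val_congr {A : Atom} (hA : A.Ok) {ν ν' μ μ' : ℕ → Fin X.dim} (hν : ∀ v ∈ A.lo, ν v = ν' v)
    (hμ : ∀ v ∈ A.up, μ v = μ' v) : A.val P φ ν μ y = A.val P φ ν' μ' y := by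
  unfold val
  congr 1
  · funext s; rw [hν _ (getD_mem hA.1 s.2)]
  · funext s; rw [hμ _ (getD_mem hA.2 s.2)]

theorem map_ok {A : Atom} (hA : A.Ok) (g : ℕ → ℕ) : (A.map g).Ok := by
  simpa [Ok, map] using hA

theorem deriv_ok {A : Atom} (hA : A.Ok) (w : ℕ) : (A.deriv w).Ok := by
  obtain ⟨f, lo, up⟩ := A
  cases f <;> simp only [Ok, deriv, Factor.succ, Factor.lower, Factor.upper, List.length_cons] at hA ⊢ <;>
    omega

theorem getD_map {l : List ℕ} {s n : ℕ} (h : l.length = n) (hs : s < n) (g : ℕ → ℕ) :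
    (l.map g).getD s 0 = g (l.getD s 0) := by
  rw [List.getD_eq_getElem _ 0 (by simpa using h ▸ hs), List.getD_eq_getElem l 0 (h ▸ hs),
    List.getElem_map]

theorem val_map {A : Atom} (hA : A.Ok) (g : ℕ → ℕ) (ν μ : ℕ → Fin X.dim) :
    (A.map g).val P φ ν μ y = A.val P φ (ν ∘ g) (μ ∘ g) y := by
  unfold val map
  congr 1
  · funext s; rw [getD_map hA.1 s.2]; rfl
  · funext s; rw [getD_map hA.2 s.2]; rfl

theorem contDiffOn_val (A : Atom) (ν μ : ℕ → Fin X.dim) :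
    ContDiffOn ℝ ∞ (A.val P φ ν μ) φ.1.target :=
  ConnManifold.smoothOn_comp P φ A.f _ _

theorem differentiableAt_val (A : Atom) (ν μ : ℕ → Fin X.dim) (hy : y ∈ φ.1.target) :
    DifferentiableAt ℝ (A.val P φ ν μ) y :=
  ConnManifold.differentiableAt_of_contDiffOn (A.contDiffOn_val ν μ) hy

theorem sum_fin_eq_list_sum {M : Type*} [AddCommMonoid M] {l : List ℕ} {n : ℕ} (h : l.length = n)
    (g : ℕ → M) : ∑ s : Fin n, g (l.getD s 0) = (l.map g).sum := by
  subst h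
  rw [← Fin.sum_univ_fun_getElem]
  exact Finset.sum_congr rfl fun s _ => by rw [List.getD_eq_getElem l 0 s.2]

/-- Distinct labels ensure that changing the value of one label changes the index in one slot only.
-/
theorem update_getD {α : Type*} {l : List ℕ} {n : ℕ} (h : l.length = n) (hl : l.Nodup) (s : Fin n)
    (ν : ℕ → α) (e : α) : (fun t : Fin n => Function.update ν (l.getD s 0) e (l.getD t 0))
      = Function.update (fun t : Fin n => ν (l.getD t 0)) s e := by
  subst h
  funext t
  simp only [Function.update_apply, List.getD_eq_getElem l 0 s.2, List.getD_eq_getElem l 0 t.2,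
    hl.getElem_inj_iff, Fin.ext_iff]

theorem val_deriv (A : Atom) (w : ℕ) (ν μ : ℕ → Fin X.dim) :
    (A.deriv w).val P φ ν μ y = X.covDeriv φ (A.f.comp P φ)
      (Fin.cons (ν w) fun s => ν (A.lo.getD s 0)) (fun s => μ (A.up.getD s 0)) y := by
  obtain ⟨f, lo, up⟩ := A
  cases f <;>
  · refine congrArg₂ (fun L U => X.covDeriv φ _ L U y) ?_ rfl
    funext s
    exact Fin.cases rfl (fun s => rfl) s

/-- The definition of the covariant derivative, solved for the partial derivative. Lower and upper
slots have separate assignments `ν` and `μ`, so that a Christoffel correction can act on the lower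
occurrence of a contracted label without touching the upper one. -/
theorem pd_val {A : Atom} (hA : A.Ok) (hlo : A.lo.Nodup) (hup : A.up.Nodup) (w : ℕ)
    (ν μ : ℕ → Fin X.dim) :
    pd (ν w) (A.val P φ ν μ) y = (A.deriv w).val P φ ν μ y
      + (A.lo.map fun v => ∑ e, X.christoffel φ (ν w) (ν v) e y
          * A.val P φ (Function.update ν v e) μ y).sum
      - (A.up.map fun v => ∑ e, X.christoffel φ (ν w) e (μ v) y
          * A.val P φ ν (Function.update μ v e) y).sum := by
  have e0 : A.val P φ ν μ
    = A.f.comp P φ (fun s => ν (A.lo.getD s 0)) (fun s => μ (A.up.getD s 0)) := rfl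
  rw [e0, val_deriv, ConnManifold.covDeriv, ← sum_fin_eq_list_sum hA.1, ← sum_fin_eq_list_sum hA.2]
  simp only [Fin.cons_zero, Fin.tail_cons, val, update_getD hA.1 hlo, update_getD hA.2 hup]
  ring

end Atom

namespace Expr

variable {X : ConnManifold} {P : X.PoissonTensor} {φ : X.Chart} {y : X.Model}

/-- All factors have the correct number of variables. -/
def Ok (E : Expr) : Prop := ∀ A ∈ E, A.Ok

theorem pval_congr {E : Expr} (hE : E.Ok) {ν ν' μ μ' : ℕ → Fin X.dim}
    (hν : ∀ v ∈ E.lows, ν v = ν' v) (hμ : ∀ v ∈ E.ups, μ v = μ' v) :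
    E.pval P φ ν μ y = E.pval P φ ν' μ' y := by
  induction E with
  | nil => rfl
  | cons A E ih =>
    simp only [lows_cons, ups_cons, List.mem_append] at hν hμ
    rw [pval_cons, pval_cons, Atom.val_congr (hE A (by simp)) (fun v hv => hν v (Or.inl hv))
      (fun v hv => hμ v (Or.inl hv)), ih (fun B hB => hE B (by simp [hB]))
      (fun v hv => hν v (Or.inr hv)) (fun v hv => hμ v (Or.inr hv))]

theorem pval_rename {E : Expr} (hE : E.Ok) (g : ℕ → ℕ) (ν μ : ℕ → Fin X.dim) :
    (E.rename g).pval P φ ν μ y = E.pval P φ (ν ∘ g) (μ ∘ g) y := by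
  induction E with
  | nil => rfl
  | cons A E ih =>
    have ih := ih (fun B hB => hE B (by simp [hB]))
    simp only [rename] at ih
    simp only [rename, List.map_cons, pval_cons, Atom.val_map (hE A (by simp)), ih]

theorem contDiffOn_pval (E : Expr) (ν μ : ℕ → Fin X.dim) :
    ContDiffOn ℝ ∞ (E.pval P φ ν μ) φ.1.target := by
  induction E with
  | nil => exact contDiffOn_const
  | cons A E ih =>
    have : pval P φ (A :: E) ν μ = fun y => A.val P φ ν μ y * pval P φ E ν μ y := by
      funext y; simp
    rw [this]
    exact (A.contDiffOn_val ν μ).mul ih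

/-- Leibniz rule, factor by factor. Since a label occurs at most once among the lower and at most
once among the upper slots, a correction for a label changes only one factor and the others can be
taken out of the sum. -/
theorem pd_pval {E : Expr} (hE : E.Ok) (hlo : E.lows.Nodup) (hup : E.ups.Nodup) (w : ℕ)
    (ν μ : ℕ → Fin X.dim) (hy : y ∈ φ.1.target) :
    pd (ν w) (E.pval P φ ν μ) y = ((E.deriv w).map fun F => F.pval P φ ν μ y).sum
      + (E.lows.map fun v => ∑ e, X.christoffel φ (ν w) (ν v) e y
          * E.pval P φ (Function.update ν v e) μ y).sum
      - (E.ups.map fun v => ∑ e, X.christoffel φ (ν w) e (μ v) y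
          * E.pval P φ ν (Function.update μ v e) y).sum := by
  induction E with
  | nil =>
    change pd (ν w) (fun _ => (1 : ℝ)) y = _
    simp [pd_const, deriv]
  | cons A E ih =>
    rw [lows_cons, List.nodup_append'] at hlo
    rw [ups_cons, List.nodup_append'] at hup
    have hEok : Ok E := fun B hB => hE B (by simp [hB])
    have ih := ih hEok hlo.2.1 hup.2.1
    have e0 : pval P φ (A :: E) ν μ = fun y => A.val P φ ν μ y * pval P φ E ν μ y := by
      funext y; simp
    rw [e0, pd_fun_mul (A.differentiableAt_val ν μ hy)
      (ConnManifold.differentiableAt_of_contDiffOn (contDiffOn_pval E ν μ) hy), ih,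
      Atom.pd_val (hE A (by simp)) hlo.1 hup.1]
    have h1 : (A.lo.map fun v => ∑ e, X.christoffel φ (ν w) (ν v) e y
        * pval P φ (A :: E) (Function.update ν v e) μ y)
        = A.lo.map fun v => (∑ e, X.christoffel φ (ν w) (ν v) e y
          * A.val P φ (Function.update ν v e) μ y) * pval P φ E ν μ y := by
      refine List.map_congr_left fun v hv => ?_
      rw [Finset.sum_mul]
      refine Finset.sum_congr rfl fun e _ => ?_
      rw [pval_cons, pval_congr hEok (ν' := ν) (μ' := μ) (fun u hu => Function.update_of_ne
        (ne_of_mem_of_not_mem hu (hlo.2.2 hv)) _ _) (fun _ _ => rfl), mul_assoc]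
    have h2 : (A.up.map fun v => ∑ e, X.christoffel φ (ν w) e (μ v) y
        * pval P φ (A :: E) ν (Function.update μ v e) y)
        = A.up.map fun v => (∑ e, X.christoffel φ (ν w) e (μ v) y
          * A.val P φ ν (Function.update μ v e) y) * pval P φ E ν μ y := by
      refine List.map_congr_left fun v hv => ?_
      rw [Finset.sum_mul]
      refine Finset.sum_congr rfl fun e _ => ?_
      rw [pval_cons, pval_congr hEok (ν' := ν) (μ' := μ) (fun _ _ => rfl)
        (fun u hu => Function.update_of_ne (ne_of_mem_of_not_mem hu (hup.2.2 hv)) _ _), mul_assoc]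
    have h3 : ((lows E).map fun v => ∑ e, X.christoffel φ (ν w) (ν v) e y
        * pval P φ (A :: E) (Function.update ν v e) μ y)
        = (lows E).map fun v => A.val P φ ν μ y * ∑ e, X.christoffel φ (ν w) (ν v) e y
          * pval P φ E (Function.update ν v e) μ y := by
      refine List.map_congr_left fun v hv => ?_
      rw [Finset.mul_sum]
      refine Finset.sum_congr rfl fun e _ => ?_
      rw [pval_cons, Atom.val_congr (hE A (by simp)) (ν' := ν) (μ' := μ)
        (fun u hu => Function.update_of_ne (ne_of_mem_of_not_mem hu fun h => hlo.2.2 h hv) _ _) (fun _ _ => rfl)]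
      ring
    have h4 : ((ups E).map fun v => ∑ e, X.christoffel φ (ν w) e (μ v) y
        * pval P φ (A :: E) ν (Function.update μ v e) y)
        = (ups E).map fun v => A.val P φ ν μ y * ∑ e, X.christoffel φ (ν w) e (μ v) y
          * pval P φ E ν (Function.update μ v e) y := by
      refine List.map_congr_left fun v hv => ?_
      rw [Finset.mul_sum]
      refine Finset.sum_congr rfl fun e _ => ?_
      rw [pval_cons, Atom.val_congr (hE A (by simp)) (ν' := ν) (μ' := μ) (fun _ _ => rfl)
        (fun u hu => Function.update_of_ne (ne_of_mem_of_not_mem hu fun h => hup.2.2 h hv) _ _)]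
      ring
    have h5 : ((deriv w E).map fun F => pval P φ (A :: F) ν μ y).sum
        = A.val P φ ν μ y * ((deriv w E).map fun F => pval P φ F ν μ y).sum := by
      rw [← List.sum_map_mul_left]; simp
    simp only [lows_cons, ups_cons, List.map_append, List.sum_append, h1, h2, h3, h4, deriv,
      List.map_cons, List.sum_cons, List.map_map, Function.comp_def, h5, List.sum_map_mul_left,
      List.sum_map_mul_right, pval_cons A E]
    have h6 : ∀ F, pval P φ (A.deriv w :: F) ν μ y
      = (A.deriv w).val P φ ν μ y * pval P φ F ν μ y := fun F => pval_cons P φ _ _ _ _ _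
    simp only [h6]
    ring

/-- The sum over the values of the variables in the list `vs`. -/
def ev (P : X.PoissonTensor) (φ : X.Chart) (vs : List ℕ) (E : Expr) (ν : ℕ → Fin X.dim)
    (y : X.Model) : ℝ :=
  sumOver vs (fun ν => E.pval P φ ν ν y) ν

theorem contDiffOn_sumOver {vs : List ℕ} {F : (ℕ → Fin X.dim) → X.Model → ℝ}
    (hF : ∀ ν, ContDiffOn ℝ ∞ (F ν) φ.1.target) (ν : ℕ → Fin X.dim) :
    ContDiffOn ℝ ∞ (fun y => sumOver vs (fun ν => F ν y) ν) φ.1.target := by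
  induction vs generalizing ν with
  | nil => exact hF ν
  | cons v vs ih => exact ContDiffOn.sum fun e _ => ih _

theorem pd_sumOver {vs : List ℕ} {F : (ℕ → Fin X.dim) → X.Model → ℝ}
    (hF : ∀ ν, ContDiffOn ℝ ∞ (F ν) φ.1.target) (ν : ℕ → Fin X.dim) (i : Fin X.dim)
    (hy : y ∈ φ.1.target) :
    pd i (fun y => sumOver vs (fun ν => F ν y) ν) y = sumOver vs (fun ν => pd i (F ν) y) ν := by
  induction vs generalizing ν with
  | nil => rfl
  | cons v vs ih =>
    simp only [sumOver]
    rw [pd_fun_sum fun e _ => ConnManifold.differentiableAt_of_contDiffOn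
      (contDiffOn_sumOver hF _) hy]
    exact Finset.sum_congr rfl fun e _ => ih _

theorem contDiffOn_ev (vs : List ℕ) (E : Expr) (ν : ℕ → Fin X.dim) :
    ContDiffOn ℝ ∞ (E.ev P φ vs ν) φ.1.target :=
  contDiffOn_sumOver (fun ν => E.contDiffOn_pval ν ν) ν

/-- The Leibniz rule for the covariant derivative: connection terms of contracted indices cancel. -/
theorem pd_ev {E : Expr} (hE : E.Ok) {vs fl fu : List ℕ} (hl : E.lows.Perm (fl ++ vs))
    (hu : E.ups.Perm (fu ++ vs)) (hlo : E.lows.Nodup) (hup : E.ups.Nodup) (hd : fl.Disjoint fu)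
    {w : ℕ} (hw : w ∉ vs) (ν : ℕ → Fin X.dim) (hy : y ∈ φ.1.target) :
    pd (ν w) (E.ev P φ vs ν) y = ((E.deriv w).map fun F => F.ev P φ vs ν y).sum
      + (fl.map fun v => ∑ e, X.christoffel φ (ν w) (ν v) e y
          * E.ev P φ vs (Function.update ν v e) y).sum
      - (fu.map fun v => ∑ e, X.christoffel φ (ν w) e (ν v) y
          * E.ev P φ vs (Function.update ν v e) y).sum := by
  have hlo' := hl.nodup_iff.1 hlo
  have hup' := hu.nodup_iff.1 hup
  rw [List.nodup_append'] at hlo' hup'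
  have h1 : pd (ν w) (E.ev P φ vs ν) y
      = sumOver vs (fun μ => pd (μ w) (E.pval P φ μ μ) y) ν := by
    refine (pd_sumOver (fun ν => E.contDiffOn_pval ν ν) ν (ν w) hy).trans ?_
    exact sumOver_congr fun μ hμ => by rw [hμ w hw]
  -- For a contracted label the corrections from its lower and its upper slot are the same double
  -- sum, over the value of `v` and over `e`, with the two roles exchanged. They enter with opposite
  -- signs.
  have hvs : ∀ v ∈ vs,
      sumOver vs (fun μ => ∑ e, X.christoffel φ (μ w) (μ v) e y
          * E.pval P φ (Function.update μ v e) μ y) ν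
        = sumOver vs (fun μ => ∑ e, X.christoffel φ (μ w) e (μ v) y
          * E.pval P φ μ (Function.update μ v e) y) ν := by
    intro v hv
    have hwv : w ≠ v := fun h => hw (h ▸ hv)
    refine sumOver_congr_sum hv fun μ _ => ?_
    simp only [Function.update_self, Function.update_of_ne hwv, Function.update_idem]
    rw [Finset.sum_comm]
  -- A free lower label does not occur among the upper labels, so it is harmless to change its value
  -- in both assignments, and the change commutes with the summation over `vs`.
  have hfl : ∀ v ∈ fl, sumOver vs (fun μ => ∑ e, X.christoffel φ (μ w) (μ v) e y
          * E.pval P φ (Function.update μ v e) μ y) ν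
      = ∑ e, X.christoffel φ (ν w) (ν v) e y * E.ev P φ vs (Function.update ν v e) y := by
    intro v hv
    have hvv : v ∉ vs := hlo'.2.2 hv
    have hvu : v ∉ E.ups := fun h => by
      rcases List.mem_append.1 (hu.mem_iff.1 h) with h | h
      · exact hd hv h
      · exact hvv h
    rw [sumOver_sum]
    refine Finset.sum_congr rfl fun e _ => ?_
    rw [ev, ← sumOver_update hvv, ← sumOver_mul_left]
    refine sumOver_congr fun μ hμ => ?_
    rw [hμ w hw, hμ v hvv, pval_congr hE (μ := μ) (fun _ _ => rfl) fun u hu =>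
      (Function.update_of_ne (ne_of_mem_of_not_mem hu hvu) e μ).symm]
  have hfu : ∀ v ∈ fu, sumOver vs (fun μ => ∑ e, X.christoffel φ (μ w) e (μ v) y
          * E.pval P φ μ (Function.update μ v e) y) ν
      = ∑ e, X.christoffel φ (ν w) e (ν v) y * E.ev P φ vs (Function.update ν v e) y := by
    intro v hv
    have hvv : v ∉ vs := hup'.2.2 hv
    have hvu : v ∉ E.lows := fun h => by
      rcases List.mem_append.1 (hl.mem_iff.1 h) with h | h
      · exact hd h hv
      · exact hvv h
    rw [sumOver_sum]
    refine Finset.sum_congr rfl fun e _ => ?_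
    rw [ev, ← sumOver_update hvv, ← sumOver_mul_left]
    refine sumOver_congr fun μ hμ => ?_
    rw [hμ w hw, hμ v hvv, pval_congr hE (ν := μ) (fun u hu =>
      (Function.update_of_ne (ne_of_mem_of_not_mem hu hvu) e μ).symm) (fun _ _ => rfl)]
  have h2 : ∀ μ : ℕ → Fin X.dim, pd (μ w) (E.pval P φ μ μ) y
      = ((E.deriv w).map fun F => F.pval P φ μ μ y).sum
      + (((fl ++ vs).map fun v => ∑ e, X.christoffel φ (μ w) (μ v) e y
          * E.pval P φ (Function.update μ v e) μ y).sum
      - ((fu ++ vs).map fun v => ∑ e, X.christoffel φ (μ w) e (μ v) y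
          * E.pval P φ μ (Function.update μ v e) y).sum) := by
    intro μ
    rw [pd_pval hE hlo hup w μ μ hy, (hl.map _).sum_eq, (hu.map _).sum_eq]
    ring
  rw [h1]
  simp only [h2]
  rw [sumOver_add, sumOver_sub, sumOver_list_sum, sumOver_list_sum, sumOver_list_sum,
    List.map_append, List.map_append, List.sum_append, List.sum_append, List.map_congr_left hfl,
    List.map_congr_left hfu, List.map_congr_left hvs]
  unfold ev
  ring

/-! ### Shape of the terms of a derivative -/

theorem deriv_spec {E : Expr} {w : ℕ} : ∀ {F : Expr}, F ∈ E.deriv w →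
    ∃ E₁ A E₂, E = E₁ ++ A :: E₂ ∧ F = E₁ ++ A.deriv w :: E₂ := by
  induction E with
  | nil => intro F h; simp [deriv] at h
  | cons A E ih =>
    intro F h
    rcases List.mem_cons.1 h with h | h
    · exact ⟨[], A, E, rfl, h⟩
    · obtain ⟨G, hG, rfl⟩ := List.mem_map.1 h
      obtain ⟨E₁, B, E₂, rfl, rfl⟩ := ih hG
      exact ⟨A :: E₁, B, E₂, rfl, rfl⟩

theorem deriv_ok {E F : Expr} {w : ℕ} (hE : E.Ok) (h : F ∈ E.deriv w) : F.Ok := by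
  obtain ⟨E₁, A, E₂, rfl, rfl⟩ := deriv_spec h
  intro B hB
  simp only [List.mem_append, List.mem_cons] at hB
  rcases hB with hB | rfl | hB
  · exact hE B (by simp [hB])
  · exact Atom.deriv_ok (hE A (by simp)) w
  · exact hE B (by simp [hB])

theorem lows_deriv {E F : Expr} {w : ℕ} (h : F ∈ E.deriv w) : F.lows.Perm (w :: E.lows) := by
  obtain ⟨E₁, A, E₂, rfl, rfl⟩ := deriv_spec h
  simp only [lows_append, lows_cons, Atom.deriv]
  exact List.perm_middle

theorem ups_deriv {E F : Expr} {w : ℕ} (h : F ∈ E.deriv w) : F.ups = E.ups := by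
  obtain ⟨E₁, A, E₂, rfl, rfl⟩ := deriv_spec h
  simp [Atom.deriv]

end Expr

/-! ### Expressions and concatenations -/

theorem sumOver_ofFn {n k : ℕ} (a : Fin k → ℕ) (ha : Function.Injective a)
    (F : (ℕ → Fin n) → ℝ) (ν : ℕ → Fin n) :
    sumOver (List.ofFn a) F ν = ∑ σ : Fin k → Fin n, F (Function.extend a σ ν) := by
  induction k generalizing ν with
  | zero =>
    have : ∀ σ : Fin 0 → Fin n, Function.extend a σ ν = ν := fun σ => by
      funext v; exact Function.extend_apply' _ _ _ fun ⟨i, _⟩ => i.elim0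
    simp [sumOver, this]
  | succ k ih =>
    rw [List.ofFn_succ, sumOver, ← (Fin.consEquiv fun _ : Fin (k + 1) => Fin n).sum_comp,
      Fintype.sum_prod_type]
    refine Finset.sum_congr rfl fun e _ => ?_
    rw [ih (fun i => a i.succ) fun i j h => Fin.succ_injective _ (ha h)]
    refine Finset.sum_congr rfl fun σ _ => congrArg F ?_
    funext v
    have hs : Function.Injective fun i : Fin k => a i.succ :=
      fun i j h => Fin.succ_injective _ (ha h)
    by_cases h : ∃ i, a i = v
    · obtain ⟨i, rfl⟩ := h
      rw [ha.extend_apply]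
      refine Fin.cases ?_ (fun i => ?_) i
      · rw [Function.extend_apply' _ _ _ fun ⟨i, hi⟩ => Fin.succ_ne_zero i (ha hi)]
        simp [Fin.consEquiv]
      · rw [hs.extend_apply (fun i => σ i) _ i]
        simp [Fin.consEquiv]
    · rw [Function.extend_apply' _ _ _ h, Function.extend_apply' _ _ _ fun ⟨i, hi⟩ => h ⟨_, hi⟩,
        Function.update_of_ne fun hv => h ⟨0, hv.symm⟩]

/-- Links iterated summation over labels to the single sum over all index assignments by which
concatenations are evaluated. -/
theorem sumOver_eq_sum {n : ℕ} {ι : Type*} [Fintype ι] [DecidableEq ι] {vs : List ℕ}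
    (hvs : vs.Nodup) {a : ι → ℕ}
    (ha : Function.Injective a) (h : ∀ v, v ∈ vs ↔ ∃ i, a i = v) (F : (ℕ → Fin n) → ℝ)
    (ν : ℕ → Fin n) : sumOver vs F ν = ∑ σ : ι → Fin n, F (Function.extend a σ ν) := by
  have e := Fintype.equivFin ι
  have hi : Function.Injective (a ∘ e.symm) := ha.comp e.symm.injective
  have hp : vs.Perm (List.ofFn (a ∘ e.symm)) := by
    refine (List.perm_ext_iff_of_nodup hvs (List.nodup_ofFn.2 hi)).2 fun v => ?_
    rw [h, List.mem_ofFn]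
    exact ⟨fun ⟨i, hi⟩ => ⟨e i, by simpa using hi⟩, fun ⟨i, hi⟩ => ⟨_, hi⟩⟩
  rw [sumOver_perm hp, sumOver_ofFn _ hi]
  refine Fintype.sum_equiv (e.symm.arrowCongr (Equiv.refl _)) _ _ fun σ => congrArg F ?_
  funext v
  by_cases hv : ∃ i, a i = v
  · obtain ⟨i, rfl⟩ := hv
    rw [ha.extend_apply]
    have := hi.extend_apply σ ν (e i)
    simpa using this
  · rw [Function.extend_apply' _ _ _ hv, Function.extend_apply' _ _ _ fun ⟨i, hi⟩ => hv ⟨_, hi⟩]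

/-- The assignment given by the values of the free indices. -/
def env {n q : ℕ} (I : Fin (q + 1) → Fin n) (v : ℕ) : Fin n := I (Fin.ofNat (q + 1) v)

namespace Expr

/-- The expression describes a concatenation without loops with `p` free indices. -/
structure WF (p : ℕ) (E : Expr) : Prop where
  ok : E.Ok
  nodup : E.lows.Nodup
  le : ∀ v ∈ E.lows, p ≤ v
  perm : E.ups.Perm (List.range p ++ E.lows)
  noLoop : ∀ A ∈ E, A.lo.Disjoint A.up

variable {X : ConnManifold} {q : ℕ}

/-- The contravariant tensor defined by an expression. -/
def value (P : X.PoissonTensor) (φ : X.Chart) (E : Expr) (I : Fin (q + 1) → Fin X.dim)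
    (y : X.Model) : ℝ :=
  E.ev P φ E.lows (env I) y

/-- The family of component functions defined by an expression. -/
def family (𝕂 : Type) [RCLike 𝕂] (q : ℕ) (E : Expr) : ComponentFamily 𝕂 (q + 1) :=
  fun _ P φ I => φ.1.target.indicator fun y => ((E.value P φ I y : ℝ) : 𝕂)

theorem WF.ups_nodup {p : ℕ} {E : Expr} (h : E.WF p) : E.ups.Nodup := by
  rw [h.perm.nodup_iff, List.nodup_append']
  exact ⟨List.nodup_range, h.nodup, fun v hv hv' => by
    have := h.le v hv'; rw [List.mem_range] at hv; omega⟩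

end Expr

namespace Concatenation

variable {q : ℕ}

/-- The expression for a concatenation, with given variables for the contracted indices. -/
def toExpr {p : ℕ} (G : Concatenation p) (a : (Σ f : Fin G.size, Fin (G.factor f).lower) → ℕ) :
    Expr :=
  List.ofFn fun f => ⟨G.factor f, List.ofFn fun s => a ⟨f, s⟩,
    List.ofFn fun s => Sum.elim a (fun j : Fin p => (j : ℕ)) (G.matching.symm ⟨f, s⟩)⟩

variable {p : ℕ} (G : Concatenation p) {a : (Σ f : Fin G.size, Fin (G.factor f).lower) → ℕ}

theorem toExpr_ok : (G.toExpr a).Ok := by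
  intro A hA
  obtain ⟨f, rfl⟩ := List.mem_ofFn.1 hA
  simp [Atom.Ok]

theorem mem_lows_toExpr (v : ℕ) : v ∈ (G.toExpr a).lows ↔ ∃ x, a x = v := by
  simp [toExpr, Expr.lows, List.mem_flatMap, List.mem_ofFn]

theorem mem_ups_toExpr (v : ℕ) : v ∈ (G.toExpr a).ups ↔ (∃ x, a x = v) ∨ v < p := by
  simp only [toExpr, Expr.ups, List.mem_flatMap, List.mem_ofFn]
  constructor
  · rintro ⟨A, ⟨f, rfl⟩, hv⟩
    obtain ⟨s, rfl⟩ := List.mem_ofFn.1 hv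
    rcases h : G.matching.symm ⟨f, s⟩ with x | j
    · exact Or.inl ⟨x, rfl⟩
    · exact Or.inr j.2
  · rintro (⟨x, rfl⟩ | hv)
    · refine ⟨_, ⟨(G.matching (Sum.inl x)).1, rfl⟩, List.mem_ofFn.2 ⟨(G.matching (Sum.inl x)).2, ?_⟩⟩
      simp
    · refine ⟨_, ⟨(G.matching (Sum.inr ⟨v, hv⟩)).1, rfl⟩,
        List.mem_ofFn.2 ⟨(G.matching (Sum.inr ⟨v, hv⟩)).2, ?_⟩⟩
      simp

theorem nodup_lows_toExpr (ha : Function.Injective a) : (G.toExpr a).lows.Nodup := by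
  rw [Expr.lows, List.nodup_flatMap, toExpr, List.pairwise_ofFn]
  refine ⟨fun A hA => ?_, fun f f' h v hv hv' => ?_⟩
  · obtain ⟨f, rfl⟩ := List.mem_ofFn.1 hA
    exact List.nodup_ofFn.2 fun s t h => by simpa using ha h
  · obtain ⟨s, rfl⟩ := List.mem_ofFn.1 hv
    obtain ⟨t, ht⟩ := List.mem_ofFn.1 hv'
    have := congrArg Sigma.fst (ha ht)
    exact h.ne this.symm

theorem nodup_ups_toExpr (ha : Function.Injective a) (hp : ∀ x, p ≤ a x) :
    (G.toExpr a).ups.Nodup := by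
  have hi : Function.Injective (Sum.elim a fun j : Fin p => (j : ℕ)) :=
    ha.sumElim Fin.val_injective fun x j h => by have := hp x; have := j.2; omega
  have hj := hi.comp G.matching.symm.injective
  rw [Expr.ups, List.nodup_flatMap, toExpr, List.pairwise_ofFn]
  refine ⟨fun A hA => ?_, fun f f' h v hv hv' => ?_⟩
  · obtain ⟨f, rfl⟩ := List.mem_ofFn.1 hA
    exact List.nodup_ofFn.2 fun s t h => by simpa using hj h
  · obtain ⟨s, rfl⟩ := List.mem_ofFn.1 hv
    obtain ⟨t, ht⟩ := List.mem_ofFn.1 hv'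
    have := congrArg Sigma.fst (hj ht)
    exact h.ne this.symm

theorem toExpr_wf (hG : G.NoLoop) (ha : Function.Injective a) (hp : ∀ x, p ≤ a x) :
    (G.toExpr a).WF p where
  ok := G.toExpr_ok
  nodup := G.nodup_lows_toExpr ha
  le v hv := by obtain ⟨x, rfl⟩ := (G.mem_lows_toExpr v).1 hv; exact hp x
  perm := by
    refine (List.perm_ext_iff_of_nodup (G.nodup_ups_toExpr ha hp) ?_).2 fun v => ?_
    · rw [List.nodup_append']
      refine ⟨List.nodup_range, G.nodup_lows_toExpr ha, fun v hv hv' => ?_⟩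
      obtain ⟨x, rfl⟩ := (G.mem_lows_toExpr v).1 hv'
      have := hp x; rw [List.mem_range] at hv; omega
    · rw [mem_ups_toExpr, List.mem_append, mem_lows_toExpr, List.mem_range, or_comm]
  noLoop A hA v hv hv' := by
    obtain ⟨f, rfl⟩ := List.mem_ofFn.1 hA
    obtain ⟨s, rfl⟩ := List.mem_ofFn.1 hv
    obtain ⟨t, ht⟩ := List.mem_ofFn.1 hv'
    have hi : Function.Injective (Sum.elim a fun j : Fin p => (j : ℕ)) :=
      ha.sumElim Fin.val_injective fun x j h => by have := hp x; have := j.2; omega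
    have h1 : G.matching.symm ⟨f, t⟩ = Sum.inl ⟨f, s⟩ := hi ht
    have h2 : G.matching (Sum.inl ⟨f, s⟩) = ⟨f, t⟩ := by rw [← h1, Equiv.apply_symm_apply]
    exact hG f s (by rw [h2])

/-- The labels of contracted slots start at `q + 1`, so extending `env I` by the values `σ` leaves
the values of the free labels `0, …, q` untouched. -/
theorem value_toExpr (G : Concatenation (q + 1))
    {a : (Σ f : Fin G.size, Fin (G.factor f).lower) → ℕ} (ha : Function.Injective a)
    (hp : ∀ x, q + 1 ≤ a x) {X : ConnManifold} (P : X.PoissonTensor) (φ : X.Chart)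
    (I : Fin (q + 1) → Fin X.dim) (y : X.Model) :
    (G.toExpr a).value P φ I y = G.eval P φ I y := by
  rw [Expr.value, Expr.ev, sumOver_eq_sum (G.nodup_lows_toExpr ha) ha G.mem_lows_toExpr, eval]
  refine Finset.sum_congr rfl fun σ _ => ?_
  rw [Expr.pval, toExpr, List.map_ofFn, List.prod_ofFn]
  refine Finset.prod_congr rfl fun f _ => ?_
  simp only [Function.comp_apply, Atom.val]
  congr 1
  · funext s
    rw [List.getD_eq_getElem _ 0 (by simp), List.getElem_ofFn]
    exact ha.extend_apply _ _ _
  · funext s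
    rw [List.getD_eq_getElem _ 0 (by simp), List.getElem_ofFn]
    simp only [Fin.eta]
    rcases G.matching.symm ⟨f, s⟩ with x | j
    · exact ha.extend_apply _ _ _
    · rw [Sum.elim_inr, Sum.elim_inr, Function.extend_apply' _ _ _ fun ⟨x, hx⟩ => by
        have := hp x; have := j.2; omega]
      exact congrArg I (Fin.ext (by simp [Fin.ofNat, Nat.mod_eq_of_lt j.2]))

/-- Every concatenation without loops is described by an expression. -/
theorem exists_expr (𝕂 : Type) [RCLike 𝕂] (G : Concatenation (q + 1)) (hG : G.NoLoop) :
    ∃ E : Expr, E.WF (q + 1) ∧ G.family 𝕂 = E.family 𝕂 q := by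
  have ha : Function.Injective fun x : Σ f : Fin G.size, Fin (G.factor f).lower =>
      (q + 1) + (finSigmaFinEquiv x : ℕ) := fun x y h =>
    finSigmaFinEquiv.injective (Fin.ext (by simpa using h))
  refine ⟨G.toExpr _, G.toExpr_wf hG ha fun x => Nat.le_add_right _ _, ?_⟩
  funext X P φ I
  simp only [family, Expr.family, G.value_toExpr ha fun x => Nat.le_add_right _ _]

end Concatenation

namespace Expr

/-- Since no label is repeated, a slot is determined by its label. This turns labels back into a
matching of slots. -/
theorem injective_getD {E : Expr} {g : Atom → List ℕ} (h : (E.flatMap g).Nodup)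
    {m : Fin E.length → ℕ} (hm : ∀ i : Fin E.length, m i = (g E[i]).length) :
    Function.Injective fun x : Σ i : Fin E.length, Fin (m i) => (g E[x.1]).getD x.2 0 := by
  rw [List.nodup_flatMap, List.pairwise_iff_getElem] at h
  have hmem : ∀ (i : Fin E.length) (s : Fin (m i)), (g E[i]).getD s 0 ∈ g E[i] := fun i s =>
    Atom.getD_mem (hm i).symm s.2
  rintro ⟨i, s⟩ ⟨j, t⟩ hst
  change (g E[i]).getD s 0 = (g E[j]).getD t 0 at hst
  rcases lt_trichotomy i j with hij | rfl | hij
  · exact (h.2 i j i.2 j.2 hij (hmem i s) (hst ▸ hmem j t)).elim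
  · rw [List.getD_eq_getElem _ 0 (hm i ▸ s.2), List.getD_eq_getElem _ 0 (hm i ▸ t.2)] at hst
    have := (h.1 _ (List.getElem_mem _)).getElem_inj_iff.1 hst
    exact congrArg (Sigma.mk i) (Fin.ext this)
  · exact (h.2 j i j.2 i.2 hij (hmem j t) (hst.symm ▸ hmem i s)).elim

theorem mem_flatMap_iff {E : Expr} {g : Atom → List ℕ} {m : Fin E.length → ℕ}
    (hm : ∀ i : Fin E.length, m i = (g E[i]).length) (v : ℕ) :
    v ∈ E.flatMap g ↔ ∃ x : Σ i : Fin E.length, Fin (m i), (g E[x.1]).getD x.2 0 = v := by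
  rw [List.mem_flatMap]
  constructor
  · rintro ⟨A, hA, hv⟩
    obtain ⟨i, hi, rfl⟩ := List.getElem_of_mem hA
    obtain ⟨s, hs, rfl⟩ := List.getElem_of_mem hv
    exact ⟨⟨⟨i, hi⟩, ⟨s, (hm ⟨i, hi⟩).symm ▸ hs⟩⟩, List.getD_eq_getElem _ 0 hs⟩
  · rintro ⟨⟨i, s⟩, rfl⟩
    exact ⟨E[i], List.getElem_mem _, Atom.getD_mem (hm i).symm s.2⟩

/-- Every expression without loops describes a concatenation. -/
theorem WF.exists_concatenation (𝕂 : Type) [RCLike 𝕂] {q : ℕ} {E : Expr} (h : E.WF (q + 1)) :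
    ∃ G : Concatenation (q + 1), G.NoLoop ∧ E.family 𝕂 q = G.family 𝕂 := by
  have hl : ∀ i : Fin E.length, E[i].f.lower = E[i].lo.length := fun i =>
    (h.ok _ (List.getElem_mem _)).1.symm
  have hu : ∀ i : Fin E.length, E[i].f.upper = E[i].up.length := fun i =>
    (h.ok _ (List.getElem_mem _)).2.symm
  let a : (Σ i : Fin E.length, Fin E[i].f.lower) → ℕ := fun x =>
    E[x.1].lo.getD x.2 0
  let b : (Σ i : Fin E.length, Fin E[i].f.upper) → ℕ := fun x =>
    E[x.1].up.getD x.2 0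
  have ha : Function.Injective a := injective_getD h.nodup hl
  have hb : Function.Injective b := injective_getD h.ups_nodup hu
  have ha' : ∀ v, v ∈ E.lows ↔ ∃ x, a x = v := mem_flatMap_iff hl
  have hb' : ∀ v, v ∈ E.ups ↔ ∃ x, b x = v := mem_flatMap_iff hu
  have hp : ∀ x, q + 1 ≤ a x := fun x => h.le _ ((ha' _).2 ⟨x, rfl⟩)
  have hi : Function.Injective (Sum.elim a fun j : Fin (q + 1) => (j : ℕ)) :=
    ha.sumElim Fin.val_injective fun x j h => by have := hp x; have := j.2; omega
  -- The lower labels together with the free ones are exactly the upper labels. The matching is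
  -- therefore the bijection from slots to labels followed by the inverse of the bijection for upper
  -- slots.
  have hr : Set.range (Sum.elim a fun j : Fin (q + 1) => (j : ℕ)) = Set.range b := by
    ext v
    rw [Set.mem_range, Set.mem_range, ← hb', h.perm.mem_iff, List.mem_append, ha', List.mem_range]
    constructor
    · rintro ⟨x | j, rfl⟩
      · exact Or.inr ⟨x, rfl⟩
      · exact Or.inl j.2
    · rintro (hv | ⟨x, rfl⟩)
      · exact ⟨Sum.inr ⟨v, hv⟩, rfl⟩
      · exact ⟨Sum.inl x, rfl⟩
  let G : Concatenation (q + 1) :=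
    { size := E.length
      factor := fun i => E[i].f
      matching := ((Equiv.ofInjective _ hi).trans (Equiv.setCongr hr)).trans
        (Equiv.ofInjective b hb).symm }
  have hm : ∀ x, b (G.matching x) = Sum.elim a (fun j : Fin (q + 1) => (j : ℕ)) x := by
    intro x
    have := Equiv.apply_ofInjective_symm hb
      ((Equiv.setCongr hr) ((Equiv.ofInjective _ hi) x))
    exact this
  have hE : G.toExpr a = E := by
    refine List.ext_getElem (by simp [Concatenation.toExpr, G]) fun i h1 h2 => ?_
    simp only [Concatenation.toExpr, List.getElem_ofFn]
    have e1 : (List.ofFn fun s => a ⟨⟨i, h2⟩, s⟩) = E[i].lo := by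
      refine List.ext_getElem (by simpa using hl ⟨i, h2⟩) fun s h3 h4 => ?_
      rw [List.getElem_ofFn]; exact List.getD_eq_getElem _ 0 h4
    have e2 : (List.ofFn fun s : Fin E[i].f.upper => b ⟨⟨i, h2⟩, s⟩) = E[i].up := by
      refine List.ext_getElem (by simpa using hu ⟨i, h2⟩) fun s h3 h4 => ?_
      rw [List.getElem_ofFn]; exact List.getD_eq_getElem _ 0 h4
    have e3 : ∀ s : Fin E[i].f.upper, Sum.elim a (fun j : Fin (q + 1) => (j : ℕ))
        (G.matching.symm ⟨⟨i, h2⟩, s⟩) = b ⟨⟨i, h2⟩, s⟩ := fun s => by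
      rw [← hm, Equiv.apply_symm_apply]
    change Atom.mk E[i].f (List.ofFn fun s => a ⟨⟨i, h2⟩, s⟩) (List.ofFn fun s : Fin E[i].f.upper =>
      Sum.elim a (fun j : Fin (q + 1) => (j : ℕ)) (G.matching.symm ⟨⟨i, h2⟩, s⟩)) = E[i]
    simp only [e3, e2, e1]
  refine ⟨G, fun i s hs => ?_, ?_⟩
  · have h1 := hm (Sum.inl ⟨i, s⟩)
    refine h.noLoop E[i] (List.getElem_mem _) (a := a ⟨i, s⟩)
      (Atom.getD_mem (hl i).symm s.2) ?_
    rw [show a ⟨i, s⟩ = b (G.matching (Sum.inl ⟨i, s⟩)) from h1.symm]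
    have key : ∀ (i : Fin E.length) (x : Σ i : Fin E.length, Fin E[i].f.upper), x.1 = i →
        b x ∈ E[i].up := by
      rintro i ⟨j, t⟩ hj
      change j = i at hj
      subst hj
      exact Atom.getD_mem (hu j).symm t.2
    exact key i _ hs
  · funext X P φ I
    simp only [Concatenation.family, family, ← G.value_toExpr ha hp, hE]

end Expr

/-! ### Local relations between expressions -/

namespace Expr

/-- The numbers of factors `∇^m P` and `∇^m R`. -/
def numP (E : Expr) : ℕ := E.countP fun A => match A.f with | Factor.P _ => true | Factor.R _ => false

/-- The number of factors `∇^m R`. -/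
def numR (E : Expr) : ℕ := E.countP fun A => match A.f with | Factor.P _ => false | Factor.R _ => true

@[simp] theorem numP_append (E F : Expr) : numP (E ++ F) = numP E + numP F := by simp [numP]
@[simp] theorem numR_append (E F : Expr) : numR (E ++ F) = numR E + numR F := by simp [numR]

theorem numP_deriv {E F : Expr} {w : ℕ} (h : F ∈ E.deriv w) : F.numP = E.numP := by
  obtain ⟨E₁, A, E₂, rfl, rfl⟩ := deriv_spec h
  obtain ⟨f, lo, up⟩ := A
  cases f <;> simp [numP, Atom.deriv, Factor.succ]

theorem numR_deriv {E F : Expr} {w : ℕ} (h : F ∈ E.deriv w) : F.numR = E.numR := by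
  obtain ⟨E₁, A, E₂, rfl, rfl⟩ := deriv_spec h
  obtain ⟨f, lo, up⟩ := A
  cases f <;> simp [numR, Atom.deriv, Factor.succ]

theorem noLoop_deriv {E F : Expr} {w : ℕ} (hE : ∀ A ∈ E, A.lo.Disjoint A.up) (hw : w ∉ E.ups)
    (h : F ∈ E.deriv w) : ∀ A ∈ F, A.lo.Disjoint A.up := by
  obtain ⟨E₁, A, E₂, rfl, rfl⟩ := deriv_spec h
  intro B hB
  simp only [List.mem_append, List.mem_cons] at hB
  rcases hB with hB | rfl | hB
  · exact hE B (by simp [hB])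
  · have := hE A (by simp)
    simp only [Atom.deriv, List.disjoint_cons_left]
    exact ⟨fun h => hw (by simp [h]), this⟩
  · exact hE B (by simp [hB])

end Expr

/-- The expression has free lower indices `fl`, free upper indices `fu`, contracted indices `vs`,
and no loops. -/
structure LocalShape (fl fu vs : List ℕ) (E : Expr) : Prop where
  ok : E.Ok
  lows : E.lows.Perm (fl ++ vs)
  ups : E.ups.Perm (fu ++ vs)
  noLoop : ∀ A ∈ E, A.lo.Disjoint A.up
  nodup_lows : (fl ++ vs).Nodup
  nodup_ups : (fu ++ vs).Nodup

/-- Linear combinations of expressions with given contracted indices. -/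
abbrev Comb : Type := List (ℤ × List ℕ × Expr)

/-- A linear combination of expressions with common free indices vanishes identically. -/
structure LocalRel (fl fu : List ℕ) (cs : Comb) : Prop where
  shape : ∀ x ∈ cs, LocalShape fl fu x.2.1 x.2.2
  zero : ∀ (X : ConnManifold) (P : X.PoissonTensor) (φ : X.Chart) (ν : ℕ → Fin X.dim),
    ∀ y ∈ φ.1.target, (cs.map fun x => (x.1 : ℝ) * x.2.2.ev P φ x.2.1 ν y).sum = 0

/-- The covariant derivative of a combination of expressions. -/
def derivComb (w : ℕ) (cs : Comb) : Comb :=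
  cs.flatMap fun x => (x.2.2.deriv w).map fun F => (x.1, x.2.1, F)

variable {fl fu vs : List ℕ} {cs : Comb} {w : ℕ}

theorem LocalShape.deriv {E F : Expr} (h : LocalShape fl fu vs E) (hF : F ∈ E.deriv w)
    (hwl : w ∉ fl) (hwu : w ∉ fu) (hwv : w ∉ vs) : LocalShape (w :: fl) fu vs F :=
  ⟨Expr.deriv_ok h.ok hF, (Expr.lows_deriv hF).trans (h.lows.cons w), Expr.ups_deriv hF ▸ h.ups,
    Expr.noLoop_deriv h.noLoop (fun hw => by
      rcases List.mem_append.1 (h.ups.mem_iff.1 hw) with h | h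
      exacts [hwu h, hwv h]) hF,
    by simpa [hwl, hwv] using h.nodup_lows, h.nodup_ups⟩

/-- The partial derivative of an identity is an identity, and the Christoffel corrections for the
common free indices are multiples of the same combination at other index values. Both vanish, which
leaves the combination of the covariant derivatives. -/
theorem LocalRel.deriv (h : LocalRel fl fu cs) (hd : fl.Disjoint fu) (hwl : w ∉ fl) (hwu : w ∉ fu)
    (hwv : ∀ x ∈ cs, w ∉ x.2.1) : LocalRel (w :: fl) fu (derivComb w cs) where
  shape x hx := by
    obtain ⟨z, hz, hx⟩ := List.mem_flatMap.1 hx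
    obtain ⟨F, hF, rfl⟩ := List.mem_map.1 hx
    exact (h.shape z hz).deriv hF hwl hwu (hwv z hz)
  zero X P φ ν y hy := by
    -- Stated without the vanishing of the combination, so that it can be proved by induction on the
    -- list of terms.
    have key : ∀ cs : Comb, (∀ x ∈ cs, LocalShape fl fu x.2.1 x.2.2) → (∀ x ∈ cs, w ∉ x.2.1) →
        DifferentiableAt ℝ (fun y => (cs.map fun x => (x.1 : ℝ) * x.2.2.ev P φ x.2.1 ν y).sum) y ∧
        pd (ν w) (fun y => (cs.map fun x => (x.1 : ℝ) * x.2.2.ev P φ x.2.1 ν y).sum) y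
        = ((derivComb w cs).map fun x => (x.1 : ℝ) * x.2.2.ev P φ x.2.1 ν y).sum
        + (fl.map fun v => ∑ e, X.christoffel φ (ν w) (ν v) e y
          * (cs.map fun x => (x.1 : ℝ) * x.2.2.ev P φ x.2.1 (Function.update ν v e) y).sum).sum
        - (fu.map fun v => ∑ e, X.christoffel φ (ν w) e (ν v) y
          * (cs.map fun x => (x.1 : ℝ) * x.2.2.ev P φ x.2.1 (Function.update ν v e) y).sum).sum := by
      intro cs hcs hwv
      induction cs with
      | nil => simp [derivComb, pd_const]
      | cons x cs ih =>
        obtain ⟨h1, h2⟩ := ih (fun z hz => hcs z (by simp [hz])) fun z hz => hwv z (by simp [hz])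
        have s := hcs x (by simp)
        have h3 : DifferentiableAt ℝ (x.2.2.ev P φ x.2.1 ν) y :=
          ConnManifold.differentiableAt_of_contDiffOn (x.2.2.contDiffOn_ev x.2.1 ν) hy
        have h4 := Expr.pd_ev s.ok s.lows s.ups (s.lows.nodup_iff.2 s.nodup_lows)
          (s.ups.nodup_iff.2 s.nodup_ups) hd (hwv x (by simp)) ν hy (P := P)
        simp only [List.map_cons, List.sum_cons]
        refine ⟨(h3.const_mul _).add h1, ?_⟩
        rw [pd_fun_add (h3.const_mul _) h1, pd_fun_const_mul _ h3, h2, h4]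
        have h5 : ((derivComb w (x :: cs)).map fun x => (x.1 : ℝ) * x.2.2.ev P φ x.2.1 ν y).sum
            = (x.1 : ℝ) * ((x.2.2.deriv w).map fun F => F.ev P φ x.2.1 ν y).sum
              + ((derivComb w cs).map fun x => (x.1 : ℝ) * x.2.2.ev P φ x.2.1 ν y).sum := by
          rw [← List.sum_map_mul_left]
          simp [derivComb, Function.comp_def]
        have h6 : ∀ (l : List ℕ) (g : ℕ → Fin X.dim → ℝ), (l.map fun v => ∑ e, g v e
            * ((x.1 : ℝ) * x.2.2.ev P φ x.2.1 (Function.update ν v e) y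
              + (cs.map fun x => (x.1 : ℝ) * x.2.2.ev P φ x.2.1 (Function.update ν v e) y).sum)).sum
            = (x.1 : ℝ) * (l.map fun v => ∑ e, g v e
              * x.2.2.ev P φ x.2.1 (Function.update ν v e) y).sum
              + (l.map fun v => ∑ e, g v e * (cs.map fun x =>
                (x.1 : ℝ) * x.2.2.ev P φ x.2.1 (Function.update ν v e) y).sum).sum := by
          intro l g
          rw [← List.sum_map_mul_left, ← List.sum_map_add]
          refine congrArg List.sum (List.map_congr_left fun v _ => ?_)
          rw [Finset.mul_sum, ← Finset.sum_add_distrib]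
          exact Finset.sum_congr rfl fun e _ => by ring
        rw [h5, h6 fl fun v e => X.christoffel φ (ν w) (ν v) e y,
          h6 fu fun v e => X.christoffel φ (ν w) e (ν v) y]
        ring
    -- Here the vanishing enters: on the whole target, for the left side, and at changed index
    -- values, for the corrections.
    have h0 := (key cs h.shape hwv).2
    rw [pd_congr_of_eqOn φ.1.open_target (fun z hz => h.zero X P φ ν z hz) hy, pd_const] at h0
    simp only [h.zero X P φ _ y hy, mul_zero, Finset.sum_const_zero] at h0
    simpa using h0.symm

/-! ### Relations in a context -/

/-- The remaining factors of an expression a part of which has the free indices `fl`, `fu` and the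
contracted indices `vs`. -/
structure Context (p : ℕ) (fl fu vs : List ℕ) (C : Expr) : Prop where
  ok : C.Ok
  nodup : (fl ++ vs ++ C.lows).Nodup
  le : ∀ v ∈ fl ++ vs ++ C.lows, p ≤ v
  perm : (fu ++ vs ++ C.ups).Perm (List.range p ++ (fl ++ vs ++ C.lows))
  noLoop : ∀ A ∈ C, A.lo.Disjoint A.up

/-- The curvature terms of the Ricci identity carry an additional contracted label. This shows that
the same surrounding factors serve as context when the new labels are fresh. -/
theorem Context.extend {p : ℕ} {C : Expr} (h : Context p fl fu [] C) (hvs : vs.Nodup)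
    (hv : ∀ v ∈ vs, p ≤ v ∧ v ∉ fl ∧ v ∉ C.lows) : Context p fl fu vs C where
  ok := h.ok
  nodup := by
    have h1 := h.nodup
    rw [List.append_nil] at h1
    have h2 : (fl ++ vs ++ C.lows).Perm (vs ++ (fl ++ C.lows)) := by
      rw [List.append_assoc]
      exact List.perm_append_comm_assoc _ _ _
    rw [h2.nodup_iff, List.nodup_append']
    refine ⟨hvs, h1, fun v hv' hv'' => ?_⟩
    rcases List.mem_append.1 hv'' with h3 | h3
    exacts [(hv v hv').2.1 h3, (hv v hv').2.2 h3]
  le v hv' := by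
    simp only [List.mem_append] at hv'
    rcases hv' with (hv' | hv') | hv'
    · exact h.le v (by simp [hv'])
    · exact (hv v hv').1
    · exact h.le v (by simp [hv'])
  perm := by
    have h1 := h.perm
    simp only [List.append_nil] at h1
    have h2 : ∀ l m : List ℕ, (l ++ vs ++ m).Perm (vs ++ (l ++ m)) := fun l m => by
      rw [List.append_assoc]
      exact List.perm_append_comm_assoc _ _ _
    refine (h2 _ _).trans ((h1.append_left vs).trans ?_)
    exact (List.perm_append_comm_assoc _ _ _).trans ((h2 _ _).symm.append_left _)
  noLoop := h.noLoop

theorem Context.wf {p : ℕ} {C : Expr} (h : Context p fl fu vs C) {E : Expr}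
    (hE : LocalShape fl fu vs E) : Expr.WF p (E ++ C) := by
  have h1 : (Expr.lows (E ++ C)).Perm (fl ++ vs ++ C.lows) := by
    rw [Expr.lows_append]; exact hE.lows.append_right _
  have h2 : (Expr.ups (E ++ C)).Perm (fu ++ vs ++ C.ups) := by
    rw [Expr.ups_append]; exact hE.ups.append_right _
  refine ⟨fun A hA => ?_, h1.nodup_iff.2 h.nodup, fun v hv => h.le v (h1.mem_iff.1 hv),
    h2.trans (h.perm.trans (h1.symm.append_left _)), fun A hA => ?_⟩
  · rcases List.mem_append.1 hA with hA | hA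
    exacts [hE.ok A hA, h.ok A hA]
  · rcases List.mem_append.1 hA with hA | hA
    exacts [hE.noLoop A hA, h.noLoop A hA]

/-- The labels contracted inside `E` do not occur in `C`, so their summation can be carried out
first. -/
theorem Context.value_append {q : ℕ} {C : Expr} (h : Context (q + 1) fl fu vs C) {E : Expr}
    (hE : LocalShape fl fu vs E) {X : ConnManifold} (P : X.PoissonTensor) (φ : X.Chart)
    (I : Fin (q + 1) → Fin X.dim) (y : X.Model) :
    Expr.value P φ (E ++ C) I y
      = sumOver (C.lows ++ fl) (fun ν => E.ev P φ vs ν y * C.pval P φ ν ν y) (env I) := by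
  have h1 : (Expr.lows (E ++ C)).Perm ((C.lows ++ fl) ++ vs) := by
    rw [Expr.lows_append, List.append_assoc]
    exact List.perm_append_comm.trans (hE.lows.append_left _)
  have hvl : ∀ v ∈ vs, v ∉ C.lows := fun v hv hv' =>
    (List.nodup_append'.1 h.nodup).2.2 (List.mem_append.2 (Or.inr hv)) hv'
  have hup : (fu ++ vs ++ C.ups).Nodup := by
    rw [h.perm.nodup_iff, List.nodup_append']
    exact ⟨List.nodup_range, h.nodup, fun v hv hv' => by
      have := h.le v hv'; rw [List.mem_range] at hv; omega⟩
  have hvu : ∀ v ∈ vs, v ∉ C.ups := fun v hv hv' =>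
    (List.nodup_append'.1 hup).2.2 (List.mem_append.2 (Or.inr hv)) hv'
  rw [Expr.value, Expr.ev, sumOver_perm h1, sumOver_append]
  refine sumOver_congr fun μ _ => ?_
  rw [Expr.ev, mul_comm, ← sumOver_mul_left]
  refine sumOver_congr fun μ' hμ' => ?_
  rw [Expr.pval_append, mul_comm, Expr.pval_congr (E := C) h.ok (ν' := μ) (μ' := μ)
    (fun v hv => hμ' v fun hv' => hvl v hv' hv) (fun v hv => hμ' v fun hv' => hvu v hv' hv)]

/-- The combination of families of components defined by a combination of expressions. -/
def combFamily (𝕂 : Type) [RCLike 𝕂] (q : ℕ) (cs : List (ℤ × Expr)) : ComponentFamily 𝕂 (q + 1) :=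
  (cs.map fun x => (x.1 : 𝕂) • x.2.family 𝕂 q).sum

theorem combFamily_apply (𝕂 : Type) [RCLike 𝕂] (q : ℕ) (cs : List (ℤ × Expr)) (X : ConnManifold)
    (P : X.PoissonTensor) (φ : X.Chart) (I : Fin (q + 1) → Fin X.dim) (y : X.Model)
    (hy : y ∈ φ.1.target) : combFamily 𝕂 q cs X P φ I y
      = (((cs.map fun x => (x.1 : ℝ) * x.2.value P φ I y).sum : ℝ) : 𝕂) := by
  induction cs with
  | nil => simp [combFamily]
  | cons x cs ih =>
    simp only [combFamily, List.map_cons, List.sum_cons] at ih ⊢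
    simp only [Pi.add_apply, ih, Pi.smul_apply, Expr.family, Set.indicator_of_mem hy]
    push_cast
    simp

theorem combFamily_apply_of_notMem (𝕂 : Type) [RCLike 𝕂] (q : ℕ) (cs : List (ℤ × Expr))
    (X : ConnManifold)
    (P : X.PoissonTensor) (φ : X.Chart) (I : Fin (q + 1) → Fin X.dim) (y : X.Model)
    (hy : y ∉ φ.1.target) : combFamily 𝕂 q cs X P φ I y = 0 := by
  induction cs with
  | nil => simp [combFamily]
  | cons x cs ih =>
    simp only [combFamily, List.map_cons, List.sum_cons] at ih ⊢
    simp [ih, Expr.family, hy]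

/-- With the inner sums carried out, all terms share the outer summation and the factor `C`, and the
sum of what is left is zero for all values of the outer labels. -/
theorem LocalRel.combFamily_eq_zero (𝕂 : Type) [RCLike 𝕂] (h : LocalRel fl fu cs) {q : ℕ}
    {C : Expr} (hC : ∀ x ∈ cs, Context (q + 1) fl fu x.2.1 C) :
    combFamily 𝕂 q (cs.map fun x => (x.1, x.2.2 ++ C)) = 0 := by
  funext X P φ I y
  by_cases hy : y ∈ φ.1.target
  swap
  · exact combFamily_apply_of_notMem 𝕂 q _ X P φ I y hy
  rw [combFamily_apply 𝕂 q _ X P φ I y hy, List.map_map]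
  have h1 : (cs.map ((fun x : ℤ × Expr => (x.1 : ℝ) * x.2.value P φ I y) ∘
      fun x => (x.1, x.2.2 ++ C))).sum = sumOver (C.lows ++ fl) (fun ν =>
        (cs.map fun x => (x.1 : ℝ) * x.2.2.ev P φ x.2.1 ν y).sum * C.pval P φ ν ν y) (env I) := by
    simp only [← List.sum_map_mul_right]
    rw [sumOver_list_sum]
    refine congrArg List.sum (List.map_congr_left fun x hx => ?_)
    simp only [Function.comp_apply, (hC x hx).value_append (h.shape x hx), mul_assoc]
    rw [sumOver_mul_left]
  rw [h1]
  simp only [h.zero X P φ _ y hy, zero_mul, sumOver_zero]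
  simp

/-! ### The basic relations -/

namespace Atom

variable {X : ConnManifold} {P : X.PoissonTensor} {φ : X.Chart} {y : X.Model}

theorem val_P_zero (a b : ℕ) (ν μ : ℕ → Fin X.dim) :
    val P φ ⟨Factor.P 0, [], [a, b]⟩ ν μ y = P.comp φ (μ a) (μ b) y := rfl

theorem val_P_one (l a b : ℕ) (ν μ : ℕ → Fin X.dim) :
    val P φ ⟨Factor.P 1, [l], [a, b]⟩ ν μ y
      = X.covDeriv φ (P.components φ) ![ν l] ![μ a, μ b] y := by
  refine congrArg₂ (fun L U => X.covDeriv φ (P.components φ) L U y) ?_ ?_ <;>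
  · funext s; fin_cases s <;> rfl

theorem val_R_zero (a b c u : ℕ) (ν μ : ℕ → Fin X.dim) :
    val P φ ⟨Factor.R 0, [a, b, c], [u]⟩ ν μ y = X.curvature φ ![ν a, ν b, ν c] ![μ u] y := by
  have h1 : (fun s : Fin 3 => ν ([a, b, c].getD s 0)) = ![ν a, ν b, ν c] := by
    funext s; fin_cases s <;> rfl
  have h2 : (fun s : Fin 1 => μ ([u].getD s 0)) = ![μ u] := by
    funext s; fin_cases s; rfl
  rw [← h1, ← h2]
  rfl

theorem val_R_one (a b c d u : ℕ) (ν μ : ℕ → Fin X.dim) :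
    val P φ ⟨Factor.R 1, [a, b, c, d], [u]⟩ ν μ y
      = X.covDeriv φ (X.curvature φ) ![ν a, ν b, ν c, ν d] ![μ u] y := by
  refine (val_deriv ⟨Factor.R 0, [b, c, d], [u]⟩ a ν μ).trans ?_
  have h1 : (Fin.cons (ν a) fun s : Fin 3 => ν ([b, c, d].getD s 0) : Fin 4 → Fin X.dim)
      = ![ν a, ν b, ν c, ν d] := by
    funext s; fin_cases s <;> rfl
  have h2 : (fun s : Fin 1 => μ ([u].getD s 0)) = ![μ u] := by
    funext s; fin_cases s; rfl
  rw [← h1, ← h2]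
  rfl

end Atom

variable {X : ConnManifold} {P : X.PoissonTensor} {φ : X.Chart} {y : X.Model}

@[simp] theorem Expr.ev_nil (E : Expr) (ν : ℕ → Fin X.dim) : E.ev P φ [] ν y = E.pval P φ ν ν y :=
  rfl

theorem Expr.ev_singleton (E : Expr) (v : ℕ) (ν : ℕ → Fin X.dim) :
    E.ev P φ [v] ν y = ∑ e, E.pval P φ (Function.update ν v e) (Function.update ν v e) y := rfl

theorem localShape_singleton {f : Factor} {lo up fl fu : List ℕ} (h1 : lo.length = f.lower)
    (h2 : up.length = f.upper) (h3 : lo.Disjoint up) (h4 : lo.Perm fl) (h5 : up.Perm fu)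
    (h6 : lo.Nodup) (h7 : up.Nodup) : LocalShape fl fu [] [⟨f, lo, up⟩] where
  ok := by rintro A hA; rw [List.mem_singleton.1 hA]; exact ⟨h1, h2⟩
  lows := by simpa using h4
  ups := by simpa using h5
  noLoop := by rintro A hA; rw [List.mem_singleton.1 hA]; exact h3
  nodup_lows := by simpa using h4.nodup_iff.1 h6
  nodup_ups := by simpa using h5.nodup_iff.1 h7

theorem localRel_flip {a b : ℕ} (hab : a ≠ b) :
    LocalRel [] [a, b] [(1, [], [⟨Factor.P 0, [], [a, b]⟩]), (1, [], [⟨Factor.P 0, [], [b, a]⟩])] where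
  shape := by
    have hba := hab.symm
    simp only [List.mem_cons, List.not_mem_nil, or_false, forall_eq_or_imp, forall_eq]
    refine ⟨localShape_singleton rfl rfl ?_ ?_ ?_ ?_ ?_,
      localShape_singleton rfl rfl ?_ ?_ ?_ ?_ ?_⟩ <;> simp [hab, hba, List.Perm.swap]
  zero X P φ ν y _ := by
    simp [Atom.val_P_zero, P.comp_skew φ (ν a) (ν b)]

theorem localRel_skew {a b c u : ℕ} (h : [a, b, c].Nodup) (hu : u ∉ [a, b, c]) :
    LocalRel [a, b, c] [u] [(1, [], [⟨Factor.R 0, [a, b, c], [u]⟩]),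
      (1, [], [⟨Factor.R 0, [b, a, c], [u]⟩])] where
  shape := by
    have hp : [b, a, c].Perm [a, b, c] := List.Perm.swap _ _ _
    simp only [List.mem_cons, List.not_mem_nil, or_false, forall_eq_or_imp, forall_eq]
    refine ⟨localShape_singleton rfl rfl ?_ ?_ ?_ ?_ ?_,
      localShape_singleton rfl rfl ?_ hp ?_ (hp.nodup_iff.2 h) ?_⟩ <;> simp_all
  zero X P φ ν y _ := by
    have h1 := X.curvature_skew (φ := φ) ![ν a, ν b, ν c] ![ν u] y
    have h2 : ![ν a, ν b, ν c] ∘ Equiv.swap 0 1 = ![ν b, ν a, ν c] := by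
      funext s; fin_cases s <;> rfl
    rw [h2] at h1
    simp [Atom.val_R_zero, h1]

theorem localRel_bianchi {a b c u : ℕ} (h : [a, b, c].Nodup) (hu : u ∉ [a, b, c]) :
    LocalRel [a, b, c] [u] [(1, [], [⟨Factor.R 0, [a, b, c], [u]⟩]),
      (1, [], [⟨Factor.R 0, [b, c, a], [u]⟩]), (1, [], [⟨Factor.R 0, [c, a, b], [u]⟩])] where
  shape := by
    have hp : [c, a, b].Perm [a, b, c] := (List.perm_append_comm : ([c] ++ [a, b]).Perm _)
    have hq : [b, c, a].Perm [a, b, c] := (List.perm_append_comm : ([b, c] ++ [a]).Perm _)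
    simp only [List.mem_cons, List.not_mem_nil, or_false, forall_eq_or_imp, forall_eq]
    refine ⟨localShape_singleton rfl rfl ?_ ?_ ?_ ?_ ?_,
      localShape_singleton rfl rfl ?_ hq ?_ (hq.nodup_iff.2 h) ?_,
      localShape_singleton rfl rfl ?_ hp ?_ (hp.nodup_iff.2 h) ?_⟩ <;> simp_all
  zero X P φ ν y hy := by
    have h1 := X.curvature_bianchi (φ := φ) (ν a) (ν b) (ν c) (ν u) hy
    simp [Atom.val_R_zero]
    linarith

theorem localRel_bianchi₂ {a b c d u : ℕ} (h : [a, b, c, d].Nodup) (hu : u ∉ [a, b, c, d]) :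
    LocalRel [a, b, c, d] [u] [(1, [], [⟨Factor.R 1, [a, b, c, d], [u]⟩]),
      (1, [], [⟨Factor.R 1, [b, c, a, d], [u]⟩]), (1, [], [⟨Factor.R 1, [c, a, b, d], [u]⟩])] where
  shape := by
    have hp : [c, a, b, d].Perm [a, b, c, d] :=
      (List.perm_append_comm : ([c] ++ [a, b]).Perm _).append_right [d]
    have hq : [b, c, a, d].Perm [a, b, c, d] :=
      (List.perm_append_comm : ([b, c] ++ [a]).Perm _).append_right [d]
    simp only [List.mem_cons, List.not_mem_nil, or_false, forall_eq_or_imp, forall_eq]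
    refine ⟨localShape_singleton rfl rfl ?_ ?_ ?_ ?_ ?_,
      localShape_singleton rfl rfl ?_ hq ?_ (hq.nodup_iff.2 h) ?_,
      localShape_singleton rfl rfl ?_ hp ?_ (hp.nodup_iff.2 h) ?_⟩ <;> simp_all
  zero X P φ ν y hy := by
    have h1 := X.covDeriv_curvature_bianchi (φ := φ) (ν a) (ν b) (ν c) (ν d) (ν u) hy
    simp [Atom.val_R_one]
    linarith

theorem localRel_jacobi {i j k l : ℕ} (h : [i, j, k].Nodup) (hl : l ∉ [i, j, k]) :
    LocalRel [] [i, j, k]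
      [(1, [l], [⟨Factor.P 0, [], [i, l]⟩, ⟨Factor.P 1, [l], [j, k]⟩]),
       (1, [l], [⟨Factor.P 0, [], [j, l]⟩, ⟨Factor.P 1, [l], [k, i]⟩]),
       (1, [l], [⟨Factor.P 0, [], [k, l]⟩, ⟨Factor.P 1, [l], [i, j]⟩])] where
  shape := by
    have key : ∀ i' j' k', [i', j', k'].Perm [i, j, k] → LocalShape [] [i, j, k] [l]
        [⟨Factor.P 0, [], [i', l]⟩, ⟨Factor.P 1, [l], [j', k']⟩] := by
      intro i' j' k' hp
      have hn := hp.nodup_iff.2 h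
      have hl' : l ∉ [i', j', k'] := fun h' => hl (hp.mem_iff.1 h')
      refine ⟨?_, by simp [Expr.lows], ?_, ?_, by simp, ?_⟩
      · simp only [Expr.Ok, List.mem_cons, List.not_mem_nil, or_false, forall_eq_or_imp, forall_eq]
        exact ⟨⟨rfl, rfl⟩, ⟨rfl, rfl⟩⟩
      · have : Expr.ups [⟨Factor.P 0, [], [i', l]⟩, ⟨Factor.P 1, [l], [j', k']⟩]
          = [i'] ++ ([l] ++ [j', k']) := rfl
        rw [this]
        exact ((List.perm_append_comm (l₁ := [l])).append_left [i']).trans (hp.append_right [l])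
      · simp only [List.mem_cons, List.not_mem_nil, or_false, forall_eq_or_imp, forall_eq]
        simp_all
      · rw [List.nodup_append']
        exact ⟨h, by simp, by simpa using hl⟩
    simp only [List.mem_cons, List.not_mem_nil, or_false, forall_eq_or_imp, forall_eq]
    exact ⟨key _ _ _ (List.Perm.refl _), key _ _ _ (List.perm_append_comm : ([j, k] ++ [i]).Perm _),
      key _ _ _ (List.perm_append_comm : ([k] ++ [i, j]).Perm _)⟩
  zero X P φ ν y hy := by
    have h1 := X.covariant_jacobi (φ := φ) P (ν i) (ν j) (ν k) hy
    simp only [List.mem_cons, List.not_mem_nil, or_false, not_or] at hl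
    have hu : ∀ v e, l ≠ v → Function.update ν l e v = ν v := fun v e h' =>
      Function.update_of_ne h'.symm _ _
    simp only [List.map_cons, List.map_nil, List.sum_cons, List.sum_nil, Expr.ev_singleton,
      Expr.pval_cons, Expr.pval_nil, Atom.val_P_zero, Atom.val_P_one, Function.update_self,
      hu i _ hl.1, hu j _ hl.2.1, hu k _ hl.2.2]
    rw [Finset.sum_add_distrib, Finset.sum_add_distrib] at h1
    simp only [Int.cast_one, one_mul, mul_one, add_zero]
    linarith

/-! ### The Ricci identity as a relation between expressions -/

/-- Replacement of a variable. -/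
def repl (v e : ℕ) (x : ℕ) : ℕ := if x = v then e else x

/-- The terms of the Ricci identity which contain the curvature. -/
def ricciTail (a b e : ℕ) (A : Atom) : Comb :=
  (A.lo.map fun v => ((1 : ℤ), [e], [⟨Factor.R 0, [a, b, v], [e]⟩, ⟨A.f, A.lo.map (repl v e), A.up⟩]))
  ++ (A.up.map fun v =>
    (-1, [e], [⟨Factor.R 0, [a, b, e], [v]⟩, ⟨A.f, A.lo, A.up.map (repl v e)⟩]))

theorem map_repl_perm {l : List ℕ} (hl : l.Nodup) {v : ℕ} (hv : v ∈ l) (e : ℕ) :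
    (v :: l.map (repl v e)).Perm (e :: l) := by
  induction l with
  | nil => simp at hv
  | cons x l ih =>
    rw [List.nodup_cons] at hl
    by_cases hx : x = v
    · subst hx
      have : l.map (repl x e) = l := by
        conv_rhs => rw [← List.map_id l]
        exact List.map_congr_left fun u hu => if_neg fun h => hl.1 (by rw [← h]; exact hu)
      simp only [List.map_cons, this, repl, if_true]
      exact List.Perm.swap _ _ _
    · have hv' : v ∈ l := (List.mem_cons.1 hv).resolve_left fun h => hx h.symm
      simp only [List.map_cons, repl, if_neg hx]
      exact (List.Perm.swap _ _ _).trans (((ih hl.2 hv').cons x).trans (List.Perm.swap _ _ _))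

/-- The sum over the index created by the curvature is realized by a fresh label `e`, contracted
between `R` and the factor. The signs of `ricciTail` are opposite to those of the action of the
curvature, since all terms stand on one side. -/
theorem ricci_val {A : Atom} (hA : A.Ok) (hlo : A.lo.Nodup) (hup : A.up.Nodup) {a b e : ℕ}
    (he : e ∉ a :: b :: A.lo) (heu : e ∉ A.up)
    (ν : ℕ → Fin X.dim) (hy : y ∈ φ.1.target) :
    ((A.deriv b).deriv a).val P φ ν ν y - ((A.deriv a).deriv b).val P φ ν ν y
      + ((ricciTail a b e A).map fun x => (x.1 : ℝ) * x.2.2.ev P φ x.2.1 ν y).sum = 0 := by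
  simp only [List.mem_cons, not_or] at he
  have hv : ∀ a b, ((A.deriv b).deriv a).val P φ ν ν y
      = X.covDeriv φ (X.covDeriv φ (A.f.comp P φ)) (Fin.cons (ν a) (Fin.cons (ν b)
        fun s => ν (A.lo.getD s 0))) (fun s => ν (A.up.getD s 0)) y := by
    intro a b
    obtain ⟨f, lo, up⟩ := A
    cases f <;>
    · refine congrArg₂ (fun L U => X.covDeriv φ (X.covDeriv φ _) L U y) ?_ rfl
      funext s
      exact Fin.cases rfl (fun s => Fin.cases rfl (fun s => rfl) s) s
  have h1 := X.ricci_identity (φ := φ) (T := A.f.comp P φ) (ConnManifold.smoothOn_comp P φ A.f)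
    (ν a) (ν b) (Sum.elim (fun s => ν (A.lo.getD s 0)) fun s => ν (A.up.getD s 0)) hy
  simp only [Sum.elim_inl, Sum.elim_inr] at h1
  rw [hv, hv, h1, slotOperator, Fintype.sum_sum_type, ricciTail, List.map_append, List.sum_append,
    List.map_map, List.map_map, add_add_add_comm]
  simp only [Sum.elim_inl, Sum.elim_inr]
  have h2 : ∑ s : Fin A.f.lower, ∑ x, X.curvatureMatrix φ A.f.lower A.f.upper (ν a) (ν b) y
        (Sum.inl s) (ν (A.lo.getD s 0)) x
        * (ConnManifold.Components.flat (A.f.comp P φ) (Function.update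
          (Sum.elim (fun s => ν (A.lo.getD s 0)) fun s => ν (A.up.getD s 0)) (Sum.inl s) x) y)
      = (A.lo.map fun v => - ∑ x, X.curvature φ ![ν a, ν b, ν v] ![x] y
        * A.val P φ (Function.update ν v x) ν y).sum := by
    rw [← Atom.sum_fin_eq_list_sum hA.1]
    refine Finset.sum_congr rfl fun s _ => ?_
    rw [← Finset.sum_neg_distrib]
    refine Finset.sum_congr rfl fun x _ => ?_
    simp only [ConnManifold.curvatureMatrix, ConnManifold.Components.flat, Sum.elim_inl,
      ConnManifold.update_inl, Atom.val, Atom.update_getD hA.1 hlo, neg_mul]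
    simp [Function.update_of_ne]
  have h3 : ∑ s : Fin A.f.upper, ∑ x, X.curvatureMatrix φ A.f.lower A.f.upper (ν a) (ν b) y
        (Sum.inr s) (ν (A.up.getD s 0)) x
        * (ConnManifold.Components.flat (A.f.comp P φ) (Function.update
          (Sum.elim (fun s => ν (A.lo.getD s 0)) fun s => ν (A.up.getD s 0)) (Sum.inr s) x) y)
      = (A.up.map fun v => ∑ x, X.curvature φ ![ν a, ν b, x] ![ν v] y
        * A.val P φ ν (Function.update ν v x) y).sum := by
    rw [← Atom.sum_fin_eq_list_sum hA.2]
    refine Finset.sum_congr rfl fun s _ => Finset.sum_congr rfl fun x _ => ?_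
    simp only [ConnManifold.curvatureMatrix, ConnManifold.Components.flat, Sum.elim_inr,
      ConnManifold.update_inr, Atom.val, Atom.update_getD hA.2 hup]
    simp [Function.update_of_ne]
  -- Renaming `v` to the fresh label `e` and giving `e` the value `x` has the same effect as giving
  -- `v` the value `x`.
  have hr : ∀ (l : List ℕ), e ∉ l → ∀ v ∈ l, ∀ x, ∀ u ∈ l,
      Function.update ν e x (repl v e u) = Function.update ν v x u := by
    intro l hel v hvl x u hu
    by_cases huv : u = v
    · rw [repl, if_pos huv, Function.update_self, huv, Function.update_self]
    · rw [repl, if_neg huv, Function.update_of_ne huv,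
        Function.update_of_ne (ne_of_mem_of_not_mem hu hel)]
  have hlow : ∀ (lo' up' : List ℕ), lo'.length = A.lo.length → up'.length = A.up.length →
      ∀ (μ μ' ξ ξ' : ℕ → Fin X.dim), lo'.map μ = A.lo.map μ' → up'.map ξ = A.up.map ξ' →
      Atom.val P φ ⟨A.f, lo', up'⟩ μ ξ y = A.val P φ μ' ξ' y := by
    intro lo' up' hl hu μ μ' ξ ξ' e1 e2
    have aux : ∀ {l l' : List ℕ} {n : ℕ} (h : l.length = n) (h' : l'.length = n)
        (μ μ' : ℕ → Fin X.dim), l.map μ = l'.map μ' →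
        (fun s : Fin n => μ (l.getD s 0)) = fun s : Fin n => μ' (l'.getD s 0) := by
      intro l l' n h h' μ μ' hm
      funext s
      have := congrArg (fun m => m[(s : ℕ)]?) hm
      simp only [List.getElem?_map, List.getElem?_eq_getElem (show (s : ℕ) < l.length by omega),
        List.getElem?_eq_getElem (show (s : ℕ) < l'.length by omega), Option.map_some,
        Option.some.injEq] at this
      rw [List.getD_eq_getElem l 0 (by omega), List.getD_eq_getElem l' 0 (by omega), this]
    unfold Atom.val
    rw [aux (hl.trans hA.1) hA.1 μ μ' e1, aux (hu.trans hA.2) hA.2 ξ ξ' e2]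
  have hue : ∀ x v, v ≠ e → Function.update ν e x v = ν v := fun x v h => Function.update_of_ne h _ _
  have e1 : (A.lo.map ((fun x : ℤ × List ℕ × Expr => (x.1 : ℝ) * x.2.2.ev P φ x.2.1 ν y) ∘ fun v =>
      ((1 : ℤ), [e], [⟨Factor.R 0, [a, b, v], [e]⟩, ⟨A.f, A.lo.map (repl v e), A.up⟩])))
      = A.lo.map fun v => ∑ x, X.curvature φ ![ν a, ν b, ν v] ![x] y
        * A.val P φ (Function.update ν v x) ν y := by
    refine List.map_congr_left fun v hvl => ?_
    simp only [Function.comp_apply, Int.cast_one, one_mul, Expr.ev_singleton, Expr.pval_cons,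
      Expr.pval_nil, mul_one, Atom.val_R_zero, Function.update_self, hue _ a (Ne.symm he.1),
      hue _ b (Ne.symm he.2.1), hue _ v (ne_of_mem_of_not_mem hvl he.2.2)]
    refine Finset.sum_congr rfl fun x _ => congrArg _ (hlow _ _ (by simp) rfl _ _ _ _ ?_ ?_)
    · rw [List.map_map]
      exact List.map_congr_left fun u hu => hr _ he.2.2 v hvl x u hu
    · exact List.map_congr_left fun u hu => hue _ _ (ne_of_mem_of_not_mem hu heu)
  have e2 : (A.up.map ((fun x : ℤ × List ℕ × Expr => (x.1 : ℝ) * x.2.2.ev P φ x.2.1 ν y) ∘ fun v =>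
      ((-1 : ℤ), [e], [⟨Factor.R 0, [a, b, e], [v]⟩, ⟨A.f, A.lo, A.up.map (repl v e)⟩])))
      = A.up.map fun v => - ∑ x, X.curvature φ ![ν a, ν b, x] ![ν v] y
        * A.val P φ ν (Function.update ν v x) y := by
    refine List.map_congr_left fun v hvl => ?_
    simp only [Function.comp_apply, Int.cast_neg, Int.cast_one, neg_mul, one_mul, Expr.ev_singleton,
      Expr.pval_cons, Expr.pval_nil, mul_one, Atom.val_R_zero, Function.update_self,
      hue _ a (Ne.symm he.1), hue _ b (Ne.symm he.2.1), hue _ v (ne_of_mem_of_not_mem hvl heu)]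
    refine congrArg _ (Finset.sum_congr rfl fun x _ =>
      congrArg _ (hlow _ _ rfl (by simp) _ _ _ _ ?_ ?_))
    · exact List.map_congr_left fun u hu => hue _ _ (ne_of_mem_of_not_mem hu he.2.2)
    · rw [List.map_map]
      exact List.map_congr_left fun u hu => hr _ heu v hvl x u hu
  rw [h2, h3, e1, e2, ← List.sum_map_add, ← List.sum_map_add]
  simp

/-! ### Derived relations -/

/-- Iterated covariant derivative of a factor. -/
def Atom.derivs (ws : List ℕ) (A : Atom) : Atom := ws.foldr Atom.deriv A

/-- Iterated covariant derivative of a combination of expressions. -/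
def derivsComb (ws : List ℕ) (cs : Comb) : Comb := ws.foldr derivComb cs

theorem Atom.derivs_P (ws : List ℕ) (m : ℕ) (lo up : List ℕ) :
    Atom.derivs ws ⟨Factor.P m, lo, up⟩ = ⟨Factor.P (m + ws.length), ws ++ lo, up⟩ := by
  induction ws with
  | nil => rfl
  | cons w ws ih =>
    rw [Atom.derivs] at ih ⊢
    rw [List.foldr_cons, ih]
    simp [Atom.deriv, Factor.succ, Nat.add_assoc]

theorem Atom.derivs_R (ws : List ℕ) (m : ℕ) (lo up : List ℕ) :
    Atom.derivs ws ⟨Factor.R m, lo, up⟩ = ⟨Factor.R (m + ws.length), ws ++ lo, up⟩ := by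
  induction ws with
  | nil => rfl
  | cons w ws ih =>
    rw [Atom.derivs] at ih ⊢
    rw [List.foldr_cons, ih]
    simp [Atom.deriv, Factor.succ, Nat.add_assoc]

theorem Atom.lo_derivs (ws : List ℕ) (A : Atom) : (A.derivs ws).lo = ws ++ A.lo := by
  obtain ⟨f, lo, up⟩ := A
  cases f
  · rw [Atom.derivs_P]
  · rw [Atom.derivs_R]

theorem Atom.up_derivs (ws : List ℕ) (A : Atom) : (A.derivs ws).up = A.up := by
  obtain ⟨f, lo, up⟩ := A
  cases f
  · rw [Atom.derivs_P]
  · rw [Atom.derivs_R]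

theorem derivsComb_cons (ws : List ℕ) (c : ℤ) (vs : List ℕ) (A : Atom) (cs : Comb) :
    derivsComb ws ((c, vs, [A]) :: cs) = (c, vs, [A.derivs ws]) :: derivsComb ws cs := by
  induction ws with
  | nil => rfl
  | cons w ws ih =>
    change derivComb w (derivsComb ws ((c, vs, [A]) :: cs)) = _
    rw [ih]
    rfl

theorem derivsComb_nil (ws : List ℕ) : derivsComb ws [] = [] := by
  induction ws with
  | nil => rfl
  | cons w ws ih =>
    rw [derivsComb] at ih ⊢
    rw [List.foldr_cons, ih]
    rfl

theorem mem_derivsComb {ws : List ℕ} {cs : Comb} {x : ℤ × List ℕ × Expr}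
    (hx : x ∈ derivsComb ws cs) : ∃ z ∈ cs, x.2.1 = z.2.1 ∧ x.2.2.numP = z.2.2.numP
      ∧ x.2.2.numR = z.2.2.numR := by
  induction ws generalizing x with
  | nil => exact ⟨x, hx, rfl, rfl, rfl⟩
  | cons w ws ih =>
    rw [derivsComb, List.foldr_cons] at hx
    obtain ⟨z, hz, hx⟩ := List.mem_flatMap.1 hx
    obtain ⟨F, hF, rfl⟩ := List.mem_map.1 hx
    obtain ⟨u, hu, h1, h2, h3⟩ := ih hz
    exact ⟨u, hu, h1, (Expr.numP_deriv hF).trans h2, (Expr.numR_deriv hF).trans h3⟩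

theorem LocalRel.derivs {fl fu : List ℕ} {cs : Comb} (h : LocalRel fl fu cs) {ws : List ℕ}
    (hn : (ws ++ fl).Nodup) (hd : (ws ++ fl).Disjoint fu) (hv : ∀ x ∈ cs, ∀ w ∈ ws, w ∉ x.2.1) :
    LocalRel (ws ++ fl) fu (derivsComb ws cs) := by
  induction ws with
  | nil => exact h
  | cons w ws ih =>
    rw [List.cons_append, List.nodup_cons] at hn
    rw [List.cons_append, List.disjoint_cons_left] at hd
    refine (ih hn.2 hd.2 fun x hx u hu => hv x hx u (by simp [hu])).deriv hd.2 hn.1 hd.1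
      fun x hx => ?_
    obtain ⟨z, hz, h1, -⟩ := mem_derivsComb hx
    rw [h1]
    exact hv z hz w (by simp)

/-- Converse of `Context.wf`. With it, a relation can be applied to any expression which contains
one of its terms. -/
theorem Expr.WF.context {p : ℕ} {fl fu vs : List ℕ} {E C : Expr} (h : Expr.WF p (E ++ C))
    (hE : LocalShape fl fu vs E) : Context p fl fu vs C := by
  have h1 : (Expr.lows (E ++ C)).Perm (fl ++ vs ++ C.lows) := by
    rw [Expr.lows_append]; exact hE.lows.append_right _
  have h2 : (Expr.ups (E ++ C)).Perm (fu ++ vs ++ C.ups) := by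
    rw [Expr.ups_append]; exact hE.ups.append_right _
  exact ⟨fun A hA => h.ok A (List.mem_append.2 (Or.inr hA)), h1.nodup_iff.1 h.nodup,
    fun v hv => h.le v (h1.mem_iff.2 hv), h2.symm.trans (h.perm.trans (h1.append_left _)),
    fun A hA => h.noLoop A (List.mem_append.2 (Or.inr hA))⟩

theorem Expr.WF.localShape {p : ℕ} {A : Atom} {C : Expr} (h : Expr.WF p (A :: C)) :
    LocalShape A.lo A.up [] [A] where
  ok := by rintro B hB; rw [List.mem_singleton.1 hB]; exact h.ok A (by simp)
  lows := by simp
  ups := by simp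
  noLoop := by rintro B hB; rw [List.mem_singleton.1 hB]; exact h.noLoop A (by simp)
  nodup_lows := by
    have := h.nodup
    rw [Expr.lows_cons, List.nodup_append'] at this
    simpa using this.1
  nodup_ups := by
    have := h.ups_nodup
    rw [Expr.ups_cons, List.nodup_append'] at this
    simpa using this.1

variable (𝕂 : Type) [RCLike 𝕂] {q : ℕ}

theorem combFamily_cons (c : ℤ) (E : Expr) (cs : List (ℤ × Expr)) :
    combFamily 𝕂 q ((c, E) :: cs) = (c : 𝕂) • E.family 𝕂 q + combFamily 𝕂 q cs := by
  simp [combFamily]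

theorem combFamily_nil : combFamily 𝕂 q [] = 0 := rfl

/-- Relations between components of one factor give relations between expressions. -/
theorem LocalRel.relation {fl fu vs : List ℕ} {c₀ : ℤ} {E₀ : Expr} {cs : Comb}
    (h : LocalRel fl fu ((c₀, vs, E₀) :: cs))
    (hvs : ∀ x ∈ cs, x.2.1 = vs ∧ x.2.2.numP = E₀.numP ∧ x.2.2.numR = E₀.numR) {C : Expr}
    (hC : Expr.WF (q + 1) (E₀ ++ C)) :
    (∀ x ∈ cs, (x.2.2 ++ C).WF (q + 1) ∧ Expr.numP (x.2.2 ++ C) = Expr.numP (E₀ ++ C)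
        ∧ Expr.numR (x.2.2 ++ C) = Expr.numR (E₀ ++ C)) ∧
    (c₀ : 𝕂) • Expr.family 𝕂 q (E₀ ++ C)
      + combFamily 𝕂 q (cs.map fun x => (x.1, x.2.2 ++ C)) = 0 := by
  have hctx := hC.context (h.shape _ (List.mem_cons_self ..))
  have h1 := h.combFamily_eq_zero 𝕂 (C := C) fun x hx => by
    rcases List.mem_cons.1 hx with rfl | hx
    · exact hctx
    · rw [(hvs x hx).1]; exact hctx
  refine ⟨fun x hx => ⟨?_, ?_, ?_⟩, ?_⟩
  · have hs := h.shape x (by simp [hx])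
    rw [(hvs x hx).1] at hs
    exact hctx.wf hs
  · rw [Expr.numP_append, Expr.numP_append, (hvs x hx).2.1]
  · rw [Expr.numR_append, Expr.numR_append, (hvs x hx).2.2]
  · rw [← h1, List.map_cons, combFamily_cons]

/-- Relations of the components of an iterated covariant derivative of one factor. -/
theorem LocalRel.relation_derivs {fl fu : List ℕ} {c₀ : ℤ} {A₀ : Atom} {l : List (ℤ × Atom)}
    (h : LocalRel fl fu ((c₀, [], [A₀]) :: l.map fun x => (x.1, [], [x.2])))
    (hA : ∀ x ∈ l, x.2.f = A₀.f) (h₀ : A₀.lo = fl) (h₁ : A₀.up = fu) (ws : List ℕ) {C : Expr}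
    (hC : Expr.WF (q + 1) (A₀.derivs ws :: C)) :
    (∀ x ∈ l, Expr.WF (q + 1) (x.2.derivs ws :: C)) ∧
    (c₀ : 𝕂) • Expr.family 𝕂 q (A₀.derivs ws :: C)
      + combFamily 𝕂 q (l.map fun x => (x.1, x.2.derivs ws :: C)) = 0 := by
  have hs := hC.localShape
  have hn := hs.nodup_lows
  have hd := hs.noLoop _ (List.mem_singleton_self _)
  rw [Atom.lo_derivs, h₀, List.append_nil] at hn
  rw [Atom.lo_derivs, Atom.up_derivs, h₀, h₁] at hd
  have hcs : ∀ l : List (ℤ × Atom), derivsComb ws (l.map fun x => (x.1, [], [x.2]))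
      = l.map fun x => (x.1, [], [x.2.derivs ws]) := by
    intro l
    induction l with
    | nil => exact derivsComb_nil ws
    | cons x l ih => rw [List.map_cons, derivsComb_cons, ih, List.map_cons]
  have h1 := h.derivs hn hd fun x hx w _ => by
    rcases List.mem_cons.1 hx with rfl | hx
    · simp
    · obtain ⟨z, _, rfl⟩ := List.mem_map.1 hx
      simp
  rw [derivsComb_cons, hcs] at h1
  have hnum : ∀ x ∈ l, ∀ ws, Expr.numP [x.2.derivs ws] = Expr.numP [A₀.derivs ws]
      ∧ Expr.numR [x.2.derivs ws] = Expr.numR [A₀.derivs ws] := by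
    intro x hx ws
    have := hA x hx
    obtain ⟨f, lo, up⟩ := A₀
    obtain ⟨c, ⟨g, lo', up'⟩⟩ := x
    simp only at this
    subst this
    cases g <;> simp only [Atom.derivs_P, Atom.derivs_R] <;> exact ⟨rfl, rfl⟩
  have h2 := h1.relation 𝕂 (C := C) (fun x hx => by
    obtain ⟨z, hz, rfl⟩ := List.mem_map.1 hx
    exact ⟨rfl, hnum z hz ws⟩) hC
  refine ⟨fun x hx => (h2.1 _ (List.mem_map.2 ⟨x, hx, rfl⟩)).1, ?_⟩
  rw [← h2.2, List.map_map]
  rfl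

/-! ### The commutation of covariant derivatives up to curvature -/

theorem localShape_ricciTail {a b e : ℕ} {A : Atom} (hA : A.Ok) (hlo : (a :: b :: A.lo).Nodup)
    (hup : A.up.Nodup) (hd : (a :: b :: A.lo).Disjoint A.up) (he : e ∉ a :: b :: A.lo)
    (heu : e ∉ A.up) : ∀ x ∈ ricciTail a b e A, LocalShape (a :: b :: A.lo) A.up x.2.1 x.2.2 := by
  have hn1 : (a :: b :: A.lo ++ [e]).Nodup := by
    rw [List.nodup_append']; exact ⟨hlo, by simp, by simpa using he⟩
  have hn2 : (A.up ++ [e]).Nodup := by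
    rw [List.nodup_append']; exact ⟨hup, by simp, by simpa using heu⟩
  have hlo' := (List.nodup_cons.1 (List.nodup_cons.1 hlo).2).2
  have hmem : ∀ {l : List ℕ} {v u : ℕ}, u ∈ l.map (repl v e) → u = e ∨ u ∈ l := by
    intro l v u hu
    obtain ⟨w, hw, rfl⟩ := List.mem_map.1 hu
    by_cases h : w = v
    · exact Or.inl (if_pos h)
    · exact Or.inr (by rw [repl, if_neg h]; exact hw)
  simp only [List.disjoint_cons_left, List.mem_cons, not_or] at hd he
  intro x hx
  rcases List.mem_append.1 hx with hx | hx
  · obtain ⟨v, hv, rfl⟩ := List.mem_map.1 hx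
    refine ⟨?_, ?_, ?_, ?_, hn1, hn2⟩
    · simp only [Expr.Ok, List.mem_cons, List.not_mem_nil, or_false, forall_eq_or_imp, forall_eq]
      exact ⟨⟨rfl, rfl⟩, by simpa [Atom.Ok] using hA⟩
    · simp only [Expr.lows_cons, Expr.lows_nil, List.append_nil, List.cons_append, List.nil_append]
      refine ((((map_repl_perm hlo' hv e).trans ?_).cons b).cons a)
      exact (List.perm_append_comm (l₁ := [e]))
    · simp only [Expr.ups_cons, Expr.ups_nil, List.append_nil]
      exact List.perm_append_comm
    · simp only [List.mem_cons, List.not_mem_nil, or_false, forall_eq_or_imp, forall_eq]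
      refine ⟨?_, fun u hu hu' => ?_⟩
      · simp only [List.disjoint_singleton, List.mem_cons, List.not_mem_nil, or_false, not_or]
        exact ⟨he.1, he.2.1, fun h => he.2.2 (h ▸ hv)⟩
      · rcases hmem hu with rfl | hu
        exacts [heu hu', hd.2.2 hu hu']
  · obtain ⟨v, hv, rfl⟩ := List.mem_map.1 hx
    refine ⟨?_, ?_, ?_, ?_, hn1, hn2⟩
    · simp only [Expr.Ok, List.mem_cons, List.not_mem_nil, or_false, forall_eq_or_imp, forall_eq]
      exact ⟨⟨rfl, rfl⟩, by simpa [Atom.Ok] using hA⟩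
    · simp only [Expr.lows_cons, Expr.lows_nil, List.append_nil, List.cons_append, List.nil_append]
      exact ((List.perm_append_comm (l₁ := [e])).cons b).cons a
    · simp only [Expr.ups_cons, Expr.ups_nil, List.append_nil, List.cons_append, List.nil_append]
      exact (map_repl_perm hup hv e).trans (List.perm_append_comm (l₁ := [e]))
    · simp only [List.mem_cons, List.not_mem_nil, or_false, forall_eq_or_imp, forall_eq]
      refine ⟨?_, fun u hu hu' => ?_⟩
      · simp only [List.disjoint_cons_left, List.disjoint_nil_left, List.mem_singleton]
        exact ⟨fun h => hd.1 (h ▸ hv), fun h => hd.2.1 (h ▸ hv), fun h => heu (h ▸ hv), trivial⟩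
      · rcases hmem hu' with rfl | hu'
        exacts [he.2.2 hu, hd.2.2 hu hu']

theorem localRel_ricci {a b e : ℕ} {A : Atom} (hA : A.Ok) (hlo : (a :: b :: A.lo).Nodup)
    (hup : A.up.Nodup) (hd : (a :: b :: A.lo).Disjoint A.up) (he : e ∉ a :: b :: A.lo)
    (heu : e ∉ A.up) :
    LocalRel (a :: b :: A.lo) A.up ((1, [], [(A.deriv b).deriv a]) :: (-1, [], [(A.deriv a).deriv b])
      :: ricciTail a b e A) where
  shape := by
    have h2 := localShape_ricciTail hA hlo hup hd he heu
    have hp : (b :: a :: A.lo).Perm (a :: b :: A.lo) := List.Perm.swap _ _ _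
    have o1 := Atom.deriv_ok (Atom.deriv_ok hA b) a
    have o2 := Atom.deriv_ok (Atom.deriv_ok hA a) b
    intro x hx
    rcases List.mem_cons.1 hx with rfl | hx
    · exact localShape_singleton o1.1 o1.2 hd (List.Perm.refl _) (List.Perm.refl _) hlo hup
    rcases List.mem_cons.1 hx with rfl | hx
    · exact localShape_singleton o2.1 o2.2 (fun u hu => hd (hp.mem_iff.1 hu)) hp (List.Perm.refl _)
        (hp.nodup_iff.2 hlo) hup
    · exact h2 x hx
  zero X P φ ν y hy := by
    have hlo' := (List.nodup_cons.1 (List.nodup_cons.1 hlo).2).2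
    have := ricci_val (P := P) hA hlo' hup he heu ν hy
    simp only [List.map_cons, List.sum_cons, Expr.ev_nil, Expr.pval_cons, Expr.pval_nil]
    push_cast
    linarith

/-- Covariant derivatives commute up to expressions with one more curvature. -/
theorem commute_derivs {a b : ℕ} {A : Atom} (ws : List ℕ) {C : Expr}
    (hC : Expr.WF (q + 1) (((A.deriv b).deriv a).derivs ws :: C)) (hA : A.Ok) :
    Expr.WF (q + 1) (((A.deriv a).deriv b).derivs ws :: C) ∧
    ∃ tail : List (ℤ × Expr), (∀ x ∈ tail, x.2.WF (q + 1)
        ∧ x.2.numP = Expr.numP (((A.deriv b).deriv a).derivs ws :: C)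
        ∧ x.2.numR = Expr.numR (((A.deriv b).deriv a).derivs ws :: C) + 1) ∧
      Expr.family 𝕂 q (((A.deriv b).deriv a).derivs ws :: C)
        - Expr.family 𝕂 q (((A.deriv a).deriv b).derivs ws :: C) + combFamily 𝕂 q tail = 0 := by
  have hs := hC.localShape
  have hn := hs.nodup_lows
  have hu := hs.nodup_ups
  have hd := hs.noLoop _ (List.mem_singleton_self _)
  rw [Atom.lo_derivs, List.append_nil] at hn
  rw [Atom.up_derivs, List.append_nil] at hu
  rw [Atom.lo_derivs, Atom.up_derivs] at hd
  change (ws ++ a :: b :: A.lo).Nodup at hn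
  change A.up.Nodup at hu
  change (ws ++ a :: b :: A.lo).Disjoint A.up at hd
  -- The contracted label of the curvature terms must be new with respect to this factor and the
  -- lower labels of the context, and must not be one of the free labels `0, …, q`.
  obtain ⟨e, he⟩ : ∃ e, e ∉ List.range (q + 1) ++ (ws ++ a :: b :: A.lo) ++ A.up ++ C.lows := by
    obtain ⟨e, he⟩ := Infinite.exists_notMem_finset
      (List.range (q + 1) ++ (ws ++ a :: b :: A.lo) ++ A.up ++ C.lows).toFinset
    exact ⟨e, fun h => he (List.mem_toFinset.2 h)⟩
  simp only [List.mem_append, not_or, List.mem_range, not_lt] at he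
  obtain ⟨⟨⟨he0, he1, he2⟩, he3⟩, he4⟩ := he
  rw [List.nodup_append'] at hn
  have hd2 : (a :: b :: A.lo).Disjoint A.up := fun u h => hd (List.mem_append.2 (Or.inr h))
  have h0 := localRel_ricci hA hn.2.1 hu hd2 he2 he3
  -- Each term of the tail has exactly one more factor `R` and as many factors `∇^m P` as before;
  -- further derivatives do not change these numbers.
  have htail : ∀ x ∈ ricciTail a b e A, x.2.1 = [e] ∧ x.2.2.numP = Expr.numP [A]
      ∧ x.2.2.numR = Expr.numR [A] + 1 := by
    obtain ⟨f, lo, up⟩ := A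
    intro x hx
    rcases List.mem_append.1 hx with hx | hx
    all_goals
      obtain ⟨v, hv, rfl⟩ := List.mem_map.1 hx
      cases f <;> exact ⟨rfl, rfl, rfl⟩
  have h1 := h0.derivs (ws := ws) (List.nodup_append'.2 hn) hd fun x hx w hw => by
    rcases List.mem_cons.1 hx with rfl | hx
    · simp
    rcases List.mem_cons.1 hx with rfl | hx
    · simp
    rw [(htail x hx).1, List.mem_singleton]
    exact fun h => he1 (h ▸ hw)
  rw [derivsComb_cons, derivsComb_cons] at h1
  have hctx := hC.context (E := [((A.deriv b).deriv a).derivs ws]) (h1.shape _ (List.mem_cons_self ..))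
  have hctx2 : Context (q + 1) (ws ++ a :: b :: A.lo) A.up [e] C := hctx.extend (by simp) (by
    simp only [List.mem_singleton, forall_eq, List.mem_append, not_or]
    exact ⟨he0, ⟨he1, he2⟩, he4⟩)
  have htail2 : ∀ x ∈ derivsComb ws (ricciTail a b e A), x.2.1 = [e]
      ∧ x.2.2.numP = Expr.numP [A] ∧ x.2.2.numR = Expr.numR [A] + 1 := by
    intro x hx
    obtain ⟨z, hz, e1, e2, e3⟩ := mem_derivsComb hx
    rw [e1, e2, e3]
    exact htail z hz
  have h2 := h1.combFamily_eq_zero 𝕂 (C := C) fun x hx => by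
    rcases List.mem_cons.1 hx with rfl | hx
    · exact hctx
    rcases List.mem_cons.1 hx with rfl | hx
    · exact hctx
    rw [(htail2 x hx).1]; exact hctx2
  have hnP : Expr.numP [((A.deriv b).deriv a).derivs ws] = Expr.numP [A]
      ∧ Expr.numR [((A.deriv b).deriv a).derivs ws] = Expr.numR [A] := by
    obtain ⟨f, lo, up⟩ := A
    cases f <;> simp only [Atom.deriv, Factor.succ, Atom.derivs_P, Atom.derivs_R] <;>
      exact ⟨rfl, rfl⟩
  refine ⟨hctx.wf (E := [((A.deriv a).deriv b).derivs ws]) 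
    (h1.shape (-1, [], [((A.deriv a).deriv b).derivs ws]) (by simp)),
    (derivsComb ws (ricciTail a b e A)).map fun x => (x.1, x.2.2 ++ C), fun x hx => ?_, ?_⟩
  · obtain ⟨z, hz, rfl⟩ := List.mem_map.1 hx
    obtain ⟨e1, e2, e3⟩ := htail2 z hz
    have hsz := h1.shape z (by simp [hz])
    rw [e1] at hsz
    refine ⟨hctx2.wf hsz, ?_, ?_⟩
    · rw [Expr.numP_append, e2, ← hnP.1, ← Expr.numP_append]; rfl
    · rw [Expr.numR_append, e3, ← hnP.2, add_right_comm, ← Expr.numR_append]; rfl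
  · rw [List.map_cons, List.map_cons, combFamily_cons, combFamily_cons] at h2
    rw [← h2]
    simp only [List.singleton_append, Int.cast_one, one_smul, Int.cast_neg, neg_smul]
    abel

/-! ### Symmetries of the family defined by an expression -/

namespace Expr

variable {X : ConnManifold} {P : X.PoissonTensor} {φ : X.Chart} {y : X.Model} {q : ℕ}

theorem lows_perm {E F : Expr} (h : E.Perm F) : E.lows.Perm F.lows := h.flatMap_right _

theorem ups_perm {E F : Expr} (h : E.Perm F) : E.ups.Perm F.ups := h.flatMap_right _

theorem WF.of_perm {p : ℕ} {E F : Expr} (hE : E.WF p) (h : E.Perm F) : F.WF p where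
  ok A hA := hE.ok A (h.mem_iff.2 hA)
  nodup := (lows_perm h).nodup_iff.1 hE.nodup
  le v hv := hE.le v ((lows_perm h).mem_iff.2 hv)
  perm := (ups_perm h).symm.trans (hE.perm.trans ((lows_perm h).append_left _))
  noLoop A hA := hE.noLoop A (h.mem_iff.2 hA)

theorem family_perm (𝕂 : Type) [RCLike 𝕂] {E F : Expr} (h : E.Perm F) :
    E.family 𝕂 q = F.family 𝕂 q := by
  funext X P φ I
  simp only [family, value, ev]
  have h1 : ∀ (ν : ℕ → Fin X.dim) y, E.pval P φ ν ν y = F.pval P φ ν ν y := fun ν y =>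
    (h.map _).prod_eq
  simp only [h1, sumOver_perm (lows_perm h)]

theorem numP_perm {E F : Expr} (h : E.Perm F) : E.numP = F.numP := h.countP_eq _

theorem numR_perm {E F : Expr} (h : E.Perm F) : E.numR = F.numR := h.countP_eq _

theorem ok_rename {E : Expr} (hE : E.Ok) (g : ℕ → ℕ) : (E.rename g).Ok := by
  intro A hA
  obtain ⟨B, hB, rfl⟩ := List.mem_map.1 hA
  exact Atom.map_ok (hE B hB) g

theorem numP_rename (E : Expr) (g : ℕ → ℕ) : (E.rename g).numP = E.numP := by
  simp only [numP, rename, List.countP_map]; rfl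

theorem numR_rename (E : Expr) (g : ℕ → ℕ) : (E.rename g).numR = E.numR := by
  simp only [numR, rename, List.countP_map]; rfl

/-- The variables of an expression with `p` free indices. -/
def IsVar (p : ℕ) (E : Expr) (v : ℕ) : Prop := v < p ∨ v ∈ E.lows

theorem WF.isVar_of_mem_ups {p : ℕ} {E : Expr} (h : E.WF p) {v : ℕ} (hv : v ∈ E.ups) :
    IsVar p E v := by
  simpa [IsVar] using h.perm.mem_iff.1 hv

theorem WF.rename {p : ℕ} {E : Expr} (h : E.WF p) {g : ℕ → ℕ}
    (hg : ∀ u v, IsVar p E u → IsVar p E v → g u = g v → u = v)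
    (hp : ((List.range p).map g).Perm (List.range p)) (hl : ∀ v ∈ E.lows, p ≤ g v) :
    (E.rename g).WF p where
  ok := ok_rename h.ok g
  nodup := by
    rw [lows_rename]
    exact h.nodup.map_on fun u hu v hv => hg u v (Or.inr hu) (Or.inr hv)
  le v hv := by
    rw [lows_rename] at hv
    obtain ⟨u, hu, rfl⟩ := List.mem_map.1 hv
    exact hl u hu
  perm := by
    rw [lows_rename, ups_rename]
    refine (h.perm.map g).trans ?_
    rw [List.map_append]
    exact hp.append_right _
  noLoop A hA := by
    obtain ⟨B, hB, rfl⟩ := List.mem_map.1 hA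
    intro v hv hv'
    obtain ⟨u, hu, rfl⟩ := List.mem_map.1 hv
    obtain ⟨u', hu', e⟩ := List.mem_map.1 hv'
    have h1 : u ∈ E.lows := List.mem_flatMap.2 ⟨B, hB, hu⟩
    have h2 : u' ∈ E.ups := List.mem_flatMap.2 ⟨B, hB, hu'⟩
    exact h.noLoop B hB hu (hg _ _ (h.isVar_of_mem_ups h2) (Or.inr h1) e ▸ hu')

theorem value_rename {E : Expr} (h : E.WF (q + 1)) {g : ℕ → ℕ}
    (hg : ∀ u v, IsVar (q + 1) E u → IsVar (q + 1) E v → g u = g v → u = v)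
    (I J : Fin (q + 1) → Fin X.dim) (hIJ : ∀ v < q + 1, env J v = env I (g v)) :
    (E.rename g).value P φ I y = E.value P φ J y := by
  rw [value, value, ev, ev, lows_rename]
  have h1 : ∀ ν : ℕ → Fin X.dim, (E.rename g).pval P φ ν ν y = E.pval P φ (ν ∘ g) (ν ∘ g) y :=
    fun ν => pval_rename h.ok g ν ν
  simp only [h1]
  refine sumOver_rename (F := fun ν => E.pval P φ ν ν y) (IsVar (q + 1) E) hg
    (fun v hv => Or.inr hv) (fun v hv hv' => hIJ v (hv.resolve_right hv')) fun μ μ' hμ => ?_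
  exact pval_congr h.ok (fun v hv => hμ v (Or.inr hv)) fun v hv => hμ v (h.isVar_of_mem_ups hv)

theorem family_rename (𝕂 : Type) [RCLike 𝕂] {E : Expr} (h : E.WF (q + 1)) {g : ℕ → ℕ}
    (hg : ∀ u v, IsVar (q + 1) E u → IsVar (q + 1) E v → g u = g v → u = v)
    (hp : ∀ v < q + 1, g v = v) : (E.rename g).family 𝕂 q = E.family 𝕂 q := by
  funext X P φ I
  simp only [family, value_rename h hg I I fun v hv => by rw [hp v hv]]

end Expr

/-! ### Skewsymmetrization of bivector families -/

variable (𝕂 : Type) [RCLike 𝕂]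

/-- Skewsymmetrization. -/
def skewOp : ComponentFamily 𝕂 2 →ₗ[𝕂] ComponentFamily 𝕂 2 where
  toFun c := fun X P φ I y => c X P φ I y - c X P φ (I ∘ Equiv.swap 0 1) y
  map_add' a b := by funext X P φ I y; simp only [Pi.add_apply]; ring
  map_smul' r a := by
    funext X P φ I y; simp only [Pi.smul_apply, RingHom.id_apply, smul_eq_mul]; ring

/-- The skewsymmetric family defined by an expression. -/
def skewFamily (E : Expr) : ComponentFamily 𝕂 2 := skewOp 𝕂 (E.family 𝕂 1)

theorem skewFamily_perm {E F : Expr} (h : E.Perm F) : skewFamily 𝕂 E = skewFamily 𝕂 F := by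
  rw [skewFamily, Expr.family_perm 𝕂 h, skewFamily]

theorem skewFamily_rename {E : Expr} (h : E.WF 2) {g : ℕ → ℕ}
    (hg : ∀ u v, Expr.IsVar 2 E u → Expr.IsVar 2 E v → g u = g v → u = v)
    (hp : ∀ v < 2, g v = v) : skewFamily 𝕂 (E.rename g) = skewFamily 𝕂 E := by
  rw [skewFamily, Expr.family_rename 𝕂 h hg hp, skewFamily]

/-- Exchanging the labels of the two free indices transposes the bivector, which skewsymmetrization
turns into a sign. -/
theorem skewFamily_rename_swap {E : Expr} (h : E.WF 2) :
    skewFamily 𝕂 (E.rename (Equiv.swap 0 1)) = - skewFamily 𝕂 E := by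
  have hv : ∀ {X : ConnManifold} (P : X.PoissonTensor) (φ : X.Chart) (I : Fin 2 → Fin X.dim)
      (y : X.Model), (E.rename (Equiv.swap 0 1)).value P φ I y
        = E.value P φ (I ∘ Equiv.swap 0 1) y := fun P φ I y =>
    Expr.value_rename h (fun u v _ _ h => (Equiv.swap 0 1).injective h) I _ fun v hv => by
      interval_cases v <;> rfl
  have hs : ∀ {X : ConnManifold} (I : Fin 2 → Fin X.dim),
      (I ∘ Equiv.swap 0 1) ∘ Equiv.swap 0 1 = I := fun I => by
    funext i; simp
  funext X P φ I y
  simp only [skewFamily, skewOp, LinearMap.coe_mk, AddHom.coe_mk, Expr.family, Pi.neg_apply, hv, hs]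
  ring

/-! ### Scaling of the Poisson tensor -/

namespace ConnManifold

variable {X : ConnManifold}

/-- The Poisson tensor `tP`. -/
def PoissonTensor.scale (t : ℝ) (P : X.PoissonTensor) : X.PoissonTensor where
  toFun x := t • P.toFun x
  skew x α β := by
    simp only [LinearMap.smul_apply, smul_eq_mul]; rw [P.skew x α β]; ring
  smooth φ i j := by
    have : X.bivectorComp (fun x => t • P.toFun x) φ i j
        = fun y => t * X.bivectorComp P.toFun φ i j y := by
      funext y; simp [bivectorComp]
    rw [this]
    exact contDiffOn_const.mul (P.smooth φ i j)
  jacobi φ i j k y hy := by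
    have h : ∀ i j, X.bivectorComp (fun x => t • P.toFun x) φ i j
        = fun y => t * X.bivectorComp P.toFun φ i j y := fun i j => by
      funext y; simp [bivectorComp]
    have hd : ∀ l i j, pd l (fun y => t * X.bivectorComp P.toFun φ i j y) y
        = t * pd l (X.bivectorComp P.toFun φ i j) y := fun l i j =>
      pd_fun_const_mul t (differentiableAt_of_contDiffOn (P.smooth φ i j) hy)
    have hJ := P.jacobi φ i j k y hy
    simp only [h, hd]
    rw [← mul_zero (t * t), ← hJ, Finset.mul_sum]
    exact Finset.sum_congr rfl fun l _ => by ring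

theorem covDeriv_const_mul {φ : X.Chart} {b a : ℕ} {T T' : X.Components b a} (hT : T.SmoothOn φ)
    (t : ℝ) (h : ∀ L U, ∀ y ∈ φ.1.target, T' L U y = t * T L U y) (L : Fin (b + 1) → Fin X.dim)
    (U : Fin a → Fin X.dim) {y : X.Model} (hy : y ∈ φ.1.target) :
    X.covDeriv φ T' L U y = t * X.covDeriv φ T L U y := by
  unfold ConnManifold.covDeriv
  rw [pd_congr_of_eqOn φ.1.open_target (h _ _) hy, pd_fun_const_mul t (hT.differentiableAt hy _ _)]
  simp only [h _ _ y hy, mul_add, mul_sub, Finset.mul_sum]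
  congr 1
  · congr 1
    exact Finset.sum_congr rfl fun s _ => Finset.sum_congr rfl fun e _ => by ring
  · exact Finset.sum_congr rfl fun s _ => Finset.sum_congr rfl fun e _ => by ring

end ConnManifold

theorem comp_scale {X : ConnManifold} (P : X.PoissonTensor) (φ : X.Chart) (t : ℝ) (m : ℕ) :
    ∀ L U, ∀ y ∈ φ.1.target, (Factor.P m).comp (P.scale t) φ L U y
      = t * (Factor.P m).comp P φ L U y := by
  induction m with
  | zero => intro L U y _; rfl
  | succ m ih =>
    intro L U y hy
    exact ConnManifold.covDeriv_const_mul (ConnManifold.smoothOn_comp P φ (Factor.P m)) t ih L U hy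

/-- Only the factors `∇^m P` see the scaling, each of them linearly. Thus the number of these
factors is the degree in the Poisson structure. -/
theorem pval_scale {X : ConnManifold} (P : X.PoissonTensor) (φ : X.Chart) (t : ℝ) (E : Expr)
    (ν μ : ℕ → Fin X.dim) {y : X.Model} (hy : y ∈ φ.1.target) :
    E.pval (P.scale t) φ ν μ y = t ^ E.numP * E.pval P φ ν μ y := by
  induction E with
  | nil => simp [Expr.numP]
  | cons A E ih =>
    rw [Expr.pval_cons, Expr.pval_cons, ih]
    obtain ⟨f, lo, up⟩ := A
    cases f with
    | P m =>
      have h1 : Expr.numP (⟨Factor.P m, lo, up⟩ :: E) = Expr.numP E + 1 := by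
        simp [Expr.numP]
      have h2 : Atom.val (P.scale t) φ ⟨Factor.P m, lo, up⟩ ν μ y
          = t * Atom.val P φ ⟨Factor.P m, lo, up⟩ ν μ y := comp_scale P φ t m _ _ y hy
      rw [h1, h2]; ring
    | R m =>
      have h1 : Expr.numP (⟨Factor.R m, lo, up⟩ :: E) = Expr.numP E := by
        simp [Expr.numP]
      have h2 : Atom.val (P.scale t) φ ⟨Factor.R m, lo, up⟩ ν μ y
          = Atom.val P φ ⟨Factor.R m, lo, up⟩ ν μ y := rfl
      rw [h1, h2]; ring

theorem value_scale {X : ConnManifold} {q : ℕ} (P : X.PoissonTensor) (φ : X.Chart) (t : ℝ) (E : Expr)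
    (I : Fin (q + 1) → Fin X.dim) {y : X.Model} (hy : y ∈ φ.1.target) :
    E.value (P.scale t) φ I y = t ^ E.numP * E.value P φ I y := by
  simp only [Expr.value, Expr.ev, pval_scale P φ t E _ _ hy, sumOver_mul_left]

/-- The span of the skewsymmetric families of the expressions without loops with `k` factors
`∇^m P` and at least `r` factors `∇^m R`. -/
def exprSpan (k r : ℕ) : Submodule 𝕂 (ComponentFamily 𝕂 2) :=
  Submodule.span 𝕂 {c | ∃ E : Expr, E.WF 2 ∧ E.numP = k ∧ r ≤ E.numR ∧ c = skewFamily 𝕂 E}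

theorem skewFamily_mem_exprSpan {E : Expr} (h : E.WF 2) {k r : ℕ} (hk : E.numP = k)
    (hr : r ≤ E.numR) : skewFamily 𝕂 E ∈ exprSpan 𝕂 k r :=
  Submodule.subset_span ⟨E, h, hk, hr, rfl⟩

/-- A cochain is a combination of expressions of possibly different degrees. Evaluating it at `tP`
gives a polynomial in `t` which homogeneity forces to be a monomial, so the terms of other degrees
may be dropped. Being skewsymmetric, the cochain is half its skewsymmetrization, which may then be
applied to each term. -/
theorem mem_exprSpan_of_mem_cochains {k : ℕ} {c : SmoothFamily 𝕂 2} (hc : c ∈ cochains 𝕂 2 k) :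
    c.1 ∈ exprSpan 𝕂 k 0 := by
  obtain ⟨⟨hu, hh⟩, hs⟩ := hc
  have h1 : c.1 ∈ Submodule.span 𝕂 {c | ∃ E : Expr, E.WF 2 ∧ c = E.family 𝕂 1} := by
    refine Submodule.span_mono ?_ hu
    rintro _ ⟨G, hG, rfl⟩
    obtain ⟨E, hE, e⟩ := G.exists_expr 𝕂 hG
    exact ⟨E, hE, e⟩
  obtain ⟨n, f, g, hfg⟩ := Submodule.mem_span_set'.1 h1
  choose E hE hgE using fun i => (g i).2
  have h2 : c.1 = ∑ i, f i • (E i).family 𝕂 1 := by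
    rw [← hfg]; exact Finset.sum_congr rfl fun i _ => by rw [hgE]
  -- Only the terms with exactly `k` factors `∇^m P` are kept.
  have h3 : c.1 = ∑ i with (E i).numP = k, f i • (E i).family 𝕂 1 := by
    funext X P φ I y
    by_cases hy : y ∈ φ.1.target
    swap
    · rw [(c.2 X P φ I).2 y hy]
      simp [Finset.sum_apply, Expr.family, hy]
    have h4 : ∀ t : ℝ, ∑ i, f i * ((t : 𝕂) ^ (E i).numP * ((E i).value P φ I y : 𝕂))
        = (t : 𝕂) ^ k * ∑ i, f i * ((E i).value P φ I y : 𝕂) := by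
      intro t
      have h5 := hh X P (P.scale t) t (fun x α β => rfl) φ I y
      rw [h2] at h5
      simp only [Finset.sum_apply, Pi.smul_apply, smul_eq_mul, Expr.family,
        Set.indicator_of_mem hy, value_scale P φ t _ I hy] at h5
      push_cast at h5
      exact h5
    -- The two sides of homogeneity as polynomials in `t`, for fixed structure, chart, indices and
    -- point. They agree at all real numbers, hence are equal, and the coefficients of `t^k` can be
    -- compared.
    let p : Polynomial 𝕂 := ∑ i, Polynomial.C (f i * ((E i).value P φ I y : 𝕂))
      * Polynomial.X ^ (E i).numP
    let p' : Polynomial 𝕂 := Polynomial.C (∑ i, f i * ((E i).value P φ I y : 𝕂))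
      * Polynomial.X ^ k
    have hpp : p = p' := by
      refine Polynomial.eq_of_infinite_eval_eq p p' ?_
      refine Set.Infinite.mono (s := Set.range fun t : ℝ => (t : 𝕂)) ?_
        (Set.infinite_range_of_injective RCLike.ofReal_injective)
      rintro _ ⟨t, rfl⟩
      have := h4 t
      simp only [Set.mem_ofPred_eq, p, p', Polynomial.eval_finsetSum, Polynomial.eval_mul,
        Polynomial.eval_C, Polynomial.eval_pow, Polynomial.eval_X]
      rw [mul_comm (∑ i, f i * ((E i).value P φ I y : 𝕂)), ← this]
      exact Finset.sum_congr rfl fun i _ => by ring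
    have hco := congrArg (fun p => Polynomial.coeff p k) hpp
    simp only [p, p', Polynomial.finsetSum_coeff, Polynomial.coeff_C_mul, Polynomial.coeff_X_pow,
      mul_ite, mul_one, mul_zero, if_true] at hco
    rw [h2]
    simp only [Finset.sum_apply, Pi.smul_apply, smul_eq_mul, Expr.family, Set.indicator_of_mem hy]
    rw [← hco, Finset.sum_filter]
    exact Finset.sum_congr rfl fun i _ => by simp [eq_comm]
  -- For a skewsymmetric family the transposed component is the negative, so `skewOp` doubles it.
  have h4 : c.1 = (2⁻¹ : 𝕂) • skewOp 𝕂 c.1 := by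
    funext X P φ I y
    have := hs X P φ I (Equiv.swap 0 1) y
    simp only [Pi.smul_apply, skewOp, LinearMap.coe_mk, AddHom.coe_mk, smul_eq_mul, this]
    simp
    ring
  rw [h4, h3]
  refine Submodule.smul_mem _ _ ?_
  suffices h : ∀ s : Finset (Fin n), (∀ i ∈ s, (E i).numP = k) →
      skewOp 𝕂 (∑ i ∈ s, f i • (E i).family 𝕂 1) ∈ exprSpan 𝕂 k 0 from
    h _ fun i hi => (Finset.mem_filter.1 hi).2
  intro s
  induction s using Finset.induction_on with
  | empty =>
    intro _
    rw [Finset.sum_empty, (skewOp 𝕂).map_zero]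
    exact Submodule.zero_mem _
  | insert i s hi ih =>
    intro hs
    rw [Finset.sum_insert hi, (skewOp 𝕂).map_add, (skewOp 𝕂).map_smul]
    exact Submodule.add_mem _ (Submodule.smul_mem _ _ (skewFamily_mem_exprSpan 𝕂 (hE i)
      (hs i (by simp)) (Nat.zero_le _))) (ih fun j hj => hs j (by simp [hj]))

/-! ### Relations between skewsymmetric families modulo curvature -/

/-- A linear relation between the skewsymmetric families of expressions with `k` factors `∇^m P`
and `r` factors `∇^m R`, up to expressions with more curvature. -/
structure SkewRel (𝕂 : Type) [RCLike 𝕂] (k r : ℕ) (cs : List (ℤ × Expr)) : Prop where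
  wf : ∀ x ∈ cs, x.2.WF 2 ∧ x.2.numP = k ∧ x.2.numR = r
  mem : (cs.map fun x => (x.1 : 𝕂) • skewFamily 𝕂 x.2).sum ∈ exprSpan 𝕂 k (r + 1)

variable (𝕂 : Type) [RCLike 𝕂]

theorem skewOp_combFamily (cs : List (ℤ × Expr)) :
    skewOp 𝕂 (combFamily 𝕂 1 cs) = (cs.map fun x => (x.1 : 𝕂) • skewFamily 𝕂 x.2).sum := by
  induction cs with
  | nil => rw [combFamily_nil, (skewOp 𝕂).map_zero]; rfl
  | cons x cs ih =>
    rw [show x :: cs = (x.1, x.2) :: cs from rfl, combFamily_cons, (skewOp 𝕂).map_add,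
      (skewOp 𝕂).map_smul, ih]
    rfl

theorem numP_cons_congr {A B : Atom} (h : A.f = B.f) (C : Expr) :
    Expr.numP (A :: C) = Expr.numP (B :: C) := by
  simp [Expr.numP, List.countP_cons, h]

theorem numR_cons_congr {A B : Atom} (h : A.f = B.f) (C : Expr) :
    Expr.numR (A :: C) = Expr.numR (B :: C) := by
  simp [Expr.numR, List.countP_cons, h]

/-- An exact relation is in particular one modulo more curvature; all its terms have the same
numbers of factors because only the labels of one factor change. -/
theorem skewRel_of_relation {A₀ : Atom} {c₀ : ℤ} {l : List (ℤ × Atom)} {C : Expr}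
    (h₀ : Expr.WF 2 (A₀ :: C)) (hf : ∀ x ∈ l, x.2.f = A₀.f)
    (h : (∀ x ∈ l, Expr.WF 2 (x.2 :: C)) ∧ (c₀ : 𝕂) • Expr.family 𝕂 1 (A₀ :: C)
      + combFamily 𝕂 1 (l.map fun x => (x.1, x.2 :: C)) = 0) :
    SkewRel 𝕂 (Expr.numP (A₀ :: C)) (Expr.numR (A₀ :: C))
      ((c₀, A₀ :: C) :: l.map fun x => (x.1, x.2 :: C)) where
  wf x hx := by
    rcases List.mem_cons.1 hx with rfl | hx
    · exact ⟨h₀, rfl, rfl⟩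
    · obtain ⟨z, hz, rfl⟩ := List.mem_map.1 hx
      exact ⟨h.1 z hz, numP_cons_congr (hf z hz) C, numR_cons_congr (hf z hz) C⟩
  mem := by
    rw [← skewOp_combFamily, combFamily_cons, h.2, (skewOp 𝕂).map_zero]
    exact Submodule.zero_mem _

theorem skewRel_flip {m a b : ℕ} {lo : List ℕ} {C : Expr}
    (h : Expr.WF 2 (⟨Factor.P m, lo, [a, b]⟩ :: C)) :
    SkewRel 𝕂 (Expr.numP (⟨Factor.P m, lo, [a, b]⟩ :: C))
      (Expr.numR (⟨Factor.P m, lo, [a, b]⟩ :: C))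
      [(1, ⟨Factor.P m, lo, [a, b]⟩ :: C), (1, ⟨Factor.P m, lo, [b, a]⟩ :: C)] := by
  have hlen : lo.length = 0 + m := (h.ok _ (List.mem_cons_self ..)).1
  have hab : a ≠ b := by
    have := h.localShape.nodup_ups
    simp at this; exact this
  have h1 := (localRel_flip hab).relation_derivs (q := 1) 𝕂 (C := C)
    (l := [(1, ⟨Factor.P 0, [], [b, a]⟩)]) (by simp) rfl rfl lo
  simp only [Atom.derivs_P, List.append_nil, hlen, zero_add, List.mem_singleton, forall_eq] at h1
  exact skewRel_of_relation 𝕂 (c₀ := 1) (l := [(1, ⟨Factor.P m, lo, [b, a]⟩)]) h (by simp)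
    ⟨by simpa using (h1 h).1, by simpa [Atom.derivs_P, hlen] using (h1 h).2⟩

theorem skewRel_skew {k a b c u : ℕ} {ws : List ℕ} {C : Expr} (hk : ws.length = k)
    (h : Expr.WF 2 (⟨Factor.R k, ws ++ [a, b, c], [u]⟩ :: C)) :
    SkewRel 𝕂 (Expr.numP (⟨Factor.R k, ws ++ [a, b, c], [u]⟩ :: C))
      (Expr.numR (⟨Factor.R k, ws ++ [a, b, c], [u]⟩ :: C))
      [(1, ⟨Factor.R k, ws ++ [a, b, c], [u]⟩ :: C),
       (1, ⟨Factor.R k, ws ++ [b, a, c], [u]⟩ :: C)] := by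
  subst hk
  have hn := h.localShape.nodup_lows
  rw [List.append_nil, List.nodup_append'] at hn
  have hu : u ∉ [a, b, c] := fun hu =>
    h.noLoop _ (List.mem_cons_self ..) (List.mem_append.2 (Or.inr hu)) (by simp)
  have h1 := (localRel_skew hn.2.1 hu).relation_derivs (q := 1) 𝕂 (C := C)
    (l := [(1, ⟨Factor.R 0, [b, a, c], [u]⟩)]) (by simp) rfl rfl ws
  simp only [Atom.derivs_R, zero_add, List.mem_singleton, forall_eq] at h1
  exact skewRel_of_relation 𝕂 (c₀ := 1) (l := [(1, ⟨Factor.R ws.length, ws ++ [b, a, c], [u]⟩)]) h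
    (by simp) ⟨by simpa using (h1 h).1, by simpa [Atom.derivs_R] using (h1 h).2⟩

theorem skewRel_bianchi {k a b c u : ℕ} {ws : List ℕ} {C : Expr} (hk : ws.length = k)
    (h : Expr.WF 2 (⟨Factor.R k, ws ++ [a, b, c], [u]⟩ :: C)) :
    SkewRel 𝕂 (Expr.numP (⟨Factor.R k, ws ++ [a, b, c], [u]⟩ :: C))
      (Expr.numR (⟨Factor.R k, ws ++ [a, b, c], [u]⟩ :: C))
      [(1, ⟨Factor.R k, ws ++ [a, b, c], [u]⟩ :: C),
       (1, ⟨Factor.R k, ws ++ [b, c, a], [u]⟩ :: C),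
       (1, ⟨Factor.R k, ws ++ [c, a, b], [u]⟩ :: C)] := by
  subst hk
  have hn := h.localShape.nodup_lows
  rw [List.append_nil, List.nodup_append'] at hn
  have hu : u ∉ [a, b, c] := fun hu =>
    h.noLoop _ (List.mem_cons_self ..) (List.mem_append.2 (Or.inr hu)) (by simp)
  have h1 := (localRel_bianchi hn.2.1 hu).relation_derivs (q := 1) 𝕂 (C := C)
    (l := [(1, ⟨Factor.R 0, [b, c, a], [u]⟩), (1, ⟨Factor.R 0, [c, a, b], [u]⟩)])
    (by simp) rfl rfl ws
  simp only [Atom.derivs_R, zero_add] at h1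
  exact skewRel_of_relation 𝕂 (c₀ := 1) (l := [(1, ⟨Factor.R ws.length, ws ++ [b, c, a], [u]⟩),
    (1, ⟨Factor.R ws.length, ws ++ [c, a, b], [u]⟩)]) h
    (by simp) ⟨by simpa [Atom.derivs_R] using (h1 h).1, by simpa [Atom.derivs_R] using (h1 h).2⟩

theorem skewRel_bianchi₂ {k a b c d u : ℕ} {ws : List ℕ} {C : Expr} (hk : ws.length + 1 = k)
    (h : Expr.WF 2 (⟨Factor.R k, ws ++ [a, b, c, d], [u]⟩ :: C)) :
    SkewRel 𝕂 (Expr.numP (⟨Factor.R k, ws ++ [a, b, c, d], [u]⟩ :: C))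
      (Expr.numR (⟨Factor.R k, ws ++ [a, b, c, d], [u]⟩ :: C))
      [(1, ⟨Factor.R k, ws ++ [a, b, c, d], [u]⟩ :: C),
       (1, ⟨Factor.R k, ws ++ [b, c, a, d], [u]⟩ :: C),
       (1, ⟨Factor.R k, ws ++ [c, a, b, d], [u]⟩ :: C)] := by
  subst hk
  have hn := h.localShape.nodup_lows
  rw [List.append_nil, List.nodup_append'] at hn
  have hu : u ∉ [a, b, c, d] := fun hu =>
    h.noLoop _ (List.mem_cons_self ..) (List.mem_append.2 (Or.inr hu)) (by simp)
  have h1 := (localRel_bianchi₂ hn.2.1 hu).relation_derivs (q := 1) 𝕂 (C := C)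
    (l := [(1, ⟨Factor.R 1, [b, c, a, d], [u]⟩), (1, ⟨Factor.R 1, [c, a, b, d], [u]⟩)])
    (by simp) rfl rfl ws
  simp only [Atom.derivs_R, add_comm 1] at h1
  exact skewRel_of_relation 𝕂 (c₀ := 1) (l := [(1, ⟨Factor.R (ws.length + 1), ws ++ [b, c, a, d], [u]⟩),
    (1, ⟨Factor.R (ws.length + 1), ws ++ [c, a, b, d], [u]⟩)]) h (by simp)
    ⟨by simpa [Atom.derivs_R, add_comm 1] using (h1 h).1,
      by simpa [Atom.derivs_R, add_comm 1] using (h1 h).2⟩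

/-- The covariant derivatives in a factor may be permuted up to terms with more curvature. -/
def CanCommute (f : Factor) (j : ℕ) : Prop :=
  match f with
  | Factor.P m => j + 2 ≤ m
  | Factor.R k => j + 2 ≤ k

/-- Strips off the covariant derivatives before and including `a`, `b`. The condition `CanCommute`
says that `a` and `b` are derivative indices, and for `∇^k R` that they do not reach into the last
three slots. -/
theorem exists_eq_derivs {f : Factor} {ws post up : List ℕ} {a b : ℕ}
    (hA : Atom.Ok ⟨f, ws ++ a :: b :: post, up⟩) (hf : CanCommute f ws.length) :
    ∃ A : Atom, A.Ok ∧ Atom.mk f (ws ++ a :: b :: post) up = ((A.deriv b).deriv a).derivs ws ∧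
      Atom.mk f (ws ++ b :: a :: post) up = ((A.deriv a).deriv b).derivs ws := by
  obtain ⟨h1, h2⟩ := hA
  cases f with
  | P m =>
    simp only [CanCommute] at hf
    simp only [List.length_append, List.length_cons, Factor.lower] at h1
    refine ⟨⟨Factor.P post.length, post, up⟩, ⟨by simp [Factor.lower], h2⟩, ?_, ?_⟩ <;>
      simp only [Atom.deriv, Factor.succ, Atom.derivs_P] <;> congr 2 <;> omega
  | R k =>
    simp only [CanCommute] at hf
    simp only [List.length_append, List.length_cons, Factor.lower] at h1
    refine ⟨⟨Factor.R (post.length - 3), post, up⟩, ⟨by simp only [Factor.lower]; omega, h2⟩, ?_, ?_⟩ <;>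
      simp only [Atom.deriv, Factor.succ, Atom.derivs_R] <;> congr 2 <;> omega

/-- The difference of the two orders is a combination of expressions with one more curvature factor,
which lies in the next step of the filtration. -/
theorem skewRel_commute {f : Factor} {ws post up : List ℕ} {a b : ℕ} {C : Expr}
    (hf : CanCommute f ws.length) (h : Expr.WF 2 (⟨f, ws ++ a :: b :: post, up⟩ :: C)) :
    SkewRel 𝕂 (Expr.numP (⟨f, ws ++ a :: b :: post, up⟩ :: C))
      (Expr.numR (⟨f, ws ++ a :: b :: post, up⟩ :: C))
      [(1, ⟨f, ws ++ a :: b :: post, up⟩ :: C), (-1, ⟨f, ws ++ b :: a :: post, up⟩ :: C)] := by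
  obtain ⟨A, hA, e1, e2⟩ := exists_eq_derivs (h.ok _ (List.mem_cons_self ..)) hf
  have hn1 := numP_cons_congr (A := ⟨f, ws ++ b :: a :: post, up⟩)
    (B := ⟨f, ws ++ a :: b :: post, up⟩) rfl C
  have hn2 := numR_cons_congr (A := ⟨f, ws ++ b :: a :: post, up⟩)
    (B := ⟨f, ws ++ a :: b :: post, up⟩) rfl C
  rw [e1] at h hn1 hn2 ⊢
  rw [e2] at hn1 hn2 ⊢
  obtain ⟨h2, tail, ht, hz⟩ := commute_derivs (q := 1) 𝕂 ws h hA
  refine ⟨?_, ?_⟩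
  · simp only [List.mem_cons, List.not_mem_nil, or_false, forall_eq_or_imp, forall_eq]
    exact ⟨⟨h, trivial, trivial⟩, h2, hn1, hn2⟩
  · have hz' := congrArg (skewOp 𝕂) hz
    rw [(skewOp 𝕂).map_add, (skewOp 𝕂).map_sub, (skewOp 𝕂).map_zero, skewOp_combFamily] at hz'
    simp only [List.map_cons, List.map_nil, List.sum_cons, List.sum_nil, Int.cast_one, one_smul,
      Int.cast_neg, neg_smul, add_zero, ← sub_eq_add_neg]
    have h3 : (tail.map fun x => (x.1 : 𝕂) • skewFamily 𝕂 x.2).sum ∈ exprSpan 𝕂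
        (Expr.numP (((A.deriv b).deriv a).derivs ws :: C))
        (Expr.numR (((A.deriv b).deriv a).derivs ws :: C) + 1) := by
      refine list_sum_mem fun x hx => ?_
      obtain ⟨z, hz, rfl⟩ := List.mem_map.1 hx
      obtain ⟨w1, w2, w3⟩ := ht z hz
      exact Submodule.smul_mem _ _ (skewFamily_mem_exprSpan 𝕂 w1 w2 w3.ge)
    rw [show skewFamily 𝕂 (((A.deriv b).deriv a).derivs ws :: C)
        - skewFamily 𝕂 (((A.deriv a).deriv b).derivs ws :: C)
        = - (tail.map fun x => (x.1 : 𝕂) • skewFamily 𝕂 x.2).sum from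
      eq_neg_of_add_eq_zero_left hz']
    exact Submodule.neg_mem _ h3

theorem skewRel_jacobi {i j k l : ℕ} {C : Expr}
    (h : Expr.WF 2 ([⟨Factor.P 0, [], [i, l]⟩, ⟨Factor.P 1, [l], [j, k]⟩] ++ C)) :
    SkewRel 𝕂 (Expr.numP ([⟨Factor.P 0, [], [i, l]⟩, ⟨Factor.P 1, [l], [j, k]⟩] ++ C))
      (Expr.numR ([⟨Factor.P 0, [], [i, l]⟩, ⟨Factor.P 1, [l], [j, k]⟩] ++ C))
      [(1, ⟨Factor.P 0, [], [i, l]⟩ :: ⟨Factor.P 1, [l], [j, k]⟩ :: C),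
       (1, ⟨Factor.P 0, [], [j, l]⟩ :: ⟨Factor.P 1, [l], [k, i]⟩ :: C),
       (1, ⟨Factor.P 0, [], [k, l]⟩ :: ⟨Factor.P 1, [l], [i, j]⟩ :: C)] := by
  have hn : [i, l, j, k].Nodup := by
    have := h.ups_nodup
    rw [Expr.ups_append, List.nodup_append'] at this
    exact this.1
  have h1 := (localRel_jacobi (i := i) (j := j) (k := k) (l := l)
    (by simp at hn ⊢; tauto) (by simp at hn ⊢; tauto)).relation 𝕂 (q := 1) (C := C)
    (by simp; exact ⟨⟨rfl, rfl⟩, rfl, rfl⟩) h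
  refine ⟨?_, ?_⟩
  · intro x hx
    rcases List.mem_cons.1 hx with rfl | hx
    · exact ⟨h, rfl, rfl⟩
    · have hx' : x ∈ ([(1, [l], [⟨Factor.P 0, [], [j, l]⟩, ⟨Factor.P 1, [l], [k, i]⟩]),
        (1, [l], [⟨Factor.P 0, [], [k, l]⟩, ⟨Factor.P 1, [l], [i, j]⟩])] : Comb).map
          fun x => (x.1, x.2.2 ++ C) := hx
      obtain ⟨z, hz, rfl⟩ := List.mem_map.1 hx'
      exact h1.1 z hz
  · have h2 := h1.2
    rw [← combFamily_cons] at h2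
    rw [← skewOp_combFamily]
    have h3 := congrArg (skewOp 𝕂) h2
    rw [(skewOp 𝕂).map_zero] at h3
    exact h3 ▸ Submodule.zero_mem _

/-- One covariant derivative of the Jacobi identity, by the Leibniz rule. If `w` were contracted
with `j` or `k`, other terms of the identity would contain loops; the absence of loops in the first
term excludes only `i` and `l`. -/
theorem skewRel_jacobi_deriv {i j k l w : ℕ} {C : Expr}
    (h : Expr.WF 2 ([⟨Factor.P 1, [w], [i, l]⟩, ⟨Factor.P 1, [l], [j, k]⟩] ++ C))
    (hw : w ≠ j ∧ w ≠ k) :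
    SkewRel 𝕂 (Expr.numP ([⟨Factor.P 1, [w], [i, l]⟩, ⟨Factor.P 1, [l], [j, k]⟩] ++ C))
      (Expr.numR ([⟨Factor.P 1, [w], [i, l]⟩, ⟨Factor.P 1, [l], [j, k]⟩] ++ C))
      [(1, ⟨Factor.P 1, [w], [i, l]⟩ :: ⟨Factor.P 1, [l], [j, k]⟩ :: C),
       (1, ⟨Factor.P 0, [], [i, l]⟩ :: ⟨Factor.P 2, [w, l], [j, k]⟩ :: C),
       (1, ⟨Factor.P 1, [w], [j, l]⟩ :: ⟨Factor.P 1, [l], [k, i]⟩ :: C),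
       (1, ⟨Factor.P 0, [], [j, l]⟩ :: ⟨Factor.P 2, [w, l], [k, i]⟩ :: C),
       (1, ⟨Factor.P 1, [w], [k, l]⟩ :: ⟨Factor.P 1, [l], [i, j]⟩ :: C),
       (1, ⟨Factor.P 0, [], [k, l]⟩ :: ⟨Factor.P 2, [w, l], [i, j]⟩ :: C)] := by
  have hn : [i, l, j, k].Nodup := by
    have := h.ups_nodup
    rw [Expr.ups_append, List.nodup_append'] at this
    exact this.1
  have hwi : w ≠ i ∧ w ≠ l := by
    have := h.noLoop ⟨Factor.P 1, [w], [i, l]⟩ (by simp)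
    simpa using this
  have h0 := (localRel_jacobi (i := i) (j := j) (k := k) (l := l)
    (by simp at hn ⊢; tauto) (by simp at hn ⊢; tauto)).deriv (w := w) (by simp) (by simp)
    (by simp; tauto) (by simp; tauto)
  have h1 := LocalRel.relation 𝕂 (q := 1) (C := C) (vs := [l]) (c₀ := 1)
    (E₀ := [⟨Factor.P 1, [w], [i, l]⟩, ⟨Factor.P 1, [l], [j, k]⟩])
    (cs := [(1, [l], [⟨Factor.P 0, [], [i, l]⟩, ⟨Factor.P 2, [w, l], [j, k]⟩]),
       (1, [l], [⟨Factor.P 1, [w], [j, l]⟩, ⟨Factor.P 1, [l], [k, i]⟩]),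
       (1, [l], [⟨Factor.P 0, [], [j, l]⟩, ⟨Factor.P 2, [w, l], [k, i]⟩]),
       (1, [l], [⟨Factor.P 1, [w], [k, l]⟩, ⟨Factor.P 1, [l], [i, j]⟩]),
       (1, [l], [⟨Factor.P 0, [], [k, l]⟩, ⟨Factor.P 2, [w, l], [i, j]⟩])])
    h0 (by simp; exact ⟨⟨rfl, rfl⟩, ⟨rfl, rfl⟩, ⟨rfl, rfl⟩, ⟨rfl, rfl⟩, rfl, rfl⟩) h
  refine ⟨?_, ?_⟩
  · intro x hx
    rcases List.mem_cons.1 hx with rfl | hx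
    · exact ⟨h, rfl, rfl⟩
    · have hx' : x ∈ ([(1, [l], [⟨Factor.P 0, [], [i, l]⟩, ⟨Factor.P 2, [w, l], [j, k]⟩]),
       (1, [l], [⟨Factor.P 1, [w], [j, l]⟩, ⟨Factor.P 1, [l], [k, i]⟩]),
       (1, [l], [⟨Factor.P 0, [], [j, l]⟩, ⟨Factor.P 2, [w, l], [k, i]⟩]),
       (1, [l], [⟨Factor.P 1, [w], [k, l]⟩, ⟨Factor.P 1, [l], [i, j]⟩]),
       (1, [l], [⟨Factor.P 0, [], [k, l]⟩, ⟨Factor.P 2, [w, l], [i, j]⟩])] : Comb).map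
          fun x => (x.1, x.2.2 ++ C) := hx
      obtain ⟨z, hz, rfl⟩ := List.mem_map.1 hx'
      exact h1.1 z hz
  · have h2 := h1.2
    rw [← combFamily_cons] at h2
    rw [← skewOp_combFamily]
    have h3 := congrArg (skewOp 𝕂) h2
    rw [(skewOp 𝕂).map_zero] at h3
    exact h3 ▸ Submodule.zero_mem _

/-! ### Codes -/

/-- An order on factors, by which expressions are sorted. -/
def Factor.le : Factor → Factor → Bool
  | Factor.P m, Factor.P m' => m' ≤ m
  | Factor.P _, Factor.R _ => true
  | Factor.R _, Factor.P _ => false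
  | Factor.R k, Factor.R k' => k' ≤ k

theorem Factor.le_total (f g : Factor) : f.le g = true ∨ g.le f = true := by
  cases f <;> cases g <;> simp [Factor.le] <;> omega

theorem Factor.le_trans {f g h : Factor} (h1 : f.le g = true) (h2 : g.le h = true) :
    f.le h = true := by
  cases f <;> cases g <;> cases h <;> simp_all [Factor.le] <;> omega

/-- The expression with the factors `fs`, whose lower indices are labelled consecutively from `b`
on, and with labels `l` for the upper indices. -/
def build : List Factor → ℕ → List ℕ → Expr
  | [], _, _ => []
  | f :: fs, b, l => ⟨f, List.range' b f.lower, l.take f.upper⟩ ::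
      build fs (b + f.lower) (l.drop f.upper)

/-- When the lower labels are consecutive numbers, an expression is determined by its list of
factors and the list of its upper labels. This is what codes rely on. -/
theorem eq_build {E : Expr} (hE : E.Ok) {b : ℕ} (h : E.lows = List.range' b E.lows.length) :
    E = build (E.map Atom.f) b E.ups := by
  induction E generalizing b with
  | nil => rfl
  | cons A E ih =>
    obtain ⟨hA, hE'⟩ := List.forall_mem_cons.1 hE
    rw [Expr.lows_cons, List.length_append, ← List.range'_append_1] at h
    obtain ⟨h1, h2⟩ := List.append_inj h (by simp)
    rw [List.map_cons, build, Expr.ups_cons, ← hA.1, ← h1, List.take_left' hA.2,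
      List.drop_left' hA.2, ← ih hE' h2]

theorem build_mapUp (fs : List Factor) (b : ℕ) (l : List ℕ) (g : ℕ → ℕ) :
    build fs b (l.map g) = (build fs b l).map fun A => ⟨A.f, A.lo, A.up.map g⟩ := by
  induction fs generalizing b l with
  | nil => rfl
  | cons f fs ih => simp only [build, List.map_cons, ← List.map_drop, ih, ← List.map_take]

/-- The expression with sorted factors. -/
def Expr.sort (E : Expr) : Expr := List.insertionSort (fun A B : Atom => A.f.le B.f) E

/-- The sorted list of the factors and the list of the labels of the upper indices. -/
def toCode (E : Expr) : List Factor × List ℕ :=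
  (E.sort.map Atom.f, E.sort.ups.map fun v => if v < 2 then v else 2 + E.sort.lows.idxOf v)

theorem sorted_toCode (E : Expr) : (toCode E).1.Pairwise fun f g => f.le g = true := by
  rw [toCode, List.pairwise_map]
  have : Std.Total (fun A B : Atom => A.f.le B.f = true) := ⟨fun A B => Factor.le_total _ _⟩
  have : IsTrans Atom (fun A B : Atom => A.f.le B.f = true) := ⟨fun A B C => Factor.le_trans⟩
  exact List.pairwise_insertionSort _ E

variable (𝕂 : Type) [RCLike 𝕂]

/-- Factors commute and contracted labels may be renamed, so sorting the factors and numbering the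
lower slots consecutively does not change the family. -/
theorem toCode_spec {E : Expr} (h : E.WF 2) :
    (build (toCode E).1 2 (toCode E).2).WF 2 ∧
    (build (toCode E).1 2 (toCode E).2).numP = E.numP ∧
    (build (toCode E).1 2 (toCode E).2).numR = E.numR ∧
    skewFamily 𝕂 (build (toCode E).1 2 (toCode E).2) = skewFamily 𝕂 E := by
  have hp : E.Perm E.sort := (List.perm_insertionSort _ E).symm
  rw [toCode]
  generalize E.sort = F at hp
  have hF := h.of_perm hp
  -- A contracted label is replaced by its position among the lower slots, shifted by 2 because 0
  -- and 1 are the free labels.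
  set g : ℕ → ℕ := fun v => if v < 2 then v else 2 + F.lows.idxOf v with hgdef
  have hg2 : ∀ v ∈ F.lows, g v = 2 + F.lows.idxOf v := fun v hv => by
    have := hF.le v hv
    rw [hgdef]; simp only; rw [if_neg (by omega)]
  have hg1 : ∀ v < 2, g v = v := fun v hv => if_pos hv
  have hg : ∀ u v, Expr.IsVar 2 F u → Expr.IsVar 2 F v → g u = g v → u = v := by
    rintro u v (hu | hu) (hv | hv) e
    · rwa [hg1 u hu, hg1 v hv] at e
    · rw [hg1 u hu, hg2 v hv] at e; omega
    · rw [hg2 u hu, hg1 v hv] at e; omega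
    · rw [hg2 u hu, hg2 v hv] at e
      exact (List.idxOf_inj hu).1 (by omega)
  have hl : (F.rename g).lows = List.range' 2 (F.rename g).lows.length := by
    rw [Expr.lows_rename, List.length_map]
    refine List.ext_getElem (by simp) fun i h1 h2 => ?_
    rw [List.getElem_map, hg2 _ (List.getElem_mem _), hF.nodup.idxOf_getElem, List.getElem_range']
    omega
  have hW : (F.rename g).WF 2 := hF.rename hg
    (by simp [List.range_succ, hg1]) fun v hv => by rw [hg2 v hv]; omega
  have he := eq_build hW.ok hl
  rw [Expr.ups_rename, show (F.rename g).map Atom.f = F.map Atom.f by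
    rw [Expr.rename, List.map_map]; rfl] at he
  simp only
  rw [← he]
  exact ⟨hW, by rw [Expr.numP_rename, Expr.numP_perm hp], by rw [Expr.numR_rename,
    Expr.numR_perm hp], by rw [skewFamily_rename 𝕂 hF hg hg1, skewFamily_perm 𝕂 hp]⟩

/-! ### Moves -/

/-- `E` is `e` times `F` up to skewsymmetry and terms with more curvature. -/
structure SkewEquiv (e : ℤ) (E F : Expr) : Prop where
  wf : F.WF 2
  numP : F.numP = E.numP
  numR : F.numR = E.numR
  mem : skewFamily 𝕂 E - (e : 𝕂) • skewFamily 𝕂 F ∈ exprSpan 𝕂 E.numP (E.numR + 1)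

variable {𝕂} in
theorem SkewRel.equiv {c : ℤ} {E F : Expr} (h : SkewRel 𝕂 E.numP E.numR [(1, E), (c, F)]) :
    SkewEquiv 𝕂 (-c) E F where
  wf := (h.wf (c, F) (by simp)).1
  numP := (h.wf (c, F) (by simp)).2.1
  numR := (h.wf (c, F) (by simp)).2.2
  mem := by
    have := h.mem
    simpa using this

variable {𝕂} in
theorem SkewEquiv.of_perm {e : ℤ} {E F E' F' : Expr} (hE : E.Perm E') (hF : F.Perm F')
    (h : SkewEquiv 𝕂 e E' F') : SkewEquiv 𝕂 e E F where
  wf := h.wf.of_perm hF.symm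
  numP := by rw [Expr.numP_perm hE, Expr.numP_perm hF, h.numP]
  numR := by rw [Expr.numR_perm hE, Expr.numR_perm hF, h.numR]
  mem := by
    rw [skewFamily_perm 𝕂 hE, skewFamily_perm 𝕂 hF, Expr.numP_perm hE, Expr.numR_perm hE]
    exact h.mem

theorem SkewEquiv.refl {E : Expr} (h : E.WF 2) : SkewEquiv 𝕂 1 E E :=
  ⟨h, rfl, rfl, by simp⟩

/-- Renaming of the labels of the upper indices. -/
def Expr.mapUps (g : ℕ → ℕ) (E : Expr) : Expr := E.map fun A => ⟨A.f, A.lo, A.up.map g⟩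

theorem Expr.rename_eq_mapUps {E : Expr} {g : ℕ → ℕ} (h : ∀ v ∈ E.lows, g v = v) :
    E.rename g = E.mapUps g := by
  refine List.map_congr_left fun A hA => ?_
  have : A.lo.map g = A.lo := by
    refine (List.map_congr_left fun v hv => h v (List.mem_flatMap.2 ⟨A, hA, hv⟩)).trans ?_
    simp
  rw [Atom.map, this]

/-- Lower labels are at least 2, so this is the exchange of the free indices of a skewsymmetrized
bivector. -/
theorem skewEquiv_mapUps_free {E : Expr} (h : E.WF 2) :
    SkewEquiv 𝕂 (-1) E (E.mapUps (Equiv.swap 0 1)) := by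
  have h1 : E.rename (Equiv.swap 0 1) = E.mapUps (Equiv.swap 0 1) :=
    Expr.rename_eq_mapUps fun v hv => Equiv.swap_apply_of_ne_of_ne
      (by have := h.le v hv; omega) (by have := h.le v hv; omega)
  rw [← h1]
  refine ⟨h.rename (fun u v _ _ e => (Equiv.swap 0 1).injective e) ?_ fun v hv => ?_,
    Expr.numP_rename _ _, Expr.numR_rename _ _, ?_⟩
  · decide
  · rw [Equiv.swap_apply_of_ne_of_ne (by have := h.le v hv; omega) (by have := h.le v hv; omega)]
    exact h.le v hv
  · rw [skewFamily_rename_swap 𝕂 h]; simp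

-- Exchanging two labels everywhere changes nothing. This undoes itself on adjacent lower slots if
-- these slots are exchanged too; so a symmetry of the lower slots becomes an exchange of two values
-- in the list of upper labels, and the lower labels stay consecutive.
variable {𝕂} in
theorem skewEquiv_mapUps {pre post : Expr} {f : Factor} {ws ws' up : List ℕ} {a b : ℕ} {e : ℤ}
    (h : (pre ++ ⟨f, ws ++ a :: b :: ws', up⟩ :: post).WF 2)
    (hc : ∀ (up : List ℕ) (C : Expr), Expr.WF 2 (⟨f, ws ++ b :: a :: ws', up⟩ :: C) →
      SkewEquiv 𝕂 e (⟨f, ws ++ b :: a :: ws', up⟩ :: C) (⟨f, ws ++ a :: b :: ws', up⟩ :: C)) :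
    SkewEquiv 𝕂 e (pre ++ ⟨f, ws ++ a :: b :: ws', up⟩ :: post)
      ((pre ++ ⟨f, ws ++ a :: b :: ws', up⟩ :: post).mapUps (Equiv.swap a b)) := by
  set E := pre ++ ⟨f, ws ++ a :: b :: ws', up⟩ :: post with hE
  have hlows : E.lows = pre.lows ++ ws ++ a :: b :: (ws' ++ post.lows) := by
    simp [hE]
  have ha := h.le a (by simp [hlows])
  have hb := h.le b (by simp [hlows])
  have hn := h.nodup
  rw [hlows] at hn
  have hfix : ∀ v ∈ pre.lows ++ ws ++ (ws' ++ post.lows), Equiv.swap a b v = v := by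
    intro v hv
    rw [List.nodup_append'] at hn
    obtain ⟨-, h2, h3⟩ := hn
    rw [List.nodup_cons, List.nodup_cons] at h2
    refine Equiv.swap_apply_of_ne_of_ne ?_ ?_
    · rintro rfl
      rcases List.mem_append.1 hv with hv | hv
      · exact h3 hv (by simp)
      · exact h2.1 (List.mem_cons_of_mem _ hv)
    · rintro rfl
      rcases List.mem_append.1 hv with hv | hv
      · exact h3 hv (by simp)
      · exact h2.2.1 hv
  have hmap : ∀ l : List ℕ, (∀ v ∈ l, v ∈ pre.lows ++ ws ++ (ws' ++ post.lows)) →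
      l.map (Equiv.swap a b) = l := fun l hl => by
    refine (List.map_congr_left fun v hv => hfix v (hl v hv)).trans ?_
    simp
  -- The renaming affects the upper labels everywhere, but among lower labels only the two adjacent
  -- slots.
  have hr : E.rename (Equiv.swap a b) = pre.mapUps (Equiv.swap a b) ++
      ⟨f, ws ++ b :: a :: ws', up.map (Equiv.swap a b)⟩ :: post.mapUps (Equiv.swap a b) := by
    rw [← Expr.rename_eq_mapUps fun v hv => hfix v (by simp [hv]),
      ← Expr.rename_eq_mapUps fun v hv => hfix v (by simp [hv]), hE]
    simp only [Expr.rename, List.map_append, List.map_cons, Atom.map, Equiv.swap_apply_left,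
      Equiv.swap_apply_right]
    rw [hmap ws fun v hv => by simp [hv], hmap ws' fun v hv => by simp [hv]]
  have hge : ∀ v ∈ E.lows, 2 ≤ Equiv.swap a b v := fun v hv => by
    rw [Equiv.swap_apply_def]; split_ifs
    exacts [hb, ha, h.le v hv]
  have hlt : ∀ v < 2, Equiv.swap a b v = v := fun v hv =>
    Equiv.swap_apply_of_ne_of_ne (by omega) (by omega)
  have hW : (E.rename (Equiv.swap a b)).WF 2 :=
    h.rename (fun u v _ _ e => (Equiv.swap a b).injective e)
      (by simp [List.range_succ, hlt]) hge
  have hS := skewFamily_rename 𝕂 h (fun u v _ _ e => (Equiv.swap a b).injective e) hlt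
  have hP := Expr.numP_rename E (Equiv.swap a b)
  have hR := Expr.numR_rename E (Equiv.swap a b)
  rw [hr] at hW hS hP hR
  have h1 := SkewEquiv.of_perm (List.perm_middle) (List.perm_middle) (hc _ _ (hW.of_perm
    (List.perm_middle)))
  have h2 : E.mapUps (Equiv.swap a b) = pre.mapUps (Equiv.swap a b) ++
      ⟨f, ws ++ a :: b :: ws', up.map (Equiv.swap a b)⟩ :: post.mapUps (Equiv.swap a b) := by
    simp [Expr.mapUps, hE]
  rw [h2]
  refine ⟨h1.wf, h1.numP.trans hP, h1.numR.trans hR, ?_⟩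
  have := h1.mem
  rwa [hS, hP, hR] at this

variable {𝕂} in
theorem skewEquiv_mapUps_commute {pre post : Expr} {f : Factor} {ws ws' up : List ℕ} {a b : ℕ}
    (hf : CanCommute f ws.length) (h : (pre ++ ⟨f, ws ++ a :: b :: ws', up⟩ :: post).WF 2) :
    SkewEquiv 𝕂 1 (pre ++ ⟨f, ws ++ a :: b :: ws', up⟩ :: post)
      ((pre ++ ⟨f, ws ++ a :: b :: ws', up⟩ :: post).mapUps (Equiv.swap a b)) :=
  skewEquiv_mapUps h fun _ _ hW => (skewRel_commute 𝕂 hf hW).equiv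

variable {𝕂} in
theorem skewEquiv_mapUps_skew {pre post : Expr} {k : ℕ} {ws up : List ℕ} {a b c : ℕ}
    (hk : ws.length = k) (h : (pre ++ ⟨Factor.R k, ws ++ [a, b, c], up⟩ :: post).WF 2) :
    SkewEquiv 𝕂 (-1) (pre ++ ⟨Factor.R k, ws ++ [a, b, c], up⟩ :: post)
      ((pre ++ ⟨Factor.R k, ws ++ [a, b, c], up⟩ :: post).mapUps (Equiv.swap a b)) :=
  skewEquiv_mapUps (ws' := [c]) h fun up C hW => by
    have h1 := (hW.ok _ (List.mem_cons_self ..)).2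
    obtain ⟨u, rfl⟩ := List.length_eq_one_iff.1 h1
    exact (skewRel_skew 𝕂 hk hW).equiv

variable {𝕂} in
theorem skewEquiv_flip {pre post : Expr} {m a b : ℕ} {lo : List ℕ}
    (h : (pre ++ ⟨Factor.P m, lo, [a, b]⟩ :: post).WF 2) :
    SkewEquiv 𝕂 (-1) (pre ++ ⟨Factor.P m, lo, [a, b]⟩ :: post)
      (pre ++ ⟨Factor.P m, lo, [b, a]⟩ :: post) :=
  SkewEquiv.of_perm List.perm_middle List.perm_middle
    (skewRel_flip 𝕂 (h.of_perm List.perm_middle)).equiv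

/-- A move between codes: exchange of the two upper indices of the `i`-th factor, exchange of the
upper indices of the `i`-th and the next factor, exchange of the labels `w` and `w + 1` (with a
sign). -/
inductive Move : Type
  | flip (i : ℕ)
  | block (i : ℕ)
  | val (w : ℕ) (s : ℤ)

/-- Exchange of the entries in the places `2i`, `2i + 1`. -/
def flipList : ℕ → List ℕ → List ℕ
  | 0, a :: b :: l => b :: a :: l
  | i + 1, a :: b :: l => a :: b :: flipList i l
  | _, l => l

/-- Exchange of the pairs of entries in the places `2i`, `2i + 1` and `2i + 2`, `2i + 3`. -/
def blockList : ℕ → List ℕ → List ℕ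
  | 0, a :: b :: c :: d :: l => c :: d :: a :: b :: l
  | i + 1, a :: b :: l => a :: b :: blockList i l
  | _, l => l

/-- Exchange of `w` and `w + 1`. -/
def swapSucc (w v : ℕ) : ℕ := if v = w then w + 1 else if v = w + 1 then w else v

theorem swapSucc_eq (w : ℕ) : swapSucc w = Equiv.swap w (w + 1) := by
  funext v; rw [swapSucc, Equiv.swap_apply_def]

namespace Move

/-- The action of a move. -/
def act : Move → List ℕ → List ℕ
  | flip i, l => flipList i l
  | block i, l => blockList i l
  | val w _, l => l.map (swapSucc w)

/-- The sign of a move. -/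
def sign : Move → ℤ
  | flip _ => -1
  | block _ => 1
  | val _ s => s

end Move

/-- The `i`-th factor and those before are `∇^m P`. -/
def flipOk : ℕ → List Factor → Bool
  | 0, Factor.P _ :: _ => true
  | i + 1, Factor.P _ :: fs => flipOk i fs
  | _, _ => false

/-- The `i`-th and the next factor are `P`, and those before are `∇^m P`. -/
def blockOk : ℕ → List Factor → Bool
  | 0, Factor.P 0 :: Factor.P 0 :: _ => true
  | i + 1, Factor.P _ :: fs => blockOk i fs
  | _, _ => false

/-- The pairs of consecutive lower indices which may be exchanged, with signs. -/
def slots : List Factor → ℕ → List (ℕ × ℤ)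
  | [], _ => []
  | Factor.P m :: fs, b => (List.range (m - 1)).map (fun j => (b + j, 1)) ++ slots fs (b + (0 + m))
  | Factor.R k :: fs, b => (List.range (k - 1)).map (fun j => (b + j, 1)) ++
      (b + k, -1) :: slots fs (b + (3 + k))

/-- The moves for the codes with given factors. -/
def moves (fs : List Factor) : List Move :=
  (((List.range 3).filter fun i => flipOk i fs).map Move.flip ++
    ((List.range 2).filter fun i => blockOk i fs).map Move.block) ++
    (Move.val 0 (-1) :: (slots fs 2).map fun x => Move.val x.1 x.2)

variable {𝕂 : Type} [RCLike 𝕂]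

theorem take_two_of_ok {f : Factor} (hf : f.upper = 2) {fs : List Factor} {b : ℕ} {l : List ℕ}
    {pre : Expr} (h : Expr.WF 2 (pre ++ build (f :: fs) b l)) :
    ∃ a c r, l = a :: c :: r := by
  have h1 := (h.ok _ (List.mem_append.2 (Or.inr (List.mem_cons_self ..)))).2
  simp only [hf, List.length_take] at h1
  match l with
  | [] => simp at h1
  | [a] => simp at h1
  | a :: c :: r => exact ⟨a, c, r, rfl⟩

theorem skewEquiv_flipList (i : ℕ) : ∀ (pre : Expr) (fs : List Factor) (b : ℕ) (l : List ℕ),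
    flipOk i fs = true → (pre ++ build fs b l).WF 2 →
      SkewEquiv 𝕂 (-1) (pre ++ build fs b l) (pre ++ build fs b (flipList i l)) := by
  induction i with
  | zero =>
    intro pre fs b l h hW
    match fs, h with
    | Factor.P m :: fs, _ =>
      obtain ⟨a, c, r, rfl⟩ := take_two_of_ok (f := Factor.P m) rfl hW
      exact skewEquiv_flip hW
  | succ i ih =>
    intro pre fs b l h hW
    match fs, h with
    | Factor.P m :: fs, h =>
      obtain ⟨a, c, r, rfl⟩ := take_two_of_ok (f := Factor.P m) rfl hW
      have := ih (pre ++ [⟨Factor.P m, List.range' b (0 + m), [a, c]⟩]) fs (b + (0 + m)) r h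
        (by rw [List.append_assoc]; exact hW)
      rw [List.append_assoc, List.append_assoc] at this
      exact this

/-- Factors `P` without derivatives have no lower slots, so exchanging two of them permutes factors
without disturbing the consecutive lower labels. -/
theorem skewEquiv_blockList (i : ℕ) : ∀ (pre : Expr) (fs : List Factor) (b : ℕ) (l : List ℕ),
    blockOk i fs = true → (pre ++ build fs b l).WF 2 →
      SkewEquiv 𝕂 1 (pre ++ build fs b l) (pre ++ build fs b (blockList i l)) := by
  induction i with
  | zero =>
    intro pre fs b l h hW
    match fs, h with
    | Factor.P 0 :: Factor.P 0 :: fs, _ =>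
      obtain ⟨a, c, r, rfl⟩ := take_two_of_ok (f := Factor.P 0) rfl hW
      have hW' : Expr.WF 2 ((pre ++ [⟨Factor.P 0, [], [a, c]⟩]) ++ build (Factor.P 0 :: fs) b r) := by
        rw [List.append_assoc]; exact hW
      obtain ⟨d, e, r, rfl⟩ := take_two_of_ok (f := Factor.P 0) rfl hW'
      exact SkewEquiv.of_perm (List.Perm.refl _)
        ((List.Perm.swap (Atom.mk (Factor.P 0) [] [a, c]) (Atom.mk (Factor.P 0) [] [d, e])
          (build fs b r)).append_left pre) (SkewEquiv.refl 𝕂 hW)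
  | succ i ih =>
    intro pre fs b l h hW
    match fs, h with
    | Factor.P m :: fs, h =>
      obtain ⟨a, c, r, rfl⟩ := take_two_of_ok (f := Factor.P m) rfl hW
      have := ih (pre ++ [⟨Factor.P m, List.range' b (0 + m), [a, c]⟩]) fs (b + (0 + m)) r h
        (by rw [List.append_assoc]; exact hW)
      rw [List.append_assoc, List.append_assoc] at this
      exact this

theorem range'_split {b j n : ℕ} (h : j + 2 ≤ n) : List.range' b n
    = List.range' b j ++ (b + j) :: (b + j + 1) :: List.range' (b + j + 2) (n - (j + 2)) := by
  have h1 : n = j + ((n - (j + 2)) + 1 + 1) := by omega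
  conv_lhs => rw [h1, ← List.range'_append_1, List.range'_succ, List.range'_succ]

/-- The admissible adjacent lower slots are two derivative indices, which commute modulo curvature,
and the first two indices of `R`, in which it is skew. The prefix `pre` carries the induction past
the factors already treated. -/
theorem skewEquiv_slots (fs : List Factor) : ∀ (pre : Expr) (b : ℕ) (l : List ℕ),
    ∀ x ∈ slots fs b, (pre ++ build fs b l).WF 2 →
      SkewEquiv 𝕂 x.2 (pre ++ build fs b l)
        ((pre ++ build fs b l).mapUps (Equiv.swap x.1 (x.1 + 1))) := by
  induction fs with
  | nil => intro pre b l x hx; simp [slots] at hx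
  | cons f fs ih =>
    intro pre b l x hx hW
    have hrec : x ∈ slots fs (b + f.lower) → SkewEquiv 𝕂 x.2 (pre ++ build (f :: fs) b l)
        ((pre ++ build (f :: fs) b l).mapUps (Equiv.swap x.1 (x.1 + 1))) := fun hx => by
      have := ih (pre ++ [⟨f, List.range' b f.lower, l.take f.upper⟩]) (b + f.lower)
        (l.drop f.upper) x hx (by rw [List.append_assoc]; exact hW)
      rw [List.append_assoc] at this
      exact this
    rw [build] at hW ⊢
    cases f with
    | P m =>
      rcases List.mem_append.1 hx with hx | hx
      · obtain ⟨j, hj, rfl⟩ := List.mem_map.1 hx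
        rw [List.mem_range] at hj
        simp only [Factor.lower, zero_add] at hW ⊢
        rw [range'_split (b := b) (j := j) (n := m) (by omega)] at hW ⊢
        exact skewEquiv_mapUps_commute (by simp [CanCommute]; omega) hW
      · exact hrec hx
    | R k =>
      rcases List.mem_append.1 hx with hx | hx
      · obtain ⟨j, hj, rfl⟩ := List.mem_map.1 hx
        rw [List.mem_range] at hj
        simp only [Factor.lower] at hW ⊢
        rw [range'_split (b := b) (j := j) (n := 3 + k) (by omega)] at hW ⊢
        exact skewEquiv_mapUps_commute (by simp [CanCommute]; omega) hW
      · rcases List.mem_cons.1 hx with rfl | hx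
        · simp only [Factor.lower] at hW ⊢
          rw [range'_split (b := b) (j := k) (n := 3 + k) (by omega),
            show 3 + k - (k + 2) = 1 by omega] at hW ⊢
          exact skewEquiv_mapUps_skew (by simp) hW
        · exact hrec hx

/-- The number of upper indices of a list of factors. -/
def totalUpper (fs : List Factor) : ℕ := (fs.map Factor.upper).sum

/-- The number of lower indices of a list of factors. -/
def totalLower (fs : List Factor) : ℕ := (fs.map Factor.lower).sum

theorem skewEquiv_act {fs : List Factor} {m : Move} (hm : m ∈ moves fs) {l : List ℕ}
    (hW : (build fs 2 l).WF 2) :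
    SkewEquiv 𝕂 m.sign (build fs 2 l) (build fs 2 (m.act l)) := by
  rcases List.mem_append.1 hm with hm | hm
  · rcases List.mem_append.1 hm with hm | hm
    · obtain ⟨i, hi, rfl⟩ := List.mem_map.1 hm
      exact skewEquiv_flipList i [] fs 2 l (by simpa using (List.mem_filter.1 hi).2) hW
    · obtain ⟨i, hi, rfl⟩ := List.mem_map.1 hm
      exact skewEquiv_blockList i [] fs 2 l (by simpa using (List.mem_filter.1 hi).2) hW
  · rcases List.mem_cons.1 hm with rfl | hm
    · have := skewEquiv_mapUps_free 𝕂 hW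
      rw [Move.act, build_mapUp, swapSucc_eq]
      exact this
    · obtain ⟨x, hx, rfl⟩ := List.mem_map.1 hm
      have := skewEquiv_slots (𝕂 := 𝕂) fs [] 2 l x hx hW
      rw [Move.act, build_mapUp, swapSucc_eq]
      exact this

@[simp] theorem build_map_f (fs : List Factor) (b : ℕ) (l : List ℕ) :
    (build fs b l).map Atom.f = fs := by
  induction fs generalizing b l with
  | nil => rfl
  | cons f fs ih => simp [build, ih]

theorem lows_build (fs : List Factor) (b : ℕ) (l : List ℕ) :
    (build fs b l).lows = List.range' b (totalLower fs) := by
  induction fs generalizing b l with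
  | nil => rfl
  | cons f fs ih =>
    have h : totalLower (f :: fs) = f.lower + totalLower fs := by simp [totalLower]
    rw [build, Expr.lows_cons, ih, h, ← List.range'_append_1]

theorem ups_build (fs : List Factor) (b : ℕ) (l : List ℕ) :
    (build fs b l).ups = l.take (totalUpper fs) := by
  induction fs generalizing b l with
  | nil => simp [totalUpper, build]
  | cons f fs ih =>
    have h : totalUpper (f :: fs) = f.upper + totalUpper fs := by simp [totalUpper]
    rw [build, Expr.ups_cons, ih, h, List.take_add]

theorem length_flipList (i : ℕ) (l : List ℕ) : (flipList i l).length = l.length := by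
  induction i, l using flipList.induct <;> simp_all [flipList]

theorem length_blockList (i : ℕ) (l : List ℕ) : (blockList i l).length = l.length := by
  induction i, l using blockList.induct <;> simp_all [blockList]

theorem Move.length_act (m : Move) (l : List ℕ) : (m.act l).length = l.length := by
  cases m with
  | flip i => exact length_flipList i l
  | block i => exact length_blockList i l
  | val w s => simp [act]

theorem length_toCode {E : Expr} (h : E.Ok) : (toCode E).2.length = totalUpper (toCode E).1 := by
  have hp : E.Perm E.sort := (List.perm_insertionSort _ E).symm
  rw [toCode]
  simp only [List.length_map, totalUpper, List.map_map]
  have hS : Expr.Ok E.sort := fun A hA => h A (hp.mem_iff.2 hA)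
  generalize E.sort = F at hS
  rw [Expr.ups, List.length_flatMap]
  exact congrArg List.sum (List.map_congr_left fun A hA => (hS A hA).2)

/-! ### Enumeration of codes -/

/-- A number by which codes are ordered. -/
def enc (l : List ℕ) : ℕ := l.foldl (fun a v => a * 16 + v) 0

theorem enc_append (p s : List ℕ) : enc (p ++ s) = enc p * 16 ^ s.length + enc s := by
  induction s using List.reverseRecOn generalizing p with
  | nil => simp [enc]
  | append_singleton s v ih =>
    have h : ∀ q, enc (q ++ [v]) = enc q * 16 + v := fun q => by simp [enc, List.foldl_append]
    rw [← List.append_assoc, h, h, ih, List.length_append, List.length_singleton]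
    ring

theorem enc_lt {s : List ℕ} (h : ∀ v ∈ s, v < 16) : enc s < 16 ^ s.length := by
  induction s using List.reverseRecOn with
  | nil => simp [enc]
  | append_singleton s v ih =>
    have h1 := ih fun v hv => h v (by simp [hv])
    have h2 := h v (by simp)
    rw [enc_append, List.length_append, pow_add]
    simp only [List.length_singleton, pow_one]
    have : enc [v] = v := by simp [enc]
    omega

theorem enc_lt_enc {p x y s : List ℕ} (hl : x.length = y.length) (h : enc x < enc y) :
    enc (p ++ (x ++ s)) < enc (p ++ (y ++ s)) := by
  rw [enc_append p, enc_append p, enc_append x, enc_append y, List.length_append, List.length_append,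
    hl]
  have := Nat.mul_lt_mul_of_pos_right h (Nat.pow_pos (n := s.length) (a := 16) (by norm_num))
  omega

/-- After the entries `p`, the entry `v` is superfluous because of a move. -/
def Move.excludes : Move → List ℕ → ℕ → Bool
  | flip i, p, v => p.length == 2 * i + 1 && Nat.blt v (p.getD (2 * i) 0)
  | block i, p, _ => p.length == 2 * i + 3 && Nat.blt (p.getD (2 * i + 2) 0) (p.getD (2 * i) 0)
  | val w _, p, v => v == w + 1 && !p.elem w

theorem flipList_append (i : ℕ) (p l : List ℕ) (h : p.length = 2 * i) :
    flipList i (p ++ l) = p ++ flipList 0 l := by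
  induction i generalizing p with
  | zero => rw [List.eq_nil_of_length_eq_zero h]; rfl
  | succ i ih =>
    match p, h with
    | a :: b :: p, h => simp only [List.cons_append, flipList]; rw [ih p (by simp at h; omega)]

theorem blockList_append (i : ℕ) (p l : List ℕ) (h : p.length = 2 * i) :
    blockList i (p ++ l) = p ++ blockList 0 l := by
  induction i generalizing p with
  | zero => rw [List.eq_nil_of_length_eq_zero h]; rfl
  | succ i ih =>
    match p, h with
    | a :: b :: p, h => simp only [List.cons_append, blockList]; rw [ih p (by simp at h; omega)]

theorem exists_eq_append_of_length {p : List ℕ} {i k : ℕ} (h : p.length = i + k) :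
    ∃ q r : List ℕ, p = q ++ r ∧ q.length = i ∧ r.length = k :=
  ⟨p.take i, p.drop i, (List.take_append_drop i p).symm, by simp [h], by simp [h]⟩

/-- The comparison is lexicographic, as `enc` reads the list in base 16: the move leaves the initial
entries alone and makes the first changed entry, or block of entries, smaller. Hence a prefix may be
discarded before the rest of the list is known. The bound on the labels keeps all digits below 16.
-/
theorem Move.enc_act_lt {m : Move} {p s : List ℕ} {v : ℕ} (h : m.excludes p v = true)
    (hn : (p ++ v :: s).Nodup) (h16 : ∀ w ∈ p ++ v :: s, w < 15) :
    enc (m.act (p ++ v :: s)) < enc (p ++ v :: s) := by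
  cases m with
  | flip i =>
    simp only [excludes, Bool.and_eq_true, beq_iff_eq, Nat.blt_eq] at h
    obtain ⟨q, r, rfl, hq, hr⟩ := exists_eq_append_of_length h.1
    obtain ⟨a, rfl⟩ := List.length_eq_one_iff.1 hr
    have h2 := h.2
    rw [List.getD_append_right _ _ _ _ hq.le, hq] at h2
    simp at h2
    rw [act, List.append_assoc, flipList_append i q _ hq]
    exact enc_lt_enc (x := [v, a]) (y := [a, v]) rfl (by simp [enc]; omega)
  | block i =>
    simp only [excludes, Bool.and_eq_true, beq_iff_eq, Nat.blt_eq] at h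
    obtain ⟨q, r, rfl, hq, hr⟩ := exists_eq_append_of_length h.1
    obtain ⟨a, b, c, rfl⟩ := List.length_eq_three.1 hr
    have h2 := h.2
    rw [List.getD_append_right _ _ _ _ hq.le, List.getD_append_right _ _ _ _ (by omega), hq] at h2
    simp at h2
    rw [act, List.append_assoc, blockList_append i q _ hq]
    have ha := h16 a (by simp)
    have hb := h16 b (by simp)
    have hc := h16 c (by simp)
    have hd := h16 v (by simp)
    exact enc_lt_enc (x := [c, v, a, b]) (y := [a, b, c, v]) rfl (by simp [enc]; omega)
  | val w e =>
    simp only [excludes, Bool.and_eq_true, beq_iff_eq, Bool.not_eq_true', List.elem_eq_mem,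
      decide_eq_false_iff_not] at h
    obtain ⟨rfl, hw⟩ := h
    -- Neither `w` nor `w + 1` occurs before the entry `w + 1`, so this entry is the first to
    -- change, and it becomes `w`.
    have hp : p.map (swapSucc w) = p := by
      refine (List.map_congr_left (g := id) fun v hv => ?_).trans (by simp)
      rw [swapSucc, if_neg (by rintro rfl; exact hw hv), if_neg]
      · rfl
      · rintro rfl
        rw [List.nodup_append'] at hn
        exact hn.2.2 hv (by simp)
    have hs : ∀ v ∈ s.map (swapSucc w), v < 16 := fun v hv => by
      obtain ⟨u, hu, rfl⟩ := List.mem_map.1 hv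
      have h1 := h16 u (by simp [hu])
      have h2 := h16 (w + 1) (by simp)
      rw [swapSucc]; split_ifs <;> omega
    have hs := enc_lt hs
    rw [act, List.map_append, List.map_cons, hp, show swapSucc w (w + 1) = w by simp [swapSucc],
      enc_append, enc_append]
    simp only [List.length_cons, List.length_map] at hs ⊢
    have h3 := enc_append [w] (s.map (swapSucc w))
    have h4 := enc_append [w + 1] s
    have h5 : ∀ u, enc [u] = u := fun u => by simp [enc]
    rw [h5, List.length_map] at h3
    rw [h5] at h4
    simp only [List.singleton_append] at h3 h4
    rw [h3, h4]
    nlinarith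

/-- The label `v` in the place `i` gives a loop. -/
def loopAt : List Factor → ℕ → ℕ → ℕ → Bool
  | [], _, _, _ => false
  | f :: fs, b, i, v => if i < f.upper then Nat.ble b v && Nat.blt v (b + f.lower)
      else loopAt fs (b + f.lower) (i - f.upper) v

theorem loopAt_eq_false {fs : List Factor} {b : ℕ} {p s : List ℕ} {v : ℕ}
    (h : ∀ A ∈ build fs b (p ++ v :: s), A.lo.Disjoint A.up) :
    loopAt fs b p.length v = false := by
  induction fs generalizing b p with
  | nil => rfl
  | cons f fs ih =>
    rw [build, List.forall_mem_cons] at h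
    rw [loopAt]
    split_ifs with hp
    · by_contra hc
      simp only [Bool.not_eq_false, Bool.and_eq_true, Nat.ble_eq, Nat.blt_eq] at hc
      refine List.disjoint_left.1 h.1 (List.mem_range'_1.2 hc) ?_
      have h1 : (p ++ v :: s).take f.upper = p ++ (v :: s).take (f.upper - p.length) := by
        rw [List.take_append, List.take_of_length_le hp.le]
      change v ∈ (p ++ v :: s).take f.upper
      obtain ⟨k, hk⟩ : ∃ k, f.upper - p.length = k + 1 := ⟨f.upper - p.length - 1, by omega⟩
      rw [h1, hk, List.take_succ_cons]
      simp
    · have h2 := h.2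
      rw [List.drop_append_of_le_length (by omega)] at h2
      have := ih h2
      rwa [List.length_drop] at this

/-- The lists which arise from `acc` by inserting `n` elements of `av`, without repetitions and
without the excluded ones. -/
def search (bad : List ℕ → ℕ → Bool) : ℕ → List ℕ → List ℕ → List (List ℕ)
  | 0, acc, _ => [acc]
  | n + 1, acc, av => av.flatMap fun v =>
      bif bad acc v then [] else search bad n (acc ++ [v]) (av.erase v)

/-- The search only omits lists with a bad prefix, so a permutation without bad prefixes is found.
-/
theorem mem_search {bad : List ℕ → ℕ → Bool} {n : ℕ} {acc av l : List ℕ} (hl : l.Perm av)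
    (hn : l.length = n) (h : ∀ p v s, acc ++ l = p ++ v :: s → bad p v = false) :
    acc ++ l ∈ search bad n acc av := by
  induction n generalizing acc av l with
  | zero => rw [List.eq_nil_of_length_eq_zero hn]; simp [search]
  | succ n ih =>
    match l, hn with
    | v :: l, hn =>
      refine List.mem_flatMap.2 ⟨v, hl.mem_iff.1 (by simp), ?_⟩
      rw [h acc v l rfl, cond_false]
      have := ih (acc := acc ++ [v]) (av := av.erase v) (l := l)
        (by simpa using hl.erase v) (by simpa using hn) (by simpa using h)
      simpa using this

/-- The codes with factors `fs` which are not excluded. -/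
def candidates (fs : List Factor) : List (List ℕ) :=
  search (fun p v => loopAt fs 2 p.length v || (moves fs).any fun m => m.excludes p v)
    (totalUpper fs) [] (List.range (totalUpper fs))

/-- Descent on the number `enc l`. If a move makes the code smaller, the family is a multiple of a
smaller one up to terms of `W`. If no move does, no prefix of the code is excluded, so the code is
among the candidates. -/
theorem skewFamily_mem_of_candidates {fs : List Factor} (hU : totalUpper fs ≤ 15)
    (W : Submodule 𝕂 (ComponentFamily 𝕂 2))
    (hW : ∀ l, exprSpan 𝕂 (build fs 2 l).numP ((build fs 2 l).numR + 1) ≤ W)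
    (h : ∀ l ∈ candidates fs, (build fs 2 l).WF 2 → skewFamily 𝕂 (build fs 2 l) ∈ W)
    {l : List ℕ} (hl : l.length = totalUpper fs) (hwf : (build fs 2 l).WF 2) :
    skewFamily 𝕂 (build fs 2 l) ∈ W := by
  obtain ⟨n, hn⟩ : ∃ n, enc l = n := ⟨_, rfl⟩
  induction n using Nat.strong_induction_on generalizing l with
  | _ n ih =>
  subst hn
  by_cases hd : ∃ m ∈ moves fs, enc (m.act l) < enc l
  · obtain ⟨m, hm, hlt⟩ := hd
    have h1 := skewEquiv_act (𝕂 := 𝕂) hm hwf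
    have h2 := ih _ hlt (by rw [Move.length_act, hl]) h1.wf rfl
    have h3 := Submodule.add_mem _ (hW l h1.mem) (Submodule.smul_mem _ (m.sign : 𝕂) h2)
    rwa [sub_add_cancel] at h3
  -- The code cannot be made smaller by a single move.
  · push Not at hd
    have hlow := lows_build fs 2 l
    have hups := ups_build fs 2 l
    rw [← hl, List.take_length] at hups
    have hperm := hwf.perm
    rw [hlow, hups] at hperm
    -- Two free indices and one upper index for each lower one; hence the upper labels are a
    -- permutation of an initial segment of the natural numbers.
    have hlen : 2 + totalLower fs = totalUpper fs := by
      have := hperm.length_eq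
      simp at this; omega
    have hperm' : l.Perm (List.range (totalUpper fs)) := by
      refine hperm.trans (List.Perm.of_eq ?_)
      rw [← hlen, List.range_eq_range', List.range_eq_range', show List.range' 2 (totalLower fs) = List.range' (0 + 2) (totalLower fs) from rfl,
        List.range'_append_1]
    have hnod : l.Nodup := hperm'.nodup_iff.2 List.nodup_range
    refine h l ?_ hwf
    rw [candidates]
    refine mem_search (acc := []) hperm' hl fun p v s e => ?_
    rw [List.nil_append] at e
    subst e
    rw [loopAt_eq_false hwf.noLoop, Bool.false_or, List.any_eq_false]
    intro m hm hex
    refine absurd (Move.enc_act_lt hex hnod fun w hw => ?_) (not_lt.2 (hd m hm))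
    have := hperm'.mem_iff.1 hw
    rw [List.mem_range] at this
    omega

/-! ### Elimination -/

/-- A list of factors and a list of labels. -/
abbrev Code : Type := List Factor × List ℕ

instance : DecidableEq Factor
  | Factor.P m, Factor.P n => decidable_of_iff (m = n) ⟨congrArg _, fun h => Factor.P.inj h⟩
  | Factor.R m, Factor.R n => decidable_of_iff (m = n) ⟨congrArg _, fun h => Factor.R.inj h⟩
  | Factor.P _, Factor.R _ => isFalse Factor.noConfusion
  | Factor.R _, Factor.P _ => isFalse Factor.noConfusion

/-- The expression with a given code. -/
def Code.expr (c : Code) : Expr := build c.1 2 c.2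

/-- A criterion for `Expr.WF`. -/
def Code.check (c : Code) : Bool :=
  (totalUpper c.1 == 2 + totalLower c.1 && c.2.isPerm (List.range (totalUpper c.1))) &&
    c.expr.all fun A => A.lo.all fun v => !A.up.elem v

theorem build_ok {fs : List Factor} {b : ℕ} {l : List ℕ} (h : l.length = totalUpper fs) :
    (build fs b l).Ok := by
  induction fs generalizing b l with
  | nil => intro A hA; simp [build] at hA
  | cons f fs ih =>
    have h1 : totalUpper (f :: fs) = f.upper + totalUpper fs := by simp [totalUpper]
    refine List.forall_mem_cons.2 ⟨⟨by simp, by simp; omega⟩, ih (by simp; omega)⟩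

theorem Code.wf_of_check {c : Code} (h : c.check = true) : c.expr.WF 2 := by
  simp only [check, Bool.and_eq_true, beq_iff_eq, List.isPerm_iff] at h
  obtain ⟨⟨h1, h2⟩, h3⟩ := h
  have hl : c.2.length = totalUpper c.1 := by simpa using h2.length_eq
  have hlow := lows_build c.1 2 c.2
  have hup := ups_build c.1 2 c.2
  rw [← hl, List.take_length] at hup
  refine ⟨build_ok hl, ?_, fun v hv => ?_, ?_, fun A hA => ?_⟩
  · rw [expr, hlow]; exact List.nodup_range'
  · rw [expr, hlow] at hv
    exact (List.mem_range'_1.1 hv).1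
  · rw [expr, hlow, hup]
    refine h2.trans (List.Perm.of_eq ?_)
    rw [h1, List.range_eq_range', List.range_eq_range', show List.range' 2 (totalLower c.1)
      = List.range' (0 + 2) (totalLower c.1) from rfl, List.range'_append_1]
  · have := List.all_eq_true.1 h3 A hA
    rw [List.all_eq_true] at this
    refine List.disjoint_left.2 fun v hv => ?_
    simpa using this v hv

/-- The relations which are used for the elimination. -/
inductive Rule : Type
  | move (m : Move)
  | swap
  | bianchi
  | bianchi₂
  | jacobi
  | jacobiDeriv

/-- The terms of the relation which starts with a given code. -/
def Rule.terms : Rule → Code → List (ℤ × Expr)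
  | move m, c => if m.sign = 1 ∨ m.sign = -1 then
      bif (moves c.1).any fun m' => match m, m' with
        | Move.flip i, Move.flip j => i == j
        | Move.block i, Move.block j => i == j
        | Move.val w s, Move.val w' s' => w == w' && s == s'
        | _, _ => false
      then [(1, c.expr), (-m.sign, build c.1 2 (m.act c.2))] else [] else []
  | swap, c => match c.expr with
    | A :: B :: C => [(1, A :: B :: C), (-1, B :: A :: C)]
    | _ => []
  | bianchi, c => match c.expr with
    | ⟨Factor.R k, lo, [u]⟩ :: C => match lo.drop k with
      | [x, y, z] => [(1, ⟨Factor.R k, lo.take k ++ [x, y, z], [u]⟩ :: C),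
          (1, ⟨Factor.R k, lo.take k ++ [y, z, x], [u]⟩ :: C),
          (1, ⟨Factor.R k, lo.take k ++ [z, x, y], [u]⟩ :: C)]
      | _ => []
    | _ => []
  | bianchi₂, c => match c.expr with
    | ⟨Factor.R (k + 1), lo, [u]⟩ :: C => match lo.drop k with
      | [x, y, z, t] => [(1, ⟨Factor.R (k + 1), lo.take k ++ [x, y, z, t], [u]⟩ :: C),
          (1, ⟨Factor.R (k + 1), lo.take k ++ [y, z, x, t], [u]⟩ :: C),
          (1, ⟨Factor.R (k + 1), lo.take k ++ [z, x, y, t], [u]⟩ :: C)]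
      | _ => []
    | _ => []
  | jacobi, c => match c.expr with
    | ⟨Factor.P 0, [], [i, l]⟩ :: ⟨Factor.P 1, [l'], [j, k]⟩ :: C => if l = l' then
        [(1, ⟨Factor.P 0, [], [i, l]⟩ :: ⟨Factor.P 1, [l], [j, k]⟩ :: C),
         (1, ⟨Factor.P 0, [], [j, l]⟩ :: ⟨Factor.P 1, [l], [k, i]⟩ :: C),
         (1, ⟨Factor.P 0, [], [k, l]⟩ :: ⟨Factor.P 1, [l], [i, j]⟩ :: C)] else []
    | _ => []
  | jacobiDeriv, c => match c.expr with
    | ⟨Factor.P 1, [w], [i, l]⟩ :: ⟨Factor.P 1, [l'], [j, k]⟩ :: C =>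
        if l = l' ∧ w ≠ j ∧ w ≠ k then
        [(1, ⟨Factor.P 1, [w], [i, l]⟩ :: ⟨Factor.P 1, [l], [j, k]⟩ :: C),
         (1, ⟨Factor.P 0, [], [i, l]⟩ :: ⟨Factor.P 2, [w, l], [j, k]⟩ :: C),
         (1, ⟨Factor.P 1, [w], [j, l]⟩ :: ⟨Factor.P 1, [l], [k, i]⟩ :: C),
         (1, ⟨Factor.P 0, [], [j, l]⟩ :: ⟨Factor.P 2, [w, l], [k, i]⟩ :: C),
         (1, ⟨Factor.P 1, [w], [k, l]⟩ :: ⟨Factor.P 1, [l], [i, j]⟩ :: C),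
         (1, ⟨Factor.P 0, [], [k, l]⟩ :: ⟨Factor.P 2, [w, l], [i, j]⟩ :: C)] else []
    | _ => []

variable (𝕂 : Type) [RCLike 𝕂]

theorem skewRel_nil (k r : ℕ) : SkewRel 𝕂 k r [] :=
  ⟨by simp, by simp⟩

theorem SkewEquiv.rel {E F : Expr} {e : ℤ} (h : SkewEquiv 𝕂 e E F) (hE : E.WF 2) :
    SkewRel 𝕂 E.numP E.numR [(1, E), (-e, F)] where
  wf x hx := by
    simp only [List.mem_cons, List.not_mem_nil, or_false] at hx
    rcases hx with rfl | rfl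
    exacts [⟨hE, rfl, rfl⟩, ⟨h.wf, h.numP, h.numR⟩]
  mem := by
    have := h.mem
    simpa [sub_eq_add_neg] using this

/-- A rule which does not fit the code gives the empty, trivially true relation. The codes to which
rules are applied need not be sorted; the factors concerned stand in front. Exchanges of factors and
moves are useful as relations because the descent to smaller codes only stops at a local minimum,
and because they detect families which are their own negatives. -/
theorem Rule.skewRel_terms (ρ : Rule) (c : Code) (h : c.expr.WF 2) :
    SkewRel 𝕂 c.expr.numP c.expr.numR (ρ.terms c) := by
  have hnil := skewRel_nil 𝕂 c.expr.numP c.expr.numR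
  cases ρ with
  | move m =>
    rw [terms]
    split_ifs with hs
    · cases hb : (moves c.1).any _ with
      | false => exact hnil
      | true =>
        obtain ⟨m', hm', e⟩ := List.any_eq_true.1 hb
        have : m = m' := by
          cases m <;> cases m' <;> simp_all
        subst this
        exact (skewEquiv_act (𝕂 := 𝕂) hm' h).rel 𝕂 h
    · exact hnil
  | swap =>
    rw [terms]
    generalize c.expr = E at h hnil
    match E, h with
    | A :: B :: C, h =>
      exact (SkewEquiv.of_perm (List.Perm.refl _) (List.Perm.swap A B C)
        (SkewEquiv.refl 𝕂 h)).rel 𝕂 h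
    | [], h => exact hnil
    | [A], h => exact hnil
  | bianchi =>
    rw [terms]
    generalize c.expr = E at h hnil
    split
    · rename_i k lo u C
      have hlen : lo.length = 3 + k := (h.ok _ (List.mem_cons_self ..)).1
      split
      · rename_i x y z hd
        have hlo : lo = lo.take k ++ [x, y, z] := by rw [← hd, List.take_append_drop]
        rw [hlo] at h
        have := skewRel_bianchi 𝕂 (by simp; omega) h
        rwa [← hlo] at this ⊢
      · exact hnil
    · exact hnil
  | bianchi₂ =>
    rw [terms]
    generalize c.expr = E at h hnil
    split
    · rename_i k lo u C
      have hlen : lo.length = 3 + (k + 1) := (h.ok _ (List.mem_cons_self ..)).1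
      split
      · rename_i x y z t hd
        have hlo : lo = lo.take k ++ [x, y, z, t] := by rw [← hd, List.take_append_drop]
        rw [hlo] at h
        have := skewRel_bianchi₂ 𝕂 (by simp; omega) h
        rwa [← hlo] at this ⊢
      · exact hnil
    · exact hnil
  | jacobi =>
    rw [terms]
    generalize c.expr = E at h hnil
    split
    · split_ifs with hl
      · subst hl
        exact skewRel_jacobi 𝕂 h
      · exact hnil
    · exact hnil
  | jacobiDeriv =>
    rw [terms]
    generalize c.expr = E at h hnil
    split
    · split_ifs with hl
      · obtain ⟨rfl, hw⟩ := hl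
        exact skewRel_jacobi_deriv 𝕂 h hw
      · exact hnil
    · exact hnil

/-- Moves are applied as long as they lead to smaller codes. -/
def normalize (ms : List Move) : ℕ → ℤ → List ℕ → ℤ × List ℕ
  | 0, s, l => (s, l)
  | n + 1, s, l => match ms.find? fun m => Nat.blt (enc (m.act l)) (enc l) with
    | none => (s, l)
    | some m => normalize ms n (s * m.sign) (m.act l)

/-- A term, brought to normal form. -/
def normalTerm (x : ℤ × Expr) : ℤ × Code :=
  ((normalize (moves (toCode x.2).1) 60 x.1 (toCode x.2).2).1, ((toCode x.2).1,
    (normalize (moves (toCode x.2).1) 60 x.1 (toCode x.2).2).2))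

/-- Holds for every number `n` of steps; whether a smallest code is reached is irrelevant for
correctness. -/
theorem normalize_spec {fs : List Factor} (n : ℕ) {s : ℤ} {l : List ℕ}
    (h : (build fs 2 l).WF 2) {k r : ℕ} (hk : (build fs 2 l).numP = k)
    (hr : (build fs 2 l).numR = r) :
    (s : 𝕂) • skewFamily 𝕂 (build fs 2 l) - ((normalize (moves fs) n s l).1 : 𝕂) •
      skewFamily 𝕂 (build fs 2 (normalize (moves fs) n s l).2) ∈ exprSpan 𝕂 k (r + 1) := by
  induction n generalizing s l with
  | zero => simp [normalize]
  | succ n ih =>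
    rw [normalize]
    split
    · simp
    · rename_i m hm
      have h1 := skewEquiv_act (𝕂 := 𝕂) (List.mem_of_find?_eq_some hm) h
      have h2 := ih (s := s * m.sign) h1.wf (h1.numP.trans hk) (h1.numR.trans hr)
      have h3 := Submodule.smul_mem _ (s : 𝕂) h1.mem
      rw [hk, hr] at h3
      have h4 := Submodule.add_mem _ h3 h2
      rw [smul_sub, smul_smul] at h4
      push_cast at h4
      rwa [sub_add_sub_cancel] at h4

theorem normalTerm_spec (x : ℤ × Expr) (h : x.2.WF 2) :
    (x.1 : 𝕂) • skewFamily 𝕂 x.2 - ((normalTerm x).1 : 𝕂) •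
      skewFamily 𝕂 (normalTerm x).2.expr ∈ exprSpan 𝕂 x.2.numP (x.2.numR + 1) := by
  obtain ⟨h1, h2, h3, h4⟩ := toCode_spec 𝕂 h
  rw [← h4]
  exact normalize_spec 𝕂 60 h1 h2 h3

/-- The code of the unknown term of a relation is added to the known ones, if there is only one. -/
def extend (k r : ℕ) (K : List Code) (x : Rule × Code) : List Code :=
  bif x.2.check && (x.2.expr.numP == k && x.2.expr.numR == r) then
    match ((x.1.terms x.2).map normalTerm).filter fun t => !decide (t.2 ∈ K) with
    | [] => K
    | t :: ts => bif ts.all (fun t' => decide (t'.2 = t.2)) &&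
        decide (((t :: ts).map Prod.fst).sum ≠ 0) then t.2 :: K else K
  else K

/-- The discarded terms are known to lie in `W`, so membership of the sum is not affected. -/
theorem sum_filter_mem {W : Submodule 𝕂 (ComponentFamily 𝕂 2)} {K : List Code}
    (hK : ∀ c ∈ K, skewFamily 𝕂 c.expr ∈ W) (ts : List (ℤ × Code))
    (h : (ts.map fun t => (t.1 : 𝕂) • skewFamily 𝕂 t.2.expr).sum ∈ W) :
    ((ts.filter fun t => !decide (t.2 ∈ K)).map fun t =>
      (t.1 : 𝕂) • skewFamily 𝕂 t.2.expr).sum ∈ W := by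
  induction ts generalizing W with
  | nil => simp
  | cons t ts ih =>
    suffices hs : (((t :: ts).filter fun t => !decide (t.2 ∈ K)).map fun t =>
        (t.1 : 𝕂) • skewFamily 𝕂 t.2.expr).sum
        - ((t :: ts).map fun t => (t.1 : 𝕂) • skewFamily 𝕂 t.2.expr).sum ∈ W by
      have := Submodule.add_mem _ hs h
      rwa [sub_add_cancel] at this
    clear ih h
    generalize t :: ts = l
    induction l with
    | nil => simp
    | cons t ts ih =>
      rw [List.filter_cons]
      by_cases ht : t.2 ∈ K
      · simp only [ht, decide_true, Bool.not_true, Bool.false_eq_true, if_false, List.map_cons,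
          List.sum_cons]
        rw [show ∀ a b c : ComponentFamily 𝕂 2, a - (b + c) = (a - c) - b from
          fun a b c => by abel]
        exact Submodule.sub_mem _ ih (Submodule.smul_mem _ _ (hK _ ht))
      · simp only [ht, decide_false, Bool.not_false, if_true, List.map_cons, List.sum_cons]
        rwa [add_sub_add_left_eq_sub]

/-- A relation in which all unknown terms have the same code, with a nonzero total coefficient, can
be solved for that code modulo `W`. -/
theorem extend_spec {k r : ℕ} {W : Submodule 𝕂 (ComponentFamily 𝕂 2)}
    (hW : exprSpan 𝕂 k (r + 1) ≤ W) {K : List Code}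
    (hK : ∀ c ∈ K, skewFamily 𝕂 c.expr ∈ W) (x : Rule × Code) :
    ∀ c ∈ extend k r K x, skewFamily 𝕂 c.expr ∈ W := by
  rw [extend]
  cases hc : x.2.check && (x.2.expr.numP == k && x.2.expr.numR == r) with
  | false => exact hK
  | true =>
    simp only [Bool.and_eq_true, beq_iff_eq] at hc
    obtain ⟨h1, h2, h3⟩ := hc
    have hrel := x.1.skewRel_terms 𝕂 x.2 (Code.wf_of_check h1)
    rw [h2, h3] at hrel
    have hsum : (((x.1.terms x.2).map normalTerm).map fun t =>
        (t.1 : 𝕂) • skewFamily 𝕂 t.2.expr).sum ∈ W := by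
      -- Bringing the terms of the relation to normal form changes the sum only by elements with
      -- more curvature.
      have hd : ∀ ts : List (ℤ × Expr), (∀ t ∈ ts, t.2.WF 2 ∧ t.2.numP = k ∧ t.2.numR = r) →
          (ts.map fun t => (t.1 : 𝕂) • skewFamily 𝕂 t.2).sum
            - ((ts.map normalTerm).map fun t => (t.1 : 𝕂) • skewFamily 𝕂 t.2.expr).sum ∈ W := by
        intro ts hts
        induction ts with
        | nil => simp
        | cons t ts ih =>
          obtain ⟨w1, w2, w3⟩ := hts t (by simp)
          have h4 := normalTerm_spec 𝕂 t w1
          rw [w2, w3] at h4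
          simp only [List.map_cons, List.sum_cons]
          rw [add_sub_add_comm]
          exact Submodule.add_mem _ (hW h4) (ih fun t ht => hts t (by simp [ht]))
      have h5 := Submodule.sub_mem _ (hW hrel.mem) (hd _ hrel.wf)
      rwa [sub_sub_cancel] at h5
    have hfil := sum_filter_mem 𝕂 hK _ hsum
    rw [cond_true]
    split
    · exact hK
    · rename_i t ts he
      rw [he] at hfil
      cases hb : ts.all (fun t' => decide (t'.2 = t.2)) &&
        decide (((t :: ts).map Prod.fst).sum ≠ 0) with
      | false => exact hK
      | true =>
        rw [Bool.and_eq_true, List.all_eq_true, decide_eq_true_iff] at hb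
        obtain ⟨h6, h7⟩ := hb
        refine List.forall_mem_cons.2 ⟨?_, hK⟩
        have h8 : ∀ us : List (ℤ × Code), (∀ u ∈ us, u.2 = t.2) →
            (us.map fun t => (t.1 : 𝕂) • skewFamily 𝕂 t.2.expr).sum
              = ((us.map Prod.fst).sum : ℤ) • skewFamily 𝕂 t.2.expr := by
          intro us hus
          induction us with
          | nil => simp
          | cons u us ih =>
            rw [List.map_cons, List.sum_cons, List.map_cons, List.sum_cons,
              ih fun u hu => hus u (by simp [hu]), hus u (by simp), add_smul, Int.cast_smul_eq_zsmul]
        rw [h8 _ (List.forall_mem_cons.2 ⟨rfl, fun u hu => by simpa using h6 u hu⟩)] at hfil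
        -- Characteristic zero: a nonzero integer is invertible in `𝕂`.
        have h9 : ((((t :: ts).map Prod.fst).sum : ℤ) : 𝕂) ≠ 0 := Int.cast_ne_zero.2 h7
        rw [← Int.cast_smul_eq_zsmul 𝕂] at hfil
        have := Submodule.smul_mem _ ((((t :: ts).map Prod.fst).sum : ℤ) : 𝕂)⁻¹ hfil
        rwa [smul_smul, inv_mul_cancel₀ h9, one_smul] at this

theorem foldl_extend_spec {k r : ℕ} {W : Submodule 𝕂 (ComponentFamily 𝕂 2)}
    (hW : exprSpan 𝕂 k (r + 1) ≤ W) (xs : List (Rule × Code)) {K : List Code}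
    (hK : ∀ c ∈ K, skewFamily 𝕂 c.expr ∈ W) :
    ∀ c ∈ xs.foldl (extend k r) K, skewFamily 𝕂 c.expr ∈ W := by
  induction xs generalizing K with
  | nil => exact hK
  | cons x xs ih => exact ih (extend_spec 𝕂 hW hK x)

/-! ### A generating set -/

/-- The possible lists of factors, with three factors `∇^m P` and `r` factors `∇^m R`. -/
def shapes : ℕ → List (List Factor)
  | 0 => [[.P 4, .P 0, .P 0], [.P 3, .P 1, .P 0], [.P 2, .P 2, .P 0], [.P 2, .P 1, .P 1]]
  | 1 => [[.P 0, .P 0, .P 0, .R 2], [.P 1, .P 0, .P 0, .R 1], [.P 2, .P 0, .P 0, .R 0],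
      [.P 1, .P 1, .P 0, .R 0]]
  | 2 => [[.P 0, .P 0, .P 0, .R 0, .R 0]]
  | _ => []

/-- An abbreviation: `m < 5` stands for `∇^m P`, and `5 + k` for `∇^k R`. -/
def Factor.ofNat (n : ℕ) : Factor := bif Nat.blt n 5 then Factor.P n else Factor.R (n - 5)

/-- The code with factors given by numbers. -/
def Code.of (x : List ℕ × List ℕ) : Code := (x.1.map Factor.ofNat, x.2)

/-- A function of a natural number, with a numeral for small numbers. -/
def forceNat {α : Type} (n : ℕ) (k : ℕ → α) : α :=
  bif Nat.beq n (nat_lit 0) then k (nat_lit 0) else bif Nat.beq n (nat_lit 1) then k (nat_lit 1) else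
  bif Nat.beq n (nat_lit 2) then k (nat_lit 2) else bif Nat.beq n (nat_lit 3) then k (nat_lit 3) else
  bif Nat.beq n (nat_lit 4) then k (nat_lit 4) else bif Nat.beq n (nat_lit 5) then k (nat_lit 5) else
  bif Nat.beq n (nat_lit 6) then k (nat_lit 6) else bif Nat.beq n (nat_lit 7) then k (nat_lit 7) else
  bif Nat.beq n (nat_lit 8) then k (nat_lit 8) else k n

/-- Prepend the last `k` decimal digits of a number, without its first digit, to a list. -/
def digitsAux : ℕ → ℕ → List ℕ → List ℕ
  | 0, _, l => l
  | k + 1, n, l => bif Nat.blt n 10 then l else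
    forceNat (n % 10) fun d => digitsAux k (n / 10) (d :: l)

/-- The decimal digits of a number, without the first one. -/
def digits (n : ℕ) : List ℕ := digitsAux 20 n []

/-- The numbers of the factors and the variables which are encoded by a list. -/
def splitCode (r : ℕ) (l : List ℕ) : List ℕ × List ℕ := (l.take (r + 3), l.drop (r + 3))

/-- The rules which are used, numbered. -/
def Rule.ofNat : ℕ → Rule
  | 0 => .swap
  | 1 => .bianchi
  | 2 => .bianchi₂
  | 3 => .jacobi
  | 4 => .jacobiDeriv
  | 5 => .move (.val 0 (-1))
  | 6 => .move (.val 2 (-1))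
  | n => .move (.val (n - 5) 1)

/-- The codes of a generating set of the cochains, according to the number of factors `∇^m R`, as
sequences of digits after a digit 1. -/
def basisNumbers : ℕ → List ℕ
  | 0 => [
    1211051234, 1220041235, 1211012534, 1211450213]
  | 1 => [
    111054501362, 111050614352, 110064506132, 111054605231, 111050346251, 111050415263,
    111050145362, 111050126453, 120054506123, 110060425361, 110060426351, 100070426351,
    111053402561, 111053645012, 110063401562, 111050345162, 111050612453, 111050426351,
    120050426351, 120050124563, 110064605231, 110063604251, 110060413562, 110060416352,
    120050416253, 111050426153, 120054601253, 120050614253, 110060136452, 111053624051]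
  | 2 => [
    10005505172364, 10005504235671, 10005505273614, 10005502356714, 10005524356701, 10005507253461,
    10005504152673, 10005502174563, 10005505123674, 10005501254673, 10005505264713, 10005501245673,
    10005527354601, 10005501274563]
  | _ => []

/-- The codes of a generating set of the cochains. -/
def basisCodes (r : ℕ) : List (List ℕ × List ℕ) :=
  (basisNumbers r).map fun n => splitCode r (digits n)

/-- The relations by which the other codes are expressed by those of the generating set: the digits
of the rule and of the first code of the relation, after a digit 1. -/
def certificate : ℕ → List ℕ
  | 0 => [
    13013523401, 19220012345, 17220452301, 17310052314, 17400012345, 17220450123, 17211052314,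
    19220450213, 10112451203, 18310051234, 10220450213, 17211452301, 17211450123, 10112145203]
  | 1 => [
    1700070623451, 1720050423561, 1720054506231, 1720050623451, 1170001062345, 1720050624351,
    1720054605231, 1270001062435, 1011053425061, 1151105240163, 1011050146253, 1301151204563,
    1151106042315, 1011050145263, 1011050645123, 1151105230416, 1011050416253, 1301151245063,
    1011054506123, 1151106240315, 1011054605123, 1161006350412, 1510064603152, 1261006340512,
    1261006350412, 1510064503162, 1161006230415, 1011050456231, 1151101042356, 1151101240356,
    1301153245061, 1011050624351, 1011050346251, 1151101062354, 1301156203451, 1011053645021,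
    1301153205461, 1151101245306, 1011050345261, 1301151256043, 1011050416352, 1011050415263,
    1011054501263, 1301156245013, 1011054601253, 1011050126453, 1151106015234, 1151105640123,
    1520054506123, 1152006240315, 1152006230514, 1301065204361, 1161001340625, 1261001340625,
    1161001230645, 1301064206351, 1261001056234, 1261001036524, 1161001026345, 1261001026345,
    1270001042635, 1270001023456, 1170001042536, 1011050324561, 1151101065423, 1011053602451,
    1011054526013, 1151106235401, 1151105642301, 1161006230145, 1261006350124, 1261006230145,
    1151105062413, 1011050345162, 1151106240513, 1011050316452, 1151106021534, 1011050412563,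
    1151101025463, 1011050425361, 1301156234051, 1411055304261, 1152001240563, 1720050425361,
    1152006015423, 1411051306452, 1411054301562, 1161001350462, 1261001230564, 1301066234051,
    1261001250364, 1261001230465, 1161006031245, 1261006051234, 1261006021534, 1161006021345,
    1161006031425, 1411050345162, 1011053405162, 1011050426153, 1151105640213, 1151106025314,
    1411056345012, 1411056304152, 1261006012534, 1151101625304]
  | 2 => [
    115000560517234, 105500064051723, 150005505172364, 105500063051724, 105500073041256,
    115000570412563, 115000560715234, 105500063071524, 115000560214573, 105500074021356,
    115000570516234, 115000570456231, 105500071042356, 105500071023456, 115000510567234,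
    115000510756243, 105500013052467, 105500061042357, 105500014052736, 115000570452631,
    160005505273614, 105500014072536, 115000510754623, 105500061042537, 105500061042735,
    105500071052634, 160005505263471, 115000570523461, 105500071052346, 160005524356701,
    115000502345671, 105500001243756, 105500001273456, 115000515674230, 105500013042567,
    115000510425673, 160005507243561, 115000560725341, 105500013024567, 105500061052437,
    115000560574231, 105500061072345, 115000510427563, 105500064071235, 150005502173564,
    105500064021735, 115000560417253, 150005507142563, 115000560712543, 105500063021745,
    150005504152763, 115000570512364, 105500064021537, 105500074021536, 115000560215734,
    115000570215643, 150005502154763, 150005502153764, 105500064012537, 115000570154623,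
    160005501253764, 115000510526473, 105500061023745, 115000560425371, 115000570156234,
    105500064012357, 115000560157234, 160005525374601, 115000515263740, 115000560125374]
  | _ => []

/-- All codes which are known to be expressible by the generating set. -/
def knownCodes (r : ℕ) : List Code :=
  ((certificate r).map fun n => (Rule.ofNat (digits n).headI,
      Code.of (splitCode r (digits n).tail))).foldl (extend 3 r) ((basisCodes r).map Code.of)

-- The finite core of the upper bound. For every list of factors, each code which survives the
-- enumeration is obtained from the generators by solving the certified relations one after the
-- other, so each relation has a single unknown code at its turn.
set_option maxRecDepth 10000 in
theorem candidates_known : ∀ r < 3, (shapes r).all (fun fs => (candidates fs).all fun l =>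
    decide ((fs, l) ∈ knownCodes r)) = true := by
  decide +kernel

theorem totalUpper_eq (fs : List Factor) : totalUpper fs
    = 2 * fs.countP (fun f => match f with | Factor.P _ => true | Factor.R _ => false)
      + fs.countP (fun f => match f with | Factor.P _ => false | Factor.R _ => true) := by
  induction fs with
  | nil => rfl
  | cons f fs ih =>
    rw [List.countP_cons, List.countP_cons, show totalUpper (f :: fs) = f.upper + totalUpper fs by
      simp [totalUpper], ih]
    cases f <;> simp [Factor.upper] <;> omega

theorem length_eq_countP (fs : List Factor) : fs.length
    = fs.countP (fun f => match f with | Factor.P _ => true | Factor.R _ => false)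
      + fs.countP (fun f => match f with | Factor.P _ => false | Factor.R _ => true) := by
  induction fs with
  | nil => rfl
  | cons f fs ih =>
    rw [List.countP_cons, List.countP_cons, List.length_cons, ih]
    cases f <;> simp <;> omega

theorem le_totalLower (fs : List Factor) :
    3 * fs.countP (fun f => match f with | Factor.P _ => false | Factor.R _ => true)
      ≤ totalLower fs := by
  induction fs with
  | nil => simp
  | cons f fs ih =>
    rw [List.countP_cons, show totalLower (f :: fs) = f.lower + totalLower fs by
      simp [totalLower]]
    cases f <;> simp [Factor.lower] <;> omega

/-- With three factors `∇^m P` and `r` factors `∇^m R` there are `6 + r` upper slots, hence `4 + r`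
lower ones, of which `3r` belong to the curvature tensors. So `r ≤ 2` and the number of covariant
derivatives is `4 - 2r`; sorted lists of factors correspond to the ways to distribute them. -/
theorem mem_shapes {fs : List Factor} {r : ℕ} (hs : fs.Pairwise fun f g => f.le g = true)
    (hP : fs.countP (fun f => match f with | Factor.P _ => true | Factor.R _ => false) = 3)
    (hR : fs.countP (fun f => match f with | Factor.P _ => false | Factor.R _ => true) = r)
    (ht : totalUpper fs = 2 + totalLower fs) : r < 3 ∧ fs ∈ shapes r := by
  have h1 := totalUpper_eq fs
  have h2 := length_eq_countP fs
  have h3 := le_totalLower fs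
  rw [hP, hR] at h1 h2
  rw [hR] at h3
  have hr : r < 3 := by omega
  refine ⟨hr, ?_⟩
  interval_cases r
  · obtain ⟨f, g, h, rfl⟩ := List.length_eq_three.1 h2
    rcases f with a | a <;> rcases g with b | b <;> rcases h with c | c <;> simp at hR
    simp [totalUpper, totalLower, Factor.upper, Factor.lower, Factor.le] at ht hs
    have : (a = 4 ∧ b = 0 ∧ c = 0) ∨ (a = 3 ∧ b = 1 ∧ c = 0) ∨ (a = 2 ∧ b = 2 ∧ c = 0) ∨
      (a = 2 ∧ b = 1 ∧ c = 1) := by omega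
    rcases this with ⟨rfl, rfl, rfl⟩ | ⟨rfl, rfl, rfl⟩ | ⟨rfl, rfl, rfl⟩ | ⟨rfl, rfl, rfl⟩ <;>
      simp [shapes]
  · match fs, h2 with
    | [f, g, h, i], _ =>
      rcases f with a | a <;> rcases g with b | b <;> rcases h with c | c <;>
        rcases i with d | d <;> simp [Factor.le] at hR hP hs
      simp [totalUpper, totalLower, Factor.upper, Factor.lower] at ht
      have : (a = 0 ∧ b = 0 ∧ c = 0 ∧ d = 2) ∨ (a = 1 ∧ b = 0 ∧ c = 0 ∧ d = 1) ∨
        (a = 2 ∧ b = 0 ∧ c = 0 ∧ d = 0) ∨ (a = 1 ∧ b = 1 ∧ c = 0 ∧ d = 0) := by omega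
      rcases this with ⟨rfl, rfl, rfl, rfl⟩ | ⟨rfl, rfl, rfl, rfl⟩ | ⟨rfl, rfl, rfl, rfl⟩ |
        ⟨rfl, rfl, rfl, rfl⟩ <;> simp [shapes]
  · match fs, h2 with
    | [f, g, h, i, j], _ =>
      rcases f with a | a <;> rcases g with b | b <;> rcases h with c | c <;>
        rcases i with d | d <;> rcases j with e | e <;> simp [Factor.le] at hR hP hs
      simp [totalUpper, totalLower, Factor.upper, Factor.lower] at ht
      have : a = 0 ∧ b = 0 ∧ c = 0 ∧ d = 0 ∧ e = 0 := by omega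
      obtain ⟨rfl, rfl, rfl, rfl, rfl⟩ := this
      simp [shapes]

theorem numP_eq_countP (E : Expr) : E.numP = (E.map Atom.f).countP
    (fun f => match f with | Factor.P _ => true | Factor.R _ => false) := by
  rw [List.countP_map]; rfl

theorem numR_eq_countP (E : Expr) : E.numR = (E.map Atom.f).countP
    (fun f => match f with | Factor.P _ => false | Factor.R _ => true) := by
  rw [List.countP_map]; rfl

variable (𝕂 : Type) [RCLike 𝕂]

/-- The span of the generating set. -/
def basisSpan : Submodule 𝕂 (ComponentFamily 𝕂 2) :=
  Submodule.span 𝕂 {c | ∃ x ∈ basisCodes 0 ++ basisCodes 1 ++ basisCodes 2,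
    c = skewFamily 𝕂 (Code.of x).expr}

/-- One step of the filtration: an expression is reduced to the generators with the same number of
curvature factors, up to expressions with more of them. -/
theorem skewFamily_mem_sup {E : Expr} (h : E.WF 2) (hP : E.numP = 3) :
    skewFamily 𝕂 E ∈ basisSpan 𝕂 ⊔ exprSpan 𝕂 3 (E.numR + 1) := by
  obtain ⟨w1, w2, w3, w4⟩ := toCode_spec 𝕂 h
  have hlen := length_toCode h.ok
  have hsort := sorted_toCode E
  generalize toCode E = c at *
  obtain ⟨fs, l⟩ := c
  simp only at *
  have hups := ups_build fs 2 l
  rw [← hlen, List.take_length] at hups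
  have ht : totalUpper fs = 2 + totalLower fs := by
    have := w1.perm.length_eq
    rw [hups, lows_build] at this
    simp at this; omega
  have hcount : ∀ l, (build fs 2 l).numP = 3 ∧ (build fs 2 l).numR = E.numR := fun l' => by
    rw [numP_eq_countP, numR_eq_countP, build_map_f, ← hP, ← w2, ← w3, numP_eq_countP,
      numR_eq_countP, build_map_f]
    exact ⟨rfl, rfl⟩
  have hc := hcount []
  rw [numP_eq_countP, numR_eq_countP, build_map_f] at hc
  obtain ⟨hr, hfs⟩ := mem_shapes hsort hc.1 hc.2 ht
  rw [← w4]
  -- At most eight upper slots occur; the bound keeps the labels below the base 16 of the encoding.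
  have hU : totalUpper fs ≤ 15 := by
    rw [totalUpper_eq, hc.1, hc.2]; omega
  refine skewFamily_mem_of_candidates hU _ (fun l => ?_) (fun l' hl' _ => ?_) hlen w1
  · rw [(hcount l).1, (hcount l).2]; exact le_sup_right
  · have hk := List.all_eq_true.1 (candidates_known _ hr) fs hfs
    have hk := List.all_eq_true.1 hk l' hl'
    rw [decide_eq_true_iff, knownCodes] at hk
    refine foldl_extend_spec 𝕂 le_sup_right _ (K := (basisCodes E.numR).map Code.of) ?_ _ hk
    intro c hc
    obtain ⟨x, hx, rfl⟩ := List.mem_map.1 hc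
    refine Submodule.mem_sup_left (Submodule.subset_span ⟨x, ?_, rfl⟩)
    generalize E.numR = r at hr hx
    interval_cases r <;> simp only [List.mem_append] <;> tauto

theorem numR_lt_three {E : Expr} (h : E.WF 2) (hP : E.numP = 3) : E.numR < 3 := by
  have h1 := totalUpper_eq (E.map Atom.f)
  have h2 := le_totalLower (E.map Atom.f)
  rw [← numP_eq_countP, ← numR_eq_countP] at h1
  rw [← numR_eq_countP] at h2
  have h3 : totalUpper (E.map Atom.f) = E.ups.length := by
    rw [Expr.ups, List.length_flatMap, totalUpper, List.map_map]
    exact congrArg List.sum (List.map_congr_left fun A hA => (h.ok A hA).2.symm)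
  have h4 : totalLower (E.map Atom.f) = E.lows.length := by
    rw [Expr.lows, List.length_flatMap, totalLower, List.map_map]
    exact congrArg List.sum (List.map_congr_left fun A hA => (h.ok A hA).1.symm)
  have := h.perm.length_eq
  simp at this
  omega

/-- Descending induction on the number of curvature factors, which starts because there is no
expression of degree 3 with three of them. -/
theorem exprSpan_le_basisSpan : exprSpan 𝕂 3 0 ≤ basisSpan 𝕂 := by
  have h3 : exprSpan 𝕂 3 3 ≤ basisSpan 𝕂 := Submodule.span_le.2 (by
    rintro _ ⟨E, hE, hP, hR, rfl⟩
    have := numR_lt_three hE hP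
    omega)
  have step : ∀ r, exprSpan 𝕂 3 (r + 1) ≤ basisSpan 𝕂 → exprSpan 𝕂 3 r ≤ basisSpan 𝕂 := by
    intro r hr
    refine Submodule.span_le.2 ?_
    rintro _ ⟨E, hE, hP, hR, rfl⟩
    rcases hR.eq_or_lt with rfl | hR
    · have := skewFamily_mem_sup 𝕂 hE hP
      rwa [sup_eq_left.2 hr] at this
    · exact hr (skewFamily_mem_exprSpan 𝕂 hE hP hR)
  exact step 0 (step 1 (step 2 h3))

theorem mem_basisSpan_of_mem_cochains {c : SmoothFamily 𝕂 2} (hc : c ∈ cochains 𝕂 2 3) :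
    c.1 ∈ basisSpan 𝕂 :=
  exprSpan_le_basisSpan 𝕂 (mem_exprSpan_of_mem_cochains 𝕂 hc)

/-! ### Polynomial tensors -/

/-- A term of a tensor with polynomial components: a coefficient and a monomial (a list of indices
of coordinates) in the component with given lower and upper indices. -/
structure PolyTerm where
  lo : List ℕ
  up : List ℕ
  c : ℤ
  m : List ℕ

/-- The value of a monomial. -/
def mono {n : ℕ} (y : EuclideanSpace ℝ (Fin n)) (m : List ℕ) : ℝ :=
  (m.map fun v => if h : v < n then y ⟨v, h⟩ else 0).prod

/-- The partial derivatives of a monomial: pairs of a coordinate and a monomial. -/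
def monoDeriv : List ℕ → List (ℕ × List ℕ)
  | [] => []
  | v :: m => (v, m) :: (monoDeriv m).map fun x => (x.1, v :: x.2)

/-- The components of the tensor with given terms. -/
def polyEval {n : ℕ} (T : List PolyTerm) (L U : List ℕ) (y : EuclideanSpace ℝ (Fin n)) : ℝ :=
  (T.map fun t => if t.lo = L ∧ t.up = U then (t.c : ℝ) * mono y t.m else 0).sum

section

variable {n : ℕ} (y : EuclideanSpace ℝ (Fin n)) (L U : List ℕ)

theorem mono_append (m m' : List ℕ) : mono y (m ++ m') = mono y m * mono y m' := by
  simp [mono]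

theorem contDiff_coord (v : ℕ) : ContDiff ℝ ∞ fun y : EuclideanSpace ℝ (Fin n) =>
    if h : v < n then y ⟨v, h⟩ else 0 := by
  by_cases h : v < n
  · simp only [h, dif_pos]
    exact (EuclideanSpace.proj (𝕜 := ℝ) (⟨v, h⟩ : Fin n)).contDiff
  · simp only [h, dif_neg, not_false_eq_true]
    exact contDiff_const

theorem contDiff_mono (m : List ℕ) : ContDiff ℝ ∞ fun y : EuclideanSpace ℝ (Fin n) => mono y m := by
  induction m with
  | nil => exact contDiff_const
  | cons v m ih =>
    simp only [mono, List.map_cons, List.prod_cons] at ih ⊢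
    exact (contDiff_coord v).mul ih

theorem pd_coord (v : ℕ) (l : Fin n) : pd l (fun y : EuclideanSpace ℝ (Fin n) =>
    if h : v < n then y ⟨v, h⟩ else 0) y = if v = l then 1 else 0 := by
  by_cases h : v < n
  · simp only [h, dif_pos]
    have h1 : HasFDerivAt (fun y : EuclideanSpace ℝ (Fin n) => y ⟨v, h⟩)
        (EuclideanSpace.proj (𝕜 := ℝ) (⟨v, h⟩ : Fin n)) y :=
      (EuclideanSpace.proj (𝕜 := ℝ) (⟨v, h⟩ : Fin n)).hasFDerivAt
    rw [pd, h1.fderiv]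
    simp [Fin.ext_iff]
  · simp only [h, dif_neg, not_false_eq_true]
    rw [if_neg (by have := l.2; omega)]
    simp [pd]

theorem pd_mono (m : List ℕ) (l : Fin n) : pd l (fun y => mono y m) y
    = ((monoDeriv m).map fun x => if x.1 = (l : ℕ) then mono y x.2 else 0).sum := by
  induction m with
  | nil => simp [mono, monoDeriv, pd]
  | cons v m ih =>
    have h1 := (contDiff_coord (n := n) v).differentiable (by simp) y
    have h2 := (contDiff_mono (n := n) m).differentiable (by simp) y
    have h3 := pd_fun_mul (l := l) h1 h2
    have h4 : (fun y : EuclideanSpace ℝ (Fin n) => mono y (v :: m))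
        = fun y => (if h : v < n then y ⟨v, h⟩ else 0) * mono y m := by
      funext y; simp [mono]
    rw [h4, h3, pd_coord, ih, monoDeriv, List.map_cons, List.sum_cons, List.map_map,
      ← List.sum_map_mul_left]
    congr 1
    · simp
    · refine congrArg List.sum (List.map_congr_left fun x _ => ?_)
      simp [mono]

@[simp] theorem polyEval_nil : polyEval [] L U y = 0 := rfl

@[simp] theorem polyEval_cons (t : PolyTerm) (T : List PolyTerm) : polyEval (t :: T) L U y
    = (if t.lo = L ∧ t.up = U then (t.c : ℝ) * mono y t.m else 0) + polyEval T L U y := rfl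

@[simp] theorem polyEval_append (T T' : List PolyTerm) :
    polyEval (T ++ T') L U y = polyEval T L U y + polyEval T' L U y := by
  simp [polyEval]

theorem polyEval_flatMap {α : Type*} (l : List α) (f : α → List PolyTerm) :
    polyEval (l.flatMap f) L U y = (l.map fun x => polyEval (f x) L U y).sum := by
  induction l with
  | nil => rfl
  | cons x l ih => rw [List.flatMap_cons, polyEval_append, ih, List.map_cons, List.sum_cons]

theorem polyEval_map {α : Type*} (l : List α) (f : α → PolyTerm) :
    polyEval (l.map f) L U y = (l.map fun x =>
      if (f x).lo = L ∧ (f x).up = U then ((f x).c : ℝ) * mono y (f x).m else 0).sum := by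
  rw [polyEval, List.map_map]; rfl

theorem contDiff_polyEval (T : List PolyTerm) :
    ContDiff ℝ ∞ fun y : EuclideanSpace ℝ (Fin n) => polyEval T L U y := by
  induction T with
  | nil => exact contDiff_const
  | cons t T ih =>
    simp only [polyEval_cons]
    refine ContDiff.add ?_ ih
    split_ifs
    exacts [contDiff_const.mul (contDiff_mono _), contDiff_const]

/-- Equality of lists of natural numbers. -/
def sameList : List ℕ → List ℕ → Bool
  | [], [] => true
  | a :: l, b :: l' => Nat.beq a b && sameList l l'
  | _, _ => false

theorem sameList_iff {l l' : List ℕ} : sameList l l' = true ↔ l = l' := by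
  induction l generalizing l' with
  | nil => cases l' <;> simp [sameList]
  | cons a l ih => cases l' <;> simp [sameList, ih]

/-- Equality of the indices and monomials of two terms. -/
def PolyTerm.same (s t : PolyTerm) : Bool :=
  sameList s.m t.m && (sameList s.lo t.lo && sameList s.up t.up)

theorem PolyTerm.same_iff {s t : PolyTerm} :
    s.same t = true ↔ s.lo = t.lo ∧ s.up = t.up ∧ s.m = t.m := by
  simp only [same, Bool.and_eq_true, sameList_iff]
  tauto

/-- A term is added, and combined with a term with the same indices and monomial. -/
def insertTerm (t : PolyTerm) : List PolyTerm → List PolyTerm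
  | [] => [t]
  | s :: T => bif s.same t then
      (if s.c + t.c = 0 then T else ⟨s.lo, s.up, s.c + t.c, s.m⟩ :: T) else s :: insertTerm t T

theorem insertTerm_cons (t s : PolyTerm) (T : List PolyTerm) : insertTerm t (s :: T)
    = if s.lo = t.lo ∧ s.up = t.up ∧ s.m = t.m then
      (if s.c + t.c = 0 then T else ⟨s.lo, s.up, s.c + t.c, s.m⟩ :: T) else s :: insertTerm t T := by
  rw [insertTerm]
  by_cases h : s.same t = true
  · rw [if_pos (PolyTerm.same_iff.1 h), h, cond_true]
  · rw [if_neg fun h' => h (PolyTerm.same_iff.2 h'), Bool.not_eq_true _ |>.mp h, cond_false]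

/-- Combination of equal terms. -/
def collect (T : List PolyTerm) : List PolyTerm := T.foldr insertTerm []

theorem polyEval_insertTerm (t : PolyTerm) (T : List PolyTerm) :
    polyEval (insertTerm t T) L U y = polyEval (t :: T) L U y := by
  induction T with
  | nil => rfl
  | cons s T ih =>
    rw [insertTerm_cons]
    split_ifs with h h0
    · obtain ⟨h1, h2, h3⟩ := h
      have h0' : (t.c : ℝ) = - s.c := by
        rw [eq_neg_iff_add_eq_zero, add_comm]; exact_mod_cast h0
      simp only [polyEval_cons, h1, h2, h3, h0']
      split_ifs <;> ring
    · obtain ⟨h1, h2, h3⟩ := h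
      simp only [polyEval_cons, h1, h2, h3]
      push_cast
      split_ifs <;> ring
    · rw [polyEval_cons, ih, polyEval_cons, polyEval_cons, polyEval_cons]; ring

@[simp] theorem polyEval_collect (T : List PolyTerm) :
    polyEval (collect T) L U y = polyEval T L U y := by
  induction T with
  | nil => rfl
  | cons t T ih =>
    rw [collect, List.foldr_cons, polyEval_insertTerm, polyEval_cons, polyEval_cons, ← ih, collect]

/-- The terms of the partial derivatives. -/
def PolyTerm.partials (t : PolyTerm) : List PolyTerm :=
  (monoDeriv t.m).map fun x => ⟨x.1 :: t.lo, t.up, t.c, x.2⟩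

theorem pd_polyEval (T : List PolyTerm) (l : Fin n) : pd l (fun y => polyEval T L U y) y
    = polyEval (T.flatMap PolyTerm.partials) ((l : ℕ) :: L) U y := by
  induction T with
  | nil => simp [pd]
  | cons t T ih =>
    have h1 : DifferentiableAt ℝ (fun y : EuclideanSpace ℝ (Fin n) =>
        if t.lo = L ∧ t.up = U then (t.c : ℝ) * mono y t.m else 0) y := by
      split_ifs
      exacts [((contDiff_mono (n := n) t.m).differentiable (by simp) y).const_mul _,
        differentiableAt_const _]
    have h2 := (contDiff_polyEval (n := n) L U T).differentiable (by simp) y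
    simp only [polyEval_cons, List.flatMap_cons, polyEval_append]
    rw [pd_fun_add h1 h2, ih, PolyTerm.partials, polyEval_map]
    congr 1
    by_cases h : t.lo = L ∧ t.up = U
    · simp only [if_pos h]
      rw [pd_fun_const_mul _ ((contDiff_mono (n := n) t.m).differentiable (by simp) y), pd_mono,
        ← List.sum_map_mul_left]
      refine congrArg List.sum (List.map_congr_left fun x _ => ?_)
      simp [h.1, h.2]
    · simp only [if_neg h]
      rw [show pd l (fun _ : EuclideanSpace ℝ (Fin n) => (0 : ℝ)) y = 0 by simp [pd], eq_comm]
      refine (List.sum_eq_zero ?_)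
      simp only [List.mem_map]
      rintro _ ⟨x, _, rfl⟩
      rw [if_neg]
      rintro ⟨h1, h2⟩
      exact h ⟨(List.cons.inj h1).2, h2⟩

end

/-! ### Covariant derivatives and curvature of polynomial tensors. -/

/-- A term of the Christoffel symbols `Γ_{ij}^k`. -/
structure ConnTerm where
  i : ℕ
  j : ℕ
  k : ℕ
  c : ℤ
  m : List ℕ

/-- The Christoffel symbols as a polynomial tensor. -/
def ConnTerm.term (g : ConnTerm) : PolyTerm := ⟨[g.i, g.j], [g.k], g.c, g.m⟩

/-- The terms of the covariant derivative from a lower index. -/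
def lowTerms (g : ConnTerm) (t : PolyTerm) : List PolyTerm :=
  (List.range t.lo.length).flatMap fun s => bif t.lo.getD s 0 == g.k then
    [⟨g.i :: t.lo.set s g.j, t.up, -(t.c * g.c), g.m ++ t.m⟩] else []

/-- The terms of the covariant derivative from an upper index. -/
def upTerms (g : ConnTerm) (t : PolyTerm) : List PolyTerm :=
  (List.range t.up.length).flatMap fun s => bif t.up.getD s 0 == g.j then
    [⟨g.i :: t.lo, t.up.set s g.k, t.c * g.c, g.m ++ t.m⟩] else []

/-- The covariant derivative of a polynomial tensor. -/
def polyCov (G : List ConnTerm) (T : List PolyTerm) : List PolyTerm :=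
  T.flatMap PolyTerm.partials ++
    (T.flatMap (fun t => G.flatMap fun g => lowTerms g t) ++
      T.flatMap fun t => G.flatMap fun g => upTerms g t)

/-- In the formula for the covariant derivative, the component is given and the entry `s` of its
index is replaced; in the list of terms, a given term is sent to the component to which it
contributes. This equivalence translates one description into the other. -/
theorem set_eq_iff {l l' : List ℕ} {s a b : ℕ} (hs : s < l.length) :
    (b = l.getD s 0 ∧ l' = l.set s a) ↔ (l'.length = l.length ∧ l'.getD s 0 = a ∧ l'.set s b = l) := by
  constructor
  · rintro ⟨rfl, rfl⟩
    refine ⟨by simp, ?_, ?_⟩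
    · rw [List.getD_eq_getElem _ _ (by simpa using hs), List.getElem_set_self]
    · rw [List.set_set, List.getD_eq_getElem _ _ hs, List.set_getElem_self]
  · rintro ⟨h0, rfl, rfl⟩
    rw [List.length_set] at hs
    refine ⟨?_, ?_⟩
    · rw [List.getD_eq_getElem _ _ (by simpa using hs), List.getElem_set_self]
    · rw [List.set_set, List.getD_eq_getElem _ _ hs, List.set_getElem_self]

theorem sum_range_eq {b : ℕ} (f : ℕ → ℝ) :
    ((List.range b).map f).sum = ∑ s : Fin b, f s := by
  rw [← List.sum_ofFn, List.ofFn_eq_map]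
  refine congrArg List.sum ?_
  refine List.ext_getElem (by simp) fun i h1 h2 => by simp

theorem ofFn_update {n b : ℕ} (L : Fin b → Fin n) (s : Fin b) (e : Fin n) :
    (List.ofFn fun r => (Function.update L s e r : ℕ)) = (List.ofFn fun r => (L r : ℕ)).set s e := by
  refine List.ext_getElem (by simp) fun i h1 h2 => ?_
  rw [List.getElem_ofFn, List.getElem_set, List.getElem_ofFn]
  by_cases h : (s : ℕ) = i
  · subst h; simp
  · rw [if_neg h, Function.update_of_ne fun h' => h (by rw [← h'])]

section

variable {n : ℕ} (y : EuclideanSpace ℝ (Fin n))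

/-- A single term of the connection forces the summation index to be `g.k`, so the inner sum
collapses. The bound on `g.k` makes this a legitimate value of the summation index. -/
theorem polyEval_lowTerms {b : ℕ} (g : ConnTerm) (hk : g.k < n) (t : PolyTerm) (L₀ : ℕ)
    (L : Fin b → Fin n) (U : List ℕ) :
    polyEval (lowTerms g t) (L₀ :: List.ofFn fun s => (L s : ℕ)) U y
      = - ∑ s : Fin b, ∑ e : Fin n,
        (if g.term.lo = [L₀, (L s : ℕ)] ∧ g.term.up = [(e : ℕ)] then (g.c : ℝ) * mono y g.m else 0)
        * (if t.lo = (List.ofFn fun r => (Function.update L s e r : ℕ)) ∧ t.up = U then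
            (t.c : ℝ) * mono y t.m else 0) := by
  have h1 : ∀ s : Fin b, ∑ e : Fin n,
      (if g.term.lo = [L₀, (L s : ℕ)] ∧ g.term.up = [(e : ℕ)] then (g.c : ℝ) * mono y g.m else 0)
      * (if t.lo = (List.ofFn fun r => (Function.update L s e r : ℕ)) ∧ t.up = U then
          (t.c : ℝ) * mono y t.m else 0)
      = if (g.i = L₀ ∧ t.up = U) ∧ (g.j = (L s : ℕ) ∧ t.lo = (List.ofFn fun r => (L r : ℕ)).set s g.k)
        then (g.c : ℝ) * mono y g.m * (t.c * mono y t.m) else 0 := by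
    intro s
    rw [Finset.sum_eq_single ⟨g.k, hk⟩]
    · simp only [ConnTerm.term, ofFn_update, List.cons.injEq, and_true]
      by_cases c1 : g.i = L₀ <;> by_cases c2 : t.up = U <;> by_cases c3 : g.j = (L s : ℕ) <;>
        by_cases c4 : t.lo = (List.ofFn fun r => (L r : ℕ)).set s g.k <;> simp [c1, c2, c3, c4]
    · intro e _ he
      rw [if_neg, zero_mul]
      rintro ⟨-, h⟩
      apply he
      simp only [ConnTerm.term, List.cons.injEq, and_true] at h
      exact Fin.ext h.symm
    · simp
  simp only [h1]
  rw [lowTerms, polyEval_flatMap]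
  by_cases hb : t.lo.length = b
  · rw [hb, sum_range_eq, ← Finset.sum_neg_distrib]
    refine Finset.sum_congr rfl fun s _ => ?_
    have h2 := set_eq_iff (l := List.ofFn fun r => (L r : ℕ)) (l' := t.lo) (s := s) (a := g.k)
      (b := g.j) (by simp)
    rw [List.getD_eq_getElem _ _ (by simp), List.getElem_ofFn] at h2
    simp only [Fin.eta, List.length_ofFn, hb, true_and] at h2
    simp only [h2]
    by_cases c1 : t.lo.getD s 0 = g.k
    · simp only [c1, beq_self_eq_true, cond_true, polyEval_cons, polyEval_nil, add_zero,
        List.cons.injEq, true_and, mono_append]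
      by_cases c2 : g.i = L₀ <;> by_cases c3 : t.up = U <;>
        by_cases c4 : t.lo.set s g.j = (List.ofFn fun r => (L r : ℕ)) <;> simp [c2, c3, c4] <;> ring
    · have : (t.lo.getD s 0 == g.k) = false := by simpa using c1
      rw [this, if_neg (by tauto)]
      simp
  · rw [List.sum_eq_zero, Finset.sum_eq_zero, neg_zero]
    · intro s _
      rw [if_neg]
      rintro ⟨-, -, h⟩
      apply hb
      rw [h]; simp
    · simp only [List.mem_map]
      rintro _ ⟨s, _, rfl⟩
      cases t.lo.getD s 0 == g.k with
      | false => rfl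
      | true =>
        simp only [cond_true, polyEval_cons, polyEval_nil, add_zero]
        rw [if_neg]
        rintro ⟨h, -⟩
        apply hb
        have := congrArg List.length h
        simpa using this

theorem polyEval_upTerms {b : ℕ} (g : ConnTerm) (hj : g.j < n) (t : PolyTerm) (L₀ : ℕ)
    (L : List ℕ) (U : Fin b → Fin n) :
    polyEval (upTerms g t) (L₀ :: L) (List.ofFn fun s => (U s : ℕ)) y
      = ∑ s : Fin b, ∑ e : Fin n,
        (if g.term.lo = [L₀, (e : ℕ)] ∧ g.term.up = [(U s : ℕ)] then (g.c : ℝ) * mono y g.m else 0)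
        * (if t.lo = L ∧ t.up = (List.ofFn fun r => (Function.update U s e r : ℕ)) then
            (t.c : ℝ) * mono y t.m else 0) := by
  have h1 : ∀ s : Fin b, ∑ e : Fin n,
      (if g.term.lo = [L₀, (e : ℕ)] ∧ g.term.up = [(U s : ℕ)] then (g.c : ℝ) * mono y g.m else 0)
      * (if t.lo = L ∧ t.up = (List.ofFn fun r => (Function.update U s e r : ℕ)) then
          (t.c : ℝ) * mono y t.m else 0)
      = if (g.i = L₀ ∧ t.lo = L) ∧ (g.k = (U s : ℕ) ∧ t.up = (List.ofFn fun r => (U r : ℕ)).set s g.j)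
        then (g.c : ℝ) * mono y g.m * (t.c * mono y t.m) else 0 := by
    intro s
    rw [Finset.sum_eq_single ⟨g.j, hj⟩]
    · simp only [ConnTerm.term, ofFn_update, List.cons.injEq, and_true]
      by_cases c1 : g.i = L₀ <;> by_cases c2 : t.lo = L <;> by_cases c3 : g.k = (U s : ℕ) <;>
        by_cases c4 : t.up = (List.ofFn fun r => (U r : ℕ)).set s g.j <;> simp [c1, c2, c3, c4]
    · intro e _ he
      rw [if_neg, zero_mul]
      rintro ⟨h, -⟩
      apply he
      simp only [ConnTerm.term, List.cons.injEq, and_true] at h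
      exact Fin.ext h.2.symm
    · simp
  simp only [h1]
  rw [upTerms, polyEval_flatMap]
  by_cases hb : t.up.length = b
  · rw [hb, sum_range_eq]
    refine Finset.sum_congr rfl fun s _ => ?_
    have h2 := set_eq_iff (l := List.ofFn fun r => (U r : ℕ)) (l' := t.up) (s := s) (a := g.j)
      (b := g.k) (by simp)
    rw [List.getD_eq_getElem _ _ (by simp), List.getElem_ofFn] at h2
    simp only [Fin.eta, List.length_ofFn, hb, true_and] at h2
    simp only [h2]
    by_cases c1 : t.up.getD s 0 = g.j
    · simp only [c1, beq_self_eq_true, cond_true, polyEval_cons, polyEval_nil, add_zero,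
        List.cons.injEq, true_and, mono_append]
      by_cases c2 : g.i = L₀ <;> by_cases c3 : t.lo = L <;>
        by_cases c4 : t.up.set s g.k = (List.ofFn fun r => (U r : ℕ)) <;> simp [c2, c3, c4] <;> ring
    · have : (t.up.getD s 0 == g.j) = false := by simpa using c1
      rw [this, if_neg (by tauto)]
      simp
  · rw [List.sum_eq_zero, Finset.sum_eq_zero]
    · intro s _
      rw [if_neg]
      rintro ⟨-, -, h⟩
      apply hb
      rw [h]; simp
    · simp only [List.mem_map]
      rintro _ ⟨s, _, rfl⟩
      cases t.up.getD s 0 == g.j with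
      | false => rfl
      | true =>
        simp only [cond_true, polyEval_cons, polyEval_nil, add_zero]
        rw [if_neg]
        rintro ⟨-, h⟩
        apply hb
        have := congrArg List.length h
        simpa using this

theorem polyEval_list_mul {α β : Type*} (A : List α) (B : List β) (f : α → ℝ) (g : β → ℝ) :
    (A.map f).sum * (B.map g).sum = (B.map fun b => (A.map fun a => f a * g b).sum).sum := by
  rw [← List.sum_map_mul_left]
  exact congrArg List.sum (List.map_congr_left fun b _ => (List.sum_map_mul_right ..).symm)

theorem sum_list_sum {ι α : Type*} [Fintype ι] (A : List α) (f : ι → α → ℝ) :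
    ∑ i, (A.map (f i)).sum = (A.map fun a => ∑ i, f i a).sum := by
  induction A with
  | nil => simp
  | cons a A ih => simp only [List.map_cons, List.sum_cons, Finset.sum_add_distrib, ih]

theorem sum_map_neg_list {α : Type*} (A : List α) (f : α → ℝ) :
    (A.map fun a => - f a).sum = - (A.map f).sum := by
  induction A with
  | nil => simp
  | cons a A ih => simp only [List.map_cons, List.sum_cons, ih]; ring

/-- All expressions are bilinear in the terms of the connection and of the tensor, so the
contributions of pairs of terms can be added up. -/
theorem covDeriv_poly {X : ConnManifold} {φ : X.Chart} {G : List ConnTerm}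
    (hG : ∀ g ∈ G, g.j < X.dim ∧ g.k < X.dim)
    (hGΓ : ∀ i j k y, X.christoffel φ i j k y
      = polyEval (G.map ConnTerm.term) [(i : ℕ), (j : ℕ)] [(k : ℕ)] y)
    {a b : ℕ} {T : X.Components b a} {S : List PolyTerm}
    (hT : ∀ L U y, T L U y = polyEval S
      (List.ofFn fun s => (L s : ℕ)) (List.ofFn fun s => (U s : ℕ)) y)
    (L : Fin (b + 1) → Fin X.dim) (U : Fin a → Fin X.dim) (y : X.Model) :
    X.covDeriv φ T L U y
      = polyEval (polyCov G S) (List.ofFn fun s => (L s : ℕ)) (List.ofFn fun s => (U s : ℕ)) y := by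
  unfold ConnManifold.covDeriv
  have h0 : (List.ofFn fun s => (L s : ℕ)) = (L 0 : ℕ) :: List.ofFn fun s => (Fin.tail L s : ℕ) := by
    rw [List.ofFn_succ]; rfl
  rw [h0, polyCov, polyEval_append, polyEval_append, ← add_assoc, sub_eq_add_neg]
  have e1 : pd (L 0) (T (Fin.tail L) U) y = polyEval (S.flatMap PolyTerm.partials)
      ((L 0 : ℕ) :: List.ofFn fun s => (Fin.tail L s : ℕ)) (List.ofFn fun s => (U s : ℕ)) y := by
    rw [← pd_polyEval]
    exact congrArg (fun f => pd (L 0) f y) (funext fun y => hT _ _ y)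
  refine congrArg₂ _ (congrArg₂ _ e1 ?_) ?_
  · rw [polyEval_flatMap]
    have h2 : ∀ t, polyEval (G.flatMap fun g => lowTerms g t)
        ((L 0 : ℕ) :: List.ofFn fun s => (Fin.tail L s : ℕ)) (List.ofFn fun s => (U s : ℕ)) y
        = - (G.map fun g => ∑ s : Fin b, ∑ e : Fin X.dim,
          (if g.term.lo = [(L 0 : ℕ), (Fin.tail L s : ℕ)] ∧ g.term.up = [(e : ℕ)] then
            (g.c : ℝ) * mono y g.m else 0)
          * (if t.lo = (List.ofFn fun r => (Function.update (Fin.tail L) s e r : ℕ)) ∧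
              t.up = (List.ofFn fun s => (U s : ℕ)) then (t.c : ℝ) * mono y t.m else 0)).sum := by
      intro t
      rw [polyEval_flatMap, ← sum_map_neg_list]
      exact congrArg List.sum (List.map_congr_left fun g hg =>
        polyEval_lowTerms y g (hG g hg).2 t _ _ _)
    simp only [h2]
    rw [sum_map_neg_list]
    refine congrArg Neg.neg ?_
    simp only [← sum_list_sum]
    refine Finset.sum_congr rfl fun s _ => Finset.sum_congr rfl fun e _ => ?_
    rw [hGΓ, hT, polyEval, polyEval, List.map_map, polyEval_list_mul]
    rfl
  · rw [polyEval_flatMap]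
    have h2 : ∀ t, polyEval (G.flatMap fun g => upTerms g t)
        ((L 0 : ℕ) :: List.ofFn fun s => (Fin.tail L s : ℕ)) (List.ofFn fun s => (U s : ℕ)) y
        = (G.map fun g => ∑ s : Fin a, ∑ e : Fin X.dim,
          (if g.term.lo = [(L 0 : ℕ), (e : ℕ)] ∧ g.term.up = [(U s : ℕ)] then
            (g.c : ℝ) * mono y g.m else 0)
          * (if t.lo = (List.ofFn fun s => (Fin.tail L s : ℕ)) ∧
              t.up = (List.ofFn fun r => (Function.update U s e r : ℕ)) then
                (t.c : ℝ) * mono y t.m else 0)).sum := by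
      intro t
      rw [polyEval_flatMap]
      exact congrArg List.sum (List.map_congr_left fun g hg =>
        polyEval_upTerms y g (hG g hg).1 t _ _ _)
    simp only [h2]
    simp only [← sum_list_sum]
    refine Finset.sum_congr rfl fun s _ => Finset.sum_congr rfl fun e _ => ?_
    rw [hGΓ, hT, polyEval, polyEval, List.map_map, polyEval_list_mul]
    rfl

end

/-- Exchange of the first two lower indices, with a sign. -/
def PolyTerm.swapLo (t : PolyTerm) : PolyTerm :=
  ⟨match t.lo with
    | a :: b :: l => b :: a :: l
    | l => l, t.up, -t.c, t.m⟩

theorem polyEval_swapLo {n : ℕ} (T : List PolyTerm) (a b : ℕ) (L U : List ℕ)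
    (y : EuclideanSpace ℝ (Fin n)) :
    polyEval (T.map PolyTerm.swapLo) (a :: b :: L) U y = - polyEval T (b :: a :: L) U y := by
  induction T with
  | nil => simp
  | cons t T ih =>
    rw [List.map_cons, polyEval_cons, polyEval_cons, ih, neg_add]
    congr 1
    obtain ⟨lo, up, c, m⟩ := t
    rcases lo with _ | ⟨x, _ | ⟨z, lo⟩⟩ <;> simp [PolyTerm.swapLo]
    by_cases h1 : x = b <;> by_cases h2 : z = a <;> by_cases h3 : lo = L <;> by_cases h4 : up = U <;>
      simp [h1, h2, h3, h4]

/-- The terms of `∑_e Γ_{ie}^l Γ_{jk}^e`. -/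
def connSquare (G : List ConnTerm) : List PolyTerm :=
  G.flatMap fun h => G.flatMap fun g => bif g.j == h.k then
    [⟨[g.i, h.i, h.j], [g.k], g.c * h.c, g.m ++ h.m⟩] else []

theorem polyEval_connSquare {n : ℕ} {G : List ConnTerm} (hG : ∀ g ∈ G, g.j < n)
    (a b c d : ℕ) (y : EuclideanSpace ℝ (Fin n)) :
    polyEval (connSquare G) [a, b, c] [d] y = ∑ e : Fin n,
      polyEval (G.map ConnTerm.term) [a, (e : ℕ)] [d] y
        * polyEval (G.map ConnTerm.term) [b, c] [(e : ℕ)] y := by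
  have h1 : ∀ h : ConnTerm, ∀ g ∈ G, polyEval (bif g.j == h.k then
      [⟨[g.i, h.i, h.j], [g.k], g.c * h.c, g.m ++ h.m⟩] else []) [a, b, c] [d] y
      = ∑ e : Fin n, (if g.term.lo = [a, (e : ℕ)] ∧ g.term.up = [d] then (g.c : ℝ) * mono y g.m else 0)
        * (if h.term.lo = [b, c] ∧ h.term.up = [(e : ℕ)] then (h.c : ℝ) * mono y h.m else 0) := by
    intro h g hg
    rw [Finset.sum_eq_single ⟨g.j, hG g hg⟩]
    · simp only [ConnTerm.term, List.cons.injEq, and_true]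
      by_cases c1 : g.j = h.k
      · simp only [c1, beq_self_eq_true, cond_true, polyEval_cons, polyEval_nil, mono_append]
        by_cases c2 : g.i = a <;> by_cases c3 : h.i = b <;> by_cases c4 : h.j = c <;>
          by_cases c5 : g.k = d <;> simp [c2, c3, c4, c5]
        ring
      · have : (g.j == h.k) = false := by simpa using c1
        rw [this]
        simp [Ne.symm c1]
    · intro e _ he
      rw [if_neg, zero_mul]
      rintro ⟨h, -⟩
      apply he
      simp only [ConnTerm.term, List.cons.injEq, and_true] at h
      exact Fin.ext h.2.symm
    · simp
  rw [connSquare, polyEval_flatMap]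
  have h2 : ∀ h : ConnTerm, polyEval (G.flatMap fun g => bif g.j == h.k then
      [⟨[g.i, h.i, h.j], [g.k], g.c * h.c, g.m ++ h.m⟩] else []) [a, b, c] [d] y
      = (G.map fun g => ∑ e : Fin n,
        (if g.term.lo = [a, (e : ℕ)] ∧ g.term.up = [d] then (g.c : ℝ) * mono y g.m else 0)
        * (if h.term.lo = [b, c] ∧ h.term.up = [(e : ℕ)] then (h.c : ℝ) * mono y h.m else 0)).sum := by
    intro h
    rw [polyEval_flatMap]
    exact congrArg List.sum (List.map_congr_left fun g hg => h1 h g hg)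
  simp only [h2, ← sum_list_sum]
  refine Finset.sum_congr rfl fun e _ => ?_
  rw [polyEval, polyEval, List.map_map, List.map_map, polyEval_list_mul]
  rfl

/-- The curvature of a polynomial connection. -/
def polyCurvature (G : List ConnTerm) : List PolyTerm :=
  ((G.map ConnTerm.term).flatMap PolyTerm.partials ++ connSquare G) ++
    ((G.map ConnTerm.term).flatMap PolyTerm.partials ++ connSquare G).map PolyTerm.swapLo

/-- The terms of `∇^m P` or `∇^m R`. -/
def polyFactor (P : List PolyTerm) (G : List ConnTerm) : Factor → List PolyTerm
  | Factor.P m => Nat.rec P (fun _ T => collect (polyCov G T)) m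
  | Factor.R m => Nat.rec (collect (polyCurvature G)) (fun _ T => collect (polyCov G T)) m

/-- A chart in which the connection and the Poisson tensor are polynomial. -/
structure IsPoly (X : ConnManifold) (Q : X.PoissonTensor) (φ : X.Chart) (P : List PolyTerm)
    (G : List ConnTerm) : Prop where
  bound : ∀ g ∈ G, g.j < X.dim ∧ g.k < X.dim
  conn : ∀ i j k y, X.christoffel φ i j k y
      = polyEval (G.map ConnTerm.term) [(i : ℕ), (j : ℕ)] [(k : ℕ)] y
  comp : ∀ i j y, Q.comp φ i j y = polyEval P [] [(i : ℕ), (j : ℕ)] y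
  target : ∀ y, y ∈ φ.1.target

namespace IsPoly

variable {X : ConnManifold} {Q : X.PoissonTensor} {φ : X.Chart} {P : List PolyTerm}
  {G : List ConnTerm}

theorem curvature (h : IsPoly X Q φ P G) (L : Fin 3 → Fin X.dim) (U : Fin 1 → Fin X.dim)
    (y : X.Model) : X.curvature φ L U y
      = polyEval (polyCurvature G) (List.ofFn fun s => (L s : ℕ)) (List.ofFn fun s => (U s : ℕ)) y := by
  have hL : (List.ofFn fun s => (L s : ℕ)) = [(L 0 : ℕ), (L 1 : ℕ), (L 2 : ℕ)] := by
    simp [List.ofFn_succ]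
  have hU : (List.ofFn fun s => (U s : ℕ)) = [(U 0 : ℕ)] := by simp [List.ofFn_succ]
  rw [hL, hU, polyCurvature, polyEval_append, polyEval_swapLo, polyEval_append, polyEval_append,
    polyEval_connSquare fun g hg => (h.bound g hg).1,
    polyEval_connSquare fun g hg => (h.bound g hg).1, ← pd_polyEval, ← pd_polyEval]
  unfold ConnManifold.curvature
  have h1 : ∀ i j k, X.christoffel φ i j k
      = fun y => polyEval (G.map ConnTerm.term) [(i : ℕ), (j : ℕ)] [(k : ℕ)] y :=
    fun i j k => funext fun y => h.conn i j k y
  simp only [h1, Finset.sum_sub_distrib]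
  ring

theorem factor (h : IsPoly X Q φ P G) (f : Factor) : ∀ L U y, f.comp Q φ L U y
    = polyEval (polyFactor P G f) (List.ofFn fun s => (L s : ℕ)) (List.ofFn fun s => (U s : ℕ)) y := by
  cases f with
  | P m =>
    induction m with
    | zero =>
      intro L U y
      have hU : ∀ U : Fin 2 → Fin X.dim,
          (List.ofFn fun s => (U s : ℕ)) = [(U 0 : ℕ), (U 1 : ℕ)] := fun U => by
        simp [List.ofFn_succ]
      exact (h.comp _ _ y).trans (congrArg (fun l => polyEval P [] l y) (hU U).symm)
    | succ m ih =>
      intro L U y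
      refine (covDeriv_poly h.bound h.conn ih L U y).trans ?_
      exact (polyEval_collect ..).symm
  | R m =>
    induction m with
    | zero =>
      intro L U y
      refine (h.curvature L U y).trans ?_
      exact (polyEval_collect ..).symm
    | succ m ih =>
      intro L U y
      refine (covDeriv_poly h.bound h.conn ih L U y).trans ?_
      exact (polyEval_collect ..).symm

end IsPoly

/-- The nonzero components in the origin. -/
def tableAt (n : ℕ) (T : List PolyTerm) : List (List ℕ × List ℕ × ℤ) :=
  (T.filter fun t => t.m.isEmpty && (t.lo.all (fun v => Nat.blt v n) &&
    t.up.all fun v => Nat.blt v n)).map fun t => (t.lo, t.up, t.c)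

theorem mono_zero {n : ℕ} (m : List ℕ) :
    mono (0 : EuclideanSpace ℝ (Fin n)) m = if m.isEmpty then 1 else 0 := by
  cases m with
  | nil => simp [mono]
  | cons v m => simp [mono]

/-- In the origin only constant monomials count. Terms with an index outside of the range never
match a component. -/
theorem polyEval_zero {n b a : ℕ} (T : List PolyTerm) (L : Fin b → Fin n) (U : Fin a → Fin n) :
    polyEval T (List.ofFn fun s => (L s : ℕ)) (List.ofFn fun s => (U s : ℕ))
      (0 : EuclideanSpace ℝ (Fin n))
    = ((tableAt n T).map fun t => if t.1 = (List.ofFn fun s => (L s : ℕ)) ∧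
        t.2.1 = (List.ofFn fun s => (U s : ℕ)) then (t.2.2 : ℝ) else 0).sum := by
  induction T with
  | nil => rfl
  | cons t T ih =>
    rw [polyEval_cons, tableAt, List.filter_cons, mono_zero, ih, tableAt]
    by_cases h : t.lo = (List.ofFn fun s => (L s : ℕ)) ∧ t.up = (List.ofFn fun s => (U s : ℕ))
    · have h1 : t.lo.all (fun v => Nat.blt v n) = true := by
        rw [h.1, List.all_eq_true]
        intro v hv
        obtain ⟨s, rfl⟩ := List.mem_ofFn.1 hv
        simp
      have h2 : t.up.all (fun v => Nat.blt v n) = true := by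
        rw [h.2, List.all_eq_true]
        intro v hv
        obtain ⟨s, rfl⟩ := List.mem_ofFn.1 hv
        simp
      rw [h1, h2]
      cases t.m.isEmpty <;> simp [h]
    · rw [if_neg h, zero_add]
      split_ifs
      · simp only [List.map_cons, List.sum_cons]
        rw [if_neg h, zero_add]
      · rfl

/-! ### Test manifolds -/

/-- A polynomial Poisson tensor and a polynomial connection on `ℝⁿ`, given by terms
`c x^m (∂_i ∧ ∂_j)` and `c x^m` of `Γ_{ij}^k`. -/
structure TestData where
  n : ℕ
  P : List (ℕ × ℕ × ℤ × List ℕ)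
  G : List (ℕ × ℕ × ℕ × ℤ × List ℕ)

namespace TestData

/-- The terms of the Poisson tensor. -/
def poisson (D : TestData) : List PolyTerm :=
  D.P.flatMap fun x => [⟨[], [x.1, x.2.1], x.2.2.1, x.2.2.2⟩, ⟨[], [x.2.1, x.1], -x.2.2.1, x.2.2.2⟩]

/-- The terms of the connection. -/
def conn (D : TestData) : List ConnTerm :=
  D.G.flatMap fun x => ⟨x.1, x.2.1, x.2.2.1, x.2.2.2.1, x.2.2.2.2⟩ ::
    bif x.1 == x.2.1 then [] else [⟨x.2.1, x.1, x.2.2.1, x.2.2.2.1, x.2.2.2.2⟩]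

/-- The terms of `∑_l P^{il} ∂_l P^{jk}`. -/
def jacobiator (T : List PolyTerm) : List PolyTerm :=
  T.flatMap fun q => T.flatMap fun p => (monoDeriv q.m).flatMap fun x =>
    bif x.1 == p.up.getD 1 0 then
      [⟨[], p.up.getD 0 0 :: q.up, p.c * q.c, (p.m ++ x.2).insertionSort (· ≤ ·)⟩] else []

/-- Cyclic permutation of the upper indices. -/
def rotate (t : PolyTerm) : PolyTerm :=
  ⟨t.lo, match t.up with
    | [a, b, c] => [c, a, b]
    | l => l, t.c, t.m⟩

/-- The data are correct. -/
def check (D : TestData) : Bool :=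
  (D.poisson.all (fun p => Nat.blt (p.up.getD 1 0) D.n) &&
    (collect (jacobiator D.poisson ++ ((jacobiator D.poisson).map rotate ++
      ((jacobiator D.poisson).map rotate).map rotate))).isEmpty) &&
  (D.conn.all (fun g => Nat.blt g.j D.n && Nat.blt g.k D.n) && D.conn.all fun g => !g.m.isEmpty)

theorem polyEval_rotate {n : ℕ} (T : List PolyTerm) (i j k : ℕ) (y : EuclideanSpace ℝ (Fin n)) :
    polyEval (T.map rotate) [] [i, j, k] y = polyEval T [] [j, k, i] y := by
  induction T with
  | nil => rfl
  | cons t T ih =>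
    rw [List.map_cons, polyEval_cons, polyEval_cons, ih]
    congr 1
    obtain ⟨lo, up, c, m⟩ := t
    rcases up with _ | ⟨u, _ | ⟨v, _ | ⟨w, _ | ⟨x, up⟩⟩⟩⟩ <;> simp [rotate]
    by_cases h1 : u = j <;> by_cases h2 : v = k <;> by_cases h3 : w = i <;> simp [h1, h2, h3]

theorem mono_perm {n : ℕ} (y : EuclideanSpace ℝ (Fin n)) {m m' : List ℕ} (h : m.Perm m') :
    mono y m = mono y m' := (h.map _).prod_eq

theorem polyEval_jacobiator {n : ℕ} {T : List PolyTerm}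
    (hT : ∀ t ∈ T, t.lo = [] ∧ ∃ a b, t.up = [a, b] ∧ b < n) (i j k : ℕ)
    (y : EuclideanSpace ℝ (Fin n)) : polyEval (jacobiator T) [] [i, j, k] y
      = ∑ l : Fin n, polyEval T [] [i, (l : ℕ)] y
        * pd l (fun y => polyEval T [] [j, k] y) y := by
  simp only [pd_polyEval]
  have h1 : ∀ q ∈ T, ∀ p ∈ T, polyEval ((monoDeriv q.m).flatMap fun x =>
      bif x.1 == p.up.getD 1 0 then
        [⟨[], p.up.getD 0 0 :: q.up, p.c * q.c, (p.m ++ x.2).insertionSort (· ≤ ·)⟩] else [])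
        [] [i, j, k] y
      = ∑ l : Fin n, (if p.lo = [] ∧ p.up = [i, (l : ℕ)] then (p.c : ℝ) * mono y p.m else 0)
        * polyEval q.partials [(l : ℕ)] [j, k] y := by
    intro q hq p hp
    obtain ⟨hp1, a, b, hp2, hb⟩ := hT p hp
    rw [Finset.sum_eq_single ⟨b, hb⟩]
    · rw [polyEval_flatMap, PolyTerm.partials, polyEval_map, ← List.sum_map_mul_left]
      refine congrArg List.sum (List.map_congr_left fun x _ => ?_)
      rw [hp2, hp1, (hT q hq).1]
      simp only [List.getD_cons_succ, List.getD_cons_zero, List.cons.injEq, and_true, true_and]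
      by_cases c1 : x.1 = b
      · simp only [c1, beq_self_eq_true, cond_true, polyEval_cons, polyEval_nil, add_zero,
          mono_perm y (List.perm_insertionSort _ _), mono_append]
        by_cases c2 : a = i <;> by_cases c3 : q.up = [j, k] <;> simp [c2, c3]
        ring
      · have : (x.1 == b) = false := by simpa using c1
        rw [this]
        simp [c1]
    · intro l _ hl
      rw [if_neg, zero_mul]
      rintro ⟨-, h⟩
      apply hl
      rw [hp2] at h
      simp only [List.cons.injEq, and_true] at h
      exact Fin.ext h.2.symm
    · simp
  rw [jacobiator, polyEval_flatMap]
  have h2 : ∀ q ∈ T, polyEval (T.flatMap fun p => (monoDeriv q.m).flatMap fun x =>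
      bif x.1 == p.up.getD 1 0 then
        [⟨[], p.up.getD 0 0 :: q.up, p.c * q.c, (p.m ++ x.2).insertionSort (· ≤ ·)⟩] else [])
        [] [i, j, k] y
      = (T.map fun p => ∑ l : Fin n,
        (if p.lo = [] ∧ p.up = [i, (l : ℕ)] then (p.c : ℝ) * mono y p.m else 0)
        * polyEval q.partials [(l : ℕ)] [j, k] y).sum := by
    intro q hq
    rw [polyEval_flatMap]
    exact congrArg List.sum (List.map_congr_left fun p hp => h1 q hq p hp)
  rw [List.map_congr_left h2]
  simp only [← sum_list_sum]
  refine Finset.sum_congr rfl fun l _ => ?_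
  rw [polyEval_flatMap, polyEval, polyEval_list_mul]

theorem exists_isPoly (D : TestData) (h : D.check = true) :
    ∃ (X : ConnManifold) (Q : X.PoissonTensor) (φ : X.Chart),
      X.dim = D.n ∧ IsPoly X Q φ D.poisson D.conn ∧ ∀ g ∈ D.conn, g.m.isEmpty = false := by
  simp only [check, Bool.and_eq_true, List.all_eq_true, Nat.blt_eq, List.isEmpty_iff,
    Bool.not_eq_true'] at h
  obtain ⟨⟨h1, h2⟩, h3, h4⟩ := h
  have hsymm : ∀ (i j k : Fin D.n) (y : EuclideanSpace ℝ (Fin D.n)),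
      polyEval (D.conn.map ConnTerm.term) [(i : ℕ), (j : ℕ)] [(k : ℕ)] y
        = polyEval (D.conn.map ConnTerm.term) [(j : ℕ), (i : ℕ)] [(k : ℕ)] y := by
    intro i j k y
    rw [conn, List.map_flatMap, polyEval_flatMap, polyEval_flatMap]
    refine congrArg List.sum (List.map_congr_left fun x _ => ?_)
    obtain ⟨a, b, c, e, m⟩ := x
    by_cases hab : a = b
    · subst hab
      simp only [beq_self_eq_true, cond_true, List.map_cons, List.map_nil, ConnTerm.term,
        polyEval_cons, polyEval_nil, List.cons.injEq, and_true]
      by_cases c1 : a = (i : ℕ) <;> by_cases c2 : a = (j : ℕ) <;> simp [c1, c2]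
    · have : (a == b) = false := by simpa using hab
      simp only [this, cond_false, List.map_cons, List.map_nil, ConnTerm.term,
        polyEval_cons, polyEval_nil, List.cons.injEq, and_true]
      have h : ∀ (p q r : Prop) [Decidable p] [Decidable q] [Decidable r] (t : ℝ),
          (if (p ∧ q) ∧ r then t else 0) = if (q ∧ p) ∧ r then t else 0 :=
        fun p q r _ _ _ t => if_congr (and_congr_left' and_comm) rfl rfl
      linarith [h (a = (i : ℕ)) (b = (j : ℕ)) (c = (k : ℕ)) (e * mono y m),
        h (b = (i : ℕ)) (a = (j : ℕ)) (c = (k : ℕ)) (e * mono y m)]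
  have hskew : ∀ (i j : Fin D.n) (y : EuclideanSpace ℝ (Fin D.n)),
      polyEval D.poisson [] [(i : ℕ), (j : ℕ)] y = - polyEval D.poisson [] [(j : ℕ), (i : ℕ)] y := by
    intro i j y
    rw [poisson, polyEval_flatMap, polyEval_flatMap, ← sum_map_neg_list]
    refine congrArg List.sum (List.map_congr_left fun x _ => ?_)
    obtain ⟨a, b, c, m⟩ := x
    simp only [polyEval_cons, polyEval_nil, List.cons.injEq, and_true, true_and]
    push_cast
    have h : ∀ (p q : Prop) [Decidable p] [Decidable q] (t : ℝ),
        (if p ∧ q then -t else 0) = - if q ∧ p then t else 0 := fun p q _ _ t => by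
      by_cases p <;> by_cases q <;> simp [*]
    simp only [neg_mul, add_zero]
    linarith [h (b = (i : ℕ)) (a = (j : ℕ)) (c * mono y m),
      h (b = (j : ℕ)) (a = (i : ℕ)) (c * mono y m)]
  have hT : ∀ t ∈ D.poisson, t.lo = [] ∧ ∃ a b, t.up = [a, b] ∧ b < D.n := by
    intro t ht
    have hb := h1 t ht
    obtain ⟨x, _, hx⟩ := List.mem_flatMap.1 ht
    simp only [List.mem_cons, List.not_mem_nil, or_false] at hx
    rcases hx with rfl | rfl
    exacts [⟨rfl, _, _, rfl, hb⟩, ⟨rfl, _, _, rfl, hb⟩]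
  have hjac : ∀ (i j k : Fin D.n) (y : EuclideanSpace ℝ (Fin D.n)), ∑ l : Fin D.n,
      (polyEval D.poisson [] [(i : ℕ), (l : ℕ)] y
          * pd l (fun y => polyEval D.poisson [] [(j : ℕ), (k : ℕ)] y) y
        + polyEval D.poisson [] [(j : ℕ), (l : ℕ)] y
          * pd l (fun y => polyEval D.poisson [] [(k : ℕ), (i : ℕ)] y) y
        + polyEval D.poisson [] [(k : ℕ), (l : ℕ)] y
          * pd l (fun y => polyEval D.poisson [] [(i : ℕ), (j : ℕ)] y) y) = 0 := by
    intro i j k y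
    rw [Finset.sum_add_distrib, Finset.sum_add_distrib, ← polyEval_jacobiator hT,
      ← polyEval_jacobiator hT, ← polyEval_jacobiator hT]
    have := polyEval_collect [] [(i : ℕ), (j : ℕ), (k : ℕ)] (y := y) (jacobiator D.poisson ++
      ((jacobiator D.poisson).map rotate ++ ((jacobiator D.poisson).map rotate).map rotate))
    rw [h2, polyEval_nil, polyEval_append, polyEval_append, polyEval_rotate, polyEval_rotate,
      polyEval_rotate] at this
    linarith
  let Γ : Fin D.n → Fin D.n → Fin D.n → EuclideanSpace ℝ (Fin D.n) → ℝ := fun i j k y =>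
    polyEval (D.conn.map ConnTerm.term) [(i : ℕ), (j : ℕ)] [(k : ℕ)] y
  have hΓ : ∀ i j k, ContDiff ℝ ∞ (Γ i j k) := fun i j k => contDiff_polyEval _ _ _
  refine ⟨euclideanManifold Γ hΓ hsymm, euclideanPoisson
    (fun i j y => polyEval D.poisson [] [(i : ℕ), (j : ℕ)] y)
    (fun i j => contDiff_polyEval _ _ _) hskew hjac, euclideanChart, rfl, ⟨h3, ?_, ?_, ?_⟩, h4⟩
  · intro i j k y
    exact christoffel_euclideanChart i j k y
  · intro i j y
    exact congrFun (comp_euclideanPoisson _ _ hskew hjac euclideanChart i j) y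
  · intro y
    trivial

end TestData

/-! ### Evaluation of expressions by contraction of tables -/

/-- The value of a variable in a list of assigned values. -/
def assigned : List (ℕ × ℕ) → ℕ → Option ℕ
  | [], _ => none
  | x :: σ, v => bif Nat.beq x.1 v then some x.2 else assigned σ v

/-- Extension of an assignment by given values of the variables in a list. -/
def unify : List ℕ → List ℕ → List (ℕ × ℕ) → Option (List (ℕ × ℕ))
  | [], [], σ => some σ
  | v :: vs, k :: ks, σ => match assigned σ v with
    | none => unify vs ks ((v, k) :: σ)
    | some k' => bif Nat.beq k' k then unify vs ks σ else none
  | _, _, _ => none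

/-- The contraction of the tables of the factors, for given values of some of the variables. -/
def contract (tb : Factor → List (List ℕ × List ℕ × ℤ)) : Expr → List (ℕ × ℕ) → ℤ
  | [], _ => 1
  | A :: E, σ => ((tb A.f).map fun t => match unify A.lo t.1 σ with
    | none => 0
    | some σ' => match unify A.up t.2.1 σ' with
      | none => 0
      | some σ' => t.2.2 * contract tb E σ').sum

/-- The variables in `vs` have no value, the values of the others are those of `ν`. -/
structure Compatible {n : ℕ} (σ : List (ℕ × ℕ)) (vs : List ℕ) (ν : ℕ → Fin n) : Prop where
  nodup : vs.Nodup
  none : ∀ v ∈ vs, assigned σ v = none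
  some : ∀ v k, assigned σ v = some k → k = (ν v : ℕ)

/-- Prescribing the values `K` for the labels `L` fixes each of these labels or contradicts a value
which has already been assigned; `unify` decides which. In the first case the remaining sum extends
over the labels outside `L`. -/
theorem sumOver_unify {n : ℕ} (F : (ℕ → Fin n) → ℝ) : ∀ (L K : List ℕ) (σ : List (ℕ × ℕ))
    (vs : List ℕ) (ν : ℕ → Fin n), Compatible σ vs ν → (∀ k ∈ K, k < n) →
    (∀ v ∈ L, v ∉ vs → (assigned σ v).isSome) →
    (unify L K σ = none ∧
      sumOver vs (fun μ => if L.map (fun v => (μ v : ℕ)) = K then F μ else 0) ν = 0) ∨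
    ∃ σ' vs' ν', unify L K σ = some σ' ∧ Compatible σ' vs' ν' ∧
      (∀ v, v ∈ vs' ↔ v ∈ vs ∧ v ∉ L) ∧ (∀ v, (assigned σ v).isSome → (assigned σ' v).isSome) ∧
      (∀ v ∈ L, (assigned σ' v).isSome) ∧
      sumOver vs (fun μ => if L.map (fun v => (μ v : ℕ)) = K then F μ else 0) ν
        = sumOver vs' F ν' := by
  intro L
  induction L with
  | nil =>
    intro K σ vs ν h hK hL
    cases K with
    | nil => exact Or.inr ⟨σ, vs, ν, rfl, h, by simp, fun _ h => h, by simp, by simp⟩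
    | cons k K => exact Or.inl ⟨rfl, by simpa using sumOver_zero⟩
  | cons v L ih =>
    intro K σ vs ν h hK hL
    cases K with
    | nil => exact Or.inl ⟨rfl, by simpa using sumOver_zero⟩
    | cons k K =>
      have hK' : ∀ k ∈ K, k < n := fun k hk => hK k (by simp [hk])
      cases hv : assigned σ v with
      -- The label already has a value: the condition is either satisfied by all summands or by
      -- none.
      | some k' =>
        have hvs : v ∉ vs := fun hvs => by simp [h.none v hvs] at hv
        have hk' := h.some v k' hv
        by_cases hkk : k' = k
        · have h1 : unify (v :: L) (k :: K) σ = unify L K σ := by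
            simp [unify, hv, hkk]
          have h2 : sumOver vs (fun μ => if (v :: L).map (fun v => (μ v : ℕ)) = k :: K
              then F μ else 0) ν
              = sumOver vs (fun μ => if L.map (fun v => (μ v : ℕ)) = K then F μ else 0) ν := by
            refine sumOver_congr fun μ hμ => ?_
            simp [hμ v hvs, ← hk', hkk]
          rw [h1, h2]
          rcases ih K σ vs ν h hK' fun u hu => hL u (by simp [hu]) with h3 | ⟨σ', vs', ν', h3, h4, h5, h6, h7, h8⟩
          · exact Or.inl h3
          · refine Or.inr ⟨σ', vs', ν', h3, h4, fun u => ?_, h6, fun u hu => ?_, h8⟩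
            · rw [h5, List.mem_cons]
              constructor
              · rintro ⟨hu, hu'⟩
                exact ⟨hu, fun h => h.elim (fun h => hvs (h ▸ hu)) hu'⟩
              · rintro ⟨hu, hu'⟩
                exact ⟨hu, fun h => hu' (Or.inr h)⟩
            · rcases List.mem_cons.1 hu with rfl | hu
              · exact h6 _ (by simp [hv])
              · exact h7 u hu
        · refine Or.inl ⟨?_, ?_⟩
          · have : Nat.beq k' k = false := by rwa [← Bool.not_eq_true, Nat.beq_eq]
            simp [unify, hv, this]
          · refine (sumOver_congr (G := fun _ => 0) fun μ hμ => ?_).trans sumOver_zero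
            simp [hμ v hvs, ← hk', hkk]
      | none =>
        -- A label without value is one of the summation labels; its sum collapses to the prescribed
        -- value.
        have hvs : v ∈ vs := by
          by_contra hvs
          have := hL v (by simp) hvs
          simp [hv] at this
        have h1 : unify (v :: L) (k :: K) σ = unify L K ((v, k) :: σ) := by
          simp [unify, hv]
        have hkn : k < n := hK k (by simp)
        have h2 : sumOver vs (fun μ => if (v :: L).map (fun v => (μ v : ℕ)) = k :: K
              then F μ else 0) ν
            = sumOver (vs.erase v) (fun μ => if L.map (fun v => (μ v : ℕ)) = K then F μ else 0)
              (Function.update ν v ⟨k, hkn⟩) := by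
          rw [sumOver_perm (List.perm_cons_erase hvs), sumOver,
            Finset.sum_eq_single (⟨k, hkn⟩ : Fin n)]
          · refine sumOver_congr fun μ hμ => ?_
            have : μ v = ⟨k, hkn⟩ := by
              rw [hμ v h.nodup.not_mem_erase, Function.update_self]
            simp [this]
          · intro e _ he
            refine (sumOver_congr (G := fun _ => 0) fun μ hμ => ?_).trans sumOver_zero
            have : μ v = e := by
              rw [hμ v h.nodup.not_mem_erase, Function.update_self]
            rw [if_neg]
            rw [List.map_cons, this]
            intro h
            exact he (Fin.ext (List.cons.inj h).1)
          · simp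
        have hA : ∀ u, assigned ((v, k) :: σ) u = if v = u then some k else assigned σ u := by
          intro u
          by_cases huv : v = u
          · simp [assigned, huv]
          · have : Nat.beq v u = false := by rwa [← Bool.not_eq_true, Nat.beq_eq]
            simp [assigned, huv, this]
        have hc : Compatible ((v, k) :: σ) (vs.erase v) (Function.update ν v ⟨k, hkn⟩) := by
          refine ⟨h.nodup.erase v, fun u hu => ?_, fun u k' hu => ?_⟩
          · rw [h.nodup.mem_erase_iff] at hu
            rw [hA, if_neg (Ne.symm hu.1), h.none u hu.2]
          · rw [hA] at hu
            by_cases huv : v = u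
            · subst huv
              rw [if_pos rfl] at hu
              rw [Function.update_self, ← Option.some.inj hu]
            · rw [if_neg huv] at hu
              rw [Function.update_of_ne (Ne.symm huv), h.some u k' hu]
        rw [h1, h2]
        have hL' : ∀ u ∈ L, u ∉ vs.erase v → (assigned ((v, k) :: σ) u).isSome := by
          intro u hu hu'
          rw [hA]
          by_cases huv : v = u
          · simp [huv]
          · rw [if_neg huv]
            refine hL u (by simp [hu]) fun h' => hu' ?_
            exact h.nodup.mem_erase_iff.2 ⟨Ne.symm huv, h'⟩
        rcases ih K _ _ _ hc hK' hL' with h3 | ⟨σ', vs', ν', h3, h4, h5, h6, h7, h8⟩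
        · exact Or.inl h3
        · refine Or.inr ⟨σ', vs', ν', h3, h4, fun u => ?_, fun u hu => h6 u ?_, fun u hu => ?_, h8⟩
          · rw [h5, List.mem_cons, h.nodup.mem_erase_iff]
            tauto
          · rw [hA]
            split_ifs
            · rfl
            · exact hu
          · rcases List.mem_cons.1 hu with rfl | hu
            · exact h6 u (by simp [hA])
            · exact h7 u hu

/-! ### Truncation of polynomial tensors by degree. -/

/-- The degree of the monomial is at most `k`. -/
def PolyTerm.low (k : ℕ) (t : PolyTerm) : Bool := Nat.ble t.m.length k

theorem filter_insertTerm (k : ℕ) (t : PolyTerm) (T : List PolyTerm) :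
    (insertTerm t T).filter (PolyTerm.low k)
      = if t.low k then insertTerm t (T.filter (PolyTerm.low k)) else T.filter (PolyTerm.low k) := by
  induction T with
  | nil => by_cases h : t.low k <;> simp [insertTerm, h]
  | cons s T ih =>
    by_cases hs : s.lo = t.lo ∧ s.up = t.up ∧ s.m = t.m
    · have h1 : s.low k = t.low k := by rw [PolyTerm.low, PolyTerm.low, hs.2.2]
      have h2 : PolyTerm.low k ⟨s.lo, s.up, s.c + t.c, s.m⟩ = t.low k := h1
      rw [insertTerm_cons, if_pos hs]
      by_cases h : t.low k
      · rw [if_pos h, List.filter_cons_of_pos (h1.trans h), insertTerm_cons, if_pos hs]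
        split_ifs
        · rfl
        · rw [List.filter_cons_of_pos (h2.trans h)]
      · rw [if_neg h, List.filter_cons_of_neg (by rw [h1]; exact h)]
        split_ifs
        · rfl
        · rw [List.filter_cons_of_neg (by rw [h2]; exact h)]
    · rw [insertTerm_cons, if_neg hs]
      by_cases h3 : s.low k
      · rw [List.filter_cons_of_pos h3, ih, List.filter_cons_of_pos h3]
        split_ifs
        · rw [insertTerm_cons, if_neg hs]
        · rfl
      · rw [List.filter_cons_of_neg h3, ih, List.filter_cons_of_neg h3]

theorem filter_collect (k : ℕ) (T : List PolyTerm) :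
    (collect T).filter (PolyTerm.low k) = collect (T.filter (PolyTerm.low k)) := by
  induction T with
  | nil => rfl
  | cons t T ih =>
    rw [collect, List.foldr_cons, filter_insertTerm, ← collect, ih]
    by_cases h : t.low k
    · rw [if_pos h, List.filter_cons_of_pos h]
      rfl
    · rw [if_neg h, List.filter_cons_of_neg h]

theorem length_of_mem_monoDeriv {m : List ℕ} {x : ℕ × List ℕ} (hx : x ∈ monoDeriv m) :
    m.length = x.2.length + 1 := by
  induction m generalizing x with
  | nil => simp [monoDeriv] at hx
  | cons v m ih =>
    rcases List.mem_cons.1 hx with rfl | hx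
    · rfl
    · obtain ⟨x', hx', rfl⟩ := List.mem_map.1 hx
      simp [ih hx']

/-- A term can only produce terms whose degree is smaller by at most one; terms of degree above `k +
1` do not contribute in degree at most `k`. -/
theorem filter_flatMap_filter {T : List PolyTerm} {k : ℕ} {f : PolyTerm → List PolyTerm}
    (hf : ∀ t, ∀ s ∈ f t, t.m.length ≤ s.m.length + 1) :
    ((T.filter (PolyTerm.low (k + 1))).flatMap f).filter (PolyTerm.low k)
      = (T.flatMap f).filter (PolyTerm.low k) := by
  induction T with
  | nil => rfl
  | cons t T ih =>
    rw [List.flatMap_cons, List.filter_append, ← ih]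
    by_cases h : t.low (k + 1)
    · rw [List.filter_cons_of_pos h, List.flatMap_cons, List.filter_append]
    · rw [List.filter_cons_of_neg h]
      have : (f t).filter (PolyTerm.low k) = [] := by
        rw [List.filter_eq_nil_iff]
        intro s hs hk
        have h1 := hf t s hs
        simp only [PolyTerm.low, Nat.ble_eq] at h hk
        omega
      rw [this, List.nil_append]

/-- A partial derivative lowers the degree by one and the connection terms do not lower it. To know
`m` covariant derivatives in the origin it is therefore enough to carry terms of degree at most `m`.
-/
theorem filter_polyCov (G : List ConnTerm) (T : List PolyTerm) (k : ℕ) :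
    (polyCov G (T.filter (PolyTerm.low (k + 1)))).filter (PolyTerm.low k)
      = (polyCov G T).filter (PolyTerm.low k) := by
  rw [polyCov, polyCov, List.filter_append, List.filter_append, List.filter_append,
    List.filter_append, filter_flatMap_filter, filter_flatMap_filter, filter_flatMap_filter]
  · intro t s hs
    obtain ⟨g, -, hs⟩ := List.mem_flatMap.1 hs
    obtain ⟨i, -, hs⟩ := List.mem_flatMap.1 hs
    cases h : t.up.getD i 0 == g.j <;> rw [h] at hs
    · simp at hs
    · simp only [cond_true, List.mem_singleton] at hs
      rw [hs]
      simp
      omega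
  · intro t s hs
    obtain ⟨g, -, hs⟩ := List.mem_flatMap.1 hs
    obtain ⟨i, -, hs⟩ := List.mem_flatMap.1 hs
    cases h : t.lo.getD i 0 == g.k <;> rw [h] at hs
    · simp at hs
    · simp only [cond_true, List.mem_singleton] at hs
      rw [hs]
      simp
      omega
  · intro t s hs
    obtain ⟨x, hx, rfl⟩ := List.mem_map.1 hs
    exact (length_of_mem_monoDeriv hx).le

/-- The terms of `∇^m P` or `∇^m R` of degree at most `k`. -/
def lowFactor (P : List PolyTerm) (G : List ConnTerm) : Factor → ℕ → List PolyTerm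
  | Factor.P m => Nat.rec (fun k => P.filter (PolyTerm.low k))
      (fun _ T k => collect ((polyCov G (T (k + 1))).filter (PolyTerm.low k))) m
  | Factor.R m => Nat.rec (fun k => collect ((polyCurvature G).filter (PolyTerm.low k)))
      (fun _ T k => collect ((polyCov G (T (k + 1))).filter (PolyTerm.low k))) m

theorem lowFactor_eq (P : List PolyTerm) (G : List ConnTerm) (f : Factor) (k : ℕ) :
    lowFactor P G f k = (polyFactor P G f).filter (PolyTerm.low k) := by
  cases f with
  | P m =>
    induction m generalizing k with
    | zero => rfl
    | succ m ih =>
      change collect ((polyCov G (lowFactor P G (Factor.P m) (k + 1))).filter (PolyTerm.low k)) = _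
      rw [ih, filter_polyCov, ← filter_collect]
      rfl
  | R m =>
    induction m generalizing k with
    | zero => exact (filter_collect _ _).symm
    | succ m ih =>
      change collect ((polyCov G (lowFactor P G (Factor.R m) (k + 1))).filter (PolyTerm.low k)) = _
      rw [ih, filter_polyCov, ← filter_collect]
      rfl

theorem tableAt_filter_low (n k : ℕ) (T : List PolyTerm) :
    tableAt n (T.filter (PolyTerm.low k)) = tableAt n T := by
  rw [tableAt, List.filter_filter, tableAt]
  congr 2
  funext t
  cases h : t.m <;> simp [PolyTerm.low, h]

/-- The table at the origin of a factor. -/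
def factorTable (n : ℕ) (P : List PolyTerm) (G : List ConnTerm) (f : Factor) :
    List (List ℕ × List ℕ × ℤ) :=
  tableAt n (lowFactor P G f 0)

theorem factorTable_eq (n : ℕ) (P : List PolyTerm) (G : List ConnTerm) (f : Factor) :
    factorTable n P G f = tableAt n (polyFactor P G f) := by
  rw [factorTable, lowFactor_eq, tableAt_filter_low]

theorem lt_of_mem_tableAt {n : ℕ} {T : List PolyTerm} {t : List ℕ × List ℕ × ℤ}
    (ht : t ∈ tableAt n T) : ∀ k ∈ t.1 ++ t.2.1, k < n := by
  obtain ⟨x, hx, rfl⟩ := List.mem_map.1 ht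
  have := (List.mem_filter.1 hx).2
  simp only [Bool.and_eq_true, List.all_eq_true, Nat.blt_eq] at this
  intro k hk
  rcases List.mem_append.1 hk with hk | hk
  exacts [this.2.1 k hk, this.2.2 k hk]

theorem ofFn_getD {n m : ℕ} {l : List ℕ} (h : l.length = m) (ν : ℕ → Fin n) :
    (List.ofFn fun s : Fin m => (ν (l.getD s 0) : ℕ)) = l.map fun v => (ν v : ℕ) := by
  subst h
  refine List.ext_getElem (by simp) fun i h1 h2 => ?_
  simp

namespace IsPoly

variable {X : ConnManifold} {Q : X.PoissonTensor} {φ : X.Chart} {P : List PolyTerm}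
  {G : List ConnTerm}

theorem val_zero (h : IsPoly X Q φ P G) {A : Atom} (hA : A.Ok) (μ : ℕ → Fin X.dim) :
    A.val Q φ μ μ 0 = ((factorTable X.dim P G A.f).map fun t =>
      if A.lo.map (fun v => (μ v : ℕ)) = t.1 then
        if A.up.map (fun v => (μ v : ℕ)) = t.2.1 then (t.2.2 : ℝ) else 0 else 0).sum := by
  rw [Atom.val, h.factor, polyEval_zero, ofFn_getD hA.1, ofFn_getD hA.2, factorTable_eq]
  refine congrArg List.sum (List.map_congr_left fun t _ => ?_)
  rw [← ite_and]
  exact if_congr (by rw [eq_comm, @eq_comm _ t.2.1]) rfl rfl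

theorem contract_eq (h : IsPoly X Q φ P G) : ∀ (E : Expr) (σ : List (ℕ × ℕ)) (vs : List ℕ)
    (ν : ℕ → Fin X.dim), E.Ok → Compatible σ vs ν →
    (∀ v, v ∈ E.lows ∨ v ∈ E.ups → v ∉ vs → (assigned σ v).isSome) →
    (∀ v ∈ vs, v ∈ E.lows ∨ v ∈ E.ups) →
    E.ev Q φ vs ν 0 = contract (factorTable X.dim P G) E σ := by
  intro E
  induction E with
  | nil =>
    intro σ vs ν _ _ _ hvs
    have : vs = [] := List.eq_nil_iff_forall_not_mem.2 fun v hv => by simpa using hvs v hv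
    subst this
    simp [Expr.ev, sumOver, contract]
  | cons A E ih =>
    intro σ vs ν hE hc hL hvs
    have h1 : ∀ μ : ℕ → Fin X.dim, Expr.pval Q φ (A :: E) μ μ 0
        = ((factorTable X.dim P G A.f).map fun t =>
          if A.lo.map (fun v => (μ v : ℕ)) = t.1 then
            if A.up.map (fun v => (μ v : ℕ)) = t.2.1 then (t.2.2 : ℝ) * Expr.pval Q φ E μ μ 0
            else 0 else 0).sum := by
      intro μ
      rw [Expr.pval_cons, h.val_zero (hE A (by simp)), ← List.sum_map_mul_right]
      refine congrArg List.sum (List.map_congr_left fun t _ => ?_)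
      split_ifs <;> simp
    rw [Expr.ev]
    simp only [h1]
    rw [sumOver_list_sum, contract, Int.cast_list_sum, List.map_map]
    refine congrArg List.sum (List.map_congr_left fun t ht => ?_)
    have hk := lt_of_mem_tableAt ht
    -- The lower labels of the factor are treated before the upper ones; if either fails, the entry
    -- contributes zero.
    rcases sumOver_unify (fun μ : ℕ → Fin X.dim => if A.up.map (fun v => (μ v : ℕ)) = t.2.1 then
      (t.2.2 : ℝ) * Expr.pval Q φ E μ μ 0 else 0) A.lo t.1 σ vs ν hc (fun k hk' => hk k (by simp [hk']))
      fun v hv => hL v (Or.inl (by simp [hv])) with h2 | ⟨σ₁, vs₁, ν₁, h2, h3, h4, h5, h6, h7⟩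
    · rw [h2.2]
      simp [h2.1]
    rw [h7]
    rcases sumOver_unify (fun μ : ℕ → Fin X.dim => (t.2.2 : ℝ) * Expr.pval Q φ E μ μ 0) A.up t.2.1 σ₁
      vs₁ ν₁ h3 (fun k hk' => hk k (by simp [hk'])) (fun v hv hv' => by
        by_cases hv1 : v ∈ vs
        · exact h6 v (by_contra fun h => hv' ((h4 v).2 ⟨hv1, h⟩))
        · exact h5 v (hL v (Or.inr (by simp [hv])) hv1))
      with h8 | ⟨σ₂, vs₂, ν₂, h8, h9, h10, h11, h12, h13⟩
    · rw [h8.2]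
      simp [h2, h8.1]
    rw [h13, sumOver_mul_left]
    have := ih σ₂ vs₂ ν₂ (fun B hB => hE B (by simp [hB])) h9 (fun v hv hv' => ?_) fun v hv => ?_
    · rw [Expr.ev] at this
      rw [this]
      simp [h2, h8]
    · by_cases hv1 : v ∈ vs
      · by_cases hv2 : v ∈ A.lo
        · exact h11 v (h6 v hv2)
        · by_cases hv3 : v ∈ A.up
          · exact h12 v hv3
          · exact (hv' ((h10 v).2 ⟨(h4 v).2 ⟨hv1, hv2⟩, hv3⟩)).elim
      · refine h11 v (h5 v (hL v ?_ hv1))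
        rcases hv with hv | hv
        · exact Or.inl (by simp [hv])
        · exact Or.inr (by simp [hv])
    · obtain ⟨h14, h15⟩ := (h10 v).1 hv
      obtain ⟨h16, h17⟩ := (h4 v).1 h14
      rcases hvs v h16 with h18 | h18
      · rw [Expr.lows_cons, List.mem_append] at h18
        exact Or.inl (h18.resolve_left h17)
      · rw [Expr.ups_cons, List.mem_append] at h18
        exact Or.inr (h18.resolve_left h15)

end IsPoly

/-! ### Contraction by recursors -/

/-- The value of a variable, as `assigned`. -/
def assignedRec {α : Type} (σ : List (ℕ × ℕ)) (v : ℕ) (d : α) (k : ℕ → α) : α :=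
  List.rec d (fun x _ r => Bool.rec r (k x.2) (Nat.beq x.1 v)) σ

theorem assignedRec_eq {α : Type} (σ : List (ℕ × ℕ)) (v : ℕ) (d : α) (k : ℕ → α) :
    assignedRec σ v d k = (assigned σ v).elim d k := by
  induction σ with
  | nil => rfl
  | cons x σ ih =>
    change Bool.rec (motive := fun _ => α) (assignedRec σ v d k) (k x.2) (Nat.beq x.1 v) = _
    rw [ih, assigned]
    cases Nat.beq x.1 v <;> rfl

/-- Extension of an assignment, as `unify`. -/
def unifyRec {α : Type} (vs : List ℕ) :
    List ℕ → List (ℕ × ℕ) → α → (List (ℕ × ℕ) → α) → α :=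
  List.rec (fun ks σ d k => List.rec (k σ) (fun _ _ _ => d) ks)
    (fun v _ ih ks σ d k => List.rec d (fun x ks _ => assignedRec σ v
      (ih ks ((v, x) :: σ) d k) fun x' => Bool.rec d (ih ks σ d k) (Nat.beq x' x)) ks) vs

/-- The continuation `k` replaces the optional result, with `d` as the value in case of
contradiction, so that no intermediate data are built in the evaluation. -/
theorem unifyRec_eq {α : Type} (vs ks : List ℕ) (σ : List (ℕ × ℕ)) (d : α)
    (k : List (ℕ × ℕ) → α) : unifyRec vs ks σ d k = (unify vs ks σ).elim d k := by
  induction vs generalizing ks σ with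
  | nil => cases ks <;> rfl
  | cons v vs ih =>
    cases ks with
    | nil => rfl
    | cons x ks =>
      change assignedRec σ v (unifyRec vs ks ((v, x) :: σ) d k)
        (fun x' => Bool.rec (motive := fun _ => α) d (unifyRec vs ks σ d k) (Nat.beq x' x)) = _
      rw [assignedRec_eq, unify]
      cases assigned σ v with
      | none => exact ih _ _
      | some x' =>
        simp only [Option.elim_some]
        cases Nat.beq x' x
        · rfl
        · exact ih _ _

/-- The contraction of tables, as `contract`. -/
def contractRec (tb : Factor → List (List ℕ × List ℕ × ℤ)) (E : Expr) : List (ℕ × ℕ) → ℤ :=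
  List.rec (fun _ => 1) (fun A _ ih σ => List.rec 0 (fun t _ r =>
    unifyRec A.lo t.1 σ r fun σ => unifyRec A.up t.2.1 σ r fun σ =>
      Int.add (Int.mul t.2.2 (ih σ)) r) (tb A.f)) E

/-- Besides the use of recursors, the sum over the table is accumulated: an entry which does not fit
passes on the sum `r` of the later entries. -/
theorem contractRec_eq (tb : Factor → List (List ℕ × List ℕ × ℤ)) (E : Expr)
    (σ : List (ℕ × ℕ)) : contractRec tb E σ = contract tb E σ := by
  induction E generalizing σ with
  | nil => rfl
  | cons A E ih =>
    rw [contract]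
    change List.rec (motive := fun _ => ℤ) 0 (fun t _ r => unifyRec A.lo t.1 σ r fun σ =>
      unifyRec A.up t.2.1 σ r fun σ => Int.add (Int.mul t.2.2 (contractRec tb E σ)) r) (tb A.f) = _
    induction tb A.f with
    | nil => rfl
    | cons t T ih' =>
      rw [List.map_cons, List.sum_cons, ← ih']
      simp only [unifyRec_eq, ih]
      cases unify A.lo t.1 σ with
      | none => exact (zero_add _).symm
      | some σ' =>
        simp only [Option.elim_some]
        cases unify A.up t.2.1 σ' with
        | none => exact (zero_add _).symm
        | some σ'' => rfl

/-! ### Coboundaries in the origin of a test manifold -/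

theorem pd_ofReal (𝕂 : Type) [RCLike 𝕂] {n : ℕ} {f : EuclideanSpace ℝ (Fin n) → ℝ}
    {y : EuclideanSpace ℝ (Fin n)} (hf : DifferentiableAt ℝ f y) (l : Fin n) :
    pd l (fun y => (f y : 𝕂)) y = ((pd l f y : ℝ) : 𝕂) := by
  have := ((RCLike.ofRealCLM (K := 𝕂)).hasFDerivAt.comp y hf.hasFDerivAt).fderiv
  rw [pd, pd]
  change fderiv ℝ (RCLike.ofRealCLM (K := 𝕂) ∘ f) y _ = _
  rw [this]
  rfl

theorem coboundaryComp_ofReal (𝕂 : Type) [RCLike 𝕂] {p : ℕ} {X : ConnManifold}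
    (P : X.PoissonTensor) (φ : X.Chart) {c : (Fin p → Fin X.dim) → X.Model → ℝ} {y : X.Model}
    (hc : ∀ I, DifferentiableAt ℝ (c I) y) (I : Fin (p + 1) → Fin X.dim) :
    coboundaryComp P φ (fun I y => (c I y : 𝕂)) I y = ((coboundaryComp P φ c I y : ℝ) : 𝕂) := by
  unfold coboundaryComp
  simp only [pd_ofReal 𝕂 (hc _), RCLike.real_smul_eq_coe_mul, smul_eq_mul]
  push_cast
  rfl

theorem coboundaryComp_two {X : ConnManifold} (P : X.PoissonTensor) (φ : X.Chart)
    (c : (Fin 2 → Fin X.dim) → X.Model → ℝ) (i j k : Fin X.dim) (y : X.Model) :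
    coboundaryComp P φ c ![i, j, k] y
      = ∑ l, P.comp φ i l y * pd l (c ![j, k]) y - ∑ l, P.comp φ j l y * pd l (c ![i, k]) y
        + ∑ l, P.comp φ k l y * pd l (c ![i, j]) y
        - (∑ l, pd l (P.comp φ i j) y * c ![l, k] y + ∑ l, pd l (P.comp φ i k) y * c ![j, l] y
          - ∑ l, pd l (P.comp φ j k) y * c ![i, l] y) := by
  have h0 : Finset.Ioi (0 : Fin 3) = {1, 2} := by decide
  have h1 : Finset.Ioi (1 : Fin 3) = {2} := by decide
  have h2 : Finset.Ioi (2 : Fin 3) = ∅ := by decide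
  have e0 : (![i, j, k] : Fin 3 → Fin X.dim) ∘ Fin.succAbove 0 = ![j, k] := by
    funext s; fin_cases s <;> rfl
  have e1 : (![i, j, k] : Fin 3 → Fin X.dim) ∘ Fin.succAbove 1 = ![i, k] := by
    funext s; fin_cases s <;> rfl
  have e2 : (![i, j, k] : Fin 3 → Fin X.dim) ∘ Fin.succAbove 2 = ![i, j] := by
    funext s; fin_cases s <;> rfl
  have u1 : ∀ l, Function.update (![i, j, k] : Fin 3 → Fin X.dim) 1 l ∘ Fin.succAbove 0
      = ![l, k] := fun l => by
    funext s; fin_cases s <;> rfl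
  have u2 : ∀ l, Function.update (![i, j, k] : Fin 3 → Fin X.dim) 2 l ∘ Fin.succAbove 0
      = ![j, l] := fun l => by
    funext s; fin_cases s <;> rfl
  have u3 : ∀ l, Function.update (![i, j, k] : Fin 3 → Fin X.dim) 2 l ∘ Fin.succAbove 1
      = ![i, l] := fun l => by
    funext s; fin_cases s <;> rfl
  unfold coboundaryComp
  rw [Fin.sum_univ_three, h0, h1, h2, Finset.sum_pair (by decide), Finset.sum_singleton,
    Finset.sum_empty]
  simp only [e0, e1, e2, u1, u2, u3, smul_eq_mul]
  simp
  ring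

theorem assigned_nil (v : ℕ) : assigned [] v = none := rfl

theorem assigned_cons (x : ℕ × ℕ) (σ : List (ℕ × ℕ)) (v : ℕ) :
    assigned (x :: σ) v = if x.1 = v then some x.2 else assigned σ v := by
  by_cases h : x.1 = v
  · simp [assigned, h]
  · have : Nat.beq x.1 v = false := by rwa [← Bool.not_eq_true, Nat.beq_eq]
    simp [assigned, h, this]

/-- Tables of the nonzero components of the factors. -/
abbrev Table : Type := Factor → List (List ℕ × List ℕ × ℤ)

namespace Table

/-- The component in the origin of the bivector defined by an expression. -/
def bivectorValue (tb : Table) (E : Expr) (i j : ℕ) : ℤ := contractRec tb E [(0, i), (1, j)]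

/-- The component in the origin of the skewsymmetric bivector defined by an expression. -/
def skewValue (tb : Table) (E : Expr) (i j : ℕ) : ℤ := tb.bivectorValue E i j - tb.bivectorValue E j i

/-- The partial derivatives in the origin of the bivector defined by an expression. -/
def derivValue (tb : Table) (E : Expr) (l i j : ℕ) : ℤ :=
  ((E.deriv 99).map fun F => contractRec tb F [(99, l), (0, i), (1, j)]).sum

/-- The partial derivatives in the origin of the skewsymmetric bivector defined by an expression. -/
def skewDerivValue (tb : Table) (E : Expr) (l i j : ℕ) : ℤ :=
  tb.derivValue E l i j - tb.derivValue E l j i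

/-- The sum `∑_l P^{il} g_l` in the origin. -/
def poissonSum (tb : Table) (i : ℕ) (g : ℕ → ℤ) : ℤ :=
  ((tb (Factor.P 0)).map fun t => match t with
    | ([], [u, v], c) => bif Nat.beq u i then c * g v else 0
    | _ => 0).sum

/-- The sum `∑_l ∂_l P^{ij} g_l` in the origin. -/
def poissonDerivSum (tb : Table) (i j : ℕ) (g : ℕ → ℤ) : ℤ :=
  ((tb (Factor.P 1)).map fun t => match t with
    | ([l], [u, v], c) => bif Nat.beq u i && Nat.beq v j then c * g l else 0
    | _ => 0).sum

/-- The component in the origin of the coboundary of the skewsymmetric bivector defined by an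
expression. -/
def coboundaryValue (tb : Table) (E : Expr) (i j k : ℕ) : ℤ :=
  tb.poissonSum i (fun l => tb.skewDerivValue E l j k)
    - tb.poissonSum j (fun l => tb.skewDerivValue E l i k)
    + tb.poissonSum k (fun l => tb.skewDerivValue E l i j)
    - (tb.poissonDerivSum i j (fun l => tb.skewValue E l k)
      + tb.poissonDerivSum i k (fun l => tb.skewValue E j l)
      - tb.poissonDerivSum j k (fun l => tb.skewValue E i l))

end Table

namespace TestData

/-- The table of the components in the origin of a factor. -/
def table (D : TestData) : Table :=
  factorTable D.n D.poisson D.conn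

/-- The manifold with connection and Poisson tensor realizes the data in a chart. -/
structure Realizes (D : TestData) (X : ConnManifold) (Q : X.PoissonTensor) (φ : X.Chart) :
    Prop where
  dim : X.dim = D.n
  isPoly : IsPoly X Q φ D.poisson D.conn
  conn : ∀ g ∈ D.conn, g.m.isEmpty = false

namespace Realizes

variable {D : TestData} {X : ConnManifold} {Q : X.PoissonTensor} {φ : X.Chart}

theorem table_eq (h : D.Realizes X Q φ) : factorTable X.dim D.poisson D.conn = D.table := by
  rw [table, h.dim]

theorem christoffel_zero (h : D.Realizes X Q φ) (i j k : Fin X.dim) :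
    X.christoffel φ i j k 0 = 0 := by
  rw [h.isPoly.conn, polyEval, List.map_map]
  refine List.sum_eq_zero fun x hx => ?_
  obtain ⟨g, hg, rfl⟩ := List.mem_map.1 hx
  change (if g.term.lo = _ ∧ g.term.up = _ then (g.c : ℝ) * mono 0 g.m else 0) = 0
  rw [mono_zero, h.conn g hg]
  simp

theorem value_eq (h : D.Realizes X Q φ) {E : Expr} (hE : E.WF 2) (I : Fin 2 → Fin X.dim) :
    E.value Q φ I 0 = D.table.bivectorValue E (I 0) (I 1) := by
  rw [Expr.value, h.isPoly.contract_eq E [(0, (I 0 : ℕ)), (1, (I 1 : ℕ))] _ _ hE.ok, h.table_eq,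
    Table.bivectorValue, contractRec_eq]
  · refine ⟨hE.nodup, fun v hv => ?_, fun v k hv => ?_⟩
    · have := hE.le v hv
      rw [assigned_cons, assigned_cons, if_neg (by simp; omega), if_neg (by simp; omega), assigned]
    · match v with
      | 0 => simpa [assigned_cons, env] using hv.symm
      | 1 => simpa [assigned_cons, env] using hv.symm
      | v + 2 => simp [assigned_cons, assigned_nil] at hv
  · intro v hv hv'
    have : v ∈ List.range 2 := by
      rcases hv with hv | hv
      · exact (hv' hv).elim
      · exact (List.mem_append.1 (hE.perm.mem_iff.1 hv)).resolve_right hv'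
    rw [List.mem_range] at this
    interval_cases v <;> rfl
  · exact fun v hv => Or.inl hv

theorem pd_value (h : D.Realizes X Q φ) {E : Expr} (hE : E.WF 2) (hw : 99 ∉ E.lows)
    (I : Fin 2 → Fin X.dim) (l : Fin X.dim) :
    pd l (E.value Q φ I) 0 = D.table.derivValue E l (I 0) (I 1) := by
  have hw' : 99 ∉ E.ups := fun h' => by
    have := hE.perm.mem_iff.1 h'
    simp [hw] at this
  set ν : ℕ → Fin X.dim := Function.update (env I) 99 l with hν
  -- The value of the label 99 is irrelevant for `E` and may be set to `l`.
  have e1 : E.value Q φ I = E.ev Q φ E.lows ν := by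
    funext y
    rw [Expr.value, Expr.ev, Expr.ev, hν, ← sumOver_update hw]
    refine sumOver_congr fun μ _ => Expr.pval_congr hE.ok (fun v hv => ?_) fun v hv => ?_
    · rw [Function.update_of_ne (ne_of_mem_of_not_mem hv hw)]
    · rw [Function.update_of_ne (ne_of_mem_of_not_mem hv hw')]
  have e2 : l = ν 99 := by rw [hν, Function.update_self]
  rw [e1]
  conv_lhs => rw [e2]
  rw [Expr.pd_ev hE.ok (vs := E.lows) (fl := []) (fu := List.range 2) (List.Perm.refl _) hE.perm hE.nodup
    hE.ups_nodup (by simp) hw ν (h.isPoly.target 0)]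
  simp only [h.christoffel_zero, zero_mul, Finset.sum_const_zero, List.map_nil, List.sum_nil,
    List.map_const', List.sum_replicate, smul_zero, add_zero, sub_zero]
  rw [Table.derivValue, Int.cast_list_sum, List.map_map]
  refine congrArg List.sum (List.map_congr_left fun F hF => ?_)
  have hl := (Expr.lows_deriv hF)
  have hu := Expr.ups_deriv hF
  rw [h.isPoly.contract_eq F [(99, (l : ℕ)), (0, (I 0 : ℕ)), (1, (I 1 : ℕ))] _ _
    (Expr.deriv_ok hE.ok hF), h.table_eq]
  · rw [Function.comp_apply, contractRec_eq]
  · refine ⟨hE.nodup, fun v hv => ?_, fun v k hv => ?_⟩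
    · have := hE.le v hv
      rw [assigned_cons, assigned_cons, assigned_cons, if_neg (ne_of_mem_of_not_mem hv hw).symm,
        if_neg (by simp; omega), if_neg (by simp; omega), assigned]
    · match v with
      | 0 => simpa [assigned_cons, env, hν] using hv.symm
      | 1 => simpa [assigned_cons, env, hν] using hv.symm
      | v + 2 =>
        by_cases h2 : v + 2 = 99
        · rw [h2] at hv ⊢
          simpa [assigned_cons, env, hν] using hv.symm
        · simp [assigned_cons, assigned_nil, Ne.symm h2] at hv
  · intro v hv hv'
    rw [hl.mem_iff, hu, hE.perm.mem_iff, List.mem_cons, List.mem_append, List.mem_range] at hv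
    have : v = 99 ∨ v < 2 := by tauto
    rcases this with rfl | hv
    · rfl
    · interval_cases v <;> rfl
  · intro v hv
    exact Or.inl (hl.mem_iff.2 (by simp [hv]))

theorem comp_zero (h : D.Realizes X Q φ) (i j : Fin X.dim) :
    Q.comp φ i j 0 = ((D.table (Factor.P 0)).map fun t =>
      if t.1 = [] ∧ t.2.1 = [(i : ℕ), (j : ℕ)] then (t.2.2 : ℝ) else 0).sum := by
  have := h.isPoly.factor (Factor.P 0) Fin.elim0 (![i, j] : Fin 2 → Fin X.dim) 0
  refine this.trans ((polyEval_zero (b := 0) (a := 2) _ _ _).trans ?_)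
  rw [← h.table_eq, factorTable_eq]
  simp [List.ofFn_succ]

theorem pd_comp_zero (h : D.Realizes X Q φ) (l i j : Fin X.dim) :
    pd l (Q.comp φ i j) 0 = ((D.table (Factor.P 1)).map fun t =>
      if t.1 = [(l : ℕ)] ∧ t.2.1 = [(i : ℕ), (j : ℕ)] then (t.2.2 : ℝ) else 0).sum := by
  have h1 := h.isPoly.factor (Factor.P 1) (![l] : Fin 1 → Fin X.dim) (![i, j] : Fin 2 → Fin X.dim) 0
  have h2 : (Factor.P 1).comp Q φ (![l] : Fin 1 → Fin X.dim) (![i, j] : Fin 2 → Fin X.dim) 0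
      = X.covDeriv φ (Q.components φ) (![l] : Fin 1 → Fin X.dim) ![i, j] 0 := rfl
  rw [h2, ConnManifold.covDeriv] at h1
  simp only [h.christoffel_zero, zero_mul, Finset.sum_const_zero, sub_zero, add_zero] at h1
  refine h1.trans ((polyEval_zero (b := 1) (a := 2) _ _ _).trans ?_)
  rw [← h.table_eq, factorTable_eq]
  simp [List.ofFn_succ]

theorem lt_of_mem_table {f : Factor} {t : List ℕ × List ℕ × ℤ} (ht : t ∈ D.table f) :
    ∀ k ∈ t.1 ++ t.2.1, k < D.n := lt_of_mem_tableAt ht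

theorem sum_comp_zero (h : D.Realizes X Q φ) (i : Fin X.dim) (g : ℕ → ℤ) :
    ∑ l, Q.comp φ i l 0 * (g l : ℝ) = D.table.poissonSum i g := by
  simp only [h.comp_zero, ← List.sum_map_mul_right]
  rw [sum_list_sum, Table.poissonSum, Int.cast_list_sum, List.map_map]
  refine congrArg List.sum (List.map_congr_left fun t ht => ?_)
  have hk := lt_of_mem_table ht
  obtain ⟨lo, up, c⟩ := t
  rcases lo with _ | ⟨a, lo⟩
  swap
  · simp
  rcases up with _ | ⟨u, _ | ⟨v, _ | ⟨w, up⟩⟩⟩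
  · simp
  · simp
  swap
  · simp
  have hv : v < X.dim := h.dim ▸ hk v (by simp)
  rw [Finset.sum_eq_single ⟨v, hv⟩]
  · by_cases hu : u = i
    · simp [hu]
    · have : Nat.beq u i = false := by rwa [← Bool.not_eq_true, Nat.beq_eq]
      simp [hu, this]
  · intro l _ hl
    have : v ≠ (l : ℕ) := fun h => hl (Fin.ext h.symm)
    simp [this]
  · simp

theorem sum_pd_comp_zero (h : D.Realizes X Q φ) (i j : Fin X.dim) (g : ℕ → ℤ) :
    ∑ l, pd l (Q.comp φ i j) 0 * (g l : ℝ) = D.table.poissonDerivSum i j g := by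
  simp only [h.pd_comp_zero, ← List.sum_map_mul_right]
  rw [sum_list_sum, Table.poissonDerivSum, Int.cast_list_sum, List.map_map]
  refine congrArg List.sum (List.map_congr_left fun t ht => ?_)
  have hk := lt_of_mem_table ht
  obtain ⟨lo, up, c⟩ := t
  rcases lo with _ | ⟨a, _ | ⟨b, lo⟩⟩
  · simp
  swap
  · simp
  rcases up with _ | ⟨u, _ | ⟨v, _ | ⟨w, up⟩⟩⟩
  · simp
  · simp
  swap
  · simp
  have ha : a < X.dim := h.dim ▸ hk a (by simp)
  rw [Finset.sum_eq_single ⟨a, ha⟩]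
  · by_cases hu : u = i <;> by_cases hv : v = j
    · simp [hu, hv]
    · have : Nat.beq v j = false := by rwa [← Bool.not_eq_true, Nat.beq_eq]
      simp [hv, this]
    · have : Nat.beq u i = false := by rwa [← Bool.not_eq_true, Nat.beq_eq]
      simp [hu, this]
    · have : Nat.beq u i = false := by rwa [← Bool.not_eq_true, Nat.beq_eq]
      simp [hu, this]
  · intro l _ hl
    have : a ≠ (l : ℕ) := fun h => hl (Fin.ext h.symm)
    simp [this]
  · simp

variable (𝕂 : Type) [RCLike 𝕂]

theorem skewFamily_eq (h : D.Realizes X Q φ) (E : Expr) (I : Fin 2 → Fin X.dim) :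
    skewFamily 𝕂 E X Q φ I = fun y =>
      ((E.value Q φ I y - E.value Q φ (I ∘ Equiv.swap 0 1) y : ℝ) : 𝕂) := by
  funext y
  simp [skewFamily, skewOp, Expr.family, h.isPoly.target y]

theorem skewFamily_zero (h : D.Realizes X Q φ) {E : Expr} (hE : E.WF 2) (i j : Fin X.dim) :
    skewFamily 𝕂 E X Q φ ![i, j] 0 = (D.table.skewValue E i j : 𝕂) := by
  rw [h.skewFamily_eq 𝕂]
  beta_reduce
  rw [h.value_eq hE, h.value_eq hE, Table.skewValue]
  simp

theorem coboundaryComp_zero (h : D.Realizes X Q φ) {E : Expr} (hE : E.WF 2) (hw : 99 ∉ E.lows)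
    (i j k : Fin X.dim) :
    coboundaryComp Q φ (skewFamily 𝕂 E X Q φ) ![i, j, k] 0 = (D.table.coboundaryValue E i j k : 𝕂) := by
  have hd : ∀ I : Fin 2 → Fin X.dim, DifferentiableAt ℝ (E.value Q φ I) 0 := fun I =>
    ConnManifold.differentiableAt_of_contDiffOn (E.contDiffOn_ev _ _) (h.isPoly.target 0)
  have h1 : skewFamily 𝕂 E X Q φ = fun I y =>
      ((E.value Q φ I y - E.value Q φ (I ∘ Equiv.swap 0 1) y : ℝ) : 𝕂) :=
    funext fun I => h.skewFamily_eq 𝕂 E I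
  have h2 : ∀ a b : Fin X.dim, E.value Q φ ![a, b] 0 - E.value Q φ (![a, b] ∘ Equiv.swap 0 1) 0
      = (D.table.skewValue E a b : ℝ) := fun a b => by
    rw [h.value_eq hE, h.value_eq hE, Table.skewValue]
    simp
  have h3 : ∀ l a b : Fin X.dim, pd l (fun y => E.value Q φ ![a, b] y
      - E.value Q φ (![a, b] ∘ Equiv.swap 0 1) y) 0 = (D.table.skewDerivValue E l a b : ℝ) :=
    fun l a b => by
      rw [pd_fun_sub (hd _) (hd _)]
      have e1 := h.pd_value hE hw ![a, b] l
      have e2 := h.pd_value hE hw (![a, b] ∘ Equiv.swap 0 1) l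
      rw [Table.skewDerivValue, Int.cast_sub]
      exact congrArg₂ _ e1 e2
  rw [h1, coboundaryComp_ofReal 𝕂 Q φ (c := fun I y => E.value Q φ I y
    - E.value Q φ (I ∘ Equiv.swap 0 1) y) fun I => (hd I).sub (hd _), coboundaryComp_two]
  simp only [h2, h3]
  rw [h.sum_comp_zero i fun l => D.table.skewDerivValue E l j k,
    h.sum_comp_zero j fun l => D.table.skewDerivValue E l i k,
    h.sum_comp_zero k fun l => D.table.skewDerivValue E l i j,
    h.sum_pd_comp_zero i j fun l => D.table.skewValue E l k,
    h.sum_pd_comp_zero i k fun l => D.table.skewValue E j l,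
    h.sum_pd_comp_zero j k fun l => D.table.skewValue E i l, Table.coboundaryValue]
  push_cast
  rfl

end Realizes

end TestData

/-! ### Values on the test manifolds -/

/-- A bivector and a connection with the terms given by the digits of the indices, the coefficient
and the monomial, after a digit 1. -/
def TestData.ofDigits (x : ℕ × List ℕ × List ℕ) : TestData where
  n := x.1
  P := x.2.1.map fun n => match digits n with
    | i :: j :: c :: m => (i, j, c, m)
    | _ => (0, 0, 0, [])
  G := x.2.2.map fun n => match digits n with
    | i :: j :: k :: c :: m => (i, j, k, c, m)
    | _ => (0, 0, 0, 0, [])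

/-- Polynomial Poisson tensors and connections. -/
def testData : List TestData := List.map TestData.ofDigits [
  (4, [1201, 11311], [12211020]), (5, [1311, 12412, 1401, 14010, 10224], [10031004]),
  (3, [1021, 10210], [122112]), (3, [1021, 10210], [12211200]),
  (4, [1131, 1021, 10210], [12201002]), (4, [11010, 1031, 13113], [10001033]),
  (5, [1241, 124122, 10110, 1131, 11313, 13021], [144014]),
  (4, [1301, 1301330, 1121, 11211], [10121222]), (3, [1211, 121122], [1110112]),
  (4, [1021, 10210, 11311], [1221102]), (3, [1021, 10212], [1001120]),
  (4, [1311, 102122, 1021], [1002120]), (4, [1231, 11011], [100113]),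
  (6, [11311, 1341, 13414, 14123, 15212, 12025, 10510], [144215]),
  (4, [1131, 1131, 1021, 10210], [1233122]), (5, [12312, 1141, 114111], [1132144]),
  (4, [1031, 12111], [1230100]), (3, [110100, 1021, 121202], [1220100]),
  (4, [1021, 102100, 1131, 11313], [1133111]), (4, [11010, 1021, 12112], [111312]),
  (5, [11211, 103133, 1341, 140234], [114114]), (3, [11211, 1201, 12010, 10122], [1222100]),
  (4, [11311, 1321, 13212, 12123], [1223112]), (4, [12312, 1301, 13010, 10223], [1030100]),
  (5, [1211, 103133, 1341, 140234], [1233111]), (4, [1211, 130130, 1301], [1230100]),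
  (3, [1211], [111010, 1120122]), (3, [1101], [100111, 1002111, 1112101]),
  (3, [1011, 1011001], [101111, 1002111]), (4, [1301, 1121, 11211], [112111]),
  (5, [13212, 12423, 14314, 1011, 10110], [104210, 111411]),
  (5, [1231, 1141, 1141], [112412, 1333134]), (5, [1241, 1131, 11311], [1340134, 122411]),
  (3, [1201, 12012], [102012, 100110]), (4, [1201202, 1201, 1311, 1311], [111212, 1333103]),
  (4, [1201, 13111], [122110, 103310, 12231133]),
  (5, [1311, 1311, 1241, 124122], [1240144, 113413]), (3, [10111, 1121, 12012], [111112]),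
  (4, [1301, 1121], [123013, 1022100]), (4, [1021, 1131], [122110, 1110103]),
  (5, [12411, 1241, 1301, 1301330], [122314, 1444143]),
  (4, [1131, 12010, 1201], [1113121, 103113]),
  (4, [1011, 1011001, 1321, 1321232], [1011102, 111013]),
  (6, [1211, 1051, 1051005, 1431, 14314], [125311, 1035131]), (5, [1231, 12312, 1041], [1332142])]

/-- A pair of numbers given by a single one. -/
def splitPair (n : ℕ) : ℕ × ℕ := (n / 1000, n % 1000)

/-- The components of the coboundary (for three indices) or of the bivector (for two indices) in the
origin which are used, with their nonzero values on the basis, to which 200 is added. -/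
def functionals : List (ℕ × List ℕ × List (ℕ × ℕ)) :=
  List.map (fun x => (x.1, digits x.2.1, x.2.2.map splitPair)) [
    (0, 1013, [15198, 32192]), (1, 1234, [14196]), (2, 1012, [199]), (3, 101, [15202]),
    (3, 1012, [13202, 15196, 24198, 25202]), (4, 1013, [18196]),
    (5, 1013, [14198, 15202, 27202, 32208]), (6, 1012, [1196]), (7, 1123, [24206, 25194]),
    (8, 1012, [14198, 22202, 24198]), (9, 1013, [10204, 14201, 24201]), (10, 112, [14201, 24201]),
    (10, 1012, [2202, 8199, 14201, 16201, 21199, 24201, 33201]), (11, 1123, [30196]),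
    (12, 1012, [199, 2202, 29199, 33201]), (13, 1125, [3198, 9202]), (14, 1013, [2208, 33204]),
    (15, 112, [26198]), (15, 1123, [11192, 16202, 20204, 26198]), (16, 1023, [16202]),
    (17, 1012, [14204, 23192, 26196, 27204, 31196]), (18, 1023, [17208]),
    (19, 1013, [201, 7201, 8199, 16202, 21198]), (20, 1023, [3202, 9202]),
    (21, 1012, [3196, 9204, 10216, 13204, 19208, 25204, 27208, 32232]),
    (22, 1123, [4216, 5196, 9208, 10216, 14204, 24204, 26196, 27204]),
    (23, 1023, [3196, 4184, 7204, 8196, 9196, 11184, 14192, 16208, 20208, 21192, 26196, 27204, 29196]),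
    (24, 1024, [23192, 26196]), (25, 1013, [6196, 12204, 24198, 25202, 27202, 28198, 31198]),
    (26, 1012, [1204, 15202, 22198, 39198, 44198]),
    (27, 1012, [23198, 28201, 35204, 36201, 37201, 38202, 44199, 46202]),
    (28, 1012, [13198, 15206, 22198, 24202, 25198, 38204, 39198, 44198, 46204]),
    (29, 1023, [17204, 18196, 43196, 45192, 47204]),
    (30, 1023, [10204, 15198, 21199, 22202, 32192]), (31, 1234, [15198, 22202, 44202, 46196]),
    (32, 1014, [28201, 36201, 44199, 46202]),
    (33, 1012, [1194, 2204, 3202, 5199, 7201, 8199, 13202, 15196, 16201, 19198, 20202, 21199, 22199, 23204, 24198, 25202, 28199, 31201]),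
    (34, 1123, [46216]), (35, 1123, [20198, 21199, 22201, 23198]), (36, 1012, [15208, 35168]),
    (37, 1012, [201, 3201, 4204, 5199, 9201, 11204, 15201, 19198, 22199, 23202, 26199, 27201, 28198, 29201, 31199, 35196, 36199, 37199, 39199]),
    (38, 1013, [15198, 22202, 28202, 40202, 41202, 44202]),
    (39, 1013, [15199, 23202, 28199, 37199, 39199, 40199, 41201]),
    (40, 1023, [1202, 15201, 22199, 44199, 47204]), (41, 1023, [30198, 31201, 42202, 43196]),
    (42, 1023, [15201, 31199, 34202, 37201, 42198]),
    (43, 1245, [6198, 12202, 15199, 24199, 25202, 39201, 40201, 41201, 42202, 44201]),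
    (44, 102, [6198, 25201, 26201])]

/-- Combinations of the functionals which are multiples of the coordinates; 200 is added to the
coefficients. -/
def combinations : List (List (ℕ × ℕ)) := List.map (List.map splitPair) [
  [2199], [7199],
  [196, 1204, 2196, 4198, 7194, 9198, 10196, 15202, 19202, 20202, 23198, 26199, 30196, 31202, 33204, 36204, 40196],
  [15199, 23201], [202, 1201, 6202, 14204, 16199, 18202, 19198, 22204, 23198, 26199],
  [204, 6204, 10204, 14204, 15202, 16199, 17202, 18202, 19198, 22204, 25199, 26199],
  [1203, 8198, 11212, 17194, 47188],
  [204, 2204, 9204, 10204, 11208, 12196, 16201, 19198, 22204, 33196],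
  [196, 9196, 10196, 12196, 16201, 19202, 33204], [15201, 23201], [10201, 11199],
  [196, 9198, 10196, 18198, 19202, 27201, 33204, 38196],
  [194, 1201, 4204, 6202, 9198, 10196, 11204, 14196, 16201, 17198, 18198, 19202, 24199, 25201, 27201, 28202, 30196, 31202, 33204, 38196, 40196, 47196],
  [3206, 4203, 8201], [1199], [3201], [19201], [21201], [5199],
  [1201, 4198, 6196, 10196, 15198, 24201], [196, 9198, 10196, 17198, 27201, 33204, 38196],
  [201, 9201, 10201, 11201, 33199], [9201, 11202], [17202, 27199], [1201, 11204],
  [1203, 8198, 11212], [17199], [202, 1199, 6202],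
  [194, 1201, 4204, 6202, 9198, 10196, 14196, 16201, 18198, 19202, 20201, 24199, 25201, 30196, 31202, 33204, 38196, 40196],
  [2204, 14196, 16201], [13199], [202, 1198, 6202, 20199, 27201], [199, 3199],
  [204, 1196, 2204, 4202, 7206, 9202, 10204, 15198, 16202, 19198, 20198, 23202, 26201, 30204, 31198, 33196, 36196, 40204],
  [212, 1188, 4212, 6212, 8204, 9212, 17188, 27206, 28188, 30176, 31212, 34212, 35224, 39197, 41188, 45224, 46224],
  [3204, 39199],
  [206, 1199, 3202, 4196, 6198, 10204, 11196, 14204, 16199, 18202, 19198, 20199, 24201, 25199, 30204, 31198, 33196, 34202, 35204, 38204, 40204],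
  [3196, 4196, 7204, 17204, 27198, 29204, 30208, 31196, 35192, 37201, 39201],
  [4204, 7196, 29196, 31204, 37199], [7196, 29196, 34196, 37199],
  [224, 1196, 4188, 6192, 9208, 10216, 14216, 16196, 18208, 19192, 20196, 24204, 25196, 30208, 31196, 33184, 35208, 37199, 38216, 39199, 40216, 41204, 42192],
  [4196, 30208, 31196, 34192, 35192, 37199, 39201, 41204, 42208],
  [7212, 8204, 9212, 20206, 27194, 28188, 29212, 34212, 37203, 41188, 46224],
  [212, 1188, 6212, 7212, 8204, 9212, 13212, 28188, 29212, 34212, 37203, 41188, 44176, 46224],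
  [3204, 9196, 11192, 34204, 37201],
  [197, 1203, 5206, 6197, 8199, 9197, 13197, 21203, 28203, 29197, 32194, 41203, 43206, 44206, 46194],
  [37201], [7204, 34204, 37201, 43208]]

/-! ### Evaluation with evaluated tables -/

theorem forceNat_eq {α : Type} (n : ℕ) (k : ℕ → α) : forceNat n k = k n := by
  rcases n with _ | _ | _ | _ | _ | _ | _ | _ | _ | n <;> rfl

/-- A function of an integer, with a numeral for small integers. -/
def forceInt {α : Type} (n : ℤ) (k : ℤ → α) : α :=
  match n with
  | Int.ofNat n => forceNat n fun n => k (Int.ofNat n)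
  | Int.negSucc n => forceNat n fun n => k (Int.negSucc n)

theorem forceInt_eq {α : Type} (n : ℤ) (k : ℤ → α) : forceInt n k = k n := by
  cases n <;> simp [forceInt, forceNat_eq]

/-- A function of a list, with numerals for small numbers. -/
def forceList {α : Type} : List ℕ → (List ℕ → α) → α
  | [], k => k []
  | n :: l, k => forceNat n fun n => forceList l fun l => k (n :: l)

theorem forceList_eq {α : Type} (l : List ℕ) (k : List ℕ → α) : forceList l k = k l := by
  induction l generalizing k with
  | nil => rfl
  | cons n l ih => simp [forceList, forceNat_eq, ih]

/-- A function of a list of terms, with numerals for small numbers. -/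
def forcePoly {α : Type} : List PolyTerm → (List PolyTerm → α) → α
  | [], k => k []
  | t :: T, k => forceList t.lo fun lo => forceList t.up fun up => forceInt t.c fun c =>
      forceList t.m fun m => forcePoly T fun T => k (⟨lo, up, c, m⟩ :: T)

/-- The function is handed numerals instead of unevaluated expressions; this affects only the
evaluation and not the value. -/
theorem forcePoly_eq {α : Type} (T : List PolyTerm) (k : List PolyTerm → α) :
    forcePoly T k = k T := by
  induction T generalizing k with
  | nil => rfl
  | cons t T ih => simp [forcePoly, forceInt_eq, forceList_eq, ih]

/-- The covariant derivative up to terms of degree `k`. -/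
def lowCov (G : List ConnTerm) (T : List PolyTerm) (k : ℕ) : List PolyTerm :=
  collect ((T.flatMap PolyTerm.partials).filter (PolyTerm.low k) ++
    (T.flatMap (fun t => (G.filter fun g => Nat.ble (g.m.length + t.m.length) k).flatMap
      fun g => lowTerms g t) ++
    T.flatMap fun t => (G.filter fun g => Nat.ble (g.m.length + t.m.length) k).flatMap
      fun g => upTerms g t))

theorem filter_flatMap_of_eq {α β : Type*} {p : β → Bool} {q : α → Bool} {f : α → List β}
    (h : ∀ a, ∀ x ∈ f a, p x = q a) (l : List α) :
    (l.flatMap f).filter p = (l.filter q).flatMap f := by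
  induction l with
  | nil => rfl
  | cons a l ih =>
    rw [List.flatMap_cons, List.filter_append, ih]
    by_cases hq : q a = true
    · rw [List.filter_cons_of_pos hq, List.flatMap_cons,
        List.filter_eq_self.2 fun x hx => (h a x hx).trans hq]
    · rw [List.filter_cons_of_neg hq, List.filter_eq_nil_iff.2 fun x hx => by rwa [h a x hx],
        List.nil_append]

/-- The degree of a term of `Γ T` is the sum of the two degrees, so terms of the connection which
would exceed the bound can be left out before the products are formed. -/
theorem lowCov_eq (G : List ConnTerm) (T : List PolyTerm) (k : ℕ) :
    lowCov G T k = collect ((polyCov G T).filter (PolyTerm.low k)) := by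
  have h1 : ∀ t g, ∀ x ∈ lowTerms g t, x.low k = Nat.ble (g.m.length + t.m.length) k := by
    intro t g x hx
    obtain ⟨s, -, hx⟩ := List.mem_flatMap.1 hx
    cases hb : t.lo.getD s 0 == g.k <;> simp only [hb, cond_true, cond_false] at hx
    · simp at hx
    · rw [List.mem_singleton.1 hx, PolyTerm.low, List.length_append]
  have h2 : ∀ t g, ∀ x ∈ upTerms g t, x.low k = Nat.ble (g.m.length + t.m.length) k := by
    intro t g x hx
    obtain ⟨s, -, hx⟩ := List.mem_flatMap.1 hx
    cases hb : t.up.getD s 0 == g.j <;> simp only [hb, cond_true, cond_false] at hx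
    · simp at hx
    · rw [List.mem_singleton.1 hx, PolyTerm.low, List.length_append]
  have h3 (f : PolyTerm → List PolyTerm) : (T.flatMap f).filter (PolyTerm.low k)
      = T.flatMap fun t => (f t).filter (PolyTerm.low k) := by
    rw [List.filter_flatMap]
  rw [polyCov, List.filter_append, List.filter_append, h3 fun t => G.flatMap fun g => lowTerms g t,
    h3 fun t => G.flatMap fun g => upTerms g t, lowCov]
  simp only [filter_flatMap_of_eq (h1 _), filter_flatMap_of_eq (h2 _)]

/-- A function of the tables, which are evaluated. -/
def TestData.withTable {α : Type} (D : TestData) (k : Table → α) : α :=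
  forcePoly (D.poisson.filter (PolyTerm.low 3)) fun p0 =>
  forcePoly (lowCov D.conn p0 2) fun p1 =>
  forcePoly (lowCov D.conn p1 1) fun p2 =>
  forcePoly (collect ((polyCurvature D.conn).filter (PolyTerm.low 3))) fun r0 =>
  forcePoly (lowCov D.conn r0 2) fun r1 =>
  forcePoly (lowCov D.conn r1 1) fun r2 =>
  forcePoly (lowCov D.conn p2 0) fun p3 =>
  forcePoly (lowCov D.conn r2 0) fun r3 =>
  k fun f => match f with
    | .P m => tableAt D.n ([p0, p1, p2, p3].getD m (lowFactor D.poisson D.conn (.P m) 0))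
    | .R m => tableAt D.n ([r0, r1, r2, r3].getD m (lowFactor D.poisson D.conn (.R m) 0))

/-- The tables for up to three derivatives are computed once and shared. Each derivative costs one
degree, which is why the truncation starts at degree 3 and ends at 0. Factors with more derivatives
fall back to the definition. -/
theorem TestData.withTable_eq {α : Type} (D : TestData) (k : Table → α) :
    D.withTable k = k D.table := by
  have h : ∀ f j, tableAt D.n (lowFactor D.poisson D.conn f j) = D.table f := fun f j => by
    rw [table, factorTable_eq, lowFactor_eq, tableAt_filter_low]
  have p0 : D.poisson.filter (PolyTerm.low 3) = lowFactor D.poisson D.conn (.P 0) 3 := rfl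
  have p1 : lowCov D.conn (lowFactor D.poisson D.conn (.P 0) 3) 2
    = lowFactor D.poisson D.conn (.P 1) 2 := lowCov_eq _ _ _
  have p2 : lowCov D.conn (lowFactor D.poisson D.conn (.P 1) 2) 1
    = lowFactor D.poisson D.conn (.P 2) 1 := lowCov_eq _ _ _
  have p3 : lowCov D.conn (lowFactor D.poisson D.conn (.P 2) 1) 0
    = lowFactor D.poisson D.conn (.P 3) 0 := lowCov_eq _ _ _
  have r0 : collect ((polyCurvature D.conn).filter (PolyTerm.low 3))
    = lowFactor D.poisson D.conn (.R 0) 3 := rfl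
  have r1 : lowCov D.conn (lowFactor D.poisson D.conn (.R 0) 3) 2
    = lowFactor D.poisson D.conn (.R 1) 2 := lowCov_eq _ _ _
  have r2 : lowCov D.conn (lowFactor D.poisson D.conn (.R 1) 2) 1
    = lowFactor D.poisson D.conn (.R 2) 1 := lowCov_eq _ _ _
  have r3 : lowCov D.conn (lowFactor D.poisson D.conn (.R 2) 1) 0
    = lowFactor D.poisson D.conn (.R 3) 0 := lowCov_eq _ _ _
  simp only [withTable, forcePoly_eq, p0, p1, p2, p3, r0, r1, r2, r3]
  generalize lowFactor D.poisson D.conn = F at h ⊢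
  generalize D.table = tb at h ⊢
  refine congrArg k (funext fun f => ?_)
  rcases f with m | m
  · match m with
    | 0 => exact h (.P 0) 3
    | 1 => exact h (.P 1) 2
    | 2 => exact h (.P 2) 1
    | 3 => exact h (.P 3) 0
    | m + 4 => exact h (.P (m + 4)) 0
  · match m with
    | 0 => exact h (.R 0) 3
    | 1 => exact h (.R 1) 2
    | 2 => exact h (.R 2) 1
    | 3 => exact h (.R 3) 0
    | m + 4 => exact h (.R (m + 4)) 0

/-- The value of a functional on the bivector defined by an expression. -/
def Table.functional (tb : Table) : List ℕ → Expr → ℤ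
  | [i, j], E => tb.skewValue E i j
  | [i, j, k], E => tb.coboundaryValue E i j k
  | _, _ => 0

/-- The order of evaluation. -/
def Atom.weight (A : Atom) : ℕ :=
  match A.f with
  | .P m => 10 - m
  | .R _ => 0

/-- The expressions of the generating set, with the factors sorted for evaluation. -/
def basisExprs : List Expr :=
  (basisCodes 0 ++ basisCodes 1 ++ basisCodes 2).map fun x =>
    (Code.of x).expr.insertionSort fun A B => A.weight ≤ B.weight

/-- The values in a sparse list of values, which are shifted by 200. -/
def sparseGet : List (ℕ × ℕ) → ℕ → ℤ
  | [], _ => 0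
  | x :: l, i => bif Nat.beq x.1 i then (x.2 : ℤ) - 200 else sparseGet l i

/-- The values of the functionals are as given. -/
def checkFunctional (x : ℕ × List ℕ × List (ℕ × ℕ)) : Bool :=
  (testData.getD x.1 ⟨0, [], []⟩).withTable fun tb =>
    (List.range 48).all fun i => decide (tb.functional x.2.1 (basisExprs.getD i [])
      = sparseGet x.2.2 i)

set_option maxRecDepth 10000 in
theorem testData_check : testData.all TestData.check = true := by decide +kernel

-- The matrix of the 48 functionals on the 48 generators, computed in the kernel and compared with
-- the listed sparse rows.
set_option maxRecDepth 10000 in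
theorem functionals_check : functionals.all checkFunctional = true := by decide +kernel

theorem functionals_lt : functionals.all (fun x => x.2.1.all fun i =>
    Nat.blt i (testData.getD x.1 ⟨0, [], []⟩).n) = true := by decide +kernel

theorem functionals_length : functionals.length = 48 := by decide +kernel

theorem basisCodes_check : (basisCodes 0 ++ basisCodes 1 ++ basisCodes 2).all (fun x =>
    (Code.of x).check) = true := by decide +kernel

theorem basisExprs_check : basisExprs.all (fun E => Nat.beq E.numP 3 &&
    E.lows.all fun v => !Nat.beq v 99) = true := by decide +kernel

theorem basisExprs_length : basisExprs.length = 48 := by decide +kernel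

-- The product of the matrix of combinations with the matrix of values is diagonal with nonzero
-- entries, so the latter is invertible. Diagonal integers instead of an inverse matrix avoid
-- fractions.
set_option maxRecDepth 10000 in
theorem combinations_check : ((List.range 48).all fun j => (List.range 48).all fun i =>
    (decide (((combinations.getD j []).map fun x => ((x.2 : ℤ) - 200) *
      sparseGet (functionals.getD x.1 (0, [], [])).2.2 i).sum = 0)) == !(Nat.beq i j)) = true := by
  decide +kernel

/-! ### The families of the generating set -/

section Families

variable (𝕂 : Type) [RCLike 𝕂]

/-- The smooth family defined by an expression. -/
def Expr.smoothFamily (q : ℕ) (E : Expr) : SmoothFamily 𝕂 (q + 1) :=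
  ⟨E.family 𝕂 q, fun X P φ I =>
    ⟨(RCLike.ofRealCLM (K := 𝕂).contDiff.comp_contDiffOn (E.contDiffOn_ev (P := P) (φ := φ) E.lows (env I))).congr
      fun y hy => by simp [Expr.family, hy, Expr.value],
      fun y hy => by simp [Expr.family, hy]⟩⟩

theorem Expr.WF.smoothFamily_mem {q : ℕ} {E : Expr} (h : E.WF (q + 1)) :
    E.smoothFamily 𝕂 q ∈ universalNoLoop 𝕂 (q + 1) := by
  obtain ⟨G, hG, e⟩ := h.exists_concatenation 𝕂
  exact Submodule.subset_span ⟨G, hG, e⟩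

theorem PoissonTensor_eq_scale {X : ConnManifold} {P Q : X.PoissonTensor} {t : ℝ}
    (h : ∀ x α β, Q.toFun x α β = t * P.toFun x α β) : Q = P.scale t := by
  obtain ⟨f, h1, h2, h3⟩ := Q
  have : f = fun x => t • P.toFun x := funext fun x => LinearMap.ext₂ fun α β => h x α β
  subst this
  rfl

theorem Expr.smoothFamily_mem_homogeneous (q : ℕ) (E : Expr) :
    E.smoothFamily 𝕂 q ∈ homogeneous 𝕂 (q + 1) E.numP := by
  intro X P Q t h φ I y
  rw [PoissonTensor_eq_scale h]
  by_cases hy : y ∈ φ.1.target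
  · simp [Expr.smoothFamily, Expr.family, hy, value_scale P φ t E I hy]
  · simp [Expr.smoothFamily, Expr.family, hy]

theorem Expr.WF.swap {E : Expr} (h : E.WF 2) : Expr.WF 2 (E.rename (Equiv.swap 0 1)) :=
  h.rename (fun u v _ _ h => (Equiv.swap 0 1).injective h) (by decide) fun v hv => by
    have := h.le v hv
    rwa [Equiv.swap_apply_of_ne_of_ne (by omega) (by omega)]

/-- The smooth skewsymmetric family defined by an expression. -/
def Expr.skewSmooth (E : Expr) : SmoothFamily 𝕂 2 :=
  E.smoothFamily 𝕂 1 - (E.rename (Equiv.swap 0 1)).smoothFamily 𝕂 1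

theorem Expr.WF.coe_skewSmooth {E : Expr} (h : E.WF 2) : (E.skewSmooth 𝕂).1 = skewFamily 𝕂 E := by
  have hv : ∀ {X : ConnManifold} (P : X.PoissonTensor) (φ : X.Chart) (I : Fin 2 → Fin X.dim)
      (y : X.Model), (E.rename (Equiv.swap 0 1)).value P φ I y
        = E.value P φ (I ∘ Equiv.swap 0 1) y := fun P φ I y =>
    Expr.value_rename h (fun u v _ _ h => (Equiv.swap 0 1).injective h) I _ fun v hv => by
      interval_cases v <;> rfl
  funext X P φ I y
  change E.family 𝕂 1 X P φ I y - (E.rename (Equiv.swap 0 1)).family 𝕂 1 X P φ I y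
    = E.family 𝕂 1 X P φ I y - E.family 𝕂 1 X P φ (I ∘ Equiv.swap 0 1) y
  simp only [Expr.family, hv]

theorem Expr.WF.skewSmooth_mem {E : Expr} (h : E.WF 2) {k : ℕ} (hk : E.numP = k) :
    E.skewSmooth 𝕂 ∈ cochains 𝕂 2 k := by
  subst hk
  refine ⟨⟨sub_mem (h.smoothFamily_mem 𝕂) (h.swap.smoothFamily_mem 𝕂),
    sub_mem (E.smoothFamily_mem_homogeneous 𝕂 1) ?_⟩, fun X P φ I τ y => ?_⟩
  · have := (E.rename (Equiv.swap 0 1)).smoothFamily_mem_homogeneous 𝕂 1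
    rwa [Expr.numP_rename] at this
  · rw [h.coe_skewSmooth 𝕂]
    change E.family 𝕂 1 X P φ (I ∘ τ) y - E.family 𝕂 1 X P φ ((I ∘ τ) ∘ Equiv.swap 0 1) y
      = _ * (E.family 𝕂 1 X P φ I y - E.family 𝕂 1 X P φ (I ∘ Equiv.swap 0 1) y)
    have : τ = 1 ∨ τ = Equiv.swap 0 1 := by
      revert τ; decide
    rcases this with rfl | rfl
    · simp
    · have : (I ∘ Equiv.swap 0 1) ∘ Equiv.swap 0 1 = I := by
        rw [Function.comp_assoc, ← Equiv.coe_trans, Equiv.swap_swap]; rfl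
      rw [this, Equiv.Perm.sign_swap (by decide)]
      simp

/-- The value of a component in the origin. -/
def evalZero {p : ℕ} {X : ConnManifold} (Q : X.PoissonTensor) (φ : X.Chart)
    (I : Fin p → Fin X.dim) : SmoothFamily 𝕂 p →ₗ[𝕂] 𝕂 where
  toFun c := c.1 X Q φ I 0
  map_add' _ _ := rfl
  map_smul' _ _ := rfl

theorem wf_of_mem_basisExprs {E : Expr} (hE : E ∈ basisExprs) : E.WF 2 := by
  obtain ⟨x, hx, rfl⟩ := List.mem_map.1 hE
  exact (Code.wf_of_check (List.all_eq_true.1 basisCodes_check x hx)).of_perm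
    (List.perm_insertionSort _ _).symm

theorem numP_of_mem_basisExprs {E : Expr} (hE : E ∈ basisExprs) : E.numP = 3 := by
  have := List.all_eq_true.1 basisExprs_check E hE
  simp only [Bool.and_eq_true, Nat.beq_eq] at this
  exact this.1

theorem notMem_lows_of_mem_basisExprs {E : Expr} (hE : E ∈ basisExprs) : 99 ∉ E.lows := by
  have := List.all_eq_true.1 basisExprs_check E hE
  simp only [Bool.and_eq_true, List.all_eq_true] at this
  intro h
  simpa using this.2 99 h

/-- The expressions of the generating set. -/
def basisExpr (i : Fin 48) : Expr := basisExprs.getD i []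

theorem basisExpr_mem (i : Fin 48) : basisExpr i ∈ basisExprs := by
  rw [basisExpr, List.getD_eq_getElem _ _ (by rw [basisExprs_length]; exact i.2)]
  exact List.getElem_mem _

/-- The elimination takes place among arbitrary families of components; as the generators are smooth
families, the span can be pulled back to the space of smooth families. -/
theorem span_skewSmooth_basisExpr :
    Submodule.span 𝕂 (Set.range fun i => (basisExpr i).skewSmooth 𝕂) = cochains 𝕂 2 3 := by
  refine le_antisymm (Submodule.span_le.2 ?_) fun c hc => ?_
  · rintro _ ⟨i, rfl⟩
    exact (wf_of_mem_basisExprs (basisExpr_mem i)).skewSmooth_mem 𝕂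
      (numP_of_mem_basisExprs (basisExpr_mem i))
  · have h := mem_basisSpan_of_mem_cochains 𝕂 hc
    have h1 : basisSpan 𝕂 ≤ (Submodule.span 𝕂 (Set.range fun i =>
        (basisExpr i).skewSmooth 𝕂)).map (SmoothFamily 𝕂 2).subtype := by
      refine Submodule.span_le.2 ?_
      rintro _ ⟨x, hx, rfl⟩
      have hE : (Code.of x).expr.insertionSort (fun A B => A.weight ≤ B.weight) ∈ basisExprs :=
        List.mem_map.2 ⟨x, hx, rfl⟩
      obtain ⟨i, hi, e⟩ := List.mem_iff_getElem.1 hE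
      rw [basisExprs_length] at hi
      refine ⟨_, Submodule.subset_span ⟨⟨i, hi⟩, rfl⟩, ?_⟩
      rw [Submodule.subtype_apply,
        (wf_of_mem_basisExprs (basisExpr_mem _)).coe_skewSmooth 𝕂, basisExpr,
        List.getD_eq_getElem _ _ (by rwa [basisExprs_length]), e]
      exact skewFamily_perm 𝕂 (List.perm_insertionSort _ _)
    obtain ⟨c', hc', e⟩ := h1 h
    rwa [← Subtype.ext e]

end Families

/-! ### Independence of the generating set -/

section Independence

variable (𝕂 : Type) [RCLike 𝕂]

/-- Realizes a listed row of values: by a component in the origin of a test manifold for two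
indices, and by a component of the coboundary for three. The latter factors through `coboundary`,
which is what the bound for cocycles needs. -/
theorem exists_functional (r : ℕ) : ∃ l : SmoothFamily 𝕂 2 →ₗ[𝕂] 𝕂,
    (∀ i : Fin 48, l ((basisExpr i).skewSmooth 𝕂)
      = (sparseGet (functionals.getD r (0, [], [])).2.2 i : 𝕂)) ∧
    ((functionals.getD r (0, [], [])).2.1.length = 3 →
      ∃ l' : SmoothFamily 𝕂 3 →ₗ[𝕂] 𝕂, l = l' ∘ₗ coboundary 𝕂 2) := by
  rcases le_or_gt functionals.length r with hr | hr
  · rw [List.getD_eq_default _ _ hr]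
    exact ⟨0, fun i => by simp [sparseGet], fun h => by simp at h⟩
  rw [List.getD_eq_getElem _ _ hr]
  have hx := List.getElem_mem hr
  generalize functionals[r] = x at hx ⊢
  obtain ⟨t, I, s⟩ := x
  have hc := List.all_eq_true.1 functionals_check _ hx
  have hlt := List.all_eq_true.1 functionals_lt _ hx
  simp only [checkFunctional, TestData.withTable_eq, List.all_eq_true, List.mem_range,
    decide_eq_true_eq] at hc
  simp only [List.all_eq_true, Nat.blt_eq] at hlt
  have hD : (testData.getD t ⟨0, [], []⟩).check = true := by
    rcases le_or_gt testData.length t with ht | ht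
    · rw [List.getD_eq_default _ _ ht]; decide
    · rw [List.getD_eq_getElem _ _ ht]
      exact List.all_eq_true.1 testData_check _ (List.getElem_mem ht)
  generalize testData.getD t ⟨0, [], []⟩ = D at hc hlt hD
  obtain ⟨X, Q, φ, h1, h2, h3⟩ := D.exists_isPoly hD
  have h : D.Realizes X Q φ := ⟨h1, h2, h3⟩
  rw [← h1] at hlt
  match I, hc, hlt with
  | [i, j], hc, hlt =>
    have hi : i < X.dim := hlt i (by simp)
    have hj : j < X.dim := hlt j (by simp)
    refine ⟨evalZero 𝕂 Q φ ![⟨i, hi⟩, ⟨j, hj⟩], fun k => ?_, fun h => by simp at h⟩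
    have hE := basisExpr_mem k
    change (Expr.skewSmooth 𝕂 (basisExpr k)).1 X Q φ ![⟨i, hi⟩, ⟨j, hj⟩] 0 = _
    rw [(wf_of_mem_basisExprs hE).coe_skewSmooth 𝕂, h.skewFamily_zero 𝕂 (wf_of_mem_basisExprs hE),
      ← hc k k.2]
    rfl
  | [i, j, l], hc, hlt =>
    have hi : i < X.dim := hlt i (by simp)
    have hj : j < X.dim := hlt j (by simp)
    have hl : l < X.dim := hlt l (by simp)
    refine ⟨evalZero 𝕂 Q φ ![⟨i, hi⟩, ⟨j, hj⟩, ⟨l, hl⟩] ∘ₗ coboundary 𝕂 2, fun k => ?_,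
      fun _ => ⟨_, rfl⟩⟩
    have hE := basisExpr_mem k
    change φ.1.target.indicator (coboundaryComp Q φ
      ((Expr.skewSmooth 𝕂 (basisExpr k)).1 X Q φ) ![⟨i, hi⟩, ⟨j, hj⟩, ⟨l, hl⟩]) 0 = _
    rw [Set.indicator_of_mem (h2.target 0), (wf_of_mem_basisExprs hE).coe_skewSmooth 𝕂,
      h.coboundaryComp_zero 𝕂 (wf_of_mem_basisExprs hE) (notMem_lows_of_mem_basisExprs hE),
      ← hc k k.2]
    rfl
  | [], hc, _ =>
    exact ⟨0, fun k => by rw [← hc k k.2]; simp [Table.functional], fun h => by simp at h⟩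
  | [_], hc, _ =>
    exact ⟨0, fun k => by rw [← hc k k.2]; simp [Table.functional], fun h => by simp at h⟩
  | _ :: _ :: _ :: _ :: _, hc, _ =>
    exact ⟨0, fun k => by rw [← hc k k.2]; simp [Table.functional], fun h => by simp at h⟩

/-- The functionals on the smooth families. -/
def functional (r : ℕ) : SmoothFamily 𝕂 2 →ₗ[𝕂] 𝕂 := (exists_functional 𝕂 r).choose

theorem functional_skewSmooth (r : ℕ) (i : Fin 48) :
    functional 𝕂 r ((basisExpr i).skewSmooth 𝕂)
      = (sparseGet (functionals.getD r (0, [], [])).2.2 i : 𝕂) :=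
  (exists_functional 𝕂 r).choose_spec.1 i

theorem functional_eq_zero {r : ℕ} (hr : (functionals.getD r (0, [], [])).2.1.length = 3)
    {c : SmoothFamily 𝕂 2} (hc : coboundary 𝕂 2 c = 0) : functional 𝕂 r c = 0 := by
  obtain ⟨l', hl⟩ := (exists_functional 𝕂 r).choose_spec.2 hr
  rw [functional, hl, LinearMap.comp_apply, hc, map_zero]

/-- The functionals determine the coefficients, since a suitable combination of them is a nonzero
multiple of each coordinate. -/
theorem eq_zero_of_functional {g : Fin 48 → 𝕂}
    (h : ∀ r, functional 𝕂 r (∑ i, g i • (basisExpr i).skewSmooth 𝕂) = 0) : g = 0 := by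
  funext j
  have hM : ∀ i : Fin 48, (((combinations.getD j []).map fun x => ((x.2 : ℤ) - 200) *
      sparseGet (functionals.getD x.1 (0, [], [])).2.2 i).sum = 0) ↔ j ≠ i := by
    intro i
    have := combinations_check
    rw [List.all_eq_true] at this
    have := List.all_eq_true.1 (this j (List.mem_range.2 j.2)) i (List.mem_range.2 i.2)
    rw [beq_iff_eq] at this
    rw [← decide_eq_true_iff (p := _ = (0 : ℤ)), this, Bool.not_eq_true', ← Bool.not_eq_true, Nat.beq_eq, Ne, Fin.ext_iff]
    exact not_congr eq_comm
  -- The `j`-th combination of the functionals, applied to the given element, is zero; by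
  -- `combinations_check` it is a nonzero multiple of `g j`.
  have hsum : ∑ i, g i * (((combinations.getD j []).map fun x => ((x.2 : ℤ) - 200) *
      sparseGet (functionals.getD x.1 (0, [], [])).2.2 i).sum : ℤ) = (0 : 𝕂) := by
    have h1 : ∀ L : List (ℕ × ℕ), ∑ i : Fin 48, g i * ((L.map fun x => ((x.2 : ℤ) - 200) *
        sparseGet (functionals.getD x.1 (0, [], [])).2.2 i).sum : ℤ) = (0 : 𝕂) := by
      intro L
      induction L with
      | nil => simp
      | cons x L ih =>
        have h2 := h x.1
        simp only [map_sum, map_smul, functional_skewSmooth, smul_eq_mul] at h2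
        simp only [List.map_cons, List.sum_cons, Int.cast_add, mul_add, Finset.sum_add_distrib, ih,
          add_zero, Int.cast_mul, mul_left_comm (g _)]
        rw [← Finset.mul_sum, h2, mul_zero]
    exact h1 _
  rw [Finset.sum_eq_single j (fun i _ hi => by rw [(hM i).2 hi.symm, Int.cast_zero, mul_zero])
    (by simp)] at hsum
  rcases mul_eq_zero.1 hsum with h0 | h0
  · exact h0
  · exact absurd rfl ((hM j).1 (by exact_mod_cast h0))

theorem linearIndependent_basisExpr :
    LinearIndependent 𝕂 fun i => (basisExpr i).skewSmooth 𝕂 := by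
  rw [Fintype.linearIndependent_iff]
  intro g hg i
  rw [eq_zero_of_functional 𝕂 (g := g) fun r => by rw [hg, map_zero]]
  rfl

theorem finrank_cochains : Module.finrank 𝕂 (cochains 𝕂 2 3) = 48 := by
  rw [← span_skewSmooth_basisExpr, finrank_span_eq_card (linearIndependent_basisExpr 𝕂),
    Fintype.card_fin]

theorem finite_cochains : Module.Finite 𝕂 (cochains 𝕂 2 3) := by
  rw [← span_skewSmooth_basisExpr]
  exact Module.Finite.span_of_finite 𝕂 (Set.finite_range _)

/-- The indices of the functionals which are evaluations of bivectors. -/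
def evaluations : List ℕ :=
  (List.range 48).filter fun r => !Nat.beq (functionals.getD r (0, [], [])).2.1.length 3

theorem evaluations_length : evaluations.length = 4 := by decide +kernel

/-- All functionals which factor through the coboundary vanish on cocycles. A cocycle is therefore
determined by the remaining evaluations, of which there are four. -/
theorem finrank_cocycles_le : Module.finrank 𝕂 (cocycles 𝕂 2 3) ≤ 4 := by
  let χ : cocycles 𝕂 2 3 →ₗ[𝕂] Fin evaluations.length → 𝕂 :=
    LinearMap.pi fun s => functional 𝕂 evaluations[s] ∘ₗ (cocycles 𝕂 2 3).subtype
  have hχ : Function.Injective χ := by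
    rw [← LinearMap.ker_eq_bot, LinearMap.ker_eq_bot']
    intro c hc
    obtain ⟨hc1, hc2⟩ := c.2
    have h1 := hc1
    change c.1 ∈ cochains 𝕂 2 3 at h1
    rw [← span_skewSmooth_basisExpr, Submodule.mem_span_range_iff_exists_fun] at h1
    obtain ⟨g, hg⟩ := h1
    have hz : ∀ r, functional 𝕂 r c.1 = 0 := by
      intro r
      by_cases hr : (functionals.getD r (0, [], [])).2.1.length = 3
      · exact functional_eq_zero 𝕂 hr hc2
      · rcases lt_or_ge r 48 with h48 | h48
        · have hmem : r ∈ evaluations := by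
            rw [evaluations, List.mem_filter, List.mem_range, Bool.not_eq_true', ← Bool.not_eq_true,
              Nat.beq_eq]
            exact ⟨h48, hr⟩
          obtain ⟨s, hs, e⟩ := List.mem_iff_getElem.1 hmem
          rw [← e]
          exact congrFun hc ⟨s, hs⟩
        -- Beyond the end of the list the default row is empty, and the functional vanishes on all
        -- generators.
        · rw [← hg]
          simp only [map_sum, map_smul, functional_skewSmooth]
          rw [List.getD_eq_default _ _ (by rwa [functionals_length])]
          simp [sparseGet]
    have := eq_zero_of_functional 𝕂 (g := g) fun r => by rw [hg, hz r]
    refine Subtype.ext ?_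
    rw [← hg, this]
    simp
  have := LinearMap.finrank_le_finrank_of_injective hχ
  rwa [Module.finrank_fintype_fun_eq_card, Fintype.card_fin, evaluations_length] at this

end Independence

/-! ### The square of the coboundary operator on vector fields -/

section Square

variable {X : ConnManifold} (P : X.PoissonTensor) (φ : X.Chart)

theorem coboundaryComp_one {𝕂 : Type} [RCLike 𝕂] (c : (Fin 1 → Fin X.dim) → X.Model → 𝕂)
    (i j : Fin X.dim) (y : X.Model) :
    coboundaryComp P φ c ![i, j] y = ∑ l, P.comp φ i l y • pd l (c ![j]) y
      - ∑ l, pd l (P.comp φ i j) y • c ![l] y - ∑ l, P.comp φ j l y • pd l (c ![i]) y := by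
  have h0 : Finset.Ioi (0 : Fin 2) = {1} := by decide
  have h1 : Finset.Ioi (1 : Fin 2) = ∅ := by decide
  have e0 : (![i, j] : Fin 2 → Fin X.dim) ∘ Fin.succAbove 0 = ![j] := by
    funext s; fin_cases s; rfl
  have e1 : (![i, j] : Fin 2 → Fin X.dim) ∘ Fin.succAbove 1 = ![i] := by
    funext s; fin_cases s; rfl
  have u1 : ∀ l, Function.update (![i, j] : Fin 2 → Fin X.dim) 1 l ∘ Fin.succAbove 0 = ![l] :=
    fun l => by funext s; fin_cases s; rfl
  unfold coboundaryComp
  rw [Fin.sum_univ_two, h0, h1, Finset.sum_singleton, Finset.sum_empty]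
  simp only [e0, e1, u1]
  simp
  ring

/-- The Hamiltonian vector field of a coordinate function. -/
def ham (i : Fin X.dim) (f : X.Model → ℝ) (y : X.Model) : ℝ := ∑ l, P.comp φ i l y * pd l f y

variable {P φ} {f g : X.Model → ℝ} {y : X.Model}

theorem contDiffOn_ham (i : Fin X.dim) (hf : ContDiffOn ℝ ∞ f φ.1.target) :
    ContDiffOn ℝ ∞ (ham P φ i f) φ.1.target :=
  ContDiffOn.sum fun l _ => (P.smooth φ i l).mul (contDiffOn_pd φ.1.open_target hf l)

theorem ham_sub (i : Fin X.dim) (hf : ContDiffOn ℝ ∞ f φ.1.target)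
    (hg : ContDiffOn ℝ ∞ g φ.1.target) (hy : y ∈ φ.1.target) :
    ham P φ i (fun y => f y - g y) y = ham P φ i f y - ham P φ i g y := by
  unfold ham
  rw [← Finset.sum_sub_distrib]
  refine Finset.sum_congr rfl fun l _ => ?_
  rw [pd_fun_sub (ConnManifold.differentiableAt_of_contDiffOn hf hy)
    (ConnManifold.differentiableAt_of_contDiffOn hg hy)]
  ring

theorem ham_neg (i : Fin X.dim) (f : X.Model → ℝ) (y : X.Model) :
    ham P φ i (fun y => - f y) y = - ham P φ i f y := by
  simp [ham, pd]

theorem ham_sum_mul (i : Fin X.dim) {f g : Fin X.dim → X.Model → ℝ}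
    (hf : ∀ l, ContDiffOn ℝ ∞ (f l) φ.1.target) (hg : ∀ l, ContDiffOn ℝ ∞ (g l) φ.1.target)
    (hy : y ∈ φ.1.target) : ham P φ i (fun y => ∑ l, f l y * g l y) y
      = ∑ l, g l y * ham P φ i (f l) y + ∑ l, f l y * ham P φ i (g l) y := by
  have hf' := fun l => ConnManifold.differentiableAt_of_contDiffOn (hf l) hy
  have hg' := fun l => ConnManifold.differentiableAt_of_contDiffOn (hg l) hy
  unfold ham
  rw [← Finset.sum_add_distrib]
  simp only [pd_fun_sum fun l _ => (hf' l).fun_mul (hg' l), pd_fun_mul (hf' _) (hg' _), Finset.mul_sum]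
  rw [Finset.sum_comm]
  refine Finset.sum_congr rfl fun l _ => ?_
  rw [← Finset.sum_add_distrib]
  exact Finset.sum_congr rfl fun m _ => by ring

theorem sum_jacobi (i j k : Fin X.dim) (hy : y ∈ φ.1.target) :
    ham P φ i (P.comp φ j k) y + ham P φ j (P.comp φ k i) y + ham P φ k (P.comp φ i j) y = 0 := by
  rw [← P.jacobi φ i j k y hy]
  simp only [Finset.sum_add_distrib]
  rfl

theorem pd_comp_skew (l i j : Fin X.dim) (y : X.Model) :
    pd l (P.comp φ i j) y = - pd l (P.comp φ j i) y := by
  have : P.comp φ i j = fun y => - P.comp φ j i y := funext fun y => P.comp_skew φ j i y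
  rw [this]
  simp [pd]

/-- The Hamiltonian fields of two coordinate functions have as commutator the Hamiltonian field of
their bracket `P^{ij}`: second derivatives of `f` cancel, and the coefficients of the first
derivatives agree by the Jacobi identity. -/
theorem ham_comm (i j : Fin X.dim) (hf : ContDiffOn ℝ ∞ f φ.1.target) (hy : y ∈ φ.1.target) :
    ham P φ i (ham P φ j f) y - ham P φ j (ham P φ i f) y
      = ∑ l, pd l (P.comp φ i j) y * ham P φ l f y := by
  have h1 : ∀ i j, ham P φ i (ham P φ j f) y = ∑ l, pd l f y * ham P φ i (P.comp φ j l) y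
      + ∑ m, P.comp φ j m y * ∑ l, P.comp φ i l y * pd l (pd m f) y := fun i j =>
    ham_sum_mul i (fun l => P.smooth φ j l) (fun l => contDiffOn_pd φ.1.open_target hf l) hy
  -- The terms with second derivatives of `f` are symmetric in `i` and `j`.
  have h2 : ∑ m, P.comp φ j m y * ∑ l, P.comp φ i l y * pd l (pd m f) y
      = ∑ m, P.comp φ i m y * ∑ l, P.comp φ j l y * pd l (pd m f) y := by
    simp only [Finset.mul_sum]
    rw [Finset.sum_comm]
    refine Finset.sum_congr rfl fun l _ => Finset.sum_congr rfl fun m _ => ?_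
    rw [pd_pd_comm φ.1.open_target hf hy]
    ring
  have h3 : ∑ l, pd l (P.comp φ i j) y * ham P φ l f y
      = ∑ m, pd m f y * - ham P φ m (P.comp φ i j) y := by
    unfold ham
    simp only [← Finset.sum_neg_distrib, Finset.mul_sum]
    rw [Finset.sum_comm]
    refine Finset.sum_congr rfl fun m _ => Finset.sum_congr rfl fun l _ => ?_
    rw [P.comp_skew φ l m]
    ring
  rw [h1, h1, h2, h3, add_sub_add_right_eq_sub, ← Finset.sum_sub_distrib]
  refine Finset.sum_congr rfl fun m _ => ?_
  have h4 : ham P φ j (P.comp φ i m) y = - ham P φ j (P.comp φ m i) y := by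
    unfold ham
    rw [← Finset.sum_neg_distrib]
    exact Finset.sum_congr rfl fun l _ => by rw [pd_comp_skew]; ring
  linear_combination (pd m f y) * sum_jacobi (P := P) i j m hy - (pd m f y) * h4

theorem pd_ham (m i : Fin X.dim) (hf : ContDiffOn ℝ ∞ f φ.1.target) (hy : y ∈ φ.1.target) :
    pd m (ham P φ i f) y = ham P φ i (pd m f) y + ∑ l, pd m (P.comp φ i l) y * pd l f y := by
  have hf' := fun l => ConnManifold.differentiableAt_of_contDiffOn
    (contDiffOn_pd φ.1.open_target hf l) hy
  have hP : ∀ l, DifferentiableAt ℝ (P.comp φ i l) y := fun l =>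
    ConnManifold.differentiableAt_of_contDiffOn (P.smooth φ i l) hy
  unfold ham
  rw [pd_fun_sum fun l _ => (hP l).fun_mul (hf' l), ← Finset.sum_add_distrib]
  refine Finset.sum_congr rfl fun l _ => ?_
  rw [pd_fun_mul (hP l) (hf' l), pd_pd_comm φ.1.open_target hf hy]
  exact add_comm _ _

/-- The partial derivative of the Jacobi identity, which holds on an open set. -/
theorem pd_sum_jacobi (m i j k : Fin X.dim) (hy : y ∈ φ.1.target) :
    ham P φ i (pd m (P.comp φ j k)) y + ham P φ j (pd m (P.comp φ k i)) y
      + ham P φ k (pd m (P.comp φ i j)) y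
      + (∑ l, pd m (P.comp φ i l) y * pd l (P.comp φ j k) y
        + ∑ l, pd m (P.comp φ j l) y * pd l (P.comp φ k i) y
        + ∑ l, pd m (P.comp φ k l) y * pd l (P.comp φ i j) y) = 0 := by
  have hd : ∀ i j k, DifferentiableAt ℝ (ham P φ i (P.comp φ j k)) y := fun i j k =>
    ConnManifold.differentiableAt_of_contDiffOn (contDiffOn_ham i (P.smooth φ j k)) hy
  have h := pd_congr_of_eqOn (l := m) φ.1.open_target
    (fun z hz => sum_jacobi (P := P) i j k hz) hy
  rw [pd_const, pd_fun_add ((hd i j k).fun_add (hd j k i)) (hd k i j),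
    pd_fun_add (hd i j k) (hd j k i), pd_ham (f := P.comp φ j k) _ _ (P.smooth φ j k) hy,
    pd_ham (f := P.comp φ k i) _ _ (P.smooth φ k i) hy,
    pd_ham (f := P.comp φ i j) _ _ (P.smooth φ i j) hy] at h
  linear_combination h

/-- In the square of the coboundary, the terms with derivatives of `c` cancel by the commutators of
Hamiltonian fields, and those with `c` itself by the differentiated Jacobi identity. -/
theorem coboundaryComp_coboundaryComp {c : (Fin 1 → Fin X.dim) → X.Model → ℝ}
    (hc : ∀ I, ContDiffOn ℝ ∞ (c I) φ.1.target) (i j k : Fin X.dim) (hy : y ∈ φ.1.target) :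
    coboundaryComp P φ (coboundaryComp P φ c) ![i, j, k] y = 0 := by
  have hC : ∀ i j, coboundaryComp P φ c ![i, j] = fun y => ham P φ i (c ![j]) y
      - (∑ l, pd l (P.comp φ i j) y * c ![l] y) - ham P φ j (c ![i]) y := fun i j =>
    funext fun y => coboundaryComp_one P φ c i j y
  have hp : ∀ l i j, ContDiffOn ℝ ∞ (pd l (P.comp φ i j)) φ.1.target := fun l i j =>
    contDiffOn_pd φ.1.open_target (P.smooth φ i j) l
  have hs : ∀ i j, ContDiffOn ℝ ∞ (fun y => ∑ l, pd l (P.comp φ i j) y * c ![l] y) φ.1.target :=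
    fun i j => ContDiffOn.sum fun l _ => (hp l i j).mul (hc _)
  have h1 : ∀ i j k, ham P φ i (coboundaryComp P φ c ![j, k]) y
      = ham P φ i (ham P φ j (c ![k])) y - (∑ l, c ![l] y * ham P φ i (pd l (P.comp φ j k)) y
        + ∑ l, pd l (P.comp φ j k) y * ham P φ i (c ![l]) y) - ham P φ i (ham P φ k (c ![j])) y := by
    intro i j k
    rw [hC, ham_sub i ((contDiffOn_ham j (hc _)).sub (hs j k)) (contDiffOn_ham k (hc _)) hy,
      ham_sub i (contDiffOn_ham j (hc _)) (hs j k) hy,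
      ham_sum_mul i (fun l => hp l j k) (fun l => hc ![l]) hy]
  have h2 : ∀ i j k, ∑ l, pd l (P.comp φ i j) y * ∑ m, pd m (P.comp φ l k) y * c ![m] y
      = - ∑ m, c ![m] y * ∑ l, pd m (P.comp φ k l) y * pd l (P.comp φ i j) y := by
    intro i j k
    simp only [Finset.mul_sum]
    rw [Finset.sum_comm, ← Finset.sum_neg_distrib]
    refine Finset.sum_congr rfl fun m _ => ?_
    rw [← Finset.sum_neg_distrib]
    refine Finset.sum_congr rfl fun l _ => ?_
    rw [pd_comp_skew m l k]
    ring
  have h3 : ∀ i j k, ∑ l, pd l (P.comp φ i j) y * ∑ m, pd m (P.comp φ k l) y * c ![m] y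
      = ∑ m, c ![m] y * ∑ l, pd m (P.comp φ k l) y * pd l (P.comp φ i j) y := by
    intro i j k
    simp only [Finset.mul_sum]
    rw [Finset.sum_comm]
    exact Finset.sum_congr rfl fun m _ => Finset.sum_congr rfl fun l _ => by ring
  have h4 : ∑ m, c ![m] y * ham P φ j (pd m (P.comp φ k i)) y
      = - ∑ m, c ![m] y * ham P φ j (pd m (P.comp φ i k)) y := by
    rw [← Finset.sum_neg_distrib]
    refine Finset.sum_congr rfl fun m _ => ?_
    have : pd m (P.comp φ k i) = fun y => - pd m (P.comp φ i k) y := funext fun y => pd_comp_skew _ _ _ _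
    rw [this, ham_neg, mul_neg]
  have h5 : ∑ m, c ![m] y * ∑ l, pd m (P.comp φ j l) y * pd l (P.comp φ k i) y
      = - ∑ m, c ![m] y * ∑ l, pd m (P.comp φ j l) y * pd l (P.comp φ i k) y := by
    rw [← Finset.sum_neg_distrib]
    refine Finset.sum_congr rfl fun m _ => ?_
    rw [← mul_neg, ← Finset.sum_neg_distrib]
    refine congrArg _ (Finset.sum_congr rfl fun l _ => ?_)
    rw [pd_comp_skew l k i]
    ring
  -- The differentiated Jacobi identity, contracted with the vector field `c`.
  have hJ : ∑ m, c ![m] y * ham P φ i (pd m (P.comp φ j k)) y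
      + ∑ m, c ![m] y * ham P φ j (pd m (P.comp φ k i)) y
      + ∑ m, c ![m] y * ham P φ k (pd m (P.comp φ i j)) y
      + (∑ m, c ![m] y * ∑ l, pd m (P.comp φ i l) y * pd l (P.comp φ j k) y
        + ∑ m, c ![m] y * ∑ l, pd m (P.comp φ j l) y * pd l (P.comp φ k i) y
        + ∑ m, c ![m] y * ∑ l, pd m (P.comp φ k l) y * pd l (P.comp φ i j) y) = 0 := by
    simp only [← Finset.sum_add_distrib, ← mul_add]
    refine Finset.sum_eq_zero fun m _ => ?_
    rw [Finset.sum_add_distrib, Finset.sum_add_distrib, pd_sum_jacobi m i j k hy, mul_zero]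
  have e : coboundaryComp P φ (coboundaryComp P φ c) ![i, j, k] y
      = ham P φ i (coboundaryComp P φ c ![j, k]) y - ham P φ j (coboundaryComp P φ c ![i, k]) y
        + ham P φ k (coboundaryComp P φ c ![i, j]) y
        - (∑ l, pd l (P.comp φ i j) y * coboundaryComp P φ c ![l, k] y
          + ∑ l, pd l (P.comp φ i k) y * coboundaryComp P φ c ![j, l] y
          - ∑ l, pd l (P.comp φ j k) y * coboundaryComp P φ c ![i, l] y) :=
    coboundaryComp_two P φ _ i j k y
  rw [e, h1, h1, h1]
  simp only [hC, mul_sub, Finset.sum_sub_distrib, h2, h3]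
  have c1 := ham_comm (P := P) i j (hc ![k]) hy
  have c2 := ham_comm (P := P) i k (hc ![j]) hy
  have c3 := ham_comm (P := P) j k (hc ![i]) hy
  linear_combination c1 - c2 + c3 - hJ + h4 + h5

end Square

/-! ### Coboundaries of the vector fields defined by expressions -/

namespace Expr

/-- The free index is replaced by `k`. -/
def atIndex (k : ℕ) (E : Expr) : Expr := E.rename fun v => if v = 0 then k else v

/-- The terms of the coboundary which are skewsymmetrized. -/
def boundaryTerms (E : Expr) : List Expr :=
  ((E.atIndex 1).deriv 99).map fun F => ⟨Factor.P 0, [], [0, 99]⟩ :: F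

/-- The term of the coboundary with the derivative of the Poisson tensor. -/
def boundaryTerm (E : Expr) : Expr := ⟨Factor.P 1, [99], [0, 1]⟩ :: E.atIndex 99

variable {X : ConnManifold} (P : X.PoissonTensor) (φ : X.Chart) {E : Expr} {y : X.Model}

theorem WF.lows_atIndex (h : E.WF 1) (k : ℕ) : (E.atIndex k).lows = E.lows := by
  rw [atIndex, lows_rename]
  conv_rhs => rw [← List.map_id E.lows]
  refine List.map_congr_left fun v hv => if_neg ?_
  have := h.le v hv
  omega

theorem WF.ev_atIndex (h : E.WF 1) {k : ℕ} (hk : k ∉ E.lows) (ν : ℕ → Fin X.dim) :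
    (E.atIndex k).ev P φ E.lows ν = E.value P φ ![ν k] := by
  funext y
  have h0 : 0 ∉ E.lows := fun h' => by simpa using h.le 0 h'
  rw [value, ev, ev]
  conv_lhs => rw [← h.lows_atIndex k, atIndex, lows_rename]
  simp only [pval_rename h.ok]
  refine sumOver_rename (F := fun ν => E.pval P φ ν ν y) (fun v => v = 0 ∨ v ∈ E.lows)
    (fun u v hu hv huv => ?_) (fun v hv => Or.inr hv) (fun v hv hv' => ?_) fun μ μ' hμ => ?_
  · rcases hu with rfl | hu <;> rcases hv with rfl | hv
    · rfl
    · have hv0 : v ≠ 0 := ne_of_mem_of_not_mem hv h0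
      simp only [if_true, if_neg hv0] at huv
      exact absurd hv (huv ▸ hk)
    · have hu0 : u ≠ 0 := ne_of_mem_of_not_mem hu h0
      simp only [if_true, if_neg hu0] at huv
      exact absurd hu (huv ▸ hk)
    · rwa [if_neg (ne_of_mem_of_not_mem hu h0), if_neg (ne_of_mem_of_not_mem hv h0)] at huv
  · rcases hv with rfl | hv
    · rfl
    · exact absurd hv hv'
  · refine pval_congr h.ok (fun v hv => hμ v (Or.inr hv)) fun v hv => hμ v ?_
    simpa using h.perm.mem_iff.1 hv

theorem value_cons_of_perm {A : Atom} {F : Expr} {vs : List ℕ} (hp : (A.lo ++ F.lows).Perm (99 :: vs))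
    {I : Fin 2 → Fin X.dim} {a : Fin X.dim → ℝ}
    (ha : ∀ ν : ℕ → Fin X.dim, (∀ v, v ∉ 99 :: vs → ν v = env I v) → A.val P φ ν ν y = a (ν 99))
    (hw : 99 ∉ vs) :
    value P φ (A :: F) I y = ∑ e, a e * F.ev P φ vs (Function.update (env I) 99 e) y := by
  rw [value, ev, lows_cons, sumOver_perm hp, sumOver]
  refine Finset.sum_congr rfl fun e _ => ?_
  rw [ev, ← sumOver_mul_left]
  refine sumOver_congr fun μ hμ => ?_
  rw [pval_cons, ha μ fun v hv => ?_, hμ 99 hw, Function.update_self]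
  rw [List.mem_cons, not_or] at hv
  rw [hμ v hv.2, Function.update_of_ne hv.1]

theorem WF.sum_value_boundaryTerms (h : E.WF 1) (h1 : 1 ∉ E.lows)
    (h99 : 99 ∉ E.lows) (i j : Fin X.dim) (hy : y ∈ φ.1.target) :
    (E.boundaryTerms.map fun F => value P φ F ![i, j] y).sum
      = ∑ e, P.comp φ i e y * (pd e (E.value P φ ![j]) y
        + ∑ f, X.christoffel φ e f j y * E.value P φ ![f] y) := by
  have h0 : 0 ∉ E.lows := fun h' => by simpa using h.le 0 h'
  have hl := h.lows_atIndex 1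
  have hu : (E.atIndex 1).ups.Perm ([1] ++ E.lows) := by
    have : (E.atIndex 1).ups = E.ups.map fun v => if v = 0 then 1 else v := ups_rename _ _
    rw [this]
    refine (h.perm.map _).trans ?_
    rw [List.map_append, ← lows_rename, ← atIndex, hl]
    rfl
  have hok : (E.atIndex 1).Ok := ok_rename h.ok _
  have hup : (E.atIndex 1).ups.Nodup := hu.nodup_iff.2 (by simpa using ⟨h1, h.nodup⟩)
  rw [boundaryTerms, List.map_map]
  have e1 : ∀ F ∈ (E.atIndex 1).deriv 99,
      ((fun F => value P φ F ![i, j] y) ∘ fun F => (⟨Factor.P 0, [], [0, 99]⟩ :: F : Expr)) F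
      = ∑ e, P.comp φ i e y * F.ev P φ E.lows (Function.update (env ![i, j]) 99 e) y := by
    intro F hF
    refine value_cons_of_perm P φ (a := fun e => P.comp φ i e y) ?_ (fun ν hν => ?_) h99
    · rw [← hl]; exact lows_deriv hF
    · change P.comp φ (ν 0) (ν 99) y = _
      rw [hν 0 (by simpa using h0)]
      rfl
  rw [List.map_congr_left e1]
  have e2 : ∀ (L : List Expr) (G : Fin X.dim → Expr → ℝ), (L.map fun F => ∑ e, P.comp φ i e y * G e F).sum
      = ∑ e, P.comp φ i e y * (L.map (G e)).sum := by
    intro L G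
    induction L with
    | nil => simp
    | cons F L ih => simp [ih, mul_add, Finset.sum_add_distrib]
  rw [e2]
  refine Finset.sum_congr rfl fun e _ => congrArg _ ?_
  have e3 := pd_ev (P := P) hok (fl := []) (fu := [1]) (vs := E.lows) (by rw [hl]; rfl) hu
    (by rw [hl]; exact h.nodup) hup (by simp) h99 (Function.update (env ![i, j]) 99 e) hy
  simp only [Function.update_self, h.ev_atIndex P φ h1, List.map_nil, List.sum_nil, List.map_cons,
    List.sum_cons, add_zero] at e3
  exact (eq_sub_iff_add_eq.1 e3).symm

theorem WF.value_boundaryTerm (h : E.WF 1) (h1 : 1 ∉ E.lows)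
    (h99 : 99 ∉ E.lows) (i j : Fin X.dim) (y : X.Model) :
    E.boundaryTerm.value P φ ![i, j] y = ∑ e, (pd e (P.comp φ i j) y
      + (∑ f, X.christoffel φ e f i y * P.comp φ f j y
        + ∑ f, X.christoffel φ e f j y * P.comp φ i f y)) * E.value P φ ![e] y := by
  have h0 : 0 ∉ E.lows := fun h' => by simpa using h.le 0 h'
  rw [boundaryTerm, value_cons_of_perm P φ (vs := E.lows) (a := fun e => pd e (P.comp φ i j) y
      + (∑ f, X.christoffel φ e f i y * P.comp φ f j y
        + ∑ f, X.christoffel φ e f j y * P.comp φ i f y)) ?_ (fun ν hν => ?_) h99]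
  · simp only [h.ev_atIndex P φ h99, Function.update_self]
  · rw [h.lows_atIndex]; rfl
  · have e0 : ν 0 = i := hν 0 (by simpa using h0)
    have e1 : ν 1 = j := hν 1 (by simpa using h1)
    rw [← e0, ← e1]
    change X.covDeriv φ (P.components φ) (fun s => ν ([99].getD s 0)) (fun s => ν ([0, 1].getD s 0)) y = _
    unfold ConnManifold.covDeriv
    rw [Fin.sum_univ_zero, sub_zero, Fin.sum_univ_two]
    rfl

theorem WF.coboundaryComp_value (h : E.WF 1) (h1 : 1 ∉ E.lows)
    (h99 : 99 ∉ E.lows) (i j : Fin X.dim) (hy : y ∈ φ.1.target) :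
    coboundaryComp P φ (E.value P φ) ![i, j] y
      = (E.boundaryTerms.map fun F => value P φ F ![i, j] y).sum
        - (E.boundaryTerms.map fun F => value P φ F ![j, i] y).sum
        - E.boundaryTerm.value P φ ![i, j] y := by
  rw [h.sum_value_boundaryTerms P φ h1 h99 i j hy, h.sum_value_boundaryTerms P φ h1 h99 j i hy,
    h.value_boundaryTerm P φ h1 h99, coboundaryComp_one]
  simp only [smul_eq_mul, mul_add, add_mul, Finset.sum_add_distrib]
  -- Symmetry of the Christoffel symbol in its lower indices and skewness of `P`, after an exchange
  -- of the two summations.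
  have e1 : ∑ e, (∑ f, X.christoffel φ e f i y * P.comp φ f j y) * E.value P φ ![e] y
      = - ∑ e, P.comp φ j e y * ∑ f, X.christoffel φ e f i y * E.value P φ ![f] y := by
    simp only [Finset.sum_mul, Finset.mul_sum, ← Finset.sum_neg_distrib]
    rw [Finset.sum_comm]
    refine Finset.sum_congr rfl fun f _ => Finset.sum_congr rfl fun e _ => ?_
    rw [X.christoffel_symm φ e f i hy, P.comp_skew φ j f]
    ring
  have e2 : ∑ e, (∑ f, X.christoffel φ e f j y * P.comp φ i f y) * E.value P φ ![e] y
      = ∑ e, P.comp φ i e y * ∑ f, X.christoffel φ e f j y * E.value P φ ![f] y := by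
    simp only [Finset.sum_mul, Finset.mul_sum]
    rw [Finset.sum_comm]
    refine Finset.sum_congr rfl fun f _ => Finset.sum_congr rfl fun e _ => ?_
    rw [X.christoffel_symm φ e f j hy]
    ring
  linear_combination e1 + e2

end Expr

/-! ### The coboundaries -/

namespace Expr

/-- A criterion for `Expr.WF`. -/
def check (p : ℕ) (E : Expr) : Bool :=
  (E.all fun A => Nat.beq A.lo.length A.f.lower && Nat.beq A.up.length A.f.upper &&
    A.lo.all fun v => !A.up.elem v) &&
  decide E.lows.Nodup && (E.lows.all fun v => Nat.ble p v) && E.ups.isPerm (List.range p ++ E.lows)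

theorem wf_of_check {p : ℕ} {E : Expr} (h : E.check p = true) : E.WF p := by
  simp only [check, Bool.and_eq_true, List.all_eq_true, Nat.beq_eq, decide_eq_true_eq, Nat.ble_eq,
    List.isPerm_iff] at h
  obtain ⟨⟨⟨h1, h2⟩, h3⟩, h4⟩ := h
  exact ⟨fun A hA => (h1 A hA).1, h2, h3, h4, fun A hA v hv hv' => by
    simpa [hv'] using (h1 A hA).2 v hv⟩

/-- A criterion for the vector field defined by an expression to be a cochain of degree 2 whose
coboundary is a combination of expressions without loops. -/
def isPrimitive (E : Expr) : Bool :=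
  E.check 1 && Nat.beq E.numP 2 && !E.lows.elem 1 && !E.lows.elem 99 &&
    E.boundaryTerms.all (fun F => F.check 2 && Nat.beq F.numP 3) &&
    (E.boundaryTerm.check 2 && Nat.beq E.boundaryTerm.numP 3)

/-- The properties which are checked by `isPrimitive`. -/
structure Primitive (E : Expr) : Prop where
  wf : E.WF 1
  numP : E.numP = 2
  one : 1 ∉ E.lows
  notMem : 99 ∉ E.lows
  terms : ∀ F ∈ E.boundaryTerms, F.WF 2 ∧ F.numP = 3
  term : E.boundaryTerm.WF 2 ∧ E.boundaryTerm.numP = 3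

theorem primitive_of_isPrimitive {E : Expr} (h : E.isPrimitive = true) : E.Primitive := by
  simp only [isPrimitive, Bool.and_eq_true, Nat.beq_eq, Bool.not_eq_true', List.all_eq_true] at h
  obtain ⟨⟨⟨⟨⟨h1, h2⟩, h3⟩, h4⟩, h5⟩, h6⟩ := h
  exact ⟨wf_of_check h1, h2, fun h => by simp [h] at h3, fun h => by simp [h] at h4,
    fun F hF => ⟨wf_of_check (h5 F hF).1, (h5 F hF).2⟩, wf_of_check h6.1, h6.2⟩

end Expr

section Coboundary

variable (𝕂 : Type) [RCLike 𝕂]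

/-- The coboundary of the vector field defined by an expression. -/
def Expr.boundarySmooth (E : Expr) : SmoothFamily 𝕂 2 :=
  (E.boundaryTerms.map (Expr.skewSmooth 𝕂)).sum - E.boundaryTerm.smoothFamily 𝕂 1

theorem coboundaryComp_congr {X : ConnManifold} (P : X.PoissonTensor) (φ : X.Chart) {p : ℕ}
    {c c' : (Fin p → Fin X.dim) → X.Model → 𝕂} (h : ∀ J, ∀ z ∈ φ.1.target, c J z = c' J z)
    (I : Fin (p + 1) → Fin X.dim) {y : X.Model} (hy : y ∈ φ.1.target) :
    coboundaryComp P φ c I y = coboundaryComp P φ c' I y := by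
  have hp : ∀ l J, pd l (c J) y = pd l (c' J) y := fun l J => by
    unfold pd
    rw [Filter.EventuallyEq.fderiv_eq
      (Filter.eventually_of_mem (φ.1.open_target.mem_nhds hy) (h J))]
  simp only [coboundaryComp, hp, h _ y hy]

theorem coboundaryComp_family {X : ConnManifold} (P : X.PoissonTensor) (φ : X.Chart) {q : ℕ}
    (E : Expr) (I : Fin (q + 2) → Fin X.dim) {y : X.Model} (hy : y ∈ φ.1.target) :
    coboundaryComp P φ (E.family 𝕂 q X P φ) I y
      = ((coboundaryComp P φ (E.value P φ) I y : ℝ) : 𝕂) := by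
  rw [← coboundaryComp_ofReal 𝕂 P φ (c := E.value P φ) (fun I =>
    ConnManifold.differentiableAt_of_contDiffOn (E.contDiffOn_ev _ _) hy)]
  exact coboundaryComp_congr 𝕂 P φ (fun J z hz => by simp [Expr.family, hz]) I hy

/-- Reduces to the real computation in a chart; components outside of the target are zero by
convention. -/
theorem coboundary_coboundary (E : Expr) :
    coboundary 𝕂 2 (coboundary 𝕂 1 (E.smoothFamily 𝕂 0)) = 0 := by
  refine Subtype.ext ?_
  funext X P φ I y
  change φ.1.target.indicator (coboundaryComp P φ (fun I =>
    φ.1.target.indicator (coboundaryComp P φ (E.family 𝕂 0 X P φ) I)) I) y = 0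
  by_cases hy : y ∈ φ.1.target
  swap
  · rw [Set.indicator_of_notMem hy]
  have hc : ∀ I, ContDiffOn ℝ ∞ (E.value (q := 0) P φ I) φ.1.target := fun I =>
    E.contDiffOn_ev _ _
  have hI : ∀ I : Fin 2 → Fin X.dim, I = ![I 0, I 1] := fun I => by
    funext s; fin_cases s <;> rfl
  have hI' : I = ![I 0, I 1, I 2] := by
    funext s; fin_cases s <;> rfl
  have hd : ∀ I, DifferentiableAt ℝ (coboundaryComp P φ (E.value (q := 0) P φ) I) y := fun I => by
    refine ConnManifold.differentiableAt_of_contDiffOn (φ := φ) ?_ hy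
    rw [hI I]
    refine ContDiffOn.congr (f := fun y => ham P φ (I 0) (E.value P φ ![I 1]) y
      - ∑ l, pd l (P.comp φ (I 0) (I 1)) y * E.value P φ ![l] y
      - ham P φ (I 1) (E.value P φ ![I 0]) y) ?_ fun y _ => coboundaryComp_one P φ _ _ _ y
    exact ((contDiffOn_ham _ (hc _)).sub (ContDiffOn.sum fun l _ =>
      (contDiffOn_pd φ.1.open_target (P.smooth φ _ _) l).mul (hc _))).sub (contDiffOn_ham _ (hc _))
  rw [Set.indicator_of_mem hy, coboundaryComp_congr 𝕂 P φ (c' := fun I y =>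
    ((coboundaryComp P φ (E.value (q := 0) P φ) I y : ℝ) : 𝕂)) (fun J z hz => by
      rw [Set.indicator_of_mem hz, coboundaryComp_family 𝕂 P φ E J hz]) I hy,
    coboundaryComp_ofReal 𝕂 P φ hd, hI', coboundaryComp_coboundaryComp hc _ _ _ hy, RCLike.ofReal_zero]

variable {E : Expr}

theorem Expr.WF.skewSmooth_apply (h : E.WF 2) {X : ConnManifold} (P : X.PoissonTensor) (φ : X.Chart)
    (i j : Fin X.dim) {y : X.Model} (hy : y ∈ φ.1.target) :
    (E.skewSmooth 𝕂).1 X P φ ![i, j] y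
      = ((E.value P φ ![i, j] y - E.value P φ ![j, i] y : ℝ) : 𝕂) := by
  have : (![i, j] : Fin 2 → Fin X.dim) ∘ Equiv.swap 0 1 = ![j, i] := by
    funext s; fin_cases s <;> rfl
  rw [h.coe_skewSmooth 𝕂, skewFamily]
  change E.family 𝕂 1 X P φ ![i, j] y - E.family 𝕂 1 X P φ (![i, j] ∘ Equiv.swap 0 1) y = _
  rw [this]
  simp [Expr.family, hy]

theorem sum_skewSmooth_apply {L : List Expr} (hL : ∀ F ∈ L, F.WF 2) {X : ConnManifold}
    (P : X.PoissonTensor) (φ : X.Chart) (i j : Fin X.dim) {y : X.Model} (hy : y ∈ φ.1.target) :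
    (L.map (Expr.skewSmooth 𝕂)).sum.1 X P φ ![i, j] y
      = (((L.map fun F => Expr.value P φ F ![i, j] y).sum
        - (L.map fun F => Expr.value P φ F ![j, i] y).sum : ℝ) : 𝕂) := by
  induction L with
  | nil => simp
  | cons F L ih =>
    have h1 := ih fun G hG => hL G (by simp [hG])
    have h2 := (hL F (by simp)).skewSmooth_apply 𝕂 P φ i j hy
    simp only [List.map_cons, List.sum_cons]
    change (F.skewSmooth 𝕂).1 X P φ ![i, j] y + (L.map (Expr.skewSmooth 𝕂)).sum.1 X P φ ![i, j] y = _
    rw [h1, h2]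
    push_cast
    ring

/-- The formula for the coboundary in terms of expressions. The term with `∇P` needs no
skewsymmetrization, since `P` is skew. -/
theorem Expr.Primitive.coboundary_smoothFamily (h : E.Primitive) :
    coboundary 𝕂 1 (E.smoothFamily 𝕂 0) = E.boundarySmooth 𝕂 := by
  refine Subtype.ext ?_
  funext X P φ I y
  by_cases hy : y ∈ φ.1.target
  swap
  · rw [(coboundary 𝕂 1 (E.smoothFamily 𝕂 0)).2 X P φ I |>.2 y hy,
      (E.boundarySmooth 𝕂).2 X P φ I |>.2 y hy]
  have hI : I = ![I 0, I 1] := by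
    funext s; fin_cases s <;> rfl
  rw [hI]
  change φ.1.target.indicator (coboundaryComp P φ (E.family 𝕂 0 X P φ) ![I 0, I 1]) y
    = (E.boundaryTerms.map (Expr.skewSmooth 𝕂)).sum.1 X P φ ![I 0, I 1] y
      - E.boundaryTerm.family 𝕂 1 X P φ ![I 0, I 1] y
  rw [Set.indicator_of_mem hy, coboundaryComp_family 𝕂 P φ E _ hy,
    h.wf.coboundaryComp_value P φ h.one h.notMem _ _ hy,
    sum_skewSmooth_apply 𝕂 (fun F hF => (h.terms F hF).1) P φ _ _ hy]
  simp [Expr.family, hy]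

theorem Expr.Primitive.smoothFamily_mem (h : E.Primitive) :
    E.smoothFamily 𝕂 0 ∈ cochains 𝕂 1 2 := by
  refine ⟨⟨h.wf.smoothFamily_mem 𝕂, ?_⟩, fun X P φ I τ y => ?_⟩
  · have := E.smoothFamily_mem_homogeneous 𝕂 0
    rwa [h.numP] at this
  · rw [Subsingleton.elim τ 1]
    simp

/-- The presentation by expressions without loops makes the coboundary universal of no-loop type and
homogeneous of degree 3, while skewness and the cocycle condition come from its being a coboundary.
-/
theorem Expr.Primitive.boundarySmooth_mem (h : E.Primitive) :
    E.boundarySmooth 𝕂 ∈ coboundaries 𝕂 1 2 := by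
  have h1 : ∀ F ∈ E.boundaryTerms, F.skewSmooth 𝕂 ∈ cochains 𝕂 2 3 := fun F hF =>
    (h.terms F hF).1.skewSmooth_mem 𝕂 (h.terms F hF).2
  have h2 : (E.boundaryTerms.map (Expr.skewSmooth 𝕂)).sum ∈ cochains 𝕂 2 3 :=
    list_sum_mem fun c hc => by
      obtain ⟨F, hF, rfl⟩ := List.mem_map.1 hc
      exact h1 F hF
  have h3 := E.boundaryTerm.smoothFamily_mem_homogeneous 𝕂 1
  rw [h.term.2] at h3
  have hmap : E.boundarySmooth 𝕂 ∈ (cochains 𝕂 1 2).map (coboundary 𝕂 1) :=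
    ⟨_, h.smoothFamily_mem 𝕂, h.coboundary_smoothFamily 𝕂⟩
  refine ⟨⟨⟨⟨sub_mem h2.1.1 (h.term.1.smoothFamily_mem 𝕂), sub_mem h2.1.2 h3⟩,
    fun X P φ I τ y => ?_⟩, ?_⟩, hmap⟩
  -- Skewness under the transposition is read off from the formula for the coboundary of a vector
  -- field.
  · have hτ : τ = 1 ∨ τ = Equiv.swap 0 1 := by
      revert τ; decide
    rcases hτ with rfl | rfl
    · simp
    by_cases hy : y ∈ φ.1.target
    swap
    · rw [(E.boundarySmooth 𝕂).2 X P φ _ |>.2 y hy, (E.boundarySmooth 𝕂).2 X P φ I |>.2 y hy, mul_zero]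
    have hI : I = ![I 0, I 1] := by
      funext s; fin_cases s <;> rfl
    have hI' : I ∘ Equiv.swap 0 1 = ![I 1, I 0] := by
      funext s; fin_cases s <;> rfl
    have hv : ∀ J, (E.boundarySmooth 𝕂).1 X P φ J y
        = ((coboundaryComp P φ (E.value P φ) J y : ℝ) : 𝕂) := fun J => by
      rw [← h.coboundary_smoothFamily 𝕂]
      change φ.1.target.indicator (coboundaryComp P φ (E.family 𝕂 0 X P φ) J) y = _
      rw [Set.indicator_of_mem hy, coboundaryComp_family 𝕂 P φ E _ hy]
    rw [hv, hv, hI', hI, Equiv.Perm.sign_swap (by decide), coboundaryComp_one, coboundaryComp_one]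
    simp only [pd_comp_skew _ (I 1) (I 0), smul_eq_mul, neg_mul, Finset.sum_neg_distrib,
      Matrix.cons_val_zero, Matrix.cons_val_one]
    push_cast
    ring
  -- The cocycle condition is the vanishing of the square of the coboundary.
  · change coboundary 𝕂 2 _ = 0
    rw [← h.coboundary_smoothFamily 𝕂, coboundary_coboundary]

end Coboundary

/-- Vector fields whose coboundaries are independent. -/
def primitives : List Expr := [
  [⟨.R 0, [2, 3, 4], [5]⟩, ⟨.P 1, [5], [2, 4]⟩, ⟨.P 0, [], [0, 3]⟩],
  [⟨.R 0, [2, 3, 4], [0]⟩, ⟨.P 1, [5], [2, 4]⟩, ⟨.P 0, [], [3, 5]⟩],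
  [⟨.R 1, [2, 3, 4, 5], [0]⟩, ⟨.P 0, [], [2, 3]⟩, ⟨.P 0, [], [4, 5]⟩],
  [⟨.R 0, [2, 3, 4], [5]⟩, ⟨.P 1, [5], [0, 2]⟩, ⟨.P 0, [], [3, 4]⟩]]

theorem primitives_check : primitives.all Expr.isPrimitive = true := by decide +kernel

/-- The component in the origin of the coboundary of the vector field defined by an expression. -/
def Table.boundaryValue (tb : Table) (E : Expr) (i j : ℕ) : ℤ :=
  (E.boundaryTerms.map fun F => tb.bivectorValue F i j).sum
    - (E.boundaryTerms.map fun F => tb.bivectorValue F j i).sum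
    - tb.bivectorValue E.boundaryTerm i j

/-- Components of the coboundaries: a manifold, two indices, and the values. -/
def boundaryTests : List (ℕ × ℕ × ℕ × List ℤ) :=
  [(3, 0, 1, [0, 0, -2, 0]), (10, 1, 2, [0, -1, 0, 0]), (15, 1, 2, [0, 0, 0, 2]),
    (44, 0, 2, [1, -1, 0, -1])]

theorem boundaryTests_check : (boundaryTests.all fun x =>
    (testData.getD x.1 ⟨0, [], []⟩).check && Nat.blt x.2.1 (testData.getD x.1 ⟨0, [], []⟩).n &&
      Nat.blt x.2.2.1 (testData.getD x.1 ⟨0, [], []⟩).n &&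
      (testData.getD x.1 ⟨0, [], []⟩).withTable fun tb => (List.range 4).all fun a =>
        decide (tb.boundaryValue (primitives.getD a []) x.2.1 x.2.2.1 = x.2.2.2.getD a 0)) = true := by
  decide +kernel

section Conclusion

variable (𝕂 : Type) [RCLike 𝕂]

theorem primitive (a : Fin 4) : (primitives.getD a []).Primitive :=
  Expr.primitive_of_isPrimitive (List.all_eq_true.1 primitives_check _ (by
    rw [List.getD_eq_getElem _ _ a.2]; exact List.getElem_mem _))

theorem exists_boundary_functional {x : ℕ × ℕ × ℕ × List ℤ} (hx : x ∈ boundaryTests) :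
    ∃ l : SmoothFamily 𝕂 2 →ₗ[𝕂] 𝕂, ∀ a : Fin 4,
      l ((primitives.getD a []).boundarySmooth 𝕂) = (x.2.2.2.getD a 0 : 𝕂) := by
  have hc := List.all_eq_true.1 boundaryTests_check x hx
  simp only [TestData.withTable_eq, Bool.and_eq_true, Nat.blt_eq, List.all_eq_true, List.mem_range,
    decide_eq_true_eq] at hc
  obtain ⟨t, i, j, v⟩ := x
  simp only at hc ⊢
  generalize testData.getD t ⟨0, [], []⟩ = D at hc
  obtain ⟨⟨⟨hD, hi⟩, hj⟩, hc⟩ := hc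
  obtain ⟨X, Q, φ, h1, h2, h3⟩ := D.exists_isPoly hD
  have h : D.Realizes X Q φ := ⟨h1, h2, h3⟩
  rw [← h1] at hi hj
  refine ⟨evalZero 𝕂 Q φ ![⟨i, hi⟩, ⟨j, hj⟩], fun a => ?_⟩
  have hp := primitive a
  have hc := hc a a.2
  generalize primitives.getD a [] = E at hp hc ⊢
  change (E.boundaryTerms.map (Expr.skewSmooth 𝕂)).sum.1 X Q φ ![⟨i, hi⟩, ⟨j, hj⟩] 0
    - E.boundaryTerm.family 𝕂 1 X Q φ ![⟨i, hi⟩, ⟨j, hj⟩] 0 = _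
  rw [sum_skewSmooth_apply 𝕂 (fun F hF => (hp.terms F hF).1) Q φ _ _ (h2.target 0), ← hc,
    Expr.family, Set.indicator_of_mem (h2.target 0), h.value_eq hp.term.1, Table.boundaryValue]
  have e : ∀ i j : Fin X.dim, (E.boundaryTerms.map fun F => Expr.value Q φ F ![i, j] 0).sum
      = ((E.boundaryTerms.map fun F => D.table.bivectorValue F i j).sum : ℤ) := fun i j => by
    rw [Int.cast_list_sum, List.map_map]
    exact congrArg _ (List.map_congr_left fun F hF => h.value_eq (hp.terms F hF).1 ![i, j])
  rw [e, e, ← Int.cast_sub, RCLike.ofReal_intCast, RCLike.ofReal_intCast, ← Int.cast_sub]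
  rfl

/-- Three of the evaluations see only one of the four coboundaries each, with nonzero value; the
fourth evaluation then detects the remaining one. -/
theorem linearIndependent_boundarySmooth :
    LinearIndependent 𝕂 fun a : Fin 4 => (primitives.getD a []).boundarySmooth 𝕂 := by
  rw [Fintype.linearIndependent_iff]
  intro g hg
  have h : ∀ x ∈ boundaryTests, ∑ a : Fin 4, g a * (x.2.2.2.getD a 0 : 𝕂) = 0 := by
    intro x hx
    obtain ⟨l, hl⟩ := exists_boundary_functional 𝕂 hx
    have := congrArg l hg
    simpa only [map_sum, map_smul, hl, map_zero, smul_eq_mul] using this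
  have h1 := h (3, 0, 1, [0, 0, -2, 0]) (by simp [boundaryTests])
  have h2 := h (10, 1, 2, [0, -1, 0, 0]) (by simp [boundaryTests])
  have h3 := h (15, 1, 2, [0, 0, 0, 2]) (by simp [boundaryTests])
  have h4 := h (44, 0, 2, [1, -1, 0, -1]) (by simp [boundaryTests])
  simp [Fin.sum_univ_four] at h1 h2 h3 h4
  intro a
  fin_cases a
  · simpa [h2, h3] using h4
  · exact h2
  · exact h1
  · exact h3

/-- The inclusion of coboundaries in cocycles, with dimension at least 4 on the one side and at most
4 on the other. -/
theorem coboundaries_eq_cocycles :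
    coboundaries 𝕂 1 2 = cocycles 𝕂 2 3 ∧ Module.finrank 𝕂 (coboundaries 𝕂 1 2) = 4 := by
  have hf := finite_cochains 𝕂
  have hle : coboundaries 𝕂 1 2 ≤ cocycles 𝕂 2 3 := inf_le_left
  have hf1 : Module.Finite 𝕂 (cocycles 𝕂 2 3) :=
    Submodule.finiteDimensional_of_le (inf_le_left : cocycles 𝕂 2 3 ≤ cochains 𝕂 2 3)
  have hf2 : Module.Finite 𝕂 (coboundaries 𝕂 1 2) := Submodule.finiteDimensional_of_le hle
  have h4 : 4 ≤ Module.finrank 𝕂 (coboundaries 𝕂 1 2) := by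
    have hi : LinearIndependent 𝕂 fun a : Fin 4 =>
        (⟨_, (primitive a).boundarySmooth_mem 𝕂⟩ : coboundaries 𝕂 1 2) :=
      LinearIndependent.of_comp (coboundaries 𝕂 1 2).subtype (linearIndependent_boundarySmooth 𝕂)
    simpa using hi.fintype_card_le_finrank
  have h5 := finrank_cocycles_le 𝕂
  have h6 := Submodule.finrank_mono hle
  exact ⟨Submodule.eq_of_le_of_finrank_le hle (h5.trans h4), le_antisymm (h6.trans h5) h4⟩

end Conclusion

end UniversalPoisson

end

open UniversalPoisson in
theorem mainTheorem3 (𝕂 : Type) [RCLike 𝕂] :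
    Module.finrank 𝕂 (cochains 𝕂 2 3) = 48 ∧
    Module.finrank 𝕂
      (cochains 𝕂 2 3 ⧸ (coboundaries 𝕂 1 2).submoduleOf (cochains 𝕂 2 3)) = 44 ∧
    Subsingleton (Cohomology 𝕂 1 2) := by
  obtain ⟨h1, h2⟩ := coboundaries_eq_cocycles 𝕂
  have h3 := finrank_cochains 𝕂
  have hle : coboundaries 𝕂 1 2 ≤ cochains 𝕂 2 3 := h1.trans_le inf_le_left
  have := finite_cochains 𝕂
  refine ⟨h3, ?_, ?_⟩
  -- The coboundaries lie in the cochains, so that `submoduleOf` keeps their dimension 4, and 48 =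
  -- 44 + 4.
  · have h4 := Submodule.finrank_quotient_add_finrank
      ((coboundaries 𝕂 1 2).submoduleOf (cochains 𝕂 2 3))
    rw [(Submodule.submoduleOfEquivOfLe hle).finrank_eq, h2, h3] at h4
    exact Nat.add_right_cancel (m := 4) h4
  · rw [Submodule.Quotient.subsingleton_iff, h1]
    exact Submodule.submoduleOf_self _
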